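/- Write $\mathbb T=\mathbb R/2\pi\mathbb Z$. For $\sigma>0$ and an integer $q\ge 0$, a real function $f(\rho,\theta,s)$ on $[0,\sigma)\times\mathbb T^2$ is called $(\sigma,H^q)$-analytic if there are coefficients $f_m(\theta,s)=\sum_{n=0}^m f_{mn}(s)e^{(2n-m)\mathrm i\theta}$ (real-valued) such that $\|f\|_{\sigma,H^q}:=\sup_m\sigma^m\|f_m\|_{H^q(\mathbb T^2)}<\infty$ and, for every $0\le\rho<\sigma$, $\sum_{m\le M}\rho^m f_m\to f(\rho,\cdot,\cdot)$ in $H^q(\mathbb T^2)$ as $M\to\infty$. A vector field is $(\sigma,H^q)$-analytic if its Cartesian components are. Let $q\ge1$ and $D\ge1$ be integers, $K>0$, $\sigma_0>0$. Let $\boldsymbol r_0\in C^{4+q}(\mathbb T;\mathbb R^3)$ be a closed curve in scaled arclength, $\ell'=\|\boldsymbol r_0'\|=L/2\pi>0$ with $L$ its length, with curvature $\kappa>0$; let $\tau$ be its torsion and $(\boldsymbol n,\boldsymbol b,\boldsymbol t)$ its Frenet–Serret frame. In the coordinates $(q^1,q^2,q^3)=(\rho,\theta,s)$ given by $\boldsymbol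 r=\boldsymbol r_0(s)+\rho\cos\theta\,\boldsymbol n(s)+\rho\sin\theta\,\boldsymbol b(s)$ let $g$ be the Euclidean metric, so that $\sqrt g=\rho h_s$ with $h_s=\ell'(1-\kappa\rho\cos\theta)$, and let $\nabla$, $\nabla\cdot$, $\Delta$ be the gradient, divergence and Laplacian of $g$. Put $\tilde{\boldsymbol B}=B_0\ell'\nabla s$, $\Delta_\perp\phi=\rho^{-1}\partial_\rho(\rho\,\partial_\rho\phi)+\rho^{-2}\partial_\theta^2\phi$ and $$P=\Bigl(-\frac1{K^2}\Bigl(\frac{L}{2\pi\ell'}\partial_s\Bigr)^2\Bigr)^{D}+\Bigl(-\frac1{K^2}\partial_\theta^2\Bigr)^{D}.$$ Then there are $\sigma>0$ with $\sigma\le\sigma_0$ and $\sigma<\min_s\kappa(s)^{-1}$, and a constant $C$, both independent of $B_0$ and $\phi^{(\mathrm{IC})}$, such that for every real $B_0\in H^{1+q}(\mathbb T)$ and every $(\sigma_0,H^{q+2D})$-analytic $\phi^{(\mathrm{IC})}$ whose expansion contains only the modes $n=0$ and $n=m$, i.e. $\phi^{(\mathrm{IC})}_m=\phi_{m0}(s)e^{-\mathrm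 im\theta}+\phi_{mm}(s)e^{\mathrm im\theta}$ for $m\ge1$ and $\phi^{(\mathrm{IC})}_0=\phi_{00}(s)$, the following hold. 1. The regularized Poisson equation $$\Delta\phi+\frac{\rho}{\sqrt g}\,\Delta_\perp P\phi=-\nabla\cdot\tilde{\boldsymbol B}\qquad(0<\rho<\sigma)$$ has a $(\sigma,H^{q+2D})$-analytic near-axis solution $\phi$ whose coefficients $\phi_{m0},\phi_{mm}$ are those of $\phi^{(\mathrm{IC})}$ for all $m$. The solution is classical for $0<\rho<\sigma$, and it is unique: every such solution on a smaller tube $0\le\rho<\sigma'$, $\sigma'\le\sigma$, coincides there with $\phi$. 2. $\|\phi\|_{\sigma,H^{q+2D}}\le C\|B_0\|_{H^{1+q}}+C\|\phi^{(\mathrm{IC})}\|_{\sigma_0,H^{q+2D}}$. 3. $\phi$ is continuous in $\boldsymbol r_0$: for fixed $B_0$ and $\phi^{(\mathrm{IC})}$ and every $\varepsilon>0$ there is $\delta>0$ such that, for every axis $\boldsymbol r_1$ satisfying the same assumptions with $\|\boldsymbol r_1-\boldsymbol r_0\|_{C^{4+q}}<\delta$, one has $\sigma<\min_s\kappa_{\boldsymbol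 r_1}(s)^{-1}$ and the problem for $\boldsymbol r_1$ has a $(\sigma,H^{q+2D})$-analytic near-axis solution $\phi_1$ with $\|\phi_1-\phi\|_{\sigma,H^{q+2D}}<\varepsilon$. 4. With $G=\mathrm{diag}(1,\rho^{-2},0)$, the field $\boldsymbol B_K$ with contravariant components $$B_K^i=g^{ij}\,\partial_{q^j}\phi+\tilde B^i+\frac{\rho}{\sqrt g}\,G^{ij}\,\partial_{q^j}(P\phi)$$ is well defined and satisfies $\nabla\cdot\boldsymbol B_K=0$ for $0<\rho<\sigma$, and, extended suitably to the axis $\rho=0$, it is $(\sigma',H^q)$-analytic for every $0<\sigma'<\sigma$. -/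

import Mathlib

open MeasureTheory Filter Topology Set
open scoped ENNReal NNReal ContDiff

noncomputable section

namespace NearAxis

/-! ### Sobolev norms on the tori `𝕋 = ℝ / 2πℤ` and `𝕋²`

Functions on `𝕋` (on `𝕋²`) are functions on `ℝ` (on `ℝ × ℝ`, written in curried form with arguments
`θ` and `s`) that are `2π`-periodic in each variable. Integrals are taken over one period. -/

/-- A function of `(θ, s)` that is `2π`-periodic in both variables, i.e. a function on `𝕋²`. -/
def IsTorusFun {E : Type*} (f : ℝ → ℝ → E) : Prop :=
  ∀ θ s, f (θ + 2 * Real.pi) s = f θ s ∧ f θ (s + 2 * Real.pi) = f θ s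

/-- Lebesgue measure on `𝕋`, carried by one period. -/
def circleMeasure : Measure ℝ := volume.restrict (Ioc 0 (2 * Real.pi))

/-- Lebesgue measure on `𝕋²`, carried by one period cell. -/
def torusMeasure : Measure (ℝ × ℝ) :=
  volume.restrict (Ioc 0 (2 * Real.pi) ×ˢ Ioc 0 (2 * Real.pi))

/-- The classical mixed derivative `∂^{a+b} ψ / ∂θ^a ∂s^b`. -/
def mixedDeriv (a b : ℕ) (ψ : ℝ → ℝ → ℝ) (θ s : ℝ) : ℝ :=
  iteratedDeriv a (fun θ' => iteratedDeriv b (fun s' => ψ θ' s') s) θ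

/-- `g ∈ L²(𝕋²)` is the weak derivative `∂^{a+b} f / ∂θ^a ∂s^b` of the integrable function `f`. -/
def HasWeakDeriv (a b : ℕ) (f g : ℝ → ℝ → ℝ) : Prop :=
  Integrable (fun p : ℝ × ℝ => f p.1 p.2) torusMeasure ∧
  MemLp (fun p : ℝ × ℝ => g p.1 p.2) 2 torusMeasure ∧
  ∀ ψ : ℝ → ℝ → ℝ, ContDiff ℝ ∞ (fun p : ℝ × ℝ => ψ p.1 p.2) → IsTorusFun ψ →
    ∫ p : ℝ × ℝ, f p.1 p.2 * mixedDeriv a b ψ p.1 p.2 ∂torusMeasure =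
      (-1) ^ (a + b) * ∫ p : ℝ × ℝ, g p.1 p.2 * ψ p.1 p.2 ∂torusMeasure

/-- The `L²(𝕋²)` norm of the weak derivative `∂^{a+b} f / ∂θ^a ∂s^b`. Weak derivatives are unique
almost everywhere, so the infimum is over a single value, or is `⊤` if there is none in `L²`. -/
def weakDerivNorm (a b : ℕ) (f : ℝ → ℝ → ℝ) : ℝ≥0∞ :=
  ⨅ (g : ℝ → ℝ → ℝ) (_ : HasWeakDeriv a b f g),
    eLpNorm (fun p : ℝ × ℝ => g p.1 p.2) 2 torusMeasure

/-- The norm of `H^q(𝕋²)`: the square root of the sum of `‖D_α f‖²_{L²}` over `|α| ≤ q`.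
It is `⊤` exactly if `f` does not belong to `H^q(𝕋²)`. -/
def sobolevNorm (q : ℕ) (f : ℝ → ℝ → ℝ) : ℝ≥0∞ :=
  (∑ α ∈ (Finset.range (q + 1) ×ˢ Finset.range (q + 1)).filter (fun α => α.1 + α.2 ≤ q),
    weakDerivNorm α.1 α.2 f ^ 2) ^ (1 / 2 : ℝ)

/-- `g ∈ L²(𝕋)` is the `j`-th weak derivative of the integrable function `f` on `𝕋`. -/
def HasWeakDerivCircle (j : ℕ) (f g : ℝ → ℝ) : Prop :=
  Integrable f circleMeasure ∧ MemLp g 2 circleMeasure ∧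
  ∀ ψ : ℝ → ℝ, ContDiff ℝ ∞ ψ → Function.Periodic ψ (2 * Real.pi) →
    ∫ s, f s * iteratedDeriv j ψ s ∂circleMeasure =
      (-1) ^ j * ∫ s, g s * ψ s ∂circleMeasure

/-- The norm of `H^k(𝕋)`; it is `⊤` exactly if `f` does not belong to `H^k(𝕋)`. -/
def sobolevNormCircle (k : ℕ) (f : ℝ → ℝ) : ℝ≥0∞ :=
  (∑ j ∈ Finset.range (k + 1),
    (⨅ (g : ℝ → ℝ) (_ : HasWeakDerivCircle j f g), eLpNorm g 2 circleMeasure) ^ 2) ^ (1 / 2 : ℝ)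

/-! ### Near-axis expansions

Functions on the solid torus `[0, σ) × 𝕋²` are functions of `ρ`, `θ`, `s`, in this order. -/

/-- The coefficient `f_m(θ, s) = ∑_{n ≤ m} f_{mn}(s) e^{(2n-m)iθ}` with `f_{mn} = c m n`. -/
def expCoeff (c : ℕ → ℕ → ℝ → ℂ) (m : ℕ) (θ s : ℝ) : ℂ :=
  ∑ n ∈ Finset.range (m + 1),
    c m n s * Complex.exp ((2 * (n : ℂ) - (m : ℂ)) * Complex.I * (θ : ℂ))

/-- The norm `sup_m σ^m ‖f_m‖_{H^q}` of a near-axis expansion with real coefficients `f_m`. -/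
def expNorm (σ : ℝ) (q : ℕ) (c : ℕ → ℕ → ℝ → ℂ) : ℝ≥0∞ :=
  ⨆ m : ℕ, ENNReal.ofReal (σ ^ m) * sobolevNorm q (fun θ s => (expCoeff c m θ s).re)

/-- The real function `f` on `[0, σ) × 𝕋²` is `(σ, H^q)`-analytic, with the expansion
`f = ∑_m ρ^m f_m`, `f_m = ∑_{n ≤ m} f_{mn}(s) e^{(2n-m)iθ}`, where `f_{mn} = c m n`. -/
structure HasExpansion (σ : ℝ) (q : ℕ) (f : ℝ → ℝ → ℝ → ℝ) (c : ℕ → ℕ → ℝ → ℂ) : Prop where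
  periodic : ∀ ρ, 0 ≤ ρ → ρ < σ → IsTorusFun (f ρ)
  coeff_periodic : ∀ m n, n ≤ m → Function.Periodic (c m n) (2 * Real.pi)
  coeff_real : ∀ m θ s, (expCoeff c m θ s).im = 0
  norm_lt_top : expNorm σ q c < ⊤
  converges : ∀ ρ, 0 ≤ ρ → ρ < σ →
    Tendsto (fun M : ℕ => sobolevNorm q
      (fun θ s => f ρ θ s - ∑ m ∈ Finset.range (M + 1), ρ ^ m * (expCoeff c m θ s).re))
      atTop (𝓝 0)

/-- `f` is `(σ, H^q)`-analytic. -/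
def IsAnalytic (σ : ℝ) (q : ℕ) (f : ℝ → ℝ → ℝ → ℝ) : Prop := ∃ c, HasExpansion σ q f c

/-! ### The axis and its Frenet-Serret frame -/

/-- Euclidean three-space. -/
abbrev E3 := EuclideanSpace ℝ (Fin 3)

/-- The vector product on Euclidean three-space. -/
def cross (u v : E3) : E3 := WithLp.toLp 2 (crossProduct (WithLp.ofLp u) (WithLp.ofLp v))

/-- `ℓ' = ‖r₀'‖`. -/
def speed (r₀ : ℝ → E3) (s : ℝ) : ℝ := ‖deriv r₀ s‖

/-- The length `L` of the closed curve `r₀`. -/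
def axisLength (r₀ : ℝ → E3) : ℝ := ∫ s in (0 : ℝ)..(2 * Real.pi), speed r₀ s

/-- The unit tangent `t`. -/
def tangent (r₀ : ℝ → E3) (s : ℝ) : E3 := (speed r₀ s)⁻¹ • deriv r₀ s

/-- The curvature `κ = ‖t'‖ / ℓ'`. -/
def curvature (r₀ : ℝ → E3) (s : ℝ) : ℝ := ‖deriv (tangent r₀) s‖ / speed r₀ s

/-- The principal normal `n = t' / (κ ℓ')`. -/
def normal (r₀ : ℝ → E3) (s : ℝ) : E3 :=
  (curvature r₀ s * speed r₀ s)⁻¹ • deriv (tangent r₀) s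

/-- The binormal `b = t × n`. -/
def binormal (r₀ : ℝ → E3) (s : ℝ) : E3 := cross (tangent r₀ s) (normal r₀ s)

/-- The torsion `τ = ((r₀' × r₀'') · r₀''') / ‖r₀' × r₀''‖²`. -/
def torsion (r₀ : ℝ → E3) (s : ℝ) : ℝ :=
  inner ℝ (cross (deriv r₀ s) (iteratedDeriv 2 r₀ s)) (iteratedDeriv 3 r₀ s) /
    ‖cross (deriv r₀ s) (iteratedDeriv 2 r₀ s)‖ ^ 2

/-- A closed axis of class `C^k` in scaled arclength, `ℓ' = L / 2π > 0`, with curvature `κ > 0`. -/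
structure IsAxis (k : ℕ) (r₀ : ℝ → E3) : Prop where
  contDiff : ContDiff ℝ k r₀
  periodic : Function.Periodic r₀ (2 * Real.pi)
  length_pos : 0 < axisLength r₀
  speed_eq : ∀ s, speed r₀ s = axisLength r₀ / (2 * Real.pi)
  curvature_pos : ∀ s, 0 < curvature r₀ s

/-- The `C^k(𝕋)` norm of a vector function. -/
def cNorm (k : ℕ) (u : ℝ → E3) : ℝ≥0∞ :=
  ∑ j ∈ Finset.range (k + 1), ⨆ s : ℝ, ‖iteratedDeriv j u s‖ₑ

/-! ### Vector calculus in the coordinates `(ρ, θ, s)` -/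

/-- The partial derivatives with respect to `ρ` (index 0), `θ` (index 1) and `s` (index 2). -/
def pd (i : Fin 3) (f : ℝ → ℝ → ℝ → ℝ) (ρ θ s : ℝ) : ℝ :=
  ![deriv (fun r => f r θ s) ρ, deriv (fun t => f ρ t s) θ, deriv (fun t => f ρ θ t) s] i

/-- `h_s = ℓ' (1 - κ ρ cos θ)`. -/
def hs (r₀ : ℝ → E3) (ρ θ s : ℝ) : ℝ :=
  speed r₀ s * (1 - curvature r₀ s * ρ * Real.cos θ)

/-- The volume ratio `√g = ρ h_s`. -/
def sqrtG (r₀ : ℝ → E3) (ρ θ s : ℝ) : ℝ := ρ * hs r₀ ρ θ s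

/-- The inverse metric `g^{ij}` of the Frenet-Serret coordinates. -/
def gInv (r₀ : ℝ → E3) (ρ θ s : ℝ) : Matrix (Fin 3) (Fin 3) ℝ :=
  !![1, 0, 0;
     0, speed r₀ s ^ 2 * torsion r₀ s ^ 2 / hs r₀ ρ θ s ^ 2 + 1 / ρ ^ 2,
       -(speed r₀ s * torsion r₀ s) / hs r₀ ρ θ s ^ 2;
     0, -(speed r₀ s * torsion r₀ s) / hs r₀ ρ θ s ^ 2, 1 / hs r₀ ρ θ s ^ 2]

/-- The contravariant components `g^{ij} ∂_j φ` of `∇φ`. -/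
def grad (r₀ : ℝ → E3) (φ : ℝ → ℝ → ℝ → ℝ) (i : Fin 3) (ρ θ s : ℝ) : ℝ :=
  ∑ j, gInv r₀ ρ θ s i j * pd j φ ρ θ s

/-- The divergence `√g⁻¹ ∂_i (√g X^i)` of the field with contravariant components `X^i`. -/
def divg (r₀ : ℝ → E3) (X : Fin 3 → ℝ → ℝ → ℝ → ℝ) (ρ θ s : ℝ) : ℝ :=
  (sqrtG r₀ ρ θ s)⁻¹ * ∑ i, pd i (fun ρ' θ' s' => sqrtG r₀ ρ' θ' s' * X i ρ' θ' s') ρ θ s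

/-- The contravariant components of `B̃ = B₀ ℓ' ∇s`. -/
def Btilde (r₀ : ℝ → E3) (B₀ : ℝ → ℝ) (i : Fin 3) (ρ θ s : ℝ) : ℝ :=
  B₀ s * speed r₀ s * grad r₀ (fun _ _ s' => s') i ρ θ s

/-- `Δ_⊥ φ = ρ⁻¹ ∂_ρ (ρ ∂_ρ φ) + ρ⁻² ∂_θ² φ`. -/
def lapPerp (φ : ℝ → ℝ → ℝ → ℝ) (ρ θ s : ℝ) : ℝ :=
  1 / ρ * pd 0 (fun ρ' θ' s' => ρ' * pd 0 φ ρ' θ' s') ρ θ s + 1 / ρ ^ 2 * pd 1 (pd 1 φ) ρ θ s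

/-- The scaled arclength derivative `(L / 2πℓ') ∂_s`. -/
def arcDeriv (r₀ : ℝ → E3) (φ : ℝ → ℝ → ℝ → ℝ) (ρ θ s : ℝ) : ℝ :=
  axisLength r₀ / (2 * Real.pi * speed r₀ s) * pd 2 φ ρ θ s

/-- The regularizing operator
`P = (-K⁻² ((L / 2πℓ') ∂_s)²)^D + (-K⁻² ∂_θ²)^D`. -/
def Preg (D : ℕ) (K : ℝ) (r₀ : ℝ → E3) (φ : ℝ → ℝ → ℝ → ℝ) (ρ θ s : ℝ) : ℝ :=
  (fun (u : ℝ → ℝ → ℝ → ℝ) (ρ' θ' s' : ℝ) =>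
      -(1 / K ^ 2) * arcDeriv r₀ (arcDeriv r₀ u) ρ' θ' s')^[D] φ ρ θ s +
  (fun (u : ℝ → ℝ → ℝ → ℝ) (ρ' θ' s' : ℝ) =>
      -(1 / K ^ 2) * pd 1 (pd 1 u) ρ' θ' s')^[D] φ ρ θ s

/-- The contravariant components of
`B_K = ∇φ + B̃ + (ρ / √g) G ∂(Pφ)`, with `G = diag(1, ρ⁻², 0)`. -/
def BK (D : ℕ) (K : ℝ) (r₀ : ℝ → E3) (B₀ : ℝ → ℝ) (φ : ℝ → ℝ → ℝ → ℝ) (i : Fin 3)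
    (ρ θ s : ℝ) : ℝ :=
  grad r₀ φ i ρ θ s + Btilde r₀ B₀ i ρ θ s +
    ρ / sqrtG r₀ ρ θ s * (![1, 1 / ρ ^ 2, 0] i * pd i (Preg D K r₀ φ) ρ θ s)

/-- The coordinate basis vectors `∂r/∂ρ`, `∂r/∂θ`, `∂r/∂s` of
`r(ρ, θ, s) = r₀(s) + ρ cos θ n(s) + ρ sin θ b(s)`. -/
def coordBasis (r₀ : ℝ → E3) (ρ θ s : ℝ) : Fin 3 → E3 :=
  ![Real.cos θ • normal r₀ s + Real.sin θ • binormal r₀ s,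
    (-(ρ * Real.sin θ)) • normal r₀ s + (ρ * Real.cos θ) • binormal r₀ s,
    (-(speed r₀ s * torsion r₀ s * ρ * Real.sin θ)) • normal r₀ s +
      (speed r₀ s * torsion r₀ s * ρ * Real.cos θ) • binormal r₀ s +
      hs r₀ ρ θ s • tangent r₀ s]

/-- The vector in three-space with contravariant components `X^i` at `(ρ, θ, s)`. -/
def toVector (r₀ : ℝ → E3) (X : Fin 3 → ℝ → ℝ → ℝ → ℝ) (ρ θ s : ℝ) : E3 :=
  ∑ i, X i ρ θ s • coordBasis r₀ ρ θ s i

/-- `φ`, with expansion coefficients `φ_{mn} = c m n`, is the `(σ, H^{q+2D})`-analytic near-axis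
solution, on `0 ≤ ρ < σ`, of
`Δφ + (ρ / √g) Δ_⊥ P φ = -∇·B̃`
with initial data `φ_{m0}`, `φ_{mm}` prescribed by `cIC`. The equation holds pointwise off the axis;
the regularity fields say that all derivatives in it exist there in the classical sense. -/
structure IsNearAxisSolution (q D : ℕ) (K σ : ℝ) (r₀ : ℝ → E3) (B₀ : ℝ → ℝ)
    (cIC : ℕ → ℕ → ℝ → ℂ) (φ : ℝ → ℝ → ℝ → ℝ) (c : ℕ → ℕ → ℝ → ℂ) : Prop where
  expansion : HasExpansion σ (q + 2 * D) φ c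
  initial : ∀ m, c m 0 =ᵐ[volume] cIC m 0 ∧ c m m =ᵐ[volume] cIC m m
  continuousOn : ContinuousOn (fun p : ℝ × ℝ × ℝ => φ p.1 p.2.1 p.2.2) (Ico 0 σ ×ˢ univ)
  contDiffOn : ContDiffOn ℝ ((2 * D : ℕ) : WithTop ℕ∞)
    (fun p : ℝ × ℝ × ℝ => φ p.1 p.2.1 p.2.2) (Ioo 0 σ ×ˢ univ)
  contDiffOn_Preg : ∀ s, ContDiffOn ℝ 2
    (fun p : ℝ × ℝ => Preg D K r₀ φ p.1 p.2 s) (Ioo 0 σ ×ˢ univ)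
  equation : ∀ ρ θ s, 0 < ρ → ρ < σ →
    divg r₀ (grad r₀ φ) ρ θ s + ρ / sqrtG r₀ ρ θ s * lapPerp (Preg D K r₀ φ) ρ θ s =
      -divg r₀ (Btilde r₀ B₀) ρ θ s

end NearAxis

end

open NearAxis

/-! Put z = ρe^{iθ} and w = ρe^{-iθ}. A near-axis expansion is a power series Σ u_{ab}(s) z^a w^b
with a = n and b = m - n, and Δ_⊥ = 4∂_z∂_w. The terms with a = 0 or b = 0 are annihilated by Δ_⊥.
They are the free data, and every other coefficient is determined by coefficients of lower total
degree.

The equation involves division by h_s = ℓ'(1 - κ(z+w)/2). This division is isolated in the flux J =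
(∂_sφ - ℓ'τ∂_θφ + ℓ'B₀)/h_s: the field √g(∇φ + B̃) is polynomial in h_s, J and first derivatives of
φ, up to powers of ρ. The coefficients of J follow from those of φ by a recursion on the degree
(`IsDivh`). Comparing coefficients of z^{a+1}w^{b+1} in ρ√g times the equation gives 4(a+1)(b+1)(ℓ'
+ P_{a-b}) u_{a+1,b+1} = ℓ'κ((2a+1)(b+1)u_{a,b+1} + (a+1)(2b+1)u_{a+1,b}) - (∂_s - ℓ'τ i(a-b))
J_{ab}, where P_k is P restricted to the poloidal mode k. This is `stepU`, and `IsSol` is the whole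
recursion.

Without P, the term ∂_s J would cost two s-derivatives at each step, and no fixed Sobolev space
would survive. On the mode e^{ijs} the operator ℓ' + P_k is multiplication by `ellSym`, which
dominates (1+|j|+|k|)^{2D} uniformly in j and k (`pow_le_resC_mul`). Its inverse therefore maps
H^{q+1} into H^{q+2D} even after one more derivative in s or θ (`multBound_res`). Since D ≥ 1, the
flux of a potential in H^{q+2D} lies in H^{q+1}. That space is an algebra (`conv_bound`), and it
contains κ and τ because r₀ is C^{4+q}. The flux picks up a factor 1+a+b from ∂_θ, and the division
by 4(a+1)(b+1) removes it. Induction on the degree then gives ‖u_{ab}‖ ≤ 2M R^{a+b} (`IsSol.bound`),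
where M is linear in the data and R depends only on bounds for the geometry. The tube has radius σ =
1/(2R): the spare factor 2^{-m} absorbs all polynomial factors in the degree m.

The estimates live in spaces `Hs r` of Fourier sequences in s. `sobolev_lower` and `sobolev_upper`
compare them with the weak-derivative norms of the statement.

Equation and recursion are equivalent: `defect_eq_zero` in one direction, `isSol_of_defect` in the
other. The second uses that a vanishing power series in z and w has zero coefficients
(`eq_zero_of_PS_eq_zero`). Uniqueness follows, because the recursion has one solution for given
data. So does reality of the solution, by comparing it with its own real part.

For continuity in the axis, curvature, torsion and ℓ' depend continuously on r₀, hence so does each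
coefficient (`tendsto_sol`). The bound R is common to all nearby axes, so the tails of the series
are uniformly small (`eventually_geometric_term_le`).

In Cartesian components the torsion terms of the field cancel. What remains is ∂_xφ + h_s^{-1}∂_xPφ
along n, ∂_yφ + h_s^{-1}∂_yPφ along b, and J along t. These are power series with coefficients in
H^q, which also define the field on the axis (`exists_field`). -/

noncomputable section

namespace NearAxis

/-! ### Sobolev spaces of Fourier coefficient sequences -/

/-- The weight `1 + |j|`. -/
def wt (j : ℤ) : ℝ := 1 + |(j : ℝ)|

lemma one_le_wt (j : ℤ) : 1 ≤ wt j := by unfold wt; linarith [abs_nonneg (j : ℝ)]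

lemma wt_pos (j : ℤ) : 0 < wt j := lt_of_lt_of_le one_pos (one_le_wt j)

lemma abs_le_wt (j : ℤ) : |(j : ℝ)| ≤ wt j := by unfold wt; linarith

lemma wt_neg (j : ℤ) : wt (-j) = wt j := by simp [wt]

lemma wt_add_le (i j : ℤ) : wt (i + j) ≤ wt i + wt j := by
  unfold wt; push_cast; linarith [abs_add_le (i : ℝ) j]

lemma wt_pow_add_le (r : ℕ) (i j : ℤ) : wt (i + j) ^ r ≤ 2 ^ r * (wt i ^ r + wt j ^ r) := by
  have hi := wt_pos i
  have hj := wt_pos j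
  rcases le_total (wt i) (wt j) with h | h
  · calc wt (i + j) ^ r ≤ (2 * wt j) ^ r := by
          apply pow_le_pow_left₀ (wt_pos _).le; linarith [wt_add_le i j]
      _ = 2 ^ r * wt j ^ r := mul_pow _ _ _
      _ ≤ _ := by gcongr; linarith [pow_pos hi r]
  · calc wt (i + j) ^ r ≤ (2 * wt i) ^ r := by
          apply pow_le_pow_left₀ (wt_pos _).le; linarith [wt_add_le i j]
      _ = 2 ^ r * wt i ^ r := mul_pow _ _ _
      _ ≤ _ := by gcongr; linarith [pow_pos hj r]

lemma summable_inv_wt_sq : Summable fun j : ℤ => ((wt j)⁻¹) ^ 2 := by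
  have h : Summable fun j : ℤ => 1 / (j : ℝ) ^ 2 := Real.summable_one_div_int_pow.mpr one_lt_two
  refine Summable.of_norm_bounded_eventually h ?_
  filter_upwards [(Set.finite_singleton (0 : ℤ)).compl_mem_cofinite] with j hj
  have hj0 : (j : ℝ) ≠ 0 := by simpa using hj
  rw [Real.norm_of_nonneg (by positivity), one_div, inv_pow]
  apply inv_anti₀ (by positivity)
  calc (j : ℝ) ^ 2 = |(j : ℝ)| ^ 2 := (sq_abs _).symm
    _ ≤ _ := pow_le_pow_left₀ (abs_nonneg _) (abs_le_wt j) 2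

/-- Young's inequality `ℓ¹ * ℓ² ⊆ ℓ²` for nonnegative sequences. -/
lemma young_sq {a b : ℤ → ℝ} (ha : ∀ i, 0 ≤ a i) (hb : ∀ i, 0 ≤ b i) (hsb : Summable b)
    (hsa : Summable fun i => a i ^ 2) :
    (∀ j, Summable fun i => b i * a (j - i)) ∧
    Summable (fun j => (∑' i, b i * a (j - i)) ^ 2) ∧
    ∑' j, (∑' i, b i * a (j - i)) ^ 2 ≤ (∑' i, b i) ^ 2 * ∑' i, a i ^ 2 := by
  have hF : Summable fun p : ℤ × ℤ => b p.1 * a (p.2 - p.1) ^ 2 := by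
    have h1 := Summable.mul_of_nonneg hsb hsa hb (fun i => sq_nonneg (a i))
    let e : ℤ × ℤ ≃ ℤ × ℤ := ⟨fun p => (p.1, p.2 - p.1), fun p => (p.1, p.2 + p.1),
      fun p => by simp, fun p => by simp⟩
    exact (e.summable_iff.mpr h1)
  have hF' : Summable fun p : ℤ × ℤ => b p.2 * a (p.1 - p.2) ^ 2 := hF.prod_symm
  have hrow : ∀ j, Summable fun i => b i * a (j - i) ^ 2 := fun j => hF'.prod_factor j
  have key : ∀ j, (Summable fun i => b i * a (j - i)) ∧
      (∑' i, b i * a (j - i)) ^ 2 ≤ (∑' i, b i) * ∑' i, b i * a (j - i) ^ 2 := by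
    intro j
    -- Cauchy–Schwarz with `b i` split as `√(b i) * √(b i)`. The remaining `b`-weighted sums of
    -- squares can be summed over `j` by Tonelli.
    have h := Real.summable_and_inner_le_Lp_mul_Lq_tsum_of_nonneg (f := fun i => √(b i))
      (g := fun i => √(b i) * a (j - i)) (p := 2) (q := 2) Real.HolderConjugate.two_two
      (fun i => Real.sqrt_nonneg _) (fun i => mul_nonneg (Real.sqrt_nonneg _) (ha _))
      (by simpa [Real.sq_sqrt (hb _)] using hsb)
      (by simpa [mul_pow, Real.sq_sqrt (hb _)] using hrow j)
    have e1 : ∀ i, √(b i) * (√(b i) * a (j - i)) = b i * a (j - i) := fun i => by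
      rw [← mul_assoc, Real.mul_self_sqrt (hb i)]
    simp only [e1] at h
    refine ⟨h.1, ?_⟩
    have h2 := h.2
    simp only [Real.rpow_ofNat, mul_pow, Real.sq_sqrt (hb _)] at h2
    rw [← Real.sqrt_eq_rpow, ← Real.sqrt_eq_rpow] at h2
    have h0 : 0 ≤ ∑' i, b i * a (j - i) := tsum_nonneg fun i => mul_nonneg (hb _) (ha _)
    calc (∑' i, b i * a (j - i)) ^ 2 ≤ (√(∑' i, b i) * √(∑' i, b i * a (j - i) ^ 2)) ^ 2 :=
          pow_le_pow_left₀ h0 h2 2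
      _ = _ := by
          rw [mul_pow, Real.sq_sqrt (tsum_nonneg hb),
            Real.sq_sqrt (tsum_nonneg fun i => mul_nonneg (hb _) (sq_nonneg _))]
  have hcol : Summable fun j => ∑' i, b i * a (j - i) ^ 2 := hF'.prod
  have hs2 : Summable (fun j => (∑' i, b i * a (j - i)) ^ 2) :=
    Summable.of_nonneg_of_le (fun _ => sq_nonneg _) (fun j => (key j).2) (hcol.mul_left _)
  refine ⟨fun j => (key j).1, hs2, ?_⟩
  calc ∑' j, (∑' i, b i * a (j - i)) ^ 2
      ≤ ∑' j, (∑' i, b i) * ∑' i, b i * a (j - i) ^ 2 :=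
        hs2.tsum_le_tsum (fun j => (key j).2) (hcol.mul_left _)
    _ = (∑' i, b i) * ∑' j, ∑' i, b i * a (j - i) ^ 2 := tsum_mul_left
    _ = (∑' i, b i) * ∑' i, ∑' j, b i * a (j - i) ^ 2 := by
        congr 1
        exact Summable.tsum_comm (f := fun i j => b i * a (j - i) ^ 2) hF
    _ = (∑' i, b i) * ∑' i, b i * ∑' j, a j ^ 2 := by
        congr 2; ext i
        rw [tsum_mul_left]
        congr 1
        exact (Equiv.subRight i).tsum_eq (fun j => a j ^ 2)
    _ = _ := by rw [tsum_mul_right]; ring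

lemma summable_weight_add {r : ℕ} {u v : ℤ → ℂ} (hu : Summable fun j => (wt j ^ r * ‖u j‖) ^ 2)
    (hv : Summable fun j => (wt j ^ r * ‖v j‖) ^ 2) :
    Summable fun j => (wt j ^ r * ‖(u + v) j‖) ^ 2 := by
  refine Summable.of_nonneg_of_le (fun _ => sq_nonneg _) (fun j => ?_)
    ((hu.add hv).mul_left 2)
  have h0 : 0 ≤ wt j ^ r := pow_nonneg (wt_pos j).le _
  have h1 : wt j ^ r * ‖(u + v) j‖ ≤ wt j ^ r * ‖u j‖ + wt j ^ r * ‖v j‖ := by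
    rw [← mul_add]; exact mul_le_mul_of_nonneg_left (norm_add_le _ _) h0
  have h2 := pow_le_pow_left₀ (mul_nonneg h0 (norm_nonneg _)) h1 2
  nlinarith [sq_nonneg (wt j ^ r * ‖u j‖ - wt j ^ r * ‖v j‖)]

/-- The weighted sequence space `h^r`. -/
def hsSub (r : ℕ) : Submodule ℂ (ℤ → ℂ) where
  carrier := {u | Summable fun j => (wt j ^ r * ‖u j‖) ^ 2}
  add_mem' := summable_weight_add
  zero_mem' := by simp
  smul_mem' := fun c a (ha : Summable _) => by
    refine (ha.mul_left (‖c‖ ^ 2)).congr fun j => ?_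
    rw [Pi.smul_apply, norm_smul]; ring

/-- The Sobolev space `H^r(𝕋)`, as a space of sequences of Fourier coefficients. -/
def Hs (r : ℕ) : Type := hsSub r

namespace Hs

instance (r : ℕ) : AddCommGroup (Hs r) := inferInstanceAs (AddCommGroup (hsSub r))
instance (r : ℕ) : Module ℂ (Hs r) := inferInstanceAs (Module ℂ (hsSub r))

instance (r : ℕ) : CoeFun (Hs r) (fun _ => ℤ → ℂ) := ⟨fun u => u.1⟩

variable {r : ℕ}

@[ext] lemma ext {u v : Hs r} (h : ∀ j, u j = v j) : u = v := Subtype.ext (funext h)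

@[simp] lemma add_apply (u v : Hs r) (j : ℤ) : (u + v) j = u j + v j := rfl
@[simp] lemma sub_apply (u v : Hs r) (j : ℤ) : (u - v) j = u j - v j := rfl
@[simp] lemma zero_apply (j : ℤ) : (0 : Hs r) j = 0 := rfl
@[simp] lemma smul_apply (c : ℂ) (u : Hs r) (j : ℤ) : (c • u) j = c * u j := rfl

lemma memlp_weight (u : Hs r) : Memℓp (fun j => (wt j : ℂ) ^ r * u j) 2 :=
  memℓp_gen (by
    have h : Summable fun j => (wt j ^ r * ‖u j‖) ^ 2 := u.2
    refine h.congr fun j => ?_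
    rw [norm_mul, norm_pow, Complex.norm_real, Real.norm_of_nonneg (wt_pos j).le]
    simp)

/-- The isometry into `ℓ²` given by the weight. -/
def toL2 (r : ℕ) : Hs r →ₗ[ℂ] lp (fun _ : ℤ => ℂ) 2 where
  toFun u := ⟨fun j => (wt j : ℂ) ^ r * u j, memlp_weight u⟩
  map_add' u v := by ext j; exact mul_add _ _ _
  map_smul' c u := by ext j; exact mul_left_comm _ _ _

lemma toL2_apply (u : Hs r) (j : ℤ) : toL2 r u j = (wt j : ℂ) ^ r * u j := rfl

lemma toL2_injective : Function.Injective (toL2 r) := fun u v h => by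
  ext j
  have := congrArg (fun x : lp (fun _ : ℤ => ℂ) 2 => x j) h
  simp only [toL2_apply] at this
  exact mul_left_cancel₀ (pow_ne_zero _ (Complex.ofReal_ne_zero.mpr (wt_pos j).ne')) this

/-- `Hs` is a type of its own, so that this norm does not compete with the product topology which a
submodule of `ℤ → ℂ` inherits. -/
instance : NormedAddCommGroup (Hs r) :=
  NormedAddCommGroup.induced _ _ (toL2 r) toL2_injective

instance : NormedSpace ℂ (Hs r) := NormedSpace.induced ℂ _ _ (toL2 r)

lemma norm_toL2_apply (u : Hs r) (j : ℤ) : ‖toL2 r u j‖ = wt j ^ r * ‖u j‖ := by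
  rw [toL2_apply, norm_mul, norm_pow, Complex.norm_real, Real.norm_of_nonneg (wt_pos j).le]

lemma hasSum_sq (u : Hs r) : HasSum (fun j => (wt j ^ r * ‖u j‖) ^ 2) (‖u‖ ^ 2) := by
  have := lp.hasSum_norm (p := 2) (by norm_num) (toL2 r u)
  simp only [norm_toL2_apply] at this
  have e : ‖u‖ = ‖toL2 r u‖ := rfl
  rw [e]
  simpa using this

lemma norm_sq (u : Hs r) : ‖u‖ ^ 2 = ∑' j, (wt j ^ r * ‖u j‖) ^ 2 := (hasSum_sq u).tsum_eq.symm

lemma weight_le_norm (u : Hs r) (j : ℤ) : wt j ^ r * ‖u j‖ ≤ ‖u‖ := by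
  rw [← norm_toL2_apply]; exact lp.norm_apply_le_norm (by norm_num) (toL2 r u) j

lemma apply_le_norm (u : Hs r) (j : ℤ) : ‖u j‖ ≤ ‖u‖ :=
  le_trans (le_mul_of_one_le_left (norm_nonneg _) (one_le_pow₀ (one_le_wt j))) (weight_le_norm u j)

/-- An element of `h^r` from a sequence with summable weighted squares. -/
def of (r : ℕ) (u : ℤ → ℂ) (h : Summable fun j => (wt j ^ r * ‖u j‖) ^ 2) : Hs r := ⟨u, h⟩

@[simp] lemma of_apply (u : ℤ → ℂ) (h) (j : ℤ) : (of r u h) j = u j := rfl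

/-- Cauchy–Schwarz against `(wt j)⁻¹`, which is square summable: one derivative buys absolute
summability. The pointwise calculus of Fourier series below rests on this. -/
lemma summable_weight (u : Hs (r + 1)) : Summable fun j => wt j ^ r * ‖u j‖ := by
  have h := Real.summable_and_inner_le_Lp_mul_Lq_tsum_of_nonneg (f := fun j => (wt j)⁻¹)
      (g := fun j => wt j ^ (r + 1) * ‖u j‖) (p := 2) (q := 2) Real.HolderConjugate.two_two
      (fun i => (inv_pos.mpr (wt_pos i)).le)
      (fun i => mul_nonneg (pow_nonneg (wt_pos i).le _) (norm_nonneg _))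
      (by simpa using summable_inv_wt_sq) (by simpa using (hasSum_sq u).summable)
  refine h.1.congr fun j => ?_
  have hw := (wt_pos j).ne'
  rw [pow_succ]; field_simp

/-- The constant of the embedding of `h¹` into `ℓ¹`. -/
def embC : ℝ := √(∑' j : ℤ, ((wt j)⁻¹) ^ 2)

lemma embC_nonneg : 0 ≤ embC := Real.sqrt_nonneg _

lemma tsum_weight_le (u : Hs (r + 1)) : ∑' j, wt j ^ r * ‖u j‖ ≤ embC * ‖u‖ := by
  have h := Real.summable_and_inner_le_Lp_mul_Lq_tsum_of_nonneg (f := fun j => (wt j)⁻¹)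
      (g := fun j => wt j ^ (r + 1) * ‖u j‖) (p := 2) (q := 2) Real.HolderConjugate.two_two
      (fun i => (inv_pos.mpr (wt_pos i)).le)
      (fun i => mul_nonneg (pow_nonneg (wt_pos i).le _) (norm_nonneg _))
      (by simpa using summable_inv_wt_sq) (by simpa using (hasSum_sq u).summable)
  have e : ∀ j, (wt j)⁻¹ * (wt j ^ (r + 1) * ‖u j‖) = wt j ^ r * ‖u j‖ := fun j => by
    have hw := (wt_pos j).ne'
    rw [pow_succ]; field_simp
  simp only [e, Real.rpow_ofNat] at h
  rw [← Real.sqrt_eq_rpow, ← Real.sqrt_eq_rpow, ← norm_sq, Real.sqrt_sq (norm_nonneg _)] at h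
  exact h.2

lemma norm_le_of_tsum {u : Hs r} {C : ℝ} (hC : 0 ≤ C)
    (h : ∑' j, (wt j ^ r * ‖u j‖) ^ 2 ≤ C ^ 2) : ‖u‖ ≤ C := by
  rw [← norm_sq] at h
  exact abs_le_of_sq_le_sq' h hC |>.2

lemma summable_norm_pos (hr : 1 ≤ r) (u : Hs r) : Summable fun j => ‖u j‖ := by
  obtain ⟨r, rfl⟩ := Nat.exists_eq_add_of_le' hr
  refine Summable.of_nonneg_of_le (fun _ => norm_nonneg _) (fun j => ?_) (summable_weight u)
  exact le_mul_of_one_le_left (norm_nonneg _) (one_le_pow₀ (one_le_wt j))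

lemma tsum_norm_le (hr : 1 ≤ r) (u : Hs r) : ∑' j, ‖u j‖ ≤ embC * ‖u‖ := by
  have h1 := summable_norm_pos hr u
  obtain ⟨r, rfl⟩ := Nat.exists_eq_add_of_le' hr
  refine (h1.tsum_le_tsum (fun j => ?_) (summable_weight u)).trans (tsum_weight_le u)
  exact le_mul_of_one_le_left (norm_nonneg _) (one_le_pow₀ (one_le_wt j))

/-! #### Fourier multipliers -/

/-- `d` is the symbol of a multiplier of norm at most `C` from `h^r` to `h^{r'}`. -/
def MultBound (d : ℤ → ℂ) (r r' : ℕ) (C : ℝ) : Prop :=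
  0 ≤ C ∧ ∀ j, wt j ^ r' * ‖d j‖ ≤ C * wt j ^ r

lemma MultBound.sq_le {d : ℤ → ℂ} {r r' : ℕ} {C : ℝ} (h : MultBound d r r' C) (u : Hs r) (j : ℤ) :
    (wt j ^ r' * ‖d j * u j‖) ^ 2 ≤ C ^ 2 * (wt j ^ r * ‖u j‖) ^ 2 := by
  rw [← mul_pow]
  apply pow_le_pow_left₀ (by have := wt_pos j; positivity)
  rw [norm_mul, ← mul_assoc, ← mul_assoc]
  exact mul_le_mul_of_nonneg_right (h.2 j) (norm_nonneg _)

lemma MultBound.summable {d : ℤ → ℂ} {r r' : ℕ} {C : ℝ} (h : MultBound d r r' C) (u : Hs r) :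
    Summable fun j => (wt j ^ r' * ‖d j * u j‖) ^ 2 :=
  Summable.of_nonneg_of_le (fun _ => sq_nonneg _) (h.sq_le u) ((hasSum_sq u).summable.mul_left _)

/-- A bounded multiplier as a continuous linear map. -/
def MultBound.toCLM {d : ℤ → ℂ} {r r' : ℕ} {C : ℝ} (h : MultBound d r r' C) : Hs r →L[ℂ] Hs r' :=
  LinearMap.mkContinuous
    { toFun := fun u => of r' (fun j => d j * u j) (h.summable u)
      map_add' := fun u v => by ext j; simp [mul_add]
      map_smul' := fun c u => by ext j; simp; ring } C
    (fun u => by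
      apply norm_le_of_tsum (mul_nonneg h.1 (norm_nonneg _))
      rw [mul_pow, norm_sq u, ← tsum_mul_left]
      exact (h.summable u).tsum_le_tsum (h.sq_le u) ((hasSum_sq u).summable.mul_left _))

open Classical in
/-- The multiplier with symbol `d` as a map from `h^r` to `h^{r'}`, zero if it is unbounded. -/
def multL (d : ℤ → ℂ) (r r' : ℕ) : Hs r →L[ℂ] Hs r' :=
  if h : ∃ C, MultBound d r r' C then h.choose_spec.toCLM else 0

lemma MultBound.multL_apply {d : ℤ → ℂ} {r r' : ℕ} {C : ℝ} (h : MultBound d r r' C) (u : Hs r)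
    (j : ℤ) : multL d r r' u j = d j * u j := by
  have h' : ∃ C, MultBound d r r' C := ⟨C, h⟩
  simp only [multL, dif_pos h']; rfl

lemma MultBound.norm_le {d : ℤ → ℂ} {r r' : ℕ} {C : ℝ} (h : MultBound d r r' C) (u : Hs r) :
    ‖multL d r r' u‖ ≤ C * ‖u‖ := by
  have : multL d r r' u = h.toCLM u := by
    ext j; rw [h.multL_apply]; rfl
  rw [this]
  exact LinearMap.mkContinuous_norm_le _ h.1 _ |> fun hh =>
    (h.toCLM.le_opNorm u).trans (mul_le_mul_of_nonneg_right hh (norm_nonneg _))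

/-- The symbol of the inclusion is bounded. -/
lemma multBound_one {r r' : ℕ} (h : r' ≤ r) : MultBound (fun _ => 1) r r' 1 :=
  ⟨zero_le_one, fun j => by simpa using pow_le_pow_right₀ (one_le_wt j) h⟩

/-- The symbol of the `i`-th derivative is bounded. -/
lemma multBound_deriv {r r' i : ℕ} (h : r' + i ≤ r) :
    MultBound (fun j => (Complex.I * j) ^ i) r r' 1 := by
  refine ⟨zero_le_one, fun j => ?_⟩
  have : ‖(Complex.I * (j : ℂ)) ^ i‖ = |(j : ℝ)| ^ i := by
    rw [norm_pow, norm_mul, Complex.norm_I, one_mul, Complex.norm_intCast]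
  rw [this, one_mul]
  calc wt j ^ r' * |(j : ℝ)| ^ i ≤ wt j ^ r' * wt j ^ i :=
        mul_le_mul_of_nonneg_left (pow_le_pow_left₀ (abs_nonneg _) (abs_le_wt j) i)
          (pow_nonneg (wt_pos j).le _)
    _ = wt j ^ (r' + i) := (pow_add _ _ _).symm
    _ ≤ _ := pow_le_pow_right₀ (one_le_wt j) h

/-- The inclusion `h^r ⊆ h^{r'}`. -/
abbrev incl (r r' : ℕ) : Hs r →L[ℂ] Hs r' := multL (fun _ => 1) r r'

lemma incl_apply {r r' : ℕ} (h : r' ≤ r) (u : Hs r) (j : ℤ) : incl r r' u j = u j := by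
  rw [(multBound_one h).multL_apply, one_mul]

/-- The `i`-th derivative. -/
abbrev derivL (i r k : ℕ) : Hs r →L[ℂ] Hs k := multL (fun j => (Complex.I * j) ^ i) r k

/-! #### Products -/

/-- Convolution of sequences. -/
def conv (f u : ℤ → ℂ) (j : ℤ) : ℂ := ∑' i, f i * u (j - i)

/-- The constant in the algebra property. -/
def algC (r : ℕ) : ℝ := 2 ^ r * (2 * embC)

lemma algC_nonneg (r : ℕ) : 0 ≤ algC r := by have := embC_nonneg; unfold algC; positivity

lemma conv_summable (hr : 1 ≤ r) (f u : Hs r) (j : ℤ) : Summable fun i => f i * u (j - i) := by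
  refine Summable.of_norm_bounded ((summable_norm_pos hr f).mul_right ‖u‖) fun i => ?_
  rw [norm_mul]
  exact mul_le_mul_of_nonneg_left (apply_le_norm u _) (norm_nonneg _)

/-- Up to the factor `2 ^ r` the weight is subadditive, so it can be put on one of the two factors.
The other factor is then only needed in `ℓ¹`, which `1 ≤ r` provides, and Young's inequality applies
to both resulting convolutions. -/
lemma conv_bound (hr : 1 ≤ r) (f u : Hs r) :
    (Summable fun j => (wt j ^ r * ‖conv f u j‖) ^ 2) ∧
    ∑' j, (wt j ^ r * ‖conv f u j‖) ^ 2 ≤ (algC r * (‖f‖ * ‖u‖)) ^ 2 := by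
  have hw : ∀ (v : Hs r) (i : ℤ), 0 ≤ wt i ^ r * ‖v i‖ := fun v i =>
    mul_nonneg (pow_nonneg (wt_pos i).le _) (norm_nonneg _)
  obtain ⟨a1, a2, a3⟩ := young_sq (a := fun i => wt i ^ r * ‖u i‖) (b := fun i => ‖f i‖)
    (hw u) (fun _ => norm_nonneg _) (summable_norm_pos hr f) (hasSum_sq u).summable
  obtain ⟨b1, b2, b3⟩ := young_sq (a := fun i => wt i ^ r * ‖f i‖) (b := fun i => ‖u i‖)
    (hw f) (fun _ => norm_nonneg _) (summable_norm_pos hr u) (hasSum_sq f).summable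
  have b1' : ∀ j, Summable fun i => ‖u (j - i)‖ * (wt i ^ r * ‖f i‖) := fun j => by
    have := (Equiv.subLeft j).summable_iff.mpr (b1 j)
    refine this.congr fun i => ?_
    simp
  -- Reflecting `i ↦ j - i` brings both convolutions to one summation index, so that the weight
  -- estimate can be summed termwise.
  have be : ∀ j, ∑' i, ‖u i‖ * (wt (j - i) ^ r * ‖f (j - i)‖) =
      ∑' i, ‖u (j - i)‖ * (wt i ^ r * ‖f i‖) := fun j => by
    rw [← (Equiv.subLeft j).tsum_eq]; simp
  rw [← norm_sq] at a3 b3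
  have fl := tsum_norm_le hr f
  have ul := tsum_norm_le hr u
  have pt : ∀ j, (wt j ^ r * ‖conv f u j‖) ^ 2 ≤ (2 ^ r) ^ 2 *
      (2 * ((∑' i, ‖f i‖ * (wt (j - i) ^ r * ‖u (j - i)‖)) ^ 2 +
        (∑' i, ‖u i‖ * (wt (j - i) ^ r * ‖f (j - i)‖)) ^ 2)) := by
    intro j
    have h1 : wt j ^ r * ‖conv f u j‖ ≤ 2 ^ r * ((∑' i, ‖f i‖ * (wt (j - i) ^ r * ‖u (j - i)‖)) +
        ∑' i, ‖u i‖ * (wt (j - i) ^ r * ‖f (j - i)‖)) := by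
      rw [be j, ← (a1 j).tsum_add (b1' j), ← tsum_mul_left]
      have hn : Summable fun i => ‖f i * u (j - i)‖ := (conv_summable hr f u j).norm
      calc wt j ^ r * ‖conv f u j‖ ≤ wt j ^ r * ∑' i, ‖f i * u (j - i)‖ :=
            mul_le_mul_of_nonneg_left (norm_tsum_le_tsum_norm hn) (pow_nonneg (wt_pos j).le _)
        _ = ∑' i, wt j ^ r * ‖f i * u (j - i)‖ := tsum_mul_left.symm
        _ ≤ _ := by
            refine (hn.mul_left _).tsum_le_tsum (fun i => ?_)
              (((a1 j).add (b1' j)).mul_left _)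
            have hh := wt_pow_add_le r i (j - i)
            rw [add_sub_cancel] at hh
            rw [norm_mul]
            calc wt j ^ r * (‖f i‖ * ‖u (j - i)‖)
                ≤ (2 ^ r * (wt i ^ r + wt (j - i) ^ r)) * (‖f i‖ * ‖u (j - i)‖) :=
                  mul_le_mul_of_nonneg_right hh (by positivity)
              _ = _ := by ring
    have h2 := pow_le_pow_left₀ (mul_nonneg (pow_nonneg (wt_pos j).le _) (norm_nonneg _)) h1 2
    refine h2.trans ?_
    rw [mul_pow]
    refine mul_le_mul_of_nonneg_left ?_ (by positivity)
    set x := ∑' i, ‖f i‖ * (wt (j - i) ^ r * ‖u (j - i)‖)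
    set y := ∑' i, ‖u i‖ * (wt (j - i) ^ r * ‖f (j - i)‖)
    nlinarith [sq_nonneg (x - y)]
  have hs : Summable fun j => (2 ^ r : ℝ) ^ 2 *
      (2 * ((∑' i, ‖f i‖ * (wt (j - i) ^ r * ‖u (j - i)‖)) ^ 2 +
        (∑' i, ‖u i‖ * (wt (j - i) ^ r * ‖f (j - i)‖)) ^ 2)) :=
    ((a2.add b2).mul_left 2).mul_left _
  have hs1 := Summable.of_nonneg_of_le (fun _ => sq_nonneg _) pt hs
  refine ⟨hs1, (hs1.tsum_le_tsum pt hs).trans ?_⟩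
  rw [tsum_mul_left, tsum_mul_left, a2.tsum_add b2]
  have hf0 : 0 ≤ ∑' i, ‖f i‖ := tsum_nonneg fun _ => norm_nonneg _
  have hu0 : 0 ≤ ∑' i, ‖u i‖ := tsum_nonneg fun _ => norm_nonneg _
  have A : ∑' j, (∑' i, ‖f i‖ * (wt (j - i) ^ r * ‖u (j - i)‖)) ^ 2 ≤
      (embC * ‖f‖) ^ 2 * ‖u‖ ^ 2 :=
    a3.trans (mul_le_mul_of_nonneg_right (pow_le_pow_left₀ hf0 fl 2) (sq_nonneg _))
  have B : ∑' j, (∑' i, ‖u i‖ * (wt (j - i) ^ r * ‖f (j - i)‖)) ^ 2 ≤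
      (embC * ‖u‖) ^ 2 * ‖f‖ ^ 2 :=
    b3.trans (mul_le_mul_of_nonneg_right (pow_le_pow_left₀ hu0 ul 2) (sq_nonneg _))
  have : (algC r * (‖f‖ * ‖u‖)) ^ 2 = (2 ^ r) ^ 2 *
      (2 * ((embC * ‖f‖) ^ 2 * ‖u‖ ^ 2 + (embC * ‖u‖) ^ 2 * ‖f‖ ^ 2)) := by
    unfold algC; ring
  rw [this]
  gcongr

/-- The product of functions in terms of Fourier coefficients. -/
def mulCLM (r : ℕ) (hr : 1 ≤ r) : Hs r →L[ℂ] Hs r →L[ℂ] Hs r :=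
  LinearMap.mkContinuous₂
    (LinearMap.mk₂ ℂ (fun f u => of r (conv f u) (conv_bound hr f u).1)
      (fun f g u => by
        ext j; simp only [of_apply, conv, add_apply, add_mul]
        exact (conv_summable hr f u j).tsum_add (conv_summable hr g u j))
      (fun c f u => by
        ext j; simp only [of_apply, conv, smul_apply, mul_assoc]; exact tsum_mul_left)
      (fun f u v => by
        ext j; simp only [of_apply, conv, add_apply, mul_add]
        exact (conv_summable hr f u j).tsum_add (conv_summable hr f v j))
      (fun c f u => by
        ext j; simp only [of_apply, conv, smul_apply]
        rw [← tsum_mul_left]; congr 1; ext i; ring)) (algC r)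
    (fun f u => by
      refine (norm_le_of_tsum (by have := algC_nonneg r; positivity)
        (conv_bound hr f u).2).trans ?_
      rw [mul_assoc])

/-- The product on `h^r`, zero if `r = 0`. -/
def mulL (r : ℕ) : Hs r →L[ℂ] Hs r →L[ℂ] Hs r := if hr : 1 ≤ r then mulCLM r hr else 0

lemma mulL_apply (hr : 1 ≤ r) (f u : Hs r) (j : ℤ) : mulL r f u j = conv f u j := by
  simp only [mulL, dif_pos hr]; rfl

lemma norm_mulL_le (f u : Hs r) : ‖mulL r f u‖ ≤ algC r * ‖f‖ * ‖u‖ := by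
  by_cases hr : 1 ≤ r
  · refine (norm_le_of_tsum (C := algC r * (‖f‖ * ‖u‖)) (by have := algC_nonneg r; positivity)
      ?_).trans (le_of_eq (mul_assoc _ _ _).symm)
    simp only [mulL_apply hr]
    exact (conv_bound hr f u).2
  · simp only [mulL, dif_neg hr]
    have := algC_nonneg r
    simp only [_root_.zero_apply, norm_zero]
    positivity

/-! #### Conjugation -/

/-- The coefficients of the conjugate function. -/
def starFun (u : ℤ → ℂ) (j : ℤ) : ℂ := (starRingEnd ℂ) (u (-j))

lemma star_summable (u : Hs r) : Summable fun j => (wt j ^ r * ‖starFun u j‖) ^ 2 := by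
  have := (Equiv.neg ℤ).summable_iff.mpr (hasSum_sq u).summable
  refine this.congr fun j => ?_
  simp [starFun, wt_neg]

/-- The coefficients of the conjugate function, as an element of `h^r`. -/
def conjH (u : Hs r) : Hs r := of r (starFun u) (star_summable u)

@[simp] lemma conjH_apply (u : Hs r) (j : ℤ) : conjH u j = (starRingEnd ℂ) (u (-j)) := rfl

lemma norm_conjH (u : Hs r) : ‖conjH u‖ = ‖u‖ := by
  have : ‖conjH u‖ ^ 2 = ‖u‖ ^ 2 := by
    rw [norm_sq, norm_sq, ← (Equiv.neg ℤ).tsum_eq]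
    simp [wt_neg]
  exact (pow_left_inj₀ (norm_nonneg _) (norm_nonneg _) two_ne_zero).mp this

end Hs

end NearAxis
end

/-! ### Square integrable functions and Fourier series on the circle and the torus -/

noncomputable section

namespace NearAxis

/-! ### Orthogonal systems in `L²` -/

/-- A system of square integrable functions with `∫ ē_i e_j = c δ_{ij}`, `c > 0`. -/
structure OrthoSys {α ι : Type*} [MeasurableSpace α] [DecidableEq ι] (μ : Measure α)
    (e : ι → α → ℂ) (c : ℝ) : Prop where
  pos : 0 < c
  memLp : ∀ i, MemLp (e i) 2 μ
  ortho : ∀ i j, ∫ x, (starRingEnd ℂ) (e i x) * e j x ∂μ = if i = j then (c : ℂ) else 0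

section Ortho

variable {α ι : Type*} [MeasurableSpace α] [DecidableEq ι] {μ : Measure α} {e : ι → α → ℂ} {c : ℝ}

lemma inner_toLp {f g : α → ℂ} (hf : MemLp f 2 μ) (hg : MemLp g 2 μ) :
    inner ℂ (hf.toLp f) (hg.toLp g) = ∫ x, (starRingEnd ℂ) (f x) * g x ∂μ := by
  rw [L2.inner_def]
  apply integral_congr_ae
  filter_upwards [hf.coeFn_toLp, hg.coeFn_toLp] with x h1 h2
  rw [h1, h2, RCLike.inner_apply, mul_comm]

lemma OrthoSys.orthonormal (h : OrthoSys μ e c) :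
    Orthonormal ℂ fun i => ((√c : ℂ))⁻¹ • (h.memLp i).toLp (e i) := by
  have hc : (√c : ℂ) * √c = c := by
    rw [← Complex.ofReal_mul, Real.mul_self_sqrt h.pos.le]
  have hc0 : (√c : ℂ) ≠ 0 := by
    simpa using (Real.sqrt_pos.mpr h.pos).ne'
  rw [orthonormal_iff_ite]
  intro i j
  rw [inner_smul_left, inner_smul_right, inner_toLp, h.ortho]
  split_ifs
  · rw [← hc, map_inv₀, Complex.conj_ofReal]; field_simp
  · simp

/-- Bessel's inequality. -/
lemma OrthoSys.bessel (h : OrthoSys μ e c) {g : α → ℂ} (hg : MemLp g 2 μ) :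
    (Summable fun i => ‖∫ x, (starRingEnd ℂ) (e i x) * g x ∂μ‖ ^ 2) ∧
    ∑' i, ‖∫ x, (starRingEnd ℂ) (e i x) * g x ∂μ‖ ^ 2 ≤ c * (eLpNorm g 2 μ).toReal ^ 2 := by
  have e1 : ∀ i, ‖inner ℂ (((√c : ℂ))⁻¹ • (h.memLp i).toLp (e i)) (hg.toLp g)‖ ^ 2 =
      c⁻¹ * ‖∫ x, (starRingEnd ℂ) (e i x) * g x ∂μ‖ ^ 2 := fun i => by
    rw [inner_smul_left, inner_toLp, norm_mul, mul_pow, map_inv₀, Complex.conj_ofReal, norm_inv,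
      Complex.norm_real, Real.norm_of_nonneg (Real.sqrt_nonneg _), inv_pow, Real.sq_sqrt h.pos.le]
  have hs := h.orthonormal.inner_products_summable (hg.toLp g)
  have hb := h.orthonormal.tsum_inner_products_le (hg.toLp g)
  simp only [e1] at hs hb
  have hs' := (summable_mul_left_iff (inv_ne_zero h.pos.ne')).mp hs
  refine ⟨hs', ?_⟩
  rw [tsum_mul_left, Lp.norm_toLp, inv_mul_le_iff₀ h.pos] at hb
  exact hb

/-- The Riesz-Fischer theorem. -/
lemma OrthoSys.exists_hasSum (h : OrthoSys μ e c) {v : ι → ℂ} (hv : Summable fun i => ‖v i‖ ^ 2) :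
    ∃ G : Lp ℂ 2 μ, HasSum (fun i => v i • (h.memLp i).toLp (e i)) G ∧
      ‖G‖ ^ 2 = c * ∑' i, ‖v i‖ ^ 2 := by
  have hc0 : (√c : ℂ) ≠ 0 := by
    simpa using (Real.sqrt_pos.mpr h.pos).ne'
  have hn : ∀ i, ‖(√c : ℂ) * v i‖ ^ 2 = c * ‖v i‖ ^ 2 := fun i => by
    rw [norm_mul, mul_pow, Complex.norm_real, Real.norm_of_nonneg (Real.sqrt_nonneg _),
      Real.sq_sqrt h.pos.le]
  let f : lp (fun _ : ι => ℂ) 2 := ⟨fun i => (√c : ℂ) * v i, memℓp_gen (by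
    refine (hv.mul_left c).congr fun i => ?_
    rw [← hn i]; simp)⟩
  refine ⟨h.orthonormal.orthogonalFamily.linearIsometry f, ?_, ?_⟩
  · have := h.orthonormal.orthogonalFamily.hasSum_linearIsometry f
    convert this using 1
    ext1 i
    change v i • (h.memLp i).toLp (e i) =
      ((√c : ℂ) * v i) • (((√c : ℂ))⁻¹ • (h.memLp i).toLp (e i))
    rw [smul_smul]
    congr 1
    field_simp
  · rw [LinearIsometry.norm_map]
    have := lp.hasSum_norm (p := 2) (by norm_num) f
    have h2 : ‖f‖ ^ 2 = ∑' i, ‖f i‖ ^ 2 := by simpa using this.tsum_eq.symm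
    rw [h2, ← tsum_mul_left]
    exact tsum_congr hn

/-- Integration against a square integrable function. -/
def pairL {ψ : α → ℂ} (hψ : MemLp ψ 2 μ) : Lp ℂ 2 μ →L[ℂ] ℂ :=
  innerSL ℂ (hψ.star.toLp (star ψ))

lemma pairL_apply {ψ : α → ℂ} (hψ : MemLp ψ 2 μ) (G : Lp ℂ 2 μ) :
    pairL hψ G = ∫ x, G x * ψ x ∂μ := by
  simp only [pairL, innerSL_apply_apply]
  rw [L2.inner_def]
  apply integral_congr_ae
  filter_upwards [hψ.star.coeFn_toLp] with x h1
  rw [h1, RCLike.inner_apply]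
  simp

lemma pairL_toLp {ψ g : α → ℂ} (hψ : MemLp ψ 2 μ) (hg : MemLp g 2 μ) :
    pairL hψ (hg.toLp g) = ∫ x, g x * ψ x ∂μ := by
  rw [pairL_apply]
  apply integral_congr_ae
  filter_upwards [hg.coeFn_toLp] with x h1
  rw [h1]

end Ortho

/-! ### Fourier modes on the circle and on the torus -/

instance : IsFiniteMeasure circleMeasure := by unfold circleMeasure; infer_instance

lemma torusMeasure_eq : torusMeasure = circleMeasure.prod circleMeasure := by
  rw [torusMeasure, circleMeasure, Measure.prod_restrict]; rfl

instance : IsFiniteMeasure torusMeasure := by rw [torusMeasure_eq]; infer_instance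

/-- The Fourier mode `e^{ijx}`. -/
def em (j : ℤ) (x : ℝ) : ℂ := Complex.exp (j * Complex.I * x)

lemma em_eq (j : ℤ) (x : ℝ) : em j x = Complex.exp ((j * x : ℝ) * Complex.I) := by
  unfold em; congr 1; push_cast; ring

@[simp] lemma norm_em (j : ℤ) (x : ℝ) : ‖em j x‖ = 1 := by
  rw [em_eq, Complex.norm_exp_ofReal_mul_I]

lemma em_add (i j : ℤ) (x : ℝ) : em (i + j) x = em i x * em j x := by
  unfold em; rw [← Complex.exp_add]; congr 1; push_cast; ring

@[simp] lemma em_zero (x : ℝ) : em 0 x = 1 := by simp [em]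

lemma conj_em (j : ℤ) (x : ℝ) : (starRingEnd ℂ) (em j x) = em (-j) x := by
  unfold em; rw [← Complex.exp_conj]; congr 1; simp

lemma em_periodic (j : ℤ) : Function.Periodic (em j) (2 * Real.pi) := fun x => by
  unfold em
  rw [Complex.exp_eq_exp_iff_exists_int]
  exact ⟨j, by push_cast; ring⟩

lemma contDiff_em (j : ℤ) {n : WithTop ℕ∞} : ContDiff ℝ n (em j) :=
  (contDiff_const.mul Complex.ofRealCLM.contDiff).cexp

lemma continuous_em (j : ℤ) : Continuous (em j) := (contDiff_em j (n := 0)).continuous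

lemma hasDerivAt_em (j : ℤ) (x : ℝ) : HasDerivAt (em j) (Complex.I * j * em j x) x := by
  have h : HasDerivAt (fun y : ℝ => (j * Complex.I * y : ℂ)) (j * Complex.I * 1) x :=
    (Complex.ofRealCLM.hasDerivAt (x := x)).const_mul _
  have := h.cexp
  refine this.congr_deriv ?_
  unfold em; ring

lemma integral_circle_eq {E : Type*} [NormedAddCommGroup E] [NormedSpace ℝ E] (f : ℝ → E) :
    ∫ x, f x ∂circleMeasure = ∫ x in (0 : ℝ)..(2 * Real.pi), f x := by
  rw [intervalIntegral.integral_of_le Real.two_pi_pos.le]; rfl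

lemma integral_em (j : ℤ) :
    ∫ x, em j x ∂circleMeasure = if j = 0 then ((2 * Real.pi : ℝ) : ℂ) else 0 := by
  rw [integral_circle_eq]
  split_ifs with h
  · subst h; simp
  · unfold em
    have hc : (j : ℂ) * Complex.I ≠ 0 := mul_ne_zero (by exact_mod_cast h) Complex.I_ne_zero
    rw [integral_exp_mul_complex hc]
    have := em_periodic j 0
    unfold em at this
    rw [zero_add] at this
    rw [this, sub_self, zero_div]

lemma memLp_of_continuous_circle {f : ℝ → ℂ} (hf : Continuous f) {p : ℝ≥0∞} :
    MemLp f p circleMeasure := by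
  obtain ⟨C, hC⟩ := (isCompact_Icc (a := (0 : ℝ)) (b := 2 * Real.pi)).exists_bound_of_continuousOn
    hf.continuousOn
  refine MemLp.of_bound hf.aestronglyMeasurable C ?_
  refine (ae_restrict_iff' measurableSet_Ioc).mpr (Eventually.of_forall fun x hx => ?_)
  exact hC x (Ioc_subset_Icc_self hx)

lemma memLp_of_continuous_torus {E : Type*} [NormedAddCommGroup E] {f : ℝ × ℝ → E}
    (hf : Continuous f) {p : ℝ≥0∞} : MemLp f p torusMeasure := by
  obtain ⟨C, hC⟩ := ((isCompact_Icc (a := (0 : ℝ)) (b := 2 * Real.pi)).prod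
    (isCompact_Icc (a := (0 : ℝ)) (b := 2 * Real.pi))).exists_bound_of_continuousOn
    hf.continuousOn
  refine MemLp.of_bound hf.aestronglyMeasurable C ?_
  refine (ae_restrict_iff' (measurableSet_Ioc.prod measurableSet_Ioc)).mpr
    (Eventually.of_forall fun x hx => ?_)
  exact hC x (Set.prod_mono Ioc_subset_Icc_self Ioc_subset_Icc_self hx)

/-- The Fourier mode `e^{i(kθ + js)}`. -/
def em2 (i : ℤ × ℤ) (p : ℝ × ℝ) : ℂ := em i.1 p.1 * em i.2 p.2

lemma continuous_em2 (i : ℤ × ℤ) : Continuous (em2 i) :=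
  ((continuous_em _).comp continuous_fst).mul ((continuous_em _).comp continuous_snd)

@[simp] lemma norm_em2 (i : ℤ × ℤ) (p : ℝ × ℝ) : ‖em2 i p‖ = 1 := by simp [em2]

lemma orthoSys_circle : OrthoSys circleMeasure em (2 * Real.pi) where
  pos := Real.two_pi_pos
  memLp j := memLp_of_continuous_circle (continuous_em j)
  ortho i j := by
    simp only [conj_em, ← em_add, integral_em]
    congr 1
    rw [neg_add_eq_zero]

lemma orthoSys_torus : OrthoSys torusMeasure em2 ((2 * Real.pi) * (2 * Real.pi)) where
  pos := mul_pos Real.two_pi_pos Real.two_pi_pos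
  memLp j := memLp_of_continuous_torus (continuous_em2 j)
  ortho i j := by
    have : ∀ p : ℝ × ℝ, (starRingEnd ℂ) (em2 i p) * em2 j p =
        em (-i.1 + j.1) p.1 * em (-i.2 + j.2) p.2 := fun p => by
      simp only [em2, map_mul, conj_em, em_add]; ring
    simp only [this]
    rw [torusMeasure_eq, integral_prod_mul, integral_em, integral_em]
    simp only [neg_add_eq_zero, Prod.ext_iff]
    split_ifs <;> simp_all

/-- A sequence of modes with the same poloidal number is an orthogonal system. -/
lemma orthoSys_mode (k : ℤ) :
    OrthoSys torusMeasure (fun j => em2 (k, j)) ((2 * Real.pi) * (2 * Real.pi)) where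
  pos := orthoSys_torus.pos
  memLp j := orthoSys_torus.memLp _
  ortho i j := by rw [orthoSys_torus.ortho]; simp

/-! ### Uniqueness of Fourier coefficients of integrable functions -/

/-- Only integrability is available, so `L²` completeness does not apply. Pairing with the function
is a continuous functional on continuous functions of the circle. It vanishes on trigonometric
polynomials, which are dense, hence on every bump function inside the period. -/
lemma ae_eq_zero_of_fourier_eq_zero {f : ℝ → ℂ} (hf : Integrable f circleMeasure)
    (h : ∀ j, ∫ s, f s * em j s ∂circleMeasure = 0) : f =ᵐ[circleMeasure] 0 := by
  have : Fact (0 < 2 * Real.pi) := ⟨Real.two_pi_pos⟩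
  have hint : ∀ g : C(AddCircle (2 * Real.pi), ℂ),
      Integrable (fun s : ℝ => f s * g (s : AddCircle (2 * Real.pi))) circleMeasure := fun g => by
    exact hf.mul_bdd (c := ‖g‖)
      (g.continuous.comp (AddCircle.continuous_mk' _)).aestronglyMeasurable
      (Eventually.of_forall fun s => g.norm_coe_le_norm _)
  let Λ : C(AddCircle (2 * Real.pi), ℂ) →L[ℂ] ℂ := LinearMap.mkContinuous
    { toFun := fun g => ∫ s, f s * g (s : AddCircle (2 * Real.pi)) ∂circleMeasure
      map_add' := fun g g' => by
        simp only [ContinuousMap.add_apply, mul_add]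
        exact integral_add (hint g) (hint g')
      map_smul' := fun c g => by
        simp only [ContinuousMap.smul_apply, smul_eq_mul, RingHom.id_apply, mul_left_comm _ c]
        exact integral_const_mul _ _ } (∫ s, ‖f s‖ ∂circleMeasure) (fun g => by
      change ‖∫ s, f s * g (s : AddCircle (2 * Real.pi)) ∂circleMeasure‖ ≤ _
      rw [← integral_mul_const]
      refine norm_integral_le_of_norm_le (hf.norm.mul_const _) (Eventually.of_forall fun s => ?_)
      rw [norm_mul]
      exact mul_le_mul_of_nonneg_left (g.norm_coe_le_norm _) (norm_nonneg _))
  have hΛ : ∀ g, Λ g = 0 := by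
    have h1 : Submodule.span ℂ (range (@fourier (2 * Real.pi))) ≤ LinearMap.ker Λ.toLinearMap := by
      rw [Submodule.span_le]
      rintro _ ⟨n, rfl⟩
      change ∫ s, f s * fourier n (s : AddCircle (2 * Real.pi)) ∂circleMeasure = 0
      rw [← h n]
      congr 1; ext s
      rw [fourier_coe_apply, em]
      congr 2
      have := Real.pi_ne_zero
      push_cast
      field_simp
    have h2 := Submodule.topologicalClosure_minimal _ h1 Λ.isClosed_ker
    rw [span_fourier_closure_eq_top] at h2
    exact fun g => h2 (Submodule.mem_top : g ∈ ⊤)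
  have hIoo : volume.restrict (Ioo 0 (2 * Real.pi)) = circleMeasure :=
    Measure.restrict_congr_set Ioo_ae_eq_Ioc
  rw [← hIoo] at hf ⊢
  refine (ae_restrict_iff' measurableSet_Ioo).mpr ?_
  refine IsOpen.ae_eq_zero_of_integral_contDiff_smul_eq_zero isOpen_Ioo
    (IntegrableOn.locallyIntegrableOn hf) fun g hg hgc hgs => ?_
  have hz : ∀ x, x ∉ Ioo 0 (2 * Real.pi) → g x = 0 := fun x hx =>
    image_eq_zero_of_notMem_tsupport fun hh => hx (hgs hh)
  -- A bump function supported in the open period vanishes at both ends, so it glues to a continuous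
  -- function on the circle.
  let G : C(AddCircle (2 * Real.pi), ℂ) := ⟨AddCircle.liftIco (2 * Real.pi) 0 (fun s => (g s : ℂ)),
    AddCircle.liftIco_continuous (by simp [hz 0 (by simp), hz (2 * Real.pi) (by simp)])
      (Complex.continuous_ofReal.comp hg.continuous).continuousOn⟩
  have h3 := hΛ G
  change ∫ s, f s * G (s : AddCircle (2 * Real.pi)) ∂circleMeasure = 0 at h3
  rw [← hIoo] at h3
  rw [← setIntegral_eq_integral_of_forall_compl_eq_zero (s := Ioo 0 (2 * Real.pi))
    (fun x hx => by rw [hz x hx, zero_smul]), ← h3]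
  refine setIntegral_congr_fun measurableSet_Ioo fun s hs => ?_
  have hs0 : s ∈ Ico 0 (0 + 2 * Real.pi) := by rw [zero_add]; exact Ioo_subset_Ico_self hs
  have : G (s : AddCircle (2 * Real.pi)) = (g s : ℂ) :=
    AddCircle.liftIco_coe_apply (f := fun s => (g s : ℂ)) hs0
  simp only [this, Complex.real_smul, mul_comm]

/-- A property of a periodic function that holds almost everywhere on one period holds almost
everywhere. -/
lemma ae_of_ae_circle {f g : ℝ → ℂ} (hf : Function.Periodic f (2 * Real.pi))
    (hg : Function.Periodic g (2 * Real.pi)) (h : f =ᵐ[circleMeasure] g) : f =ᵐ[volume] g := by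
  have h1 : ∀ n : ℤ, ∀ᵐ x ∂volume, x - n • (2 * Real.pi) ∈ Ioc 0 (2 * Real.pi) → f x = g x := by
    intro n
    have h2 := (ae_restrict_iff' measurableSet_Ioc).mp h
    have h3 := (measurePreserving_sub_right volume (n • (2 * Real.pi))).quasiMeasurePreserving.ae h2
    filter_upwards [h3] with x hx hx'
    have := hx hx'
    rwa [hf.sub_zsmul_eq, hg.sub_zsmul_eq] at this
  filter_upwards [ae_all_iff.mpr h1] with x hx
  obtain ⟨n, hn, -⟩ := existsUnique_sub_zsmul_mem_Ioc Real.two_pi_pos x 0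
  exact hx n (by simpa using hn)

/-- Continuous functions that agree almost everywhere on one period, and are periodic, agree. -/
lemma eq_of_ae_circle {f g : ℝ → ℂ} (hfc : Continuous f) (hgc : Continuous g)
    (hf : Function.Periodic f (2 * Real.pi))
    (hg : Function.Periodic g (2 * Real.pi)) (h : f =ᵐ[circleMeasure] g) : f = g :=
  Continuous.ae_eq_iff_eq volume hfc hgc |>.mp (ae_of_ae_circle hf hg h)

/-! ### Fourier series and Fourier coefficients -/

/-- The sum of a Fourier series. -/
def evs (u : ℤ → ℂ) (s : ℝ) : ℂ := ∑' j, u j * em j s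

lemma evs_summable {u : ℤ → ℂ} (hu : Summable fun j => ‖u j‖) (s : ℝ) :
    Summable fun j => u j * em j s := Summable.of_norm (by simpa using hu)

lemma norm_evs_le {u : ℤ → ℂ} (hu : Summable fun j => ‖u j‖) (s : ℝ) :
    ‖evs u s‖ ≤ ∑' j, ‖u j‖ := by
  refine (norm_tsum_le_tsum_norm (by simpa using hu)).trans_eq ?_
  simp

lemma continuous_evs {u : ℤ → ℂ} (hu : Summable fun j => ‖u j‖) : Continuous (evs u) :=
  continuous_tsum (fun j => continuous_const.mul (continuous_em j)) hu (fun j s => by simp)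

lemma evs_periodic (u : ℤ → ℂ) : Function.Periodic (evs u) (2 * Real.pi) := fun s => by
  simp only [evs, em_periodic _ s]

lemma evs_congr {u v : ℤ → ℂ} (h : ∀ j, u j = v j) : evs u = evs v := by
  rw [show u = v from funext h]

lemma evs_add {u v : ℤ → ℂ} (hu : Summable fun j => ‖u j‖) (hv : Summable fun j => ‖v j‖) (s : ℝ) :
    evs (fun j => u j + v j) s = evs u s + evs v s := by
  simp only [evs, add_mul]
  exact (evs_summable hu s).tsum_add (evs_summable hv s)

lemma evs_mul_left (c : ℂ) (u : ℤ → ℂ) (s : ℝ) : evs (fun j => c * u j) s = c * evs u s := by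
  simp only [evs, mul_assoc]; exact tsum_mul_left

lemma evs_star (u : ℤ → ℂ) (s : ℝ) : evs (Hs.starFun u) s = (starRingEnd ℂ) (evs u s) := by
  rw [evs, evs, Complex.conj_tsum, ← (Equiv.neg ℤ).tsum_eq]
  simp [Hs.starFun, conj_em]

lemma hasDerivAt_evs {u : ℤ → ℂ} (hu : Summable fun j => wt j * ‖u j‖) (s : ℝ) :
    HasDerivAt (evs u) (evs (fun j => Complex.I * j * u j) s) s := by
  have h := hasDerivAt_tsum (𝕜 := ℝ) (u := fun j => wt j * ‖u j‖) hu
    (g := fun j s => u j * em j s) (g' := fun j s => u j * (Complex.I * j * em j s)) (y₀ := 0)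
    (fun j s => (hasDerivAt_em j s).const_mul _)
    (fun j s => by
      rw [norm_mul, norm_mul, norm_mul, norm_em, Complex.norm_I, Complex.norm_intCast, one_mul,
        mul_one, mul_comm]
      exact mul_le_mul_of_nonneg_right (abs_le_wt j) (norm_nonneg _))
    (evs_summable (Summable.of_nonneg_of_le (fun _ => norm_nonneg _) (fun j =>
      le_mul_of_one_le_left (norm_nonneg _) (one_le_wt j)) hu) 0) s
  refine h.congr_deriv ?_
  simp only [evs]
  congr 1; ext j; ring

lemma evs_conv {f u : ℤ → ℂ} (hf : Summable fun j => ‖f j‖) (hu : Summable fun j => ‖u j‖) (s : ℝ) :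
    evs (Hs.conv f u) s = evs f s * evs u s := by
  have hm := summable_mul_of_summable_norm (f := fun j => f j * em j s) (g := fun j => u j * em j s)
    (by simpa using hf) (by simpa using hu)
  rw [evs, evs, evs, tsum_mul_tsum_of_summable_norm (by simpa using hf) (by simpa using hu)]
  let e : ℤ × ℤ ≃ ℤ × ℤ := ⟨fun p => (p.2, p.1 - p.2), fun p => (p.1 + p.2, p.1),
      fun p => by simp, fun p => by simp⟩
  rw [← e.tsum_eq]
  have hme : Summable fun c => f (e c).1 * em (e c).1 s * (u (e c).2 * em (e c).2 s) :=
    e.summable_iff.mpr hm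
  rw [hme.tsum_prod]
  congr 1; ext j
  rw [Hs.conv, ← tsum_mul_right]
  congr 1; ext i
  change f i * u (j - i) * em j s = f i * em i s * (u (j - i) * em (j - i) s)
  have : em j s = em i s * em (j - i) s := by rw [← em_add]; simp
  rw [this]; ring

/-- Fourier coefficients on the circle. -/
def fc (f : ℝ → ℂ) (j : ℤ) : ℂ := (2 * Real.pi : ℂ)⁻¹ * ∫ s, f s * em (-j) s ∂circleMeasure

lemma fc_evs {u : ℤ → ℂ} (hu : Summable fun j => ‖u j‖) (j : ℤ) : fc (evs u) j = u j := by
  have h2 : (2 * Real.pi : ℂ) ≠ 0 := by exact_mod_cast Real.two_pi_pos.ne'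
  have hint : ∀ i, Integrable (fun s => u i * em i s * em (-j) s) circleMeasure := fun i =>
    (memLp_of_continuous_circle ((continuous_const.mul (continuous_em i)).mul
      (continuous_em _)) (p := 1)).integrable le_rfl
  have := hasSum_integral_of_summable_integral_norm hint (by
    simp only [norm_mul, norm_em, mul_one, integral_const, smul_eq_mul]
    exact hu.mul_left _)
  have e1 : ∀ i, ∫ s, u i * em i s * em (-j) s ∂circleMeasure =
      if i = j then u j * (2 * Real.pi) else 0 := fun i => by
    simp only [mul_assoc, ← em_add]
    rw [integral_const_mul, integral_em]
    by_cases h : i = j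
    · subst h; simp
    · rw [if_neg h, if_neg, mul_zero]; rwa [← sub_eq_add_neg, sub_eq_zero]
  simp only [e1] at this
  have h3 := (hasSum_ite_eq j (u j * (2 * Real.pi : ℂ))).unique this
  rw [fc]
  simp only [evs, ← tsum_mul_right]
  rw [← h3]
  field_simp

lemma evs_injective {u v : ℤ → ℂ} (hu : Summable fun j => ‖u j‖) (hv : Summable fun j => ‖v j‖)
    (h : ∀ s, evs u s = evs v s) : u = v := by
  ext j; rw [← fc_evs hu, ← fc_evs hv, show evs u = evs v from funext h]

/-- The function and the sum of its series have the same coefficients, and these determine an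
integrable function. -/
lemma ae_eq_evs_fc {f : ℝ → ℂ} (hf : Integrable f circleMeasure)
    (hs : Summable fun j => ‖fc f j‖) : f =ᵐ[circleMeasure] evs (fc f) := by
  have hc := (memLp_of_continuous_circle (continuous_evs hs) (p := 1)).integrable le_rfl
  have hm : ∀ {g : ℝ → ℂ} (j : ℤ), Integrable g circleMeasure →
      Integrable (fun s => g s * em j s) circleMeasure := fun j hg =>
    hg.mul_bdd (c := 1) (continuous_em j).aestronglyMeasurable
      (Eventually.of_forall fun s => (norm_em j s).le)
  have := ae_eq_zero_of_fourier_eq_zero (hf.sub hc) fun j => by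
    have h2 : (2 * Real.pi : ℂ)⁻¹ ≠ 0 := by
      apply inv_ne_zero; exact_mod_cast Real.two_pi_pos.ne'
    have h1 := fc_evs hs (-j)
    simp only [Pi.sub_apply, sub_mul]
    rw [integral_sub (hm j hf) (hm j hc), sub_eq_zero]
    have h3 : fc f (-j) = fc (evs (fc f)) (-j) := h1.symm
    unfold fc at h3
    rw [neg_neg] at h3
    exact mul_left_cancel₀ h2 h3
  filter_upwards [this] with s hs
  simpa [sub_eq_zero] using hs

lemma eq_evs_fc {f : ℝ → ℂ} (hf : Continuous f) (hp : Function.Periodic f (2 * Real.pi))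
    (hs : Summable fun j => ‖fc f j‖) (s : ℝ) : f s = evs (fc f) s :=
  congrFun (eq_of_ae_circle hf (continuous_evs hs) hp (evs_periodic _)
    (ae_eq_evs_fc ((memLp_of_continuous_circle hf (p := 1)).integrable le_rfl) hs)) s

/-! ### Integration by parts -/

lemma integral_deriv_mul_em {f f' : ℝ → ℂ} (hf : ∀ x, HasDerivAt f (f' x) x) (hc : Continuous f')
    (hp : Function.Periodic f (2 * Real.pi)) (j : ℤ) :
    ∫ s, f' s * em j s ∂circleMeasure = -(Complex.I * j) * ∫ s, f s * em j s ∂circleMeasure := by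
  have hfc : Continuous f := continuous_iff_continuousAt.mpr fun x => (hf x).continuousAt
  rw [integral_circle_eq, integral_circle_eq]
  have := intervalIntegral.integral_deriv_mul_eq_sub (a := 0) (b := 2 * Real.pi)
    (u := f) (v := em j) (fun x _ => hf x) (fun x _ => hasDerivAt_em j x)
    (hc.intervalIntegrable _ _)
    ((continuous_const.mul (continuous_em j)).intervalIntegrable _ _)
  have h0 : f (2 * Real.pi) * em j (2 * Real.pi) - f 0 * em j 0 = 0 := by
    have h1 := hp 0
    have h2 := em_periodic j 0
    rw [zero_add] at h1 h2
    rw [h1, h2, sub_self]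
  have i1 : IntervalIntegrable (fun x => f' x * em j x) volume 0 (2 * Real.pi) :=
    (hc.mul (continuous_em j)).intervalIntegrable _ _
  have i2 : IntervalIntegrable (fun x => f x * (Complex.I * j * em j x)) volume 0 (2 * Real.pi) :=
    (hfc.mul (continuous_const.mul (continuous_em j))).intervalIntegrable _ _
  rw [h0, intervalIntegral.integral_add i1 i2] at this
  rw [eq_neg_of_add_eq_zero_left this, neg_mul]
  congr 1
  rw [← intervalIntegral.integral_const_mul]
  congr 1; ext x; ring

lemma iteratedDeriv_periodic {E : Type*} [NormedAddCommGroup E] [NormedSpace ℝ E] {f : ℝ → E}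
    {c : ℝ} (hp : Function.Periodic f c) (n : ℕ) : Function.Periodic (iteratedDeriv n f) c := by
  intro x
  have h : (fun z => f (z + c)) = f := funext hp
  have := congrFun (iteratedDeriv_comp_add_const n f c) x
  rw [h] at this
  exact this.symm

lemma hasDerivAt_iteratedDeriv {E : Type*} [NormedAddCommGroup E] [NormedSpace ℝ E] {f : ℝ → E}
    {r i : ℕ} (hf : ContDiff ℝ r f) (hi : i < r) (x : ℝ) :
    HasDerivAt (iteratedDeriv i f) (iteratedDeriv (i + 1) f x) x := by
  rw [iteratedDeriv_succ]
  exact ((hf.differentiable_iteratedDeriv i (by exact_mod_cast hi)) x).hasDerivAt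

lemma integral_iteratedDeriv_mul_em {f : ℝ → ℂ} {r : ℕ} (hf : ContDiff ℝ r f)
    (hp : Function.Periodic f (2 * Real.pi)) (j : ℤ) {i : ℕ} (hi : i ≤ r) :
    ∫ s, iteratedDeriv i f s * em j s ∂circleMeasure =
      (-1) ^ i * (Complex.I * j) ^ i * ∫ s, f s * em j s ∂circleMeasure := by
  induction i with
  | zero => simp
  | succ i ih =>
    rw [integral_deriv_mul_em (fun x => hasDerivAt_iteratedDeriv hf (Nat.lt_of_succ_le hi) x)
      (hf.continuous_iteratedDeriv (i + 1) (by exact_mod_cast hi)) (iteratedDeriv_periodic hp i),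
      ih (Nat.le_of_succ_le hi)]
    ring

lemma fc_iteratedDeriv {f : ℝ → ℂ} {r : ℕ} (hf : ContDiff ℝ r f)
    (hp : Function.Periodic f (2 * Real.pi)) (j : ℤ) {i : ℕ} (hi : i ≤ r) :
    fc (iteratedDeriv i f) j = (Complex.I * j) ^ i * fc f j := by
  rw [fc, fc, integral_iteratedDeriv_mul_em hf hp (-j) hi, ← mul_pow]
  push_cast
  ring_nf

/-! ### Sequences whose derivatives are square summable -/

lemma wt_pow_le (r : ℕ) (j : ℤ) : wt j ^ r ≤ 2 ^ r * (1 + |(j : ℝ)| ^ r) := by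
  have h0 := abs_nonneg (j : ℝ)
  unfold wt
  rcases le_total 1 |(j : ℝ)| with h | h
  · calc (1 + |(j : ℝ)|) ^ r ≤ (2 * |(j : ℝ)|) ^ r := by
          apply pow_le_pow_left₀ (by positivity); linarith
      _ = 2 ^ r * |(j : ℝ)| ^ r := mul_pow _ _ _
      _ ≤ _ := by gcongr; linarith
  · calc (1 + |(j : ℝ)|) ^ r ≤ 2 ^ r := by
          apply pow_le_pow_left₀ (by positivity); linarith
      _ ≤ _ := le_mul_of_one_le_right (by positivity) (by linarith [pow_nonneg h0 r])

/-- The weight is at most `2 ^ r * (1 + |j| ^ r)`, so the orders `0` and `r` control the full norm.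
No intermediate derivative is needed. -/
lemma summable_weight_of_bessel {u : ℤ → ℂ} {r : ℕ} {A B : ℝ}
    (h0 : Summable fun j => ‖u j‖ ^ 2) (h0' : ∑' j, ‖u j‖ ^ 2 ≤ A)
    (h1 : Summable fun j => ‖(Complex.I * j) ^ r * u j‖ ^ 2)
    (h1' : ∑' j : ℤ, ‖(Complex.I * j) ^ r * u j‖ ^ 2 ≤ B) :
    (Summable fun j => (wt j ^ r * ‖u j‖) ^ 2) ∧
    ∑' j, (wt j ^ r * ‖u j‖) ^ 2 ≤ 2 * 4 ^ r * (A + B) := by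
  have e : ∀ j : ℤ, ‖(Complex.I * j) ^ r * u j‖ = |(j : ℝ)| ^ r * ‖u j‖ := fun j => by
    rw [norm_mul, norm_pow, norm_mul, Complex.norm_I, one_mul, Complex.norm_intCast]
  have pt : ∀ j, (wt j ^ r * ‖u j‖) ^ 2 ≤
      2 * 4 ^ r * (‖u j‖ ^ 2 + ‖(Complex.I * j) ^ r * u j‖ ^ 2) := fun j => by
    rw [e]
    have h := mul_le_mul_of_nonneg_right (wt_pow_le r j) (norm_nonneg (u j))
    have h2 := pow_le_pow_left₀ (mul_nonneg (pow_nonneg (wt_pos j).le _) (norm_nonneg _)) h 2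
    refine h2.trans ?_
    have h4 : (4 : ℝ) ^ r = (2 ^ r) ^ 2 := by rw [← pow_mul, mul_comm, pow_mul]; norm_num
    rw [h4]
    have h5 : (0 : ℝ) ≤ (2 ^ r) ^ 2 := by positivity
    have h6 : (1 + |(j : ℝ)| ^ r) ^ 2 ≤ 2 * (1 + (|(j : ℝ)| ^ r) ^ 2) := by
      nlinarith [sq_nonneg (1 - |(j : ℝ)| ^ r)]
    calc (2 ^ r * (1 + |(j : ℝ)| ^ r) * ‖u j‖) ^ 2
        = (2 ^ r) ^ 2 * ((1 + |(j : ℝ)| ^ r) ^ 2 * ‖u j‖ ^ 2) := by ring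
      _ ≤ (2 ^ r) ^ 2 * (2 * (1 + (|(j : ℝ)| ^ r) ^ 2) * ‖u j‖ ^ 2) := by gcongr
      _ = _ := by ring
  have hs := (h0.add h1).mul_left (2 * 4 ^ r)
  have hs1 := Summable.of_nonneg_of_le (fun _ => sq_nonneg _) pt hs
  refine ⟨hs1, (hs1.tsum_le_tsum pt hs).trans ?_⟩
  rw [tsum_mul_left, h0.tsum_add h1]
  gcongr

end NearAxis
end

/-! ### Sobolev norms by weak derivatives versus norms of Fourier coefficients -/

noncomputable section

namespace NearAxis

/-! ### Fourier coefficients and weak derivatives -/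

lemma iteratedDeriv_re_mul_em (c : ℂ) (j : ℤ) (b : ℕ) :
    iteratedDeriv b (fun s => (c * em j s).re) =
      fun s => (c * (Complex.I * j) ^ b * em j s).re := by
  induction b with
  | zero => simp
  | succ b ih =>
    rw [iteratedDeriv_succ, ih]
    ext s
    have h := ((hasDerivAt_em j s).const_mul (c * (Complex.I * j) ^ b))
    have h2 := (Complex.reCLM.hasFDerivAt.comp_hasDerivAt s h)
    have h3 : HasDerivAt (fun s => (c * (Complex.I * j) ^ b * em j s).re)
      (c * (Complex.I * j) ^ b * (Complex.I * j * em j s)).re s := h2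
    rw [h3.deriv]; congr 1; ring

lemma mixedDeriv_re_em (c : ℂ) (k j : ℤ) (a b : ℕ) (θ s : ℝ) :
    mixedDeriv a b (fun θ s => (c * (em k θ * em j s)).re) θ s =
      (c * ((Complex.I * k) ^ a * (Complex.I * j) ^ b) * (em k θ * em j s)).re := by
  unfold mixedDeriv
  have h1 : ∀ θ', iteratedDeriv b (fun s' => (c * (em k θ' * em j s')).re) s =
      (c * (Complex.I * j) ^ b * em j s * em k θ').re := fun θ' => by
    have := congrFun (iteratedDeriv_re_mul_em (c * em k θ') j b) s
    simp only [← mul_assoc] at this ⊢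
    rw [this]; congr 1; ring
  simp only [h1]
  rw [iteratedDeriv_re_mul_em]
  ring_nf

lemma contDiff_re_em2 (c : ℂ) (i : ℤ × ℤ) :
    ContDiff ℝ ∞ (fun p : ℝ × ℝ => (c * (em i.1 p.1 * em i.2 p.2)).re) :=
  Complex.reCLM.contDiff.comp (contDiff_const.mul
    (((contDiff_em i.1).comp contDiff_fst).mul ((contDiff_em i.2).comp contDiff_snd)))

lemma isTorusFun_re_em (c : ℂ) (i : ℤ × ℤ) :
    IsTorusFun (fun θ s => (c * (em i.1 θ * em i.2 s)).re) := fun θ s => by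
  simp only [em_periodic _ _, and_self]

lemma integrable_mul_em2 {f : ℝ × ℝ → ℂ} (hf : Integrable f torusMeasure) (i : ℤ × ℤ) :
    Integrable (fun p => f p * em2 i p) torusMeasure :=
  hf.mul_bdd (c := 1) (continuous_em2 i).aestronglyMeasurable
    (Eventually.of_forall fun p => (norm_em2 i p).le)

lemma integral_ofReal_mul_re {f : ℝ × ℝ → ℝ} (hf : Integrable f torusMeasure) (i : ℤ × ℤ) (c : ℂ) :
    ∫ p, f p * (c * em2 i p).re ∂torusMeasure = (c * ∫ p, (f p : ℂ) * em2 i p ∂torusMeasure).re := by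
  rw [← integral_const_mul]
  have h := integral_re (𝕜 := ℂ) ((integrable_mul_em2 hf.ofReal i).const_mul c)
  refine Eq.trans ?_ h
  congr 1; ext p
  have : c * (f p * em2 i p) = (f p : ℂ) * (c * em2 i p) := by ring
  change _ = (c * ((f p : ℂ) * em2 i p)).re
  rw [this, Complex.re_ofReal_mul]

/-- Test functions are real, so the complex mode is tested through the real parts of its multiples.
The multiples by `1` and `-I` recover the real and the imaginary part of the identity. -/
lemma HasWeakDeriv.integral_em2 {a b : ℕ} {f g : ℝ → ℝ → ℝ} (h : HasWeakDeriv a b f g)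
    (i : ℤ × ℤ) :
    (Complex.I * i.1) ^ a * (Complex.I * i.2) ^ b *
      ∫ p : ℝ × ℝ, (f p.1 p.2 : ℂ) * em2 i p ∂torusMeasure =
      (-1) ^ (a + b) * ∫ p : ℝ × ℝ, (g p.1 p.2 : ℂ) * em2 i p ∂torusMeasure := by
  obtain ⟨hf, hg, hψ⟩ := h
  have hgi : Integrable (fun p : ℝ × ℝ => g p.1 p.2) torusMeasure := hg.integrable one_le_two
  have key : ∀ c : ℂ, (c * ((Complex.I * i.1) ^ a * (Complex.I * i.2) ^ b *
      ∫ p : ℝ × ℝ, (f p.1 p.2 : ℂ) * em2 i p ∂torusMeasure)).re =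
      (c * ((-1) ^ (a + b) * ∫ p : ℝ × ℝ, (g p.1 p.2 : ℂ) * em2 i p ∂torusMeasure)).re := by
    intro c
    have h1 := hψ _ (contDiff_re_em2 c i) (isTorusFun_re_em c i)
    simp only [mixedDeriv_re_em] at h1
    have h2 := integral_ofReal_mul_re hf i (c * ((Complex.I * i.1) ^ a * (Complex.I * i.2) ^ b))
    have h3 := integral_ofReal_mul_re hgi i c
    simp only [em2] at h2 h3 ⊢
    rw [h2, h3] at h1
    rw [← mul_assoc, h1]
    have : ∀ z : ℂ, c * ((-1) ^ (a + b) * z) = (((-1) ^ (a + b) : ℝ) : ℂ) * (c * z) := fun z => by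
      push_cast; ring
    rw [this, Complex.re_ofReal_mul]
  apply Complex.ext
  · simpa using key 1
  · simpa using key (-Complex.I)

/-- Fourier coefficients on the torus of a real function. -/
def tfc (f : ℝ → ℝ → ℝ) (k j : ℤ) : ℂ :=
  ((2 * Real.pi) * (2 * Real.pi) : ℂ)⁻¹ *
    ∫ p : ℝ × ℝ, (f p.1 p.2 : ℂ) * em2 (-k, -j) p ∂torusMeasure

lemma HasWeakDeriv.tfc_eq {a b : ℕ} {f g : ℝ → ℝ → ℝ} (h : HasWeakDeriv a b f g) (k j : ℤ) :
    tfc g k j = (Complex.I * k) ^ a * (Complex.I * j) ^ b * tfc f k j := by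
  have := h.integral_em2 (-k, -j)
  unfold tfc
  have e : ∀ z w : ℂ, (Complex.I * (-k : ℤ)) ^ a * (Complex.I * (-j : ℤ)) ^ b * z =
      (-1) ^ (a + b) * w → w = (Complex.I * k) ^ a * (Complex.I * j) ^ b * z := fun z w hh => by
    have h1 : ((-1 : ℂ) ^ (a + b)) * (-1) ^ (a + b) = 1 := by
      rw [← mul_pow]; norm_num
    calc w = (-1) ^ (a + b) * ((-1) ^ (a + b) * w) := by rw [← mul_assoc, h1, one_mul]
      _ = _ := by
        rw [← hh]; push_cast
        rw [mul_neg, mul_neg, neg_pow (Complex.I * k), neg_pow (Complex.I * j)]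
        calc _ = ((-1 : ℂ) ^ (a + b) * (-1) ^ (a + b)) *
            ((Complex.I * k) ^ a * (Complex.I * j) ^ b * z) := by rw [pow_add]; ring
          _ = _ := by rw [h1, one_mul]
  rw [e _ _ this]; ring

lemma tfc_bessel {g : ℝ → ℝ → ℝ} (hg : MemLp (fun p : ℝ × ℝ => g p.1 p.2) 2 torusMeasure) (k : ℤ) :
    (Summable fun j => ‖tfc g k j‖ ^ 2) ∧
    ∑' j, ‖tfc g k j‖ ^ 2 ≤ (eLpNorm (fun p : ℝ × ℝ => g p.1 p.2) 2 torusMeasure).toReal ^ 2 := by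
  have hgc : MemLp (fun p : ℝ × ℝ => (g p.1 p.2 : ℂ)) 2 torusMeasure := hg.ofReal
  have hn : eLpNorm (fun p : ℝ × ℝ => (g p.1 p.2 : ℂ)) 2 torusMeasure =
      eLpNorm (fun p : ℝ × ℝ => g p.1 p.2) 2 torusMeasure :=
    eLpNorm_congr_norm_ae (Eventually.of_forall fun p => Complex.norm_real _)
  obtain ⟨h1, h2⟩ := (orthoSys_mode k).bessel hgc
  rw [hn] at h2
  set c : ℝ := (2 * Real.pi) * (2 * Real.pi) with hc
  have hc1 : 1 ≤ c := by nlinarith [Real.pi_gt_three]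
  have e : ∀ j, ‖tfc g k j‖ ^ 2 = (c⁻¹) ^ 2 *
      ‖∫ p : ℝ × ℝ, (starRingEnd ℂ) (em2 (k, j) p) * (g p.1 p.2 : ℂ) ∂torusMeasure‖ ^ 2 := fun j => by
    unfold tfc
    have e2 : ((2 * Real.pi) * (2 * Real.pi) : ℂ) = ((c : ℝ) : ℂ) := by rw [hc]; push_cast; ring
    rw [e2, norm_mul, mul_pow, norm_inv, Complex.norm_real, Real.norm_of_nonneg (by linarith)]
    congr 4; ext p
    simp only [em2, map_mul, conj_em]; ring
  simp only [e]
  refine ⟨h1.mul_left _, ?_⟩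
  rw [tsum_mul_left]
  set N := (eLpNorm (fun p : ℝ × ℝ => g p.1 p.2) 2 torusMeasure).toReal
  calc _ ≤ (c⁻¹) ^ 2 * (c * N ^ 2) := by gcongr
    _ = c⁻¹ * N ^ 2 := by field_simp
    _ ≤ 1 * N ^ 2 := by gcongr; exact inv_le_one_of_one_le₀ hc1
    _ = _ := one_mul _

/-- An infimum over nothing is `⊤`, so finiteness supplies a weak derivative. All weak derivatives
have the same Fourier coefficients, so Bessel's inequality holds for each of them and passes to the
infimum. -/
lemma weakDerivNorm_lower {b : ℕ} {f : ℝ → ℝ → ℝ} (h : weakDerivNorm 0 b f < ⊤) (k : ℤ) :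
    Integrable (fun p : ℝ × ℝ => f p.1 p.2) torusMeasure ∧
    (Summable fun j : ℤ => ‖(Complex.I * j) ^ b * tfc f k j‖ ^ 2) ∧
    ∑' j : ℤ, ‖(Complex.I * j) ^ b * tfc f k j‖ ^ 2 ≤ (weakDerivNorm 0 b f).toReal ^ 2 := by
  have key : ∀ g, HasWeakDeriv 0 b f g →
      (Summable fun j : ℤ => ‖(Complex.I * j) ^ b * tfc f k j‖ ^ 2) ∧
      ∑' j : ℤ, ‖(Complex.I * j) ^ b * tfc f k j‖ ^ 2 ≤
        (eLpNorm (fun p : ℝ × ℝ => g p.1 p.2) 2 torusMeasure).toReal ^ 2 := fun g hg => by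
    have := tfc_bessel hg.2.1 k
    simpa only [hg.tfc_eq, pow_zero, one_mul] using this
  have h' := h
  unfold weakDerivNorm at h
  obtain ⟨g, hg⟩ := iInf_lt_iff.mp h
  obtain ⟨hg, -⟩ := iInf_lt_iff.mp hg
  refine ⟨hg.1, (key g hg).1, ?_⟩
  have : ENNReal.ofReal (√(∑' j : ℤ, ‖(Complex.I * j) ^ b * tfc f k j‖ ^ 2)) ≤
      weakDerivNorm 0 b f := by
    refine le_iInf₂ fun g hg => ?_
    rw [ENNReal.ofReal_le_iff_le_toReal hg.2.1.eLpNorm_ne_top]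
    exact Real.sqrt_le_iff.mpr ⟨ENNReal.toReal_nonneg, (key g hg).2⟩
  rw [ENNReal.ofReal_le_iff_le_toReal h'.ne] at this
  exact (Real.sqrt_le_iff.mp this).2

lemma weakDerivNorm_le_sobolevNorm {Q a b : ℕ} (hab : a + b ≤ Q) (f : ℝ → ℝ → ℝ) :
    weakDerivNorm a b f ≤ sobolevNorm Q f := by
  have h1 : weakDerivNorm a b f ^ 2 ≤
      ∑ α ∈ (Finset.range (Q + 1) ×ˢ Finset.range (Q + 1)).filter (fun α => α.1 + α.2 ≤ Q),
        weakDerivNorm α.1 α.2 f ^ 2 :=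
    Finset.single_le_sum (f := fun α : ℕ × ℕ => weakDerivNorm α.1 α.2 f ^ 2)
      (fun _ _ => zero_le) (a := (a, b)) (by simp; omega)
  calc weakDerivNorm a b f = (weakDerivNorm a b f ^ 2) ^ (1 / 2 : ℝ) := by
        rw [← ENNReal.rpow_natCast, ← ENNReal.rpow_mul]; norm_num
    _ ≤ _ := ENNReal.rpow_le_rpow h1 (by norm_num)

/-- Fourier coefficients of a function in `H^Q(𝕋²)` with a fixed poloidal mode number. -/
lemma sobolev_lower {Q : ℕ} {f : ℝ → ℝ → ℝ} (h : sobolevNorm Q f < ⊤) (k : ℤ) :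
    Integrable (fun p : ℝ × ℝ => f p.1 p.2) torusMeasure ∧
    ∃ u : Hs Q, (∀ j, u j = tfc f k j) ∧ ‖u‖ ≤ 2 ^ (Q + 1) * (sobolevNorm Q f).toReal := by
  -- At a fixed poloidal number only `s`-derivatives matter, and of these only the orders `0` and
  -- `Q`.
  have a0 := weakDerivNorm_le_sobolevNorm (show 0 + 0 ≤ Q by omega) f
  have a1 := weakDerivNorm_le_sobolevNorm (show 0 + Q ≤ Q by omega) f
  obtain ⟨h1, h2, h3⟩ := weakDerivNorm_lower (a0.trans_lt h) k
  obtain ⟨-, h4, h5⟩ := weakDerivNorm_lower (a1.trans_lt h) k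
  simp only [pow_zero, one_mul] at h2 h3
  have b0 := ENNReal.toReal_mono h.ne a0
  have b1 := ENNReal.toReal_mono h.ne a1
  obtain ⟨s1, s2⟩ := summable_weight_of_bessel (r := Q) h2
    (h3.trans (pow_le_pow_left₀ ENNReal.toReal_nonneg b0 2)) h4
    (h5.trans (pow_le_pow_left₀ ENNReal.toReal_nonneg b1 2))
  refine ⟨h1, Hs.of Q _ s1, fun j => rfl, Hs.norm_le_of_tsum (by positivity) (s2.trans ?_)⟩
  have h4 : (4 : ℝ) ^ Q = (2 ^ Q) ^ 2 := by rw [← pow_mul, mul_comm, pow_mul]; norm_num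
  rw [h4, pow_succ]
  apply le_of_eq; ring

/-! #### The circle -/

lemma HasWeakDerivCircle.fc_eq {b : ℕ} {f g : ℝ → ℝ} (h : HasWeakDerivCircle b f g) (j : ℤ) :
    fc (fun s => (g s : ℂ)) j = (Complex.I * j) ^ b * fc (fun s => (f s : ℂ)) j := by
  obtain ⟨hf, hg, hψ⟩ := h
  have hgi : Integrable g circleMeasure := hg.integrable one_le_two
  have hint : ∀ {f : ℝ → ℝ}, Integrable f circleMeasure → ∀ c : ℂ,
      ∫ s, f s * (c * em (-j) s).re ∂circleMeasure =
        (c * ∫ s, (f s : ℂ) * em (-j) s ∂circleMeasure).re := fun {f} hf c => by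
    rw [← integral_const_mul]
    have hi : Integrable (fun s => (f s : ℂ) * em (-j) s) circleMeasure :=
      hf.ofReal.mul_bdd (c := 1) (continuous_em _).aestronglyMeasurable
        (Eventually.of_forall fun p => (norm_em _ p).le)
    have h := integral_re (𝕜 := ℂ) (hi.const_mul c)
    refine Eq.trans ?_ h
    congr 1; ext p
    have : c * (f p * em (-j) p) = (f p : ℂ) * (c * em (-j) p) := by ring
    change _ = (c * ((f p : ℂ) * em (-j) p)).re
    rw [this, Complex.re_ofReal_mul]
  have key : ∀ c : ℂ, (c * ((Complex.I * (-j : ℤ)) ^ b *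
      ∫ s, (f s : ℂ) * em (-j) s ∂circleMeasure)).re =
      (c * ((-1) ^ b * ∫ s, (g s : ℂ) * em (-j) s ∂circleMeasure)).re := by
    intro c
    have h1 := hψ (fun s => (c * em (-j) s).re)
      (Complex.reCLM.contDiff.comp (contDiff_const.mul (contDiff_em _)))
      (fun s => by simp only [em_periodic _ _])
    simp only [iteratedDeriv_re_mul_em] at h1
    rw [hint hf, hint hgi] at h1
    rw [← mul_assoc, h1]
    have : ∀ z : ℂ, c * ((-1) ^ b * z) = (((-1) ^ b : ℝ) : ℂ) * (c * z) := fun z => by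
      push_cast; ring
    rw [this, Complex.re_ofReal_mul]
  have k2 : (Complex.I * (-j : ℤ)) ^ b * ∫ s, (f s : ℂ) * em (-j) s ∂circleMeasure =
      (-1) ^ b * ∫ s, (g s : ℂ) * em (-j) s ∂circleMeasure := by
    apply Complex.ext
    · simpa using key 1
    · simpa using key (-Complex.I)
  have h1 : ((-1 : ℂ) ^ b) * (-1) ^ b = 1 := by
    rw [← mul_pow]; norm_num
  have k3 : ∫ s, (g s : ℂ) * em (-j) s ∂circleMeasure =
      (Complex.I * j) ^ b * ∫ s, (f s : ℂ) * em (-j) s ∂circleMeasure := by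
    calc _ = (-1) ^ b * ((-1) ^ b * ∫ s, (g s : ℂ) * em (-j) s ∂circleMeasure) := by
          rw [← mul_assoc, h1, one_mul]
      _ = _ := by
        rw [← k2]; push_cast
        rw [mul_neg, neg_pow (Complex.I * j), ← mul_assoc, ← mul_assoc, h1, one_mul]
  unfold fc
  rw [k3]; ring

lemma fc_bessel {g : ℝ → ℂ} (hg : MemLp g 2 circleMeasure) :
    (Summable fun j => ‖fc g j‖ ^ 2) ∧
    ∑' j, ‖fc g j‖ ^ 2 ≤ (eLpNorm g 2 circleMeasure).toReal ^ 2 := by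
  obtain ⟨h1, h2⟩ := orthoSys_circle.bessel hg
  set c : ℝ := 2 * Real.pi with hc
  have hc1 : 1 ≤ c := by nlinarith [Real.pi_gt_three]
  have e : ∀ j, ‖fc g j‖ ^ 2 = (c⁻¹) ^ 2 *
      ‖∫ s, (starRingEnd ℂ) (em j s) * g s ∂circleMeasure‖ ^ 2 := fun j => by
    unfold fc
    have e2 : (2 * Real.pi : ℂ) = ((c : ℝ) : ℂ) := by rw [hc]; push_cast; ring
    rw [e2, norm_mul, mul_pow, norm_inv, Complex.norm_real, Real.norm_of_nonneg (by linarith)]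
    congr 4; ext p
    rw [conj_em, mul_comm]
  simp only [e]
  refine ⟨h1.mul_left _, ?_⟩
  rw [tsum_mul_left]
  set N := (eLpNorm g 2 circleMeasure).toReal
  calc _ ≤ (c⁻¹) ^ 2 * (c * N ^ 2) := by gcongr
    _ = c⁻¹ * N ^ 2 := by field_simp
    _ ≤ 1 * N ^ 2 := by gcongr; exact inv_le_one_of_one_le₀ hc1
    _ = _ := one_mul _

/-- Fourier coefficients of a function in `H^r(𝕋)`. -/
lemma sobolevCircle_lower {r : ℕ} {f : ℝ → ℝ} (h : sobolevNormCircle r f < ⊤) :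
    ∃ u : Hs r, (∀ j, u j = fc (fun s => (f s : ℂ)) j) ∧
      ‖u‖ ≤ 2 ^ (r + 1) * (sobolevNormCircle r f).toReal := by
  let W : ℕ → ℝ≥0∞ := fun j =>
    ⨅ (g : ℝ → ℝ) (_ : HasWeakDerivCircle j f g), eLpNorm g 2 circleMeasure
  have hW : ∀ b ≤ r, W b ≤ sobolevNormCircle r f := fun b hb => by
    have h1 : W b ^ 2 ≤ ∑ j ∈ Finset.range (r + 1), W j ^ 2 :=
      Finset.single_le_sum (f := fun j => W j ^ 2)
        (fun _ _ => zero_le) (a := b) (by simp; omega)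
    calc W b = (W b ^ 2) ^ (1 / 2 : ℝ) := by
          rw [← ENNReal.rpow_natCast, ← ENNReal.rpow_mul]; norm_num
      _ ≤ _ := ENNReal.rpow_le_rpow h1 (by norm_num)
  have low : ∀ b ≤ r,
      (Summable fun j : ℤ => ‖(Complex.I * j) ^ b * fc (fun s => (f s : ℂ)) j‖ ^ 2) ∧
      ∑' j : ℤ, ‖(Complex.I * j) ^ b * fc (fun s => (f s : ℂ)) j‖ ^ 2 ≤ (W b).toReal ^ 2 := by
    intro b hb
    have key : ∀ g, HasWeakDerivCircle b f g →
        (Summable fun j : ℤ => ‖(Complex.I * j) ^ b * fc (fun s => (f s : ℂ)) j‖ ^ 2) ∧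
        ∑' j : ℤ, ‖(Complex.I * j) ^ b * fc (fun s => (f s : ℂ)) j‖ ^ 2 ≤
          (eLpNorm g 2 circleMeasure).toReal ^ 2 := fun g hg => by
      have hn : eLpNorm (fun s => (g s : ℂ)) 2 circleMeasure = eLpNorm g 2 circleMeasure :=
        eLpNorm_congr_norm_ae (Eventually.of_forall fun p => Complex.norm_real _)
      have := fc_bessel (g := fun s => (g s : ℂ)) hg.2.1.ofReal
      rw [hn] at this
      simpa only [hg.fc_eq] using this
    have hlt : W b < ⊤ := (hW b hb).trans_lt h
    obtain ⟨g, hg⟩ := iInf_lt_iff.mp hlt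
    obtain ⟨hg, -⟩ := iInf_lt_iff.mp hg
    refine ⟨(key g hg).1, ?_⟩
    have : ENNReal.ofReal (√(∑' j : ℤ, ‖(Complex.I * j) ^ b * fc (fun s => (f s : ℂ)) j‖ ^ 2)) ≤
        W b := by
      refine le_iInf₂ fun g hg => ?_
      rw [ENNReal.ofReal_le_iff_le_toReal hg.2.1.eLpNorm_ne_top]
      exact Real.sqrt_le_iff.mpr ⟨ENNReal.toReal_nonneg, (key g hg).2⟩
    rw [ENNReal.ofReal_le_iff_le_toReal hlt.ne] at this
    exact (Real.sqrt_le_iff.mp this).2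
  obtain ⟨h2, h3⟩ := low 0 (Nat.zero_le _)
  obtain ⟨h4, h5⟩ := low r le_rfl
  simp only [pow_zero, one_mul] at h2 h3
  have b0 := ENNReal.toReal_mono h.ne (hW 0 (Nat.zero_le _))
  have b1 := ENNReal.toReal_mono h.ne (hW r le_rfl)
  obtain ⟨s1, s2⟩ := summable_weight_of_bessel (r := r) h2
    (h3.trans (pow_le_pow_left₀ ENNReal.toReal_nonneg b0 2)) h4
    (h5.trans (pow_le_pow_left₀ ENNReal.toReal_nonneg b1 2))
  refine ⟨Hs.of r _ s1, fun j => rfl, Hs.norm_le_of_tsum (by positivity) (s2.trans ?_)⟩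
  have h4 : (4 : ℝ) ^ r = (2 ^ r) ^ 2 := by rw [← pow_mul, mul_comm, pow_mul]; norm_num
  rw [h4, pow_succ]
  apply le_of_eq; ring

/-- Functions of class `C^r` on the circle belong to `H^r`. -/
lemma contDiff_lower {r : ℕ} {f : ℝ → ℂ} (hf : ContDiff ℝ r f)
    (hp : Function.Periodic f (2 * Real.pi)) {N : ℝ} (hN : 0 ≤ N)
    (h0 : ∀ s, ‖f s‖ ≤ N) (hr : ∀ s, ‖iteratedDeriv r f s‖ ≤ N) :
    ∃ u : Hs r, (∀ j, u j = fc f j) ∧ ‖u‖ ≤ 2 ^ (r + 1) * (2 * Real.pi * N) := by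
  have hb : ∀ g : ℝ → ℂ, Continuous g → (∀ s, ‖g s‖ ≤ N) →
      (eLpNorm g 2 circleMeasure).toReal ≤ 2 * Real.pi * N := fun g hg hgN => by
    have h1 := eLpNorm_le_of_ae_bound (p := 2) (μ := circleMeasure)
      (Eventually.of_forall hgN)
    have hm : circleMeasure univ = ENNReal.ofReal (2 * Real.pi) := by
      simp [circleMeasure]
    have h2 : (eLpNorm g 2 circleMeasure) ≤ ENNReal.ofReal (2 * Real.pi * N) := by
      refine h1.trans ?_
      rw [hm, ENNReal.ofReal_mul Real.two_pi_pos.le]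
      gcongr
      calc ENNReal.ofReal (2 * Real.pi) ^ (2 : ℝ≥0∞).toReal⁻¹
          ≤ ENNReal.ofReal (2 * Real.pi) ^ (1 : ℝ) := by
            apply ENNReal.rpow_le_rpow_of_exponent_le
            · rw [← ENNReal.ofReal_one]
              apply ENNReal.ofReal_le_ofReal
              nlinarith [Real.pi_gt_three]
            · norm_num
        _ = _ := ENNReal.rpow_one _
    exact ENNReal.toReal_le_of_le_ofReal (by have := Real.pi_pos; positivity) h2
  have hrc : Continuous (iteratedDeriv r f) := hf.continuous_iteratedDeriv r le_rfl
  obtain ⟨h2, h3⟩ := fc_bessel (memLp_of_continuous_circle hf.continuous)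
  obtain ⟨h4, h5⟩ := fc_bessel (memLp_of_continuous_circle hrc)
  simp only [fc_iteratedDeriv hf hp _ le_rfl] at h4 h5
  obtain ⟨s1, s2⟩ := summable_weight_of_bessel (r := r) h2
    (h3.trans (pow_le_pow_left₀ ENNReal.toReal_nonneg (hb _ hf.continuous h0) 2)) h4
    (h5.trans (pow_le_pow_left₀ ENNReal.toReal_nonneg (hb _ hrc hr) 2))
  refine ⟨Hs.of r _ s1, fun j => rfl, Hs.norm_le_of_tsum (by have := Real.pi_pos; positivity)
    (s2.trans ?_)⟩
  have h4 : (4 : ℝ) ^ r = (2 ^ r) ^ 2 := by rw [← pow_mul, mul_comm, pow_mul]; norm_num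
  rw [h4, pow_succ]
  apply le_of_eq; ring

/-! ### Upper bounds for Sobolev norms of Fourier series -/

lemma contDiff_iteratedDeriv_param {ψ : ℝ → ℝ → ℝ} (h : ContDiff ℝ ∞ (fun p : ℝ × ℝ => ψ p.1 p.2))
    (b : ℕ) : ContDiff ℝ ∞ (fun p : ℝ × ℝ => iteratedDeriv b (fun s' => ψ p.1 s') p.2) := by
  induction b with
  | zero => simpa using h
  | succ b ih =>
    have e : (fun p : ℝ × ℝ => iteratedDeriv (b + 1) (fun s' => ψ p.1 s') p.2) =
        fun p => fderiv ℝ (fun p : ℝ × ℝ => iteratedDeriv b (fun s' => ψ p.1 s') p.2) p (0, 1) := by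
      ext ⟨θ, s⟩
      rw [iteratedDeriv_succ]
      have h1 := ((ih.differentiable (by simp)) (θ, s)).hasFDerivAt
      have h2 : HasDerivAt (fun x : ℝ => (θ, x)) ((0 : ℝ), (1 : ℝ)) s :=
        (hasDerivAt_const s θ).prodMk (hasDerivAt_id s)
      exact (h1.comp_hasDerivAt s h2).deriv
    rw [e]
    exact (ih.fderiv_right (by simp)).clm_apply contDiff_const

lemma iteratedDeriv_ofReal {f : ℝ → ℝ} (hf : ContDiff ℝ ∞ f) (n : ℕ) :
    iteratedDeriv n (fun x => (f x : ℂ)) = fun x => ((iteratedDeriv n f x : ℝ) : ℂ) := by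
  induction n with
  | zero => simp
  | succ n ih =>
    ext x
    rw [iteratedDeriv_succ, ih, iteratedDeriv_succ]
    exact (((hf.differentiable_iteratedDeriv n (by exact_mod_cast ENat.natCast_lt_top n)) x).hasDerivAt.ofReal_comp).deriv

lemma integral_mul_em_iteratedDeriv {f : ℝ → ℝ} (hf : ContDiff ℝ ∞ f)
    (hp : Function.Periodic f (2 * Real.pi)) (j : ℤ) (i : ℕ) :
    ∫ s, ((iteratedDeriv i f s : ℝ) : ℂ) * em j s ∂circleMeasure =
      (-1) ^ i * (Complex.I * j) ^ i * ∫ s, (f s : ℂ) * em j s ∂circleMeasure := by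
  have h1 : ContDiff ℝ i (fun x => (f x : ℂ)) :=
    Complex.ofRealCLM.contDiff.comp (hf.of_le (by exact_mod_cast le_top))
  have := integral_iteratedDeriv_mul_em h1 (fun x => by simp [hp x]) j le_rfl
  rwa [iteratedDeriv_ofReal hf] at this

/-- Integration by parts in one variable at a time. The `θ`-derivatives are outermost in
`mixedDeriv`, so the `θ`-integral is done first, and Fubini is used twice to exchange the order. -/
lemma integral_mixedDeriv_mul_em2 {ψ : ℝ → ℝ → ℝ} (h : ContDiff ℝ ∞ (fun p : ℝ × ℝ => ψ p.1 p.2))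
    (hp : IsTorusFun ψ) (a b : ℕ) (i : ℤ × ℤ) :
    ∫ p : ℝ × ℝ, (mixedDeriv a b ψ p.1 p.2 : ℂ) * em2 i p ∂torusMeasure =
      (-1) ^ (a + b) * ((Complex.I * i.1) ^ a * (Complex.I * i.2) ^ b) *
        ∫ p : ℝ × ℝ, (ψ p.1 p.2 : ℂ) * em2 i p ∂torusMeasure := by
  have hb := contDiff_iteratedDeriv_param h b
  have hab : ContDiff ℝ ∞ (fun p : ℝ × ℝ => mixedDeriv a b ψ p.1 p.2) := by
    have hb' : ContDiff ℝ ∞ (fun p : ℝ × ℝ => iteratedDeriv b (fun s' => ψ p.2 s') p.1) :=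
      hb.comp (contDiff_snd.prodMk contDiff_fst)
    exact (contDiff_iteratedDeriv_param
      (ψ := fun x y => iteratedDeriv b (fun s' => ψ y s') x) hb' a).comp
      (contDiff_snd.prodMk contDiff_fst)
  have hint : ∀ {f : ℝ → ℝ → ℝ}, Continuous (fun p : ℝ × ℝ => f p.1 p.2) →
      Integrable (fun p : ℝ × ℝ => (f p.1 p.2 : ℂ) * em2 i p) (circleMeasure.prod circleMeasure) :=
    fun hf => by
      rw [← torusMeasure_eq]
      exact (memLp_of_continuous_torus ((Complex.continuous_ofReal.comp hf).mul
        (continuous_em2 i)) (p := 1)).integrable le_rfl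
  rw [torusMeasure_eq, integral_prod_symm _ (hint hab.continuous)]
  have hbi := hint (f := fun θ s => iteratedDeriv b (fun s' => ψ θ s') s) hb.continuous
  have e1 : ∀ s, ∫ θ, (mixedDeriv a b ψ θ s : ℂ) * em2 i (θ, s) ∂circleMeasure =
      (-1) ^ a * (Complex.I * i.1) ^ a *
        ∫ θ, ((iteratedDeriv b (fun s' => ψ θ s') s : ℝ) : ℂ) * em2 i (θ, s) ∂circleMeasure := by
    intro s
    have hs : ContDiff ℝ ∞ (fun θ => iteratedDeriv b (fun s' => ψ θ s') s) :=
      hb.comp (contDiff_id.prodMk contDiff_const)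
    have hs' : Function.Periodic (fun θ => iteratedDeriv b (fun s' => ψ θ s') s) (2 * Real.pi) :=
      fun θ => by
        have : (fun s' => ψ (θ + 2 * Real.pi) s') = fun s' => ψ θ s' :=
          funext fun s' => (hp θ s').1
        simp only [this]
    have := integral_mul_em_iteratedDeriv hs hs' i.1 a
    simp only [em2, ← mul_assoc, integral_mul_const]
    simp only [mixedDeriv]
    rw [this]
  simp only [e1]
  rw [integral_const_mul, ← integral_prod_symm (fun p : ℝ × ℝ =>
    ((iteratedDeriv b (fun s' => ψ p.1 s') p.2 : ℝ) : ℂ) * em2 i p) hbi,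
    integral_prod _ hbi]
  have e2 : ∀ θ, ∫ s, ((iteratedDeriv b (fun s' => ψ θ s') s : ℝ) : ℂ) * em2 i (θ, s) ∂circleMeasure =
      (-1) ^ b * (Complex.I * i.2) ^ b * ∫ s, (ψ θ s : ℂ) * em2 i (θ, s) ∂circleMeasure := by
    intro θ
    have := integral_mul_em_iteratedDeriv (f := fun s => ψ θ s)
      (h.comp (contDiff_const.prodMk contDiff_id)) (fun s => (hp θ s).2) i.2 b
    have e3 : ∀ x : ℝ → ℂ, ∫ s, x s * em2 i (θ, s) ∂circleMeasure =
        em i.1 θ * ∫ s, x s * em i.2 s ∂circleMeasure := fun x => by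
      rw [← integral_const_mul]; congr 1; ext s; simp only [em2]; ring
    rw [e3, e3, this]; ring
  simp only [e2]
  rw [integral_const_mul, ← integral_prod _ (hint h.continuous)]
  rw [pow_add]; ring

lemma summable_double {ι : Type*} {Q : ℕ} (hQ : 1 ≤ Q) {y : ι → Hs Q}
    (hs : Summable fun i => ‖y i‖) : Summable fun x : ι × ℤ => ‖y x.1 x.2‖ := by
  refine (summable_prod_of_nonneg (fun _ => norm_nonneg _)).mpr
    ⟨fun i => Hs.summable_norm_pos hQ (y i), ?_⟩
  exact Summable.of_nonneg_of_le (fun _ => tsum_nonneg fun _ => norm_nonneg _)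
    (fun i => Hs.tsum_norm_le hQ (y i)) (hs.mul_left _)

/-- Weak derivatives of a double Fourier series. -/
lemma exists_hasWeakDeriv {ι : Type*} [Countable ι] {Q : ℕ} (hQ : 1 ≤ Q) (k : ι → ℤ) (y : ι → Hs Q)
    (hs : Summable fun i => wt (k i) ^ Q * ‖y i‖) {a b : ℕ} (hab : a + b ≤ Q) :
    ∃ g, HasWeakDeriv a b (fun θ s => (∑' i, em (k i) θ * evs (y i) s).re) g ∧
      eLpNorm (fun p : ℝ × ℝ => g p.1 p.2) 2 torusMeasure ≤
        ENNReal.ofReal (2 * Real.pi * ∑' i, wt (k i) ^ Q * ‖y i‖) := by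
  have hs1 : Summable fun i => ‖y i‖ := Summable.of_nonneg_of_le (fun _ => norm_nonneg _)
    (fun i => le_mul_of_one_le_left (norm_nonneg _) (one_le_pow₀ (one_le_wt _))) hs
  have hd := summable_double hQ hs1
  have hM : Hs.MultBound (fun j : ℤ => (Complex.I * j) ^ b) Q 0 1 :=
    Hs.multBound_deriv (by omega)
  -- For `b = Q` the series differentiated in `s` is merely square summable. It is therefore built
  -- in `L²` by Riesz–Fischer, for each index `i` separately. The sum over `i` then converges
  -- absolutely in `L²`, because the hypothesis is an `ℓ¹` condition there.
  have hG : ∀ i, ∃ G : Lp ℂ 2 torusMeasure,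
      HasSum (fun j => ((Complex.I * j) ^ b * y i j) •
        ((orthoSys_mode (k i)).memLp j).toLp (em2 (k i, j))) G ∧ ‖G‖ ≤ 2 * Real.pi * ‖y i‖ := by
    intro i
    have h1 := Hs.hasSum_sq (Hs.multL (fun j : ℤ => (Complex.I * j) ^ b) Q 0 (y i))
    simp only [hM.multL_apply, pow_zero, one_mul] at h1
    obtain ⟨G, hG, hn⟩ := (orthoSys_mode (k i)).exists_hasSum h1.summable
    refine ⟨G, hG, ?_⟩
    rw [h1.tsum_eq, ← pow_two, ← mul_pow] at hn
    have h2 := hM.norm_le (y i)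
    rw [one_mul] at h2
    have h3 : ‖G‖ = 2 * Real.pi * ‖Hs.multL (fun j : ℤ => (Complex.I * j) ^ b) Q 0 (y i)‖ :=
      (pow_left_inj₀ (norm_nonneg _) (by have := Real.pi_pos; positivity) two_ne_zero).mp hn
    rw [h3]
    have := Real.pi_pos
    gcongr
  choose G hG hGn using hG
  have hk : ∀ i, ‖(Complex.I * (k i : ℂ)) ^ a‖ ≤ wt (k i) ^ Q := fun i => by
    rw [norm_pow, norm_mul, Complex.norm_I, one_mul, Complex.norm_intCast]
    exact (pow_le_pow_left₀ (abs_nonneg _) (abs_le_wt _) a).trans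
      (pow_le_pow_right₀ (one_le_wt _) (by omega))
  have hGb : ∀ i, ‖(Complex.I * (k i : ℂ)) ^ a • G i‖ ≤
      2 * Real.pi * (wt (k i) ^ Q * ‖y i‖) := fun i => by
    rw [norm_smul]
    calc _ ≤ wt (k i) ^ Q * (2 * Real.pi * ‖y i‖) :=
          mul_le_mul (hk i) (hGn i) (norm_nonneg _) (pow_nonneg (wt_pos _).le _)
      _ = _ := by ring
  have hGs : Summable fun i => (Complex.I * (k i : ℂ)) ^ a • G i :=
    Summable.of_norm_bounded (hs.mul_left _) hGb
  set T := ∑' i, (Complex.I * (k i : ℂ)) ^ a • G i with hT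
  have hTn : ‖T‖ ≤ 2 * Real.pi * ∑' i, wt (k i) ^ Q * ‖y i‖ := by
    rw [← tsum_mul_left]
    exact tsum_of_norm_bounded (hs.mul_left _).hasSum hGb
  have hTm := Lp.memLp T
  set F : ℝ × ℝ → ℂ := fun p => ∑' i, em (k i) p.1 * evs (y i) p.2 with hF
  have hFp : ∀ p, F p = ∑' x : ι × ℤ, y x.1 x.2 * em2 (k x.1, x.2) p := fun p => by
    rw [Summable.tsum_prod (Summable.of_norm (by simpa using hd))]
    simp only [hF, evs, ← tsum_mul_left, em2]
    congr 1; ext i; congr 1; ext j; ring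
  have hFc : Continuous F := by
    rw [show F = _ from funext hFp]
    exact continuous_tsum (fun x => continuous_const.mul (continuous_em2 _)) hd (fun x p => by simp)
  refine ⟨fun θ s => (T (θ, s)).re, ⟨?_, hTm.re, ?_⟩, ?_⟩
  · exact (memLp_of_continuous_torus (Complex.continuous_re.comp hFc) (p := 1)).integrable le_rfl
  · intro ψ hψ hψp
    have hψc : MemLp (fun p : ℝ × ℝ => (ψ p.1 p.2 : ℂ)) 2 torusMeasure :=
      memLp_of_continuous_torus (Complex.continuous_ofReal.comp hψ.continuous)
    have hmd : Continuous (fun p : ℝ × ℝ => mixedDeriv a b ψ p.1 p.2) := by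
      have hb' : ContDiff ℝ ∞ (fun p : ℝ × ℝ => iteratedDeriv b (fun s' => ψ p.2 s') p.1) :=
        (contDiff_iteratedDeriv_param hψ b).comp (contDiff_snd.prodMk contDiff_fst)
      exact ((contDiff_iteratedDeriv_param
        (ψ := fun x y => iteratedDeriv b (fun s' => ψ y s') x) hb' a).comp
        (contDiff_snd.prodMk contDiff_fst)).continuous
    have hI1 : ∀ x : ι × ℤ, Integrable (fun p : ℝ × ℝ =>
        y x.1 x.2 * em2 (k x.1, x.2) p * (mixedDeriv a b ψ p.1 p.2 : ℂ)) torusMeasure := fun x =>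
      (memLp_of_continuous_torus ((continuous_const.mul (continuous_em2 _)).mul
        (Complex.continuous_ofReal.comp hmd)) (p := 1)).integrable le_rfl
    have hI2 := hasSum_integral_of_summable_integral_norm hI1 (by
      simp only [norm_mul, norm_em2, mul_one]
      simp only [integral_const_mul]
      exact hd.mul_right _)
    simp only [tsum_mul_right, ← hFp] at hI2
    have hP1 := (pairL hψc).hasSum hGs.hasSum
    have hP2 : ∀ i, HasSum (fun j => ((Complex.I * j) ^ b * y i j) *
        ∫ p : ℝ × ℝ, em2 (k i, j) p * (ψ p.1 p.2 : ℂ) ∂torusMeasure) (pairL hψc (G i)) := fun i => by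
      have := (pairL hψc).hasSum (hG i)
      simpa only [map_smul, smul_eq_mul, pairL_toLp] using this
    have hterm : ∀ x : ι × ℤ, ∫ p : ℝ × ℝ, y x.1 x.2 * em2 (k x.1, x.2) p *
        (mixedDeriv a b ψ p.1 p.2 : ℂ) ∂torusMeasure = (-1) ^ (a + b) *
        ((Complex.I * k x.1) ^ a * (((Complex.I * x.2) ^ b * y x.1 x.2) *
          ∫ p : ℝ × ℝ, em2 (k x.1, x.2) p * (ψ p.1 p.2 : ℂ) ∂torusMeasure)) := fun x => by
      have := integral_mixedDeriv_mul_em2 hψ hψp a b (k x.1, x.2)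
      simp only [mul_assoc]
      rw [integral_const_mul]
      simp only [mul_comm (em2 _ _)]
      rw [this]; ring
    -- Both sides are the same sum over modes. On the left, sum and integral are exchanged by
    -- absolute convergence. On the right this is continuity of the `L²` pairing.
    have hmain : ∫ p, F p * (mixedDeriv a b ψ p.1 p.2 : ℂ) ∂torusMeasure =
        (-1) ^ (a + b) * ∫ p, T p * (ψ p.1 p.2 : ℂ) ∂torusMeasure := by
      rw [← hI2.tsum_eq, hI2.summable.tsum_prod, ← pairL_apply hψc, ← hP1.tsum_eq]
      have hterm' := fun i j => hterm (i, j)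
      simp only at hterm'
      simp only [hterm', tsum_mul_left, (hP2 _).tsum_eq, map_smul, smul_eq_mul]
    have hr1 := integral_re (𝕜 := ℂ) (μ := torusMeasure)
      (f := fun p => F p * (mixedDeriv a b ψ p.1 p.2 : ℂ))
      ((memLp_of_continuous_torus (hFc.mul
        (Complex.continuous_ofReal.comp hmd)) (p := 1)).integrable le_rfl)
    have hr2 := integral_re (𝕜 := ℂ) (μ := torusMeasure)
      (f := fun p => T p * (ψ p.1 p.2 : ℂ)) (hTm.integrable_mul hψc)
    rw [hmain] at hr1
    have e1 : ∀ p : ℝ × ℝ, RCLike.re (F p * (mixedDeriv a b ψ p.1 p.2 : ℂ)) =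
        (F p).re * mixedDeriv a b ψ p.1 p.2 := fun p => Complex.re_mul_ofReal _ _
    have e2 : ∀ p : ℝ × ℝ, RCLike.re (T p * (ψ p.1 p.2 : ℂ)) =
        (T p).re * ψ p.1 p.2 := fun p => Complex.re_mul_ofReal _ _
    simp only [e1] at hr1
    simp only [e2] at hr2
    refine hr1.trans ?_
    refine Eq.trans ?_ (congrArg _ hr2.symm)
    have : ((-1 : ℂ) ^ (a + b)) = (((-1) ^ (a + b) : ℝ) : ℂ) := by push_cast; rfl
    rw [this]
    exact Complex.re_ofReal_mul _ _
  · have h1 : eLpNorm (fun p : ℝ × ℝ => (T (p.1, p.2)).re) 2 torusMeasure ≤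
        eLpNorm T 2 torusMeasure :=
      eLpNorm_mono fun p => (Real.norm_eq_abs _).trans_le (Complex.abs_re_le_norm _)
    refine h1.trans ?_
    rw [← ENNReal.ofReal_toReal hTm.eLpNorm_ne_top]
    exact ENNReal.ofReal_le_ofReal hTn

/-- The constant in `sobolev_upper`. -/
def upC (Q : ℕ) : ℝ := (Q + 1) * (2 * Real.pi)

lemma upC_nonneg (Q : ℕ) : 0 ≤ upC Q := by have := Real.pi_pos; unfold upC; positivity

/-- Bound for the Sobolev norm of a double Fourier series. -/
lemma sobolev_upper {ι : Type*} [Countable ι] {Q : ℕ} (hQ : 1 ≤ Q) (k : ι → ℤ) (y : ι → Hs Q)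
    (hs : Summable fun i => wt (k i) ^ Q * ‖y i‖) :
    sobolevNorm Q (fun θ s => (∑' i, em (k i) θ * evs (y i) s).re) ≤
      ENNReal.ofReal (upC Q * ∑' i, wt (k i) ^ Q * ‖y i‖) := by
  set S := ∑' i, wt (k i) ^ Q * ‖y i‖ with hS
  have hS0 : 0 ≤ S := tsum_nonneg fun i =>
    mul_nonneg (pow_nonneg (wt_pos _).le _) (norm_nonneg _)
  have hp := Real.pi_pos
  have h1 : ∀ α ∈ (Finset.range (Q + 1) ×ˢ Finset.range (Q + 1)).filter
      (fun α => α.1 + α.2 ≤ Q),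
      weakDerivNorm α.1 α.2 (fun θ s => (∑' i, em (k i) θ * evs (y i) s).re) ^ 2 ≤
      ENNReal.ofReal (2 * Real.pi * S) ^ 2 := by
    intro α hα
    obtain ⟨g, hg, hn⟩ := exists_hasWeakDeriv hQ k y hs (Finset.mem_filter.mp hα).2
    exact pow_le_pow_left' ((iInf₂_le g hg).trans hn) 2
  unfold sobolevNorm
  -- There are at most `(Q + 1) ^ 2` multi-indices. The square root of this number is the factor `Q
  -- + 1` in `upC`.
  have h2 := (Finset.sum_le_sum h1).trans (Finset.sum_le_sum_of_subset (Finset.filter_subset _ _))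
  rw [Finset.sum_const, Finset.card_product, Finset.card_range, nsmul_eq_mul] at h2
  have h3 : (((Q + 1) * (Q + 1) : ℕ) : ℝ≥0∞) * ENNReal.ofReal (2 * Real.pi * S) ^ 2 =
      ENNReal.ofReal (upC Q * S) ^ 2 := by
    rw [← ENNReal.ofReal_natCast, ← ENNReal.ofReal_pow (by positivity),
      ← ENNReal.ofReal_mul (by positivity),
      ← ENNReal.ofReal_pow (mul_nonneg (upC_nonneg Q) hS0)]
    congr 1; unfold upC; push_cast; ring
  rw [h3] at h2
  refine (ENNReal.rpow_le_rpow h2 (by norm_num)).trans_eq ?_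
  rw [← ENNReal.rpow_natCast, ← ENNReal.rpow_mul]; norm_num

end NearAxis
end

/-! ### Resolvents, and the growth and continuity of the solution of the recursion -/

noncomputable section

namespace NearAxis

open Hs

/-! ### The recursion for the coefficients -/

/-- The symbol `ℓ + (j² / K²)^D + (k² / K²)^D`. -/
def ellSym (D : ℕ) (K ℓ : ℝ) (k j : ℤ) : ℝ :=
  ℓ + ((j : ℝ) ^ 2 / K ^ 2) ^ D + ((k : ℝ) ^ 2 / K ^ 2) ^ D

lemma le_ellSym (D : ℕ) (K ℓ : ℝ) (k j : ℤ) : ℓ ≤ ellSym D K ℓ k j := by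
  have h1 : 0 ≤ ((j : ℝ) ^ 2 / K ^ 2) ^ D := by positivity
  have h2 : 0 ≤ ((k : ℝ) ^ 2 / K ^ 2) ^ D := by positivity
  unfold ellSym; linarith

lemma ellSym_pos (D : ℕ) (K : ℝ) {ℓ : ℝ} (hℓ : 0 < ℓ) (k j : ℤ) : 0 < ellSym D K ℓ k j :=
  hℓ.trans_le (le_ellSym D K ℓ k j)

/-- The norm bound of the resolvents. -/
def resC (D : ℕ) (K ℓ₀ : ℝ) : ℝ := 3 ^ (2 * D) / min ℓ₀ ((K ^ 2)⁻¹ ^ D)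

lemma resC_nonneg {D : ℕ} {K ℓ₀ : ℝ} (hℓ : 0 < ℓ₀) : 0 ≤ resC D K ℓ₀ := by
  have : 0 ≤ min ℓ₀ ((K ^ 2)⁻¹ ^ D) := le_min hℓ.le (by positivity)
  unfold resC; positivity

/-- Joint ellipticity in `s` and `θ`. This is the gain that the regularization provides. The
constant depends neither on the modes nor on `ℓ` beyond its lower bound. -/
lemma pow_le_resC_mul {D : ℕ} {K ℓ₀ ℓ : ℝ} (hK : 0 < K) (hℓ₀ : 0 < ℓ₀) (hℓ : ℓ₀ ≤ ℓ) (k j : ℤ) :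
    (1 + |(j : ℝ)| + |(k : ℝ)|) ^ (2 * D) ≤ resC D K ℓ₀ * ellSym D K ℓ k j := by
  set c := min ℓ₀ ((K ^ 2)⁻¹ ^ D) with hc
  have hc0 : 0 < c := lt_min hℓ₀ (by positivity)
  have hx := abs_nonneg (j : ℝ)
  have hy := abs_nonneg (k : ℝ)
  have h1 : (1 + |(j : ℝ)| + |(k : ℝ)|) ^ (2 * D) ≤
      3 ^ (2 * D) * (1 + |(j : ℝ)| ^ (2 * D) + |(k : ℝ)| ^ (2 * D)) := by
    -- `m` will be the largest of `1`, `|j|` and `|k|`.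
    have aux : ∀ m : ℝ, 0 ≤ m → 1 ≤ m → |(j : ℝ)| ≤ m → |(k : ℝ)| ≤ m →
        m ^ (2 * D) ≤ 1 + |(j : ℝ)| ^ (2 * D) + |(k : ℝ)| ^ (2 * D) →
        (1 + |(j : ℝ)| + |(k : ℝ)|) ^ (2 * D) ≤
        3 ^ (2 * D) * (1 + |(j : ℝ)| ^ (2 * D) + |(k : ℝ)| ^ (2 * D)) := by
      intro m _ h1 h2 h3 h4
      calc (1 + |(j : ℝ)| + |(k : ℝ)|) ^ (2 * D) ≤ (3 * m) ^ (2 * D) :=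
            pow_le_pow_left₀ (by positivity) (by linarith) _
        _ = 3 ^ (2 * D) * m ^ (2 * D) := mul_pow _ _ _
        _ ≤ _ := by gcongr
    have p1 : 0 ≤ |(j : ℝ)| ^ (2 * D) := by positivity
    have p2 : 0 ≤ |(k : ℝ)| ^ (2 * D) := by positivity
    rcases le_total |(j : ℝ)| |(k : ℝ)| with h | h
    · rcases le_total 1 |(k : ℝ)| with h' | h'
      · exact aux _ hy h' h le_rfl (by linarith)
      · exact aux 1 zero_le_one le_rfl (h.trans h') h' (by rw [one_pow]; linarith)
    · rcases le_total 1 |(j : ℝ)| with h' | h'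
      · exact aux _ hx h' le_rfl h (by linarith)
      · exact aux 1 zero_le_one le_rfl h' (h.trans h') (by rw [one_pow]; linarith)
  have h2 : c * (1 + |(j : ℝ)| ^ (2 * D) + |(k : ℝ)| ^ (2 * D)) ≤ ellSym D K ℓ k j := by
    have e : ∀ x : ℤ, c * |(x : ℝ)| ^ (2 * D) ≤ ((x : ℝ) ^ 2 / K ^ 2) ^ D := fun x => by
      rw [pow_mul, sq_abs, div_eq_mul_inv, mul_pow, mul_comm]
      exact mul_le_mul_of_nonneg_left (min_le_right _ _) (by positivity)
    have hcl : c ≤ ℓ := (min_le_left _ _).trans hℓ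
    have := e j
    have := e k
    unfold ellSym
    linarith
  calc _ ≤ _ := h1
    _ = 3 ^ (2 * D) / c * (c * (1 + |(j : ℝ)| ^ (2 * D) + |(k : ℝ)| ^ (2 * D))) := by
        field_simp
    _ ≤ _ := mul_le_mul_of_nonneg_left h2 (by positivity)

/-- A numerator of order at most one. -/
def IsNum (k : ℤ) (d : ℤ → ℂ) : Prop := ∀ j, ‖d j‖ ≤ 1 + |(j : ℝ)| + |(k : ℝ)|

lemma isNum_one (k : ℤ) : IsNum k (fun _ => 1) := fun j => by
  simp only [norm_one]; linarith [abs_nonneg (j : ℝ), abs_nonneg (k : ℝ)]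

lemma isNum_j (k : ℤ) : IsNum k (fun j => Complex.I * j) := fun j => by
  simp only [norm_mul, Complex.norm_I, one_mul, Complex.norm_intCast]
  linarith [abs_nonneg (j : ℝ), abs_nonneg (k : ℝ)]

lemma isNum_k (k : ℤ) : IsNum k (fun _ => Complex.I * k) := fun j => by
  simp only [norm_mul, Complex.norm_I, one_mul, Complex.norm_intCast]
  linarith [abs_nonneg (j : ℝ), abs_nonneg (k : ℝ)]

/-- A numerator of order one, in `j` or in `k`, uses up one of the `2D` orders of the symbol. The
other `2D - 1` raise the regularity from `q + 1` to `q + 2D`. Uniformity in `k` keeps the poloidal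
number out of the growth estimate. -/
lemma multBound_res {q D : ℕ} (hD : 1 ≤ D) {K ℓ₀ ℓ : ℝ} (hK : 0 < K) (hℓ₀ : 0 < ℓ₀) (hℓ : ℓ₀ ≤ ℓ)
    {k : ℤ} {d : ℤ → ℂ} (hd : IsNum k d) :
    MultBound (fun j => d j * ((ellSym D K ℓ k j : ℝ) : ℂ)⁻¹) (q + 1) (q + 2 * D)
      (resC D K ℓ₀) := by
  refine ⟨resC_nonneg hℓ₀, fun j => ?_⟩
  have ha := ellSym_pos D K (hℓ₀.trans_le hℓ) k j
  have hw := wt_pos j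
  obtain ⟨D, rfl⟩ := Nat.exists_eq_add_of_le' hD
  rw [norm_mul, norm_inv, Complex.norm_real, Real.norm_of_nonneg ha.le]
  have h1 := pow_le_resC_mul (D := D + 1) hK hℓ₀ hℓ k j
  have h2 : wt j ^ (2 * D + 1) * ‖d j‖ ≤ (1 + |(j : ℝ)| + |(k : ℝ)|) ^ (2 * (D + 1)) := by
    rw [show 2 * (D + 1) = 2 * D + 1 + 1 by ring, pow_succ _ (2 * D + 1)]
    refine mul_le_mul (pow_le_pow_left₀ hw.le ?_ _) (hd j) (norm_nonneg _) (by positivity)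
    unfold wt; linarith [abs_nonneg (k : ℝ)]
  rw [show q + 2 * (D + 1) = (2 * D + 1) + (q + 1) by ring, pow_add, ← div_eq_mul_inv,
    ← mul_div_assoc, div_le_iff₀ ha]
  calc wt j ^ (2 * D + 1) * wt j ^ (q + 1) * ‖d j‖
      = wt j ^ (2 * D + 1) * ‖d j‖ * wt j ^ (q + 1) := by ring
    _ ≤ (resC (D + 1) K ℓ₀ * ellSym (D + 1) K ℓ k j) * wt j ^ (q + 1) :=
        mul_le_mul_of_nonneg_right (h2.trans h1) (pow_nonneg hw.le _)
    _ = _ := by ring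

/-- The resolvent of `ℓ + P_k`, composed with the multiplier `d`. -/
def resL (q D : ℕ) (K ℓ : ℝ) (k : ℤ) (d : ℤ → ℂ) : Hs (q + 1) →L[ℂ] Hs (q + 2 * D) :=
  multL (fun j => d j * ((ellSym D K ℓ k j : ℝ) : ℂ)⁻¹) (q + 1) (q + 2 * D)

lemma resL_apply {q D : ℕ} (hD : 1 ≤ D) {K ℓ : ℝ} (hK : 0 < K) (hℓ : 0 < ℓ)
    {k : ℤ} {d : ℤ → ℂ} (hd : IsNum k d) (u : Hs (q + 1)) (j : ℤ) :
    resL q D K ℓ k d u j = d j * ((ellSym D K ℓ k j : ℝ) : ℂ)⁻¹ * u j :=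
  (multBound_res hD hK hℓ le_rfl hd).multL_apply u j

lemma norm_resL_le {q D : ℕ} (hD : 1 ≤ D) {K ℓ₀ ℓ : ℝ} (hK : 0 < K) (hℓ₀ : 0 < ℓ₀) (hℓ : ℓ₀ ≤ ℓ)
    {k : ℤ} {d : ℤ → ℂ} (hd : IsNum k d) (u : Hs (q + 1)) :
    ‖resL q D K ℓ k d u‖ ≤ resC D K ℓ₀ * ‖u‖ :=
  (multBound_res hD hK hℓ₀ hℓ hd).norm_le u

/-- The resolvent identity: the difference of the two symbols is `ℓ₀ - ℓ` times their product, and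
the second factor is at most `ℓ₀⁻¹`. Convergence therefore holds in operator norm. -/
lemma tendsto_resL {ι : Type*} {l : Filter ι} {q D : ℕ} (hD : 1 ≤ D) {K ℓ₀ : ℝ} (hK : 0 < K)
    (hℓ₀ : 0 < ℓ₀) {k : ℤ} {d : ℤ → ℂ} (hd : IsNum k d) {ℓ : ι → ℝ} {f : ι → Hs (q + 1)}
    {f₀ : Hs (q + 1)} (hℓ : Tendsto ℓ l (𝓝 ℓ₀)) (hf : Tendsto f l (𝓝 f₀)) :
    Tendsto (fun i => resL q D K (ℓ i) k d (f i)) l (𝓝 (resL q D K ℓ₀ k d f₀)) := by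
  rw [tendsto_iff_norm_sub_tendsto_zero]
  set C := resC D K (ℓ₀ / 2)
  have hb : Tendsto (fun i => C * ‖f i - f₀‖ + |ℓ i - ℓ₀| * (ℓ₀⁻¹ * C * ‖f₀‖)) l (𝓝 0) := by
    have h1 := (tendsto_iff_norm_sub_tendsto_zero.mp hf).const_mul C
    have h2 := ((tendsto_iff_norm_sub_tendsto_zero.mp hℓ)).mul_const (ℓ₀⁻¹ * C * ‖f₀‖)
    have := h1.add h2
    simpa using this
  refine squeeze_zero' (Eventually.of_forall fun _ => norm_nonneg _) ?_ hb
  filter_upwards [hℓ.eventually (lt_mem_nhds (half_lt_self hℓ₀))] with i hi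
  have hi0 : 0 < ℓ i := (half_pos hℓ₀).trans hi
  have hM := multBound_res (q := q) hD hK (half_pos hℓ₀) hi.le hd
  have hC := resC_nonneg (D := D) (K := K) (half_pos hℓ₀)
  have hN : MultBound (fun j => (d j * ((ellSym D K (ℓ i) k j : ℝ) : ℂ)⁻¹) *
      ((ellSym D K ℓ₀ k j : ℝ) : ℂ)⁻¹) (q + 1) (q + 2 * D) (ℓ₀⁻¹ * C) := by
    refine ⟨by positivity, fun j => ?_⟩
    have ha := ellSym_pos D K hℓ₀ k j
    rw [norm_mul, ← mul_assoc, norm_inv, Complex.norm_real, Real.norm_of_nonneg ha.le]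
    calc _ ≤ (C * wt j ^ (q + 1)) * ℓ₀⁻¹ := by
          refine mul_le_mul (hM.2 j) ?_ (by positivity) ?_
          · exact inv_anti₀ hℓ₀ (le_ellSym _ _ _ _ _)
          · have := wt_pos j; positivity
      _ = _ := by ring
  have e : resL q D K (ℓ i) k d (f i) - resL q D K ℓ₀ k d f₀ =
      resL q D K (ℓ i) k d (f i - f₀) + ((ℓ₀ - ℓ i : ℝ) : ℂ) • multL (fun j =>
        (d j * ((ellSym D K (ℓ i) k j : ℝ) : ℂ)⁻¹) * ((ellSym D K ℓ₀ k j : ℝ) : ℂ)⁻¹)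
        (q + 1) (q + 2 * D) f₀ := by
    ext j
    simp only [Hs.sub_apply, Hs.add_apply, Hs.smul_apply, resL_apply hD hK hi0 hd,
      resL_apply hD hK hℓ₀ hd, hN.multL_apply]
    have a1 : ((ellSym D K (ℓ i) k j : ℝ) : ℂ) ≠ 0 := by
      exact_mod_cast (ellSym_pos D K hi0 k j).ne'
    have a2 : ((ellSym D K ℓ₀ k j : ℝ) : ℂ) ≠ 0 := by
      exact_mod_cast (ellSym_pos D K hℓ₀ k j).ne'
    have a3 : ((ellSym D K ℓ₀ k j : ℝ) : ℂ) - ((ellSym D K (ℓ i) k j : ℝ) : ℂ) =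
        ((ℓ₀ - ℓ i : ℝ) : ℂ) := by
      rw [← Complex.ofReal_sub]; congr 1; unfold ellSym; ring
    rw [← a3]
    field_simp
    ring
  rw [e]
  refine (norm_add_le _ _).trans (add_le_add (hM.norm_le _) ?_)
  rw [norm_smul, Complex.norm_real, Real.norm_eq_abs, abs_sub_comm]
  exact mul_le_mul_of_nonneg_left (hN.norm_le _) (abs_nonneg _)

/-- Multiplication by `z` of a family of coefficients of `z^a w^b`. -/
def shz {E : Type*} [Zero E] (X : ℕ → ℕ → E) : ℕ → ℕ → E
  | 0, _ => 0
  | a + 1, b => X a b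

/-- Multiplication by `w` of a family of coefficients of `z^a w^b`. -/
def shw {E : Type*} [Zero E] (X : ℕ → ℕ → E) : ℕ → ℕ → E
  | _, 0 => 0
  | a, b + 1 => X a b

/-- `X` is the quotient of `Y` by `1 - κ (z + w) / 2`. -/
def IsDivh {r : ℕ} (κ : Hs r) (Y X : ℕ → ℕ → Hs r) : Prop :=
  ∀ a b, X a b = Y a b + (1 / 2 : ℂ) • mulL r κ (shz X a b + shw X a b)

/-- The quotient of `Y` by `1 - κ (z + w) / 2`. -/
def divh {r : ℕ} (κ : Hs r) (Y : ℕ → ℕ → Hs r) : ℕ → ℕ → Hs r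
  | 0, 0 => Y 0 0
  | a + 1, 0 => Y (a + 1) 0 + (1 / 2 : ℂ) • mulL r κ (divh κ Y a 0)
  | 0, b + 1 => Y 0 (b + 1) + (1 / 2 : ℂ) • mulL r κ (divh κ Y 0 b)
  | a + 1, b + 1 => Y (a + 1) (b + 1) +
      (1 / 2 : ℂ) • mulL r κ (divh κ Y a (b + 1) + divh κ Y (a + 1) b)
termination_by a b => a + b

lemma isDivh_divh {r : ℕ} (κ : Hs r) (Y : ℕ → ℕ → Hs r) : IsDivh κ Y (divh κ Y) := by
  intro a b
  rcases a with _ | a <;> rcases b with _ | b <;> rw [divh] <;> simp [shz, shw]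

/-- At each degree the inhomogeneity contributes `M`. The correction contributes at most another
`M`, since `R` is at least twice the multiplication norm of `κ`. The cutoff `n` allows the use
inside an induction where `Y` is only controlled up to degree `n`. -/
lemma IsDivh.bound {r : ℕ} {κ : Hs r} {Y X : ℕ → ℕ → Hs r} (h : IsDivh κ Y X) {M R : ℝ} {p n : ℕ}
    (hM : 0 ≤ M) (hR : 0 < R) (hκ : 2 * (algC r * ‖κ‖) ≤ R)
    (hY : ∀ a b, a + b ≤ n → ‖Y a b‖ ≤ M * (1 + a + b) ^ p * R ^ (a + b)) :
    ∀ a b, a + b ≤ n → ‖X a b‖ ≤ 2 * M * (1 + a + b) ^ p * R ^ (a + b) := by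
  suffices H : ∀ m, ∀ a b, a + b = m → m ≤ n → ‖X a b‖ ≤ 2 * M * (1 + a + b) ^ p * R ^ (a + b) from
    fun a b hab => H _ a b rfl hab
  intro m
  induction m with
  | zero =>
    intro a b hab hn
    obtain ⟨rfl, rfl⟩ : a = 0 ∧ b = 0 := by omega
    rw [h 0 0]
    have := hY 0 0 (by omega)
    simp [shz, shw] at this ⊢
    linarith
  | succ m ih =>
    intro a b hab hn
    rw [h a b]
    have hm : (1 + a + b : ℝ) = m + 2 := by
      have : (a + b : ℝ) = m + 1 := by exact_mod_cast hab
      linarith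
    have hz : ‖shz X a b‖ ≤ 2 * M * (m + 2) ^ p * R ^ m := by
      rcases a with _ | a
      · simp only [shz, norm_zero]; positivity
      · refine (ih a b (by omega) (by omega)).trans ?_
        rw [show a + b = m by omega]
        have : (1 + a + b : ℝ) = m + 1 := by push_cast at hm; linarith
        rw [this]
        gcongr; norm_num
    have hw : ‖shw X a b‖ ≤ 2 * M * (m + 2) ^ p * R ^ m := by
      rcases b with _ | b
      · simp only [shw, norm_zero]; positivity
      · refine (ih a b (by omega) (by omega)).trans ?_
        rw [show a + b = m by omega]
        have : (1 + a + b : ℝ) = m + 1 := by push_cast at hm; linarith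
        rw [this]
        gcongr; norm_num
    have hy := hY a b (by omega)
    rw [hab, hm] at hy ⊢
    have hc := algC_nonneg r
    have h1 : ‖(1 / 2 : ℂ) • mulL r κ (shz X a b + shw X a b)‖ ≤ M * (m + 2) ^ p * R ^ (m + 1) := by
      rw [norm_smul]
      have h2 := (norm_mulL_le κ (shz X a b + shw X a b)).trans
        (mul_le_mul_of_nonneg_left ((norm_add_le _ _).trans (add_le_add hz hw)) (by positivity))
      have h3 : ‖(1 / 2 : ℂ)‖ = 1 / 2 := by norm_num
      rw [h3]
      calc _ ≤ 1 / 2 * (algC r * ‖κ‖ * (2 * M * (m + 2) ^ p * R ^ m + 2 * M * (m + 2) ^ p * R ^ m)) := by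
            gcongr
        _ = 2 * (algC r * ‖κ‖) * (M * (m + 2) ^ p * R ^ m) := by ring
        _ ≤ R * (M * (m + 2) ^ p * R ^ m) := by gcongr
        _ = _ := by ring
    refine (norm_add_le _ _).trans ((add_le_add hy h1).trans (le_of_eq ?_))
    ring

section Recursion

variable (q D : ℕ) (K ℓ : ℝ) (κ τ B : Hs (q + 1)) (IC : ℕ → ℕ → Hs (q + 2 * D))

/-- One step of the recursion: the coefficient of `z^{a+1} w^{b+1}`. -/
def stepU (a b : ℕ) (u₁ u₂ : Hs (q + 2 * D)) (J : Hs (q + 1)) : Hs (q + 2 * D) :=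
  (4 * (a + 1) * (b + 1) : ℂ)⁻¹ •
    ((ℓ : ℂ) • resL q D K ℓ (a - b) (fun _ => 1) (mulL (q + 1) κ
        (((2 * a + 1) * (b + 1) : ℂ) • incl (q + 2 * D) (q + 1) u₁ +
          ((a + 1) * (2 * b + 1) : ℂ) • incl (q + 2 * D) (q + 1) u₂))
      - resL q D K ℓ (a - b) (fun j => Complex.I * j) J
      + (ℓ : ℂ) • resL q D K ℓ (a - b) (fun _ => Complex.I * ((a - b : ℤ) : ℂ)) (mulL (q + 1) τ J))

/-- The right-hand side of the equation for the flux, for a given coefficient `u` of `z^a w^b`. -/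
def fluxY (a b : ℕ) (u : Hs (q + 2 * D)) : Hs (q + 1) :=
  (if a + b = 0 then B else 0) + (ℓ : ℂ)⁻¹ • derivL 1 (q + 2 * D) (q + 1) u
    - (Complex.I * ((a - b : ℤ) : ℂ)) • mulL (q + 1) τ (incl (q + 2 * D) (q + 1) u)

/-- The solution of the recursion: potential and flux. -/
def sol : ℕ → ℕ → Hs (q + 2 * D) × Hs (q + 1)
  | 0, 0 => (IC 0 0, fluxY q D ℓ τ B 0 0 (IC 0 0))
  | a + 1, 0 => (IC (a + 1) 0, fluxY q D ℓ τ B (a + 1) 0 (IC (a + 1) 0) +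
      (1 / 2 : ℂ) • mulL (q + 1) κ (sol a 0).2)
  | 0, b + 1 => (IC 0 (b + 1), fluxY q D ℓ τ B 0 (b + 1) (IC 0 (b + 1)) +
      (1 / 2 : ℂ) • mulL (q + 1) κ (sol 0 b).2)
  | a + 1, b + 1 =>
      (stepU q D K ℓ κ τ a b (sol a (b + 1)).1 (sol (a + 1) b).1 (sol a b).2,
        fluxY q D ℓ τ B (a + 1) (b + 1)
          (stepU q D K ℓ κ τ a b (sol a (b + 1)).1 (sol (a + 1) b).1 (sol a b).2) +
        (1 / 2 : ℂ) • mulL (q + 1) κ ((sol a (b + 1)).2 + (sol (a + 1) b).2))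
termination_by a b => a + b

/-- The recursion satisfied by the coefficients of the potential and of the flux. -/
structure IsSol (u : ℕ → ℕ → Hs (q + 2 * D)) (J : ℕ → ℕ → Hs (q + 1)) : Prop where
  ic : ∀ a b, a = 0 ∨ b = 0 → u a b = IC a b
  step : ∀ a b, u (a + 1) (b + 1) = stepU q D K ℓ κ τ a b (u a (b + 1)) (u (a + 1) b) (J a b)
  flux : IsDivh κ (fun a b => fluxY q D ℓ τ B a b (u a b)) J

lemma isSol_sol : IsSol q D K ℓ κ τ B IC (fun a b => (sol q D K ℓ κ τ B IC a b).1)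
    (fun a b => (sol q D K ℓ κ τ B IC a b).2) := by
  refine ⟨?_, ?_, ?_⟩
  · rintro a b (rfl | rfl)
    · rcases b with _ | b <;> simp only [sol]
    · rcases a with _ | a <;> simp only [sol]
  · intro a b
    conv_lhs => rw [sol]
  · intro a b
    rcases a with _ | a <;> rcases b with _ | b <;> simp only [sol, shz, shw, map_zero, add_zero,
      zero_add, smul_zero]

end Recursion

section Recursion

variable {q D : ℕ} {K ℓ : ℝ} {κ τ B : Hs (q + 1)} {IC : ℕ → ℕ → Hs (q + 2 * D)}

/-- Potential and flux at degree `a + b` depend only on smaller degrees and on the data on the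
edges, so both are compared together by strong induction. -/
lemma IsSol.unique {u u' : ℕ → ℕ → Hs (q + 2 * D)} {J J' : ℕ → ℕ → Hs (q + 1)}
    (h : IsSol q D K ℓ κ τ B IC u J) (h' : IsSol q D K ℓ κ τ B IC u' J') : u = u' := by
  suffices H : ∀ m, ∀ a b, a + b = m → u a b = u' a b ∧ J a b = J' a b from
    funext fun a => funext fun b => (H _ a b rfl).1
  intro m
  induction m using Nat.strong_induction_on with
  | _ m ih =>
    intro a b hab
    have hu : u a b = u' a b := by
      rcases a with _ | a
      · rw [h.ic _ _ (Or.inl rfl), h'.ic _ _ (Or.inl rfl)]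
      · rcases b with _ | b
        · rw [h.ic _ _ (Or.inr rfl), h'.ic _ _ (Or.inr rfl)]
        · rw [h.step, h'.step, (ih _ (by omega) a (b + 1) rfl).1,
            (ih _ (by omega) (a + 1) b rfl).1, (ih _ (by omega) a b rfl).2]
    refine ⟨hu, ?_⟩
    have hz : shz J a b = shz J' a b := by
      rcases a with _ | a
      · rfl
      · exact (ih _ (by omega) a b rfl).2
    have hw : shw J a b = shw J' a b := by
      rcases b with _ | b
      · rfl
      · exact (ih _ (by omega) a b rfl).2
    rw [h.flux a b, h'.flux a b, hz, hw]
    simp only [hu]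

/-- The bound of the flux by the potential. -/
def fluxC (q : ℕ) (ℓ₀ k₀ : ℝ) : ℝ := 1 + 2 / ℓ₀ + 2 * (algC (q + 1) * k₀)

/-- The factor `1 + a + b` is the price of the `θ`-derivative multiplied by the torsion. The
`s`-derivative is paid for by `q + 1 + 1 ≤ q + 2 * D`. -/
lemma norm_fluxY_le (hD : 1 ≤ D) {ℓ₀ k₀ M R : ℝ} (hℓ₀ : 0 < ℓ₀) (hℓ : ℓ₀ ≤ ℓ) (hk₀ : 0 ≤ k₀)
    (hτ : ‖τ‖ ≤ k₀) (hM : 0 ≤ M) (hR : 1 ≤ R) (hB : ‖B‖ ≤ M) {a b : ℕ} {u : Hs (q + 2 * D)}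
    (hu : ‖u‖ ≤ 2 * M * R ^ (a + b)) :
    ‖fluxY q D ℓ τ B a b u‖ ≤ fluxC q ℓ₀ k₀ * M * (1 + a + b) ^ 1 * R ^ (a + b) := by
  have hRm : 1 ≤ R ^ (a + b) := one_le_pow₀ hR
  have hc := algC_nonneg (q + 1)
  have h1 : ‖(if a + b = 0 then B else 0 : Hs (q + 1))‖ ≤ M * R ^ (a + b) := by
    have : ‖(if a + b = 0 then B else 0 : Hs (q + 1))‖ ≤ M := by
      split_ifs
      · exact hB
      · simpa using hM
    exact this.trans (le_mul_of_one_le_right hM hRm)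
  have h2 : ‖(ℓ : ℂ)⁻¹ • derivL 1 (q + 2 * D) (q + 1) u‖ ≤ 2 / ℓ₀ * M * R ^ (a + b) := by
    have := (multBound_deriv (r := q + 2 * D) (r' := q + 1) (i := 1) (by omega)).norm_le u
    rw [one_mul] at this
    rw [norm_smul, norm_inv, Complex.norm_real, Real.norm_of_nonneg (hℓ₀.le.trans hℓ)]
    calc _ ≤ ℓ₀⁻¹ * (2 * M * R ^ (a + b)) :=
          mul_le_mul (inv_anti₀ hℓ₀ hℓ) (this.trans hu) (norm_nonneg _) (by positivity)
      _ = _ := by ring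
  have h3 : ‖(Complex.I * ((a - b : ℤ) : ℂ)) • mulL (q + 1) τ (incl (q + 2 * D) (q + 1) u)‖ ≤
      (a + b) * (2 * (algC (q + 1) * k₀)) * M * R ^ (a + b) := by
    have hi := (multBound_one (r := q + 2 * D) (r' := q + 1) (by omega)).norm_le u
    rw [one_mul] at hi
    rw [norm_smul, norm_mul, Complex.norm_I, one_mul, Complex.norm_intCast]
    have hk : |((a - b : ℤ) : ℝ)| ≤ a + b := by
      push_cast
      rw [abs_le]
      have ha : (0 : ℝ) ≤ a := Nat.cast_nonneg a
      have hb : (0 : ℝ) ≤ b := Nat.cast_nonneg b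
      constructor <;> linarith
    have hm := norm_mulL_le τ (incl (q + 2 * D) (q + 1) u)
    calc _ ≤ (a + b) * (algC (q + 1) * k₀ * (2 * M * R ^ (a + b))) := by
          refine mul_le_mul hk (hm.trans ?_) (norm_nonneg _) (by positivity)
          have := hi.trans hu
          gcongr
      _ = _ := by ring
  unfold fluxY
  refine (norm_sub_le _ _).trans ((add_le_add ((norm_add_le _ _).trans (add_le_add h1 h2)) h3).trans ?_)
  rw [pow_one]
  unfold fluxC
  have ha : (0 : ℝ) ≤ a := Nat.cast_nonneg a
  have hb : (0 : ℝ) ≤ b := Nat.cast_nonneg b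
  have hx : 0 ≤ M * R ^ (a + b) := by positivity
  have hy : 0 ≤ 2 / ℓ₀ := by positivity
  have hz : 0 ≤ algC (q + 1) * k₀ := by positivity
  nlinarith [mul_nonneg (mul_nonneg hx hy) (add_nonneg ha hb), mul_nonneg (mul_nonneg hx hz) (add_nonneg ha hb),
    mul_nonneg hx (add_nonneg ha hb), mul_nonneg hx hz]

/-- The growth rate of the coefficients. -/
def growthC (q D : ℕ) (K ℓ₀ ℓ₁ k₀ : ℝ) : ℝ :=
  1 + 2 * (algC (q + 1) * k₀) + 2 * (ℓ₁ * resC D K ℓ₀ * algC (q + 1) * k₀) +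
    resC D K ℓ₀ * (1 + ℓ₁ * (algC (q + 1) * k₀)) * (2 * fluxC q ℓ₀ k₀)

/-- The bound does not depend on `a` and `b`. The prefactor `1 / (4(a+1)(b+1))` cancels both the
weights `(2a+1)(b+1) + (a+1)(2b+1)` of the curvature term and the factor `1 + a + b` of the flux.
The poloidal number in the last term is absorbed by the resolvent. -/
lemma norm_stepU_le (hD : 1 ≤ D) {ℓ₀ ℓ₁ k₀ A C : ℝ} (hK : 0 < K) (hℓ₀ : 0 < ℓ₀) (hℓ : ℓ₀ ≤ ℓ)
    (hℓ₁ : ℓ ≤ ℓ₁) (hk₀ : 0 ≤ k₀) (hκ : ‖κ‖ ≤ k₀) (hτ : ‖τ‖ ≤ k₀) (hA : 0 ≤ A) (hC : 0 ≤ C)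
    {a b : ℕ} {u₁ u₂ : Hs (q + 2 * D)} {J : Hs (q + 1)} (h₁ : ‖u₁‖ ≤ A) (h₂ : ‖u₂‖ ≤ A)
    (hJ : ‖J‖ ≤ C * (1 + a + b)) :
    ‖stepU q D K ℓ κ τ a b u₁ u₂ J‖ ≤ ℓ₁ * resC D K ℓ₀ * algC (q + 1) * k₀ * A +
      resC D K ℓ₀ * (1 + ℓ₁ * (algC (q + 1) * k₀)) * C := by
  have hl : 0 < ℓ := hℓ₀.trans_le hℓ
  have hl1 : 0 < ℓ₁ := hl.trans_le hℓ₁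
  have hr := resC_nonneg (D := D) (K := K) hℓ₀
  have hc := algC_nonneg (q + 1)
  have ha : (0 : ℝ) ≤ a := Nat.cast_nonneg a
  have hb : (0 : ℝ) ≤ b := Nat.cast_nonneg b
  have hi : ∀ u : Hs (q + 2 * D), ‖incl (q + 2 * D) (q + 1) u‖ ≤ ‖u‖ := fun u => by
    have := (multBound_one (r := q + 2 * D) (r' := q + 1) (by omega)).norm_le u
    rwa [one_mul] at this
  have n1 : ‖((2 * a + 1) * (b + 1) : ℂ)‖ = (2 * a + 1) * (b + 1) := by
    have : ((2 * a + 1) * (b + 1) : ℂ) = (((2 * a + 1) * (b + 1) : ℝ) : ℂ) := by push_cast; ring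
    rw [this, Complex.norm_real, Real.norm_of_nonneg (by positivity)]
  have n2 : ‖((a + 1) * (2 * b + 1) : ℂ)‖ = (a + 1) * (2 * b + 1) := by
    have : ((a + 1) * (2 * b + 1) : ℂ) = (((a + 1) * (2 * b + 1) : ℝ) : ℂ) := by push_cast; ring
    rw [this, Complex.norm_real, Real.norm_of_nonneg (by positivity)]
  have n3 : ‖(4 * (a + 1) * (b + 1) : ℂ)⁻¹‖ = (4 * (a + 1) * (b + 1) : ℝ)⁻¹ := by
    have : (4 * (a + 1) * (b + 1) : ℂ) = ((4 * (a + 1) * (b + 1) : ℝ) : ℂ) := by push_cast; ring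
    rw [this, norm_inv, Complex.norm_real, Real.norm_of_nonneg (by positivity)]
  have nℓ : ‖(ℓ : ℂ)‖ ≤ ℓ₁ := by rwa [Complex.norm_real, Real.norm_of_nonneg hl.le]
  set v : Hs (q + 1) := ((2 * a + 1) * (b + 1) : ℂ) • incl (q + 2 * D) (q + 1) u₁ +
          ((a + 1) * (2 * b + 1) : ℂ) • incl (q + 2 * D) (q + 1) u₂ with hv
  have hv' : ‖v‖ ≤ (4 * (a + 1) * (b + 1)) * A := by
    refine (norm_add_le _ _).trans ?_
    rw [norm_smul, norm_smul, n1, n2]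
    calc _ ≤ (2 * a + 1) * (b + 1) * A + (a + 1) * (2 * b + 1) * A := by
          gcongr
          · exact (hi _).trans h₁
          · exact (hi _).trans h₂
      _ ≤ _ := by nlinarith [mul_nonneg hA ha, mul_nonneg hA hb]
  have t1 : ‖(ℓ : ℂ) • resL q D K ℓ (a - b) (fun _ => 1) (mulL (q + 1) κ v)‖ ≤
      ℓ₁ * (resC D K ℓ₀ * (algC (q + 1) * k₀ * ((4 * (a + 1) * (b + 1)) * A))) := by
    rw [norm_smul]
    refine mul_le_mul nℓ ((norm_resL_le hD hK hℓ₀ hℓ (isNum_one _) _).trans ?_) (norm_nonneg _) hl1.le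
    refine mul_le_mul_of_nonneg_left ((norm_mulL_le _ _).trans ?_) hr
    gcongr
  have hJ' : ‖J‖ ≤ C * (4 * (a + 1) * (b + 1)) := by
    refine hJ.trans (mul_le_mul_of_nonneg_left ?_ hC)
    nlinarith [mul_nonneg ha hb]
  have t2 : ‖resL q D K ℓ (a - b) (fun j => Complex.I * j) J‖ ≤
      resC D K ℓ₀ * (C * (4 * (a + 1) * (b + 1))) :=
    (norm_resL_le hD hK hℓ₀ hℓ (isNum_j _) _).trans (mul_le_mul_of_nonneg_left hJ' hr)
  have t3 : ‖(ℓ : ℂ) • resL q D K ℓ (a - b) (fun _ => Complex.I * ((a - b : ℤ) : ℂ))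
      (mulL (q + 1) τ J)‖ ≤
      ℓ₁ * (resC D K ℓ₀ * (algC (q + 1) * k₀ * (C * (4 * (a + 1) * (b + 1))))) := by
    rw [norm_smul]
    refine mul_le_mul nℓ ((norm_resL_le hD hK hℓ₀ hℓ (isNum_k _) _).trans ?_) (norm_nonneg _) hl1.le
    refine mul_le_mul_of_nonneg_left ((norm_mulL_le _ _).trans ?_) hr
    gcongr
  unfold stepU
  rw [norm_smul, n3, inv_mul_le_iff₀ (by positivity)]
  refine (norm_add_le _ _).trans ((add_le_add ((norm_sub_le _ _).trans (add_le_add t1 t2)) t3).trans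
    (le_of_eq ?_))
  ring

/-- A bound for the potential up to a degree gives one for the flux up to the same degree, with the
same rate. The potential at `(a + 1, b + 1)` then uses earlier potentials one degree below and the
flux two degrees below, so the rate `R` enters once or twice. -/
lemma IsSol.bound (hD : 1 ≤ D) (hK : 0 < K) {u : ℕ → ℕ → Hs (q + 2 * D)} {J : ℕ → ℕ → Hs (q + 1)}
    (h : IsSol q D K ℓ κ τ B IC u J) {ℓ₀ ℓ₁ k₀ M R : ℝ} (hℓ₀ : 0 < ℓ₀) (hℓ : ℓ₀ ≤ ℓ)
    (hℓ₁ : ℓ ≤ ℓ₁) (hk₀ : 0 ≤ k₀) (hκ : ‖κ‖ ≤ k₀) (hτ : ‖τ‖ ≤ k₀) (hM : 0 ≤ M)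
    (hR : growthC q D K ℓ₀ ℓ₁ k₀ ≤ R) (hB : ‖B‖ ≤ M) (hIC : ∀ a b, ‖IC a b‖ ≤ M * R ^ (a + b)) :
    ∀ a b, ‖u a b‖ ≤ 2 * M * R ^ (a + b) ∧
      ‖J a b‖ ≤ 2 * (fluxC q ℓ₀ k₀ * M) * (1 + a + b) ^ 1 * R ^ (a + b) := by
  have hr := resC_nonneg (D := D) (K := K) hℓ₀
  have hc := algC_nonneg (q + 1)
  have hl1 : 0 < ℓ₁ := (hℓ₀.trans_le hℓ).trans_le hℓ₁
  have hf : 0 ≤ fluxC q ℓ₀ k₀ := by unfold fluxC; positivity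
  set c1 := algC (q + 1) * k₀ with hc1
  have hc10 : 0 ≤ c1 := by positivity
  set c2 := ℓ₁ * resC D K ℓ₀ * algC (q + 1) * k₀ with hc2
  have hc20 : 0 ≤ c2 := by positivity
  set c3 := resC D K ℓ₀ * (1 + ℓ₁ * c1) * (2 * fluxC q ℓ₀ k₀) with hc3
  have hc30 : 0 ≤ c3 := by positivity
  -- The summands of `growthC`: `2 * c1` serves the division by `h_s`, `2 * c2` the curvature term
  -- of the step, and `c3` the flux terms.
  have hR' : 1 + 2 * c1 + 2 * c2 + c3 ≤ R := hR
  have hR1 : 1 ≤ R := by linarith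
  have hR0 : 0 < R := by linarith
  have hκR : 2 * (algC (q + 1) * ‖κ‖) ≤ R := by
    have : algC (q + 1) * ‖κ‖ ≤ c1 := mul_le_mul_of_nonneg_left hκ hc
    linarith
  have Jb : ∀ n, (∀ a b, a + b ≤ n → ‖u a b‖ ≤ 2 * M * R ^ (a + b)) → ∀ a b, a + b ≤ n →
      ‖J a b‖ ≤ 2 * (fluxC q ℓ₀ k₀ * M) * (1 + a + b) ^ 1 * R ^ (a + b) := fun n hn =>
    h.flux.bound (by positivity) hR0 hκR
      (fun a b hab => norm_fluxY_le hD hℓ₀ hℓ hk₀ hτ hM hR1 hB (hn a b hab))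
  have Ub : ∀ n, ∀ a b, a + b ≤ n → ‖u a b‖ ≤ 2 * M * R ^ (a + b) := by
    have hic : ∀ a b, a = 0 ∨ b = 0 → ‖u a b‖ ≤ 2 * M * R ^ (a + b) := fun a b hab => by
      rw [h.ic a b hab]
      have := hIC a b
      have h0 : 0 ≤ M * R ^ (a + b) := by positivity
      linarith
    intro n
    induction n with
    | zero =>
      intro a b hab
      exact hic a b (by omega)
    | succ n ih =>
      intro a b hab
      rcases a with _ | a
      · exact hic _ _ (Or.inl rfl)
      rcases b with _ | b
      · exact hic _ _ (Or.inr rfl)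
      rw [h.step]
      have u1 := ih a (b + 1) (by omega)
      have u2 := ih (a + 1) b (by omega)
      rw [show a + 1 + b = a + (b + 1) by ring] at u2
      have j1 := Jb n ih a b (by omega)
      have := norm_stepU_le (K := K) (a := a) (b := b) hD hK hℓ₀ hℓ hℓ₁ hk₀ hκ hτ (A := 2 * M * R ^ (a + (b + 1)))
        (C := 2 * (fluxC q ℓ₀ k₀ * M) * R ^ (a + b)) (by positivity) (by positivity) u1 u2
        (j1.trans (le_of_eq (by rw [pow_one]; ring)))
      refine this.trans ?_
      have e1 : R ^ (a + (b + 1)) = R ^ (a + b) * R := by rw [← pow_succ]; rfl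
      have e2 : R ^ (a + 1 + (b + 1)) = R ^ (a + b) * R * R := by
        rw [← pow_succ, ← pow_succ]; congr 1; ring
      rw [e1, e2]
      have hP : 0 ≤ M * R ^ (a + b) := by positivity
      -- Both `2 * c2` and `c3` are at most `R`, and `1 ≤ R`. The two contributions are therefore at
      -- most `R ^ 2` each, and together they restore the constant `2 * M`.
      calc c2 * (2 * M * (R ^ (a + b) * R)) +
            resC D K ℓ₀ * (1 + ℓ₁ * c1) * (2 * (fluxC q ℓ₀ k₀ * M) * R ^ (a + b))
          = (2 * c2 * R + c3) * (M * R ^ (a + b)) := by rw [hc3]; ring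
        _ ≤ (R * R + R * R) * (M * R ^ (a + b)) := by
            gcongr
            · linarith
            · nlinarith
        _ = _ := by ring
  exact fun a b => ⟨Ub _ a b le_rfl, Jb _ (Ub _) a b le_rfl⟩

lemma tendsto_mulL {ι : Type*} {l : Filter ι} {r : ℕ} {f g : ι → Hs r} {f₀ g₀ : Hs r}
    (hf : Tendsto f l (𝓝 f₀)) (hg : Tendsto g l (𝓝 g₀)) :
    Tendsto (fun i => mulL r (f i) (g i)) l (𝓝 (mulL r f₀ g₀)) := by
  rw [tendsto_iff_norm_sub_tendsto_zero] at *
  have hc := algC_nonneg r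
  have hb : Tendsto (fun i => algC r * ‖f i - f₀‖ * ‖g i - g₀‖ + algC r * ‖f₀‖ * ‖g i - g₀‖ +
      algC r * ‖f i - f₀‖ * ‖g₀‖) l (𝓝 0) := by
    have := (((hf.const_mul (algC r)).mul hg).add (hg.const_mul (algC r * ‖f₀‖))).add
      ((hf.const_mul (algC r)).mul_const ‖g₀‖)
    simpa using this
  refine squeeze_zero (fun _ => norm_nonneg _) (fun i => ?_) hb
  have e : mulL r (f i) (g i) - mulL r f₀ g₀ = mulL r (f i - f₀) (g i - g₀) +
      mulL r f₀ (g i - g₀) + mulL r (f i - f₀) g₀ := by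
    simp only [map_sub, _root_.sub_apply]
    abel
  rw [e]
  exact (norm_add_le _ _).trans (add_le_add ((norm_add_le _ _).trans
    (add_le_add (norm_mulL_le _ _) (norm_mulL_le _ _))) (norm_mulL_le _ _))

/-- The coefficients depend continuously on the parameters. -/
lemma tendsto_sol {ι : Type*} {l : Filter ι} (hD : 1 ≤ D) (hK : 0 < K) {ℓ₀ : ℝ} (hℓ₀ : 0 < ℓ₀)
    {κ₀ τ₀ : Hs (q + 1)} {ℓ' : ι → ℝ} {κ' τ' : ι → Hs (q + 1)} (hℓ : Tendsto ℓ' l (𝓝 ℓ₀))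
    (hκ : Tendsto κ' l (𝓝 κ₀)) (hτ : Tendsto τ' l (𝓝 τ₀)) (a b : ℕ) :
    Tendsto (fun i => (sol q D K (ℓ' i) (κ' i) (τ' i) B IC a b).1) l
      (𝓝 (sol q D K ℓ₀ κ₀ τ₀ B IC a b).1) := by
  have hmul : ∀ {f g : ι → Hs (q + 1)} {f₀ g₀ : Hs (q + 1)}, Tendsto f l (𝓝 f₀) →
      Tendsto g l (𝓝 g₀) → Tendsto (fun i => mulL (q + 1) (f i) (g i)) l
        (𝓝 (mulL (q + 1) f₀ g₀)) := tendsto_mulL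
  have hL : ∀ {E F : Type} [NormedAddCommGroup E] [NormedSpace ℂ E] [NormedAddCommGroup F]
      [NormedSpace ℂ F] (T : E →L[ℂ] F) {f : ι → E} {f₀ : E}, Tendsto f l (𝓝 f₀) →
      Tendsto (fun i => T (f i)) l (𝓝 (T f₀)) := fun T _ _ hf =>
    (T.continuous.tendsto _).comp hf
  have hℓc : Tendsto (fun i => (ℓ' i : ℂ)) l (𝓝 (ℓ₀ : ℂ)) :=
    (Complex.continuous_ofReal.tendsto _).comp hℓ
  have hℓi : Tendsto (fun i => (ℓ' i : ℂ)⁻¹) l (𝓝 (ℓ₀ : ℂ)⁻¹) :=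
    hℓc.inv₀ (by exact_mod_cast hℓ₀.ne')
  have hstep : ∀ a b {u₁ u₂ : ι → Hs (q + 2 * D)} {J : ι → Hs (q + 1)} {v₁ v₂ : Hs (q + 2 * D)}
      {J₀ : Hs (q + 1)}, Tendsto u₁ l (𝓝 v₁) → Tendsto u₂ l (𝓝 v₂) → Tendsto J l (𝓝 J₀) →
      Tendsto (fun i => stepU q D K (ℓ' i) (κ' i) (τ' i) a b (u₁ i) (u₂ i) (J i)) l
        (𝓝 (stepU q D K ℓ₀ κ₀ τ₀ a b v₁ v₂ J₀)) := by
    intro a b u₁ u₂ J v₁ v₂ J₀ h1 h2 h3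
    unfold stepU
    refine Tendsto.const_smul (((hℓc.smul (tendsto_resL hD hK hℓ₀ (isNum_one _) hℓ (hmul hκ
      (((hL _ h1).const_smul _).add ((hL _ h2).const_smul _))))).sub
      (tendsto_resL hD hK hℓ₀ (isNum_j _) hℓ h3)).add
      (hℓc.smul (tendsto_resL hD hK hℓ₀ (isNum_k _) hℓ (hmul hτ h3)))) _
  have hflux : ∀ a b {u : ι → Hs (q + 2 * D)} {v : Hs (q + 2 * D)}, Tendsto u l (𝓝 v) →
      Tendsto (fun i => fluxY q D (ℓ' i) (τ' i) B a b (u i)) l (𝓝 (fluxY q D ℓ₀ τ₀ B a b v)) := by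
    intro a b u v h
    unfold fluxY
    exact (tendsto_const_nhds.add (hℓi.smul (hL _ h))).sub ((hmul hτ (hL _ h)).const_smul _)
  suffices H : ∀ m, ∀ a b, a + b = m →
      Tendsto (fun i => (sol q D K (ℓ' i) (κ' i) (τ' i) B IC a b).1) l
        (𝓝 (sol q D K ℓ₀ κ₀ τ₀ B IC a b).1) ∧
      Tendsto (fun i => (sol q D K (ℓ' i) (κ' i) (τ' i) B IC a b).2) l
        (𝓝 (sol q D K ℓ₀ κ₀ τ₀ B IC a b).2) from (H _ a b rfl).1
  intro m
  induction m using Nat.strong_induction_on with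
  | _ m ih =>
    intro a b hab
    rcases a with _ | a <;> rcases b with _ | b
    · simp only [sol]
      exact ⟨tendsto_const_nhds, hflux _ _ tendsto_const_nhds⟩
    · simp only [sol]
      exact ⟨tendsto_const_nhds, (hflux _ _ tendsto_const_nhds).add
        ((hmul hκ (ih _ (by omega) 0 b rfl).2).const_smul _)⟩
    · simp only [sol]
      exact ⟨tendsto_const_nhds, (hflux _ _ tendsto_const_nhds).add
        ((hmul hκ (ih _ (by omega) a 0 rfl).2).const_smul _)⟩
    · have i1 := ih _ (by omega) a (b + 1) rfl
      have i2 := ih _ (by omega) (a + 1) b rfl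
      have i3 := ih _ (by omega) a b rfl
      have hs := hstep a b i1.1 i2.1 i3.2
      rw [sol]
      simp only [sol.eq_4]
      exact ⟨hs, (hflux _ _ hs).add ((hmul hκ (i1.2.add i2.2)).const_smul _)⟩

end Recursion

end NearAxis
end

/-! ### Power series in z and its conjugate: convergence, uniqueness and differentiation -/

noncomputable section

namespace NearAxis

/-! ### Evaluation of power series in `z = ρ e^{iθ}` and its conjugate -/

/-- `∑ N_{ab} x^{a+b}` converges for `0 ≤ x < σ`. -/
def Maj (σ : ℝ) (N : ℕ → ℕ → ℝ) : Prop :=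
  ∀ x, 0 ≤ x → x < σ → Summable fun p : ℕ × ℕ => N p.1 p.2 * x ^ (p.1 + p.2)

lemma Maj.mono {σ : ℝ} {N N' : ℕ → ℕ → ℝ} (h : Maj σ N) (h0 : ∀ a b, 0 ≤ N' a b)
    (hN : ∀ a b, N' a b ≤ N a b) : Maj σ N' := fun x hx hxs =>
  Summable.of_nonneg_of_le (fun p => mul_nonneg (h0 _ _) (by positivity))
    (fun p => mul_le_mul_of_nonneg_right (hN _ _) (by positivity)) (h x hx hxs)

lemma Maj.of_le {σ σ' : ℝ} {N : ℕ → ℕ → ℝ} (h : Maj σ N) (hσ : σ' ≤ σ) : Maj σ' N :=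
  fun x hx hxs => h x hx (hxs.trans_le hσ)

lemma Maj.add {σ : ℝ} {N N' : ℕ → ℕ → ℝ} (h : Maj σ N) (h' : Maj σ N') :
    Maj σ (fun a b => N a b + N' a b) := fun x hx hxs => by
  simpa only [add_mul] using (h x hx hxs).add (h' x hx hxs)

lemma Maj.const_mul {σ : ℝ} {N : ℕ → ℕ → ℝ} (h : Maj σ N) (c : ℝ) :
    Maj σ (fun a b => c * N a b) := fun x hx hxs => by
  simpa only [mul_assoc] using (h x hx hxs).mul_left c

lemma exists_pow_mul_le {x y : ℝ} (hx : 0 ≤ x) (hxy : x < y) (p : ℕ) :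
    ∃ C, 0 ≤ C ∧ ∀ m : ℕ, (m : ℝ) ^ p * x ^ m ≤ C * y ^ m := by
  have hy : 0 < y := hx.trans_lt hxy
  have h := tendsto_pow_const_mul_const_pow_of_lt_one p (r := x / y) (by positivity)
    ((div_lt_one hy).2 hxy)
  obtain ⟨C, hC⟩ := h.bddAbove_range
  refine ⟨C, ?_, fun m => ?_⟩
  · refine le_trans ?_ (hC ⟨0, rfl⟩)
    positivity
  · have := hC ⟨m, rfl⟩
    simp only [div_pow] at this
    rw [← mul_div_assoc, div_le_iff₀ (by positivity)] at this
    exact this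

/-- The condition concerns all radii below `σ`, so a polynomial factor is absorbed by passing from
`x` to some `y` with `x < y < σ`. This is why derivatives in `ρ` and `θ` cost no radius. -/
lemma Maj.pow_mul {σ : ℝ} {N : ℕ → ℕ → ℝ} (h : Maj σ N) (h0 : ∀ a b, 0 ≤ N a b) (p : ℕ) :
    Maj σ (fun a b => ((a + b : ℕ) : ℝ) ^ p * N a b) := fun x hx hxs => by
  obtain ⟨y, hxy, hy⟩ := exists_between hxs
  obtain ⟨C, hC0, hC⟩ := exists_pow_mul_le hx hxy p
  refine Summable.of_nonneg_of_le (fun q => ?_) (fun q => ?_) ((h y (hx.trans hxy.le) hy).mul_left C)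
  · have := h0 q.1 q.2; positivity
  · calc _ = N q.1 q.2 * (((q.1 + q.2 : ℕ) : ℝ) ^ p * x ^ (q.1 + q.2)) := by ring
      _ ≤ N q.1 q.2 * (C * y ^ (q.1 + q.2)) := mul_le_mul_of_nonneg_left (hC _) (h0 _ _)
      _ = _ := by ring

lemma Maj.shz {σ : ℝ} {N : ℕ → ℕ → ℝ} (h : Maj σ N) : Maj σ (NearAxis.shz N) := fun x hx hxs => by
  have hi : Function.Injective (fun p : ℕ × ℕ => (p.1 + 1, p.2)) := fun p q e => by
    simp only [Prod.mk.injEq, add_left_inj] at e; exact Prod.ext e.1 e.2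
  rw [← hi.summable_iff]
  · refine ((h x hx hxs).mul_left x).congr fun p => ?_
    simp only [Function.comp, NearAxis.shz]; ring
  · rintro ⟨a, b⟩ hp
    rcases a with _ | a
    · simp [NearAxis.shz]
    · exact absurd ⟨(a, b), rfl⟩ hp

lemma Maj.shw {σ : ℝ} {N : ℕ → ℕ → ℝ} (h : Maj σ N) : Maj σ (NearAxis.shw N) := fun x hx hxs => by
  have hi : Function.Injective (fun p : ℕ × ℕ => (p.1, p.2 + 1)) := fun p q e => by
    simp only [Prod.mk.injEq, add_left_inj] at e; exact Prod.ext e.1 e.2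
  rw [← hi.summable_iff]
  · refine ((h x hx hxs).mul_left x).congr fun p => ?_
    simp only [Function.comp, NearAxis.shw]; ring
  · rintro ⟨a, b⟩ hp
    rcases b with _ | b
    · simp [NearAxis.shw]
    · exact absurd ⟨(a, b), rfl⟩ hp

/-- `∑_{ab} v_{ab} ρ^{a+b} e^{i(a-b)θ}`. -/
def PS (v : ℕ → ℕ → ℂ) (ρ θ : ℝ) : ℂ :=
  ∑' p : ℕ × ℕ, v p.1 p.2 * (ρ : ℂ) ^ (p.1 + p.2) * em ((p.1 : ℤ) - p.2) θ

lemma norm_PS_term (v : ℂ) (m : ℕ) (k : ℤ) (ρ θ : ℝ) :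
    ‖v * (ρ : ℂ) ^ m * em k θ‖ = ‖v‖ * |ρ| ^ m := by
  rw [norm_mul, norm_mul, norm_em, mul_one, norm_pow, Complex.norm_real, Real.norm_eq_abs]

/-- The power series with coefficients `v` converges absolutely for `|ρ| < σ`. -/
def AbsConv (σ : ℝ) (v : ℕ → ℕ → ℂ) : Prop := Maj σ (fun a b => ‖v a b‖)

namespace AbsConv

variable {σ : ℝ} {v w : ℕ → ℕ → ℂ}

lemma summable (h : AbsConv σ v) {ρ : ℝ} (hρ : |ρ| < σ) (θ : ℝ) :
    Summable fun p : ℕ × ℕ => v p.1 p.2 * (ρ : ℂ) ^ (p.1 + p.2) * em ((p.1 : ℤ) - p.2) θ := by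
  refine Summable.of_norm ?_
  simp only [norm_PS_term]
  exact h _ (abs_nonneg _) hρ

lemma add (h : AbsConv σ v) (h' : AbsConv σ w) : AbsConv σ (fun a b => v a b + w a b) :=
  (Maj.add h h').mono (fun _ _ => norm_nonneg _) fun _ _ => norm_add_le _ _

lemma const_mul (h : AbsConv σ v) (c : ℂ) : AbsConv σ (fun a b => c * v a b) :=
  (Maj.const_mul h ‖c‖).mono (fun _ _ => norm_nonneg _) fun _ _ => (norm_mul _ _).le

lemma shz (h : AbsConv σ v) : AbsConv σ (NearAxis.shz v) :=
  (Maj.shz h).mono (fun _ _ => norm_nonneg _) fun a b => by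
    rcases a with _ | a <;> simp [NearAxis.shz]

lemma shw (h : AbsConv σ v) : AbsConv σ (NearAxis.shw v) :=
  (Maj.shw h).mono (fun _ _ => norm_nonneg _) fun a b => by
    rcases b with _ | b <;> simp [NearAxis.shw]

/-- Multiplication by coefficients of polynomial growth. -/
lemma poly (h : AbsConv σ v) {c : ℕ → ℕ → ℂ} (p : ℕ) (hc : ∀ a b, ‖c a b‖ ≤ ((a + b : ℕ) : ℝ) ^ p) :
    AbsConv σ (fun a b => c a b * v a b) :=
  (Maj.pow_mul h (fun _ _ => norm_nonneg _) p).mono (fun _ _ => norm_nonneg _) fun a b => by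
    rw [norm_mul]; exact mul_le_mul_of_nonneg_right (hc a b) (norm_nonneg _)

end AbsConv

variable {σ : ℝ} {v w : ℕ → ℕ → ℂ}

lemma PS_add (hv : AbsConv σ v) (hw : AbsConv σ w) {ρ : ℝ} (hρ : |ρ| < σ) (θ : ℝ) :
    PS (fun a b => v a b + w a b) ρ θ = PS v ρ θ + PS w ρ θ := by
  unfold PS
  rw [← (hv.summable hρ θ).tsum_add (hw.summable hρ θ)]
  exact tsum_congr fun p => by ring

lemma PS_mul_left (c : ℂ) (v : ℕ → ℕ → ℂ) (ρ θ : ℝ) :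
    PS (fun a b => c * v a b) ρ θ = c * PS v ρ θ := by
  unfold PS
  rw [← tsum_mul_left]
  exact tsum_congr fun p => by ring

lemma PS_shz (v : ℕ → ℕ → ℂ) (ρ θ : ℝ) : PS (shz v) ρ θ = ρ * em 1 θ * PS v ρ θ := by
  have hi : Function.Injective (fun p : ℕ × ℕ => (p.1 + 1, p.2)) := fun p q e => by
    simp only [Prod.mk.injEq, add_left_inj] at e; exact Prod.ext e.1 e.2
  unfold PS
  rw [← tsum_mul_left, ← hi.tsum_eq]
  · refine tsum_congr fun p => ?_
    have : (((p.1 + 1 : ℕ) : ℤ) - (p.2 : ℤ)) = 1 + ((p.1 : ℤ) - p.2) := by push_cast; ring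
    simp only [shz]
    rw [this, em_add, show p.1 + 1 + p.2 = p.1 + p.2 + 1 by ring, pow_succ]
    ring
  · rintro ⟨a, b⟩ hp
    rcases a with _ | a
    · simp [shz] at hp
    · exact ⟨(a, b), rfl⟩

lemma PS_shw (v : ℕ → ℕ → ℂ) (ρ θ : ℝ) : PS (shw v) ρ θ = ρ * em (-1) θ * PS v ρ θ := by
  have hi : Function.Injective (fun p : ℕ × ℕ => (p.1, p.2 + 1)) := fun p q e => by
    simp only [Prod.mk.injEq, add_left_inj] at e; exact Prod.ext e.1 e.2
  unfold PS
  rw [← tsum_mul_left, ← hi.tsum_eq]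
  · refine tsum_congr fun p => ?_
    have : ((p.1 : ℤ) - ((p.2 + 1 : ℕ) : ℤ)) = -1 + ((p.1 : ℤ) - p.2) := by push_cast; ring
    simp only [shw]
    rw [this, em_add, show p.1 + (p.2 + 1) = p.1 + p.2 + 1 by ring, pow_succ]
    ring
  · rintro ⟨a, b⟩ hp
    rcases b with _ | b
    · simp [shw] at hp
    · exact ⟨(a, b), rfl⟩

lemma em_one_add (θ : ℝ) : em 1 θ + em (-1) θ = ((2 * Real.cos θ : ℝ) : ℂ) := by
  rw [em_eq, em_eq]; push_cast
  rw [Complex.cos]; ring_nf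

lemma em_one_sub (θ : ℝ) : em 1 θ - em (-1) θ = ((2 * Real.sin θ : ℝ) : ℂ) * Complex.I := by
  rw [em_eq, em_eq]; push_cast
  rw [Complex.sin]; ring_nf; rw [Complex.I_sq]; ring_nf

/-- A power series that vanishes for all small `ρ > 0` has zero coefficients. -/
lemma eq_zero_of_hasSum_pow {c : ℕ → ℂ} {σ : ℝ} (hσ : 0 < σ)
    (hs : ∀ x, 0 ≤ x → x < σ → Summable fun m => ‖c m‖ * x ^ m)
    (h : ∀ x, 0 < x → x < σ → ∑' m, c m * (x : ℂ) ^ m = 0) : ∀ m, c m = 0 := by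
  have hsm : ∀ n x, 0 ≤ x → x < σ → Summable fun m => ‖c (n + m)‖ * x ^ m := by
    intro n x hx hxs
    rcases hx.eq_or_lt with rfl | hx
    · refine summable_of_ne_finset_zero (s := {0}) fun m hm => ?_
      rw [zero_pow (by simpa using hm), mul_zero]
    · have := ((summable_nat_add_iff n).2 (hs x hx.le hxs)).mul_left ((x ^ n)⁻¹)
      refine this.congr fun m => ?_
      rw [add_comm m n, pow_add]; field_simp
  have hsc : ∀ n x, 0 ≤ x → x < σ → Summable fun m => c (n + m) * (x : ℂ) ^ m := by
    intro n x hx hxs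
    refine Summable.of_norm ((hsm n x hx hxs).congr fun m => ?_)
    rw [norm_mul, norm_pow, Complex.norm_real, Real.norm_of_nonneg hx]
  -- The leading coefficient is the limit of the sum as `x` decreases to `0`. The vanishing is known
  -- only for `x > 0`, so the limit is one-sided. Dividing by `x` then exposes the next coefficient.
  have zero_of : ∀ n, (∀ x, 0 < x → x < σ → ∑' m, c (n + m) * (x : ℂ) ^ m = 0) → c n = 0 := by
    intro n hn
    have hσ2 : σ / 2 < σ := half_lt_self hσ
    have hc : ContinuousOn (fun x : ℝ => ∑' m, c (n + m) * (x : ℂ) ^ m) (Icc 0 (σ / 2)) := by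
      refine continuousOn_tsum (fun m => by fun_prop) (hsm n _ (half_pos hσ).le hσ2) ?_
      intro m x hx
      rw [norm_mul, norm_pow, Complex.norm_real, Real.norm_of_nonneg hx.1]
      exact mul_le_mul_of_nonneg_left (pow_le_pow_left₀ hx.1 hx.2 _) (norm_nonneg _)
    have h0 := (hc 0 ⟨le_rfl, (half_pos hσ).le⟩).mono (Ioc_subset_Icc_self (a := 0) (b := σ / 2))
    have e0 : ∑' m, c (n + m) * (((0 : ℝ) : ℂ)) ^ m = c n := by
      rw [tsum_eq_single 0]
      · simp
      · intro m hm; simp [hm]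
    have ht : Tendsto (fun x : ℝ => ∑' m, c (n + m) * (x : ℂ) ^ m) (𝓝[Ioc 0 (σ / 2)] 0)
        (𝓝 (c n)) := e0 ▸ h0
    have hz : Tendsto (fun x : ℝ => ∑' m, c (n + m) * (x : ℂ) ^ m) (𝓝[Ioc 0 (σ / 2)] 0)
        (𝓝 0) := by
      refine (tendsto_const_nhds (x := (0 : ℂ))).congr' ?_
      filter_upwards [self_mem_nhdsWithin] with x hx
      exact (hn x hx.1 (hx.2.trans_lt hσ2)).symm
    have : (𝓝[Ioc 0 (σ / 2)] (0 : ℝ)).NeBot := by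
      rw [nhdsWithin_Ioc_eq_nhdsGT (half_pos hσ)]; infer_instance
    exact tendsto_nhds_unique ht hz
  have key : ∀ n, ∀ x, 0 < x → x < σ → ∑' m, c (n + m) * (x : ℂ) ^ m = 0 := by
    intro n
    induction n with
    | zero => intro x hx hxs; simpa using h x hx hxs
    | succ n ih =>
      intro x hx hxs
      have h1 := ih x hx hxs
      rw [(hsc n x hx.le hxs).tsum_eq_zero_add] at h1
      simp only [add_zero, zero_of n ih, zero_mul, zero_add] at h1
      have e : ∑' m, c (n + (m + 1)) * (x : ℂ) ^ (m + 1) =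
          x * ∑' m, c (n + 1 + m) * (x : ℂ) ^ m := by
        rw [← tsum_mul_left]
        refine tsum_congr fun m => ?_
        rw [show n + 1 + m = n + (m + 1) by ring, pow_succ]; ring
      rw [e] at h1
      exact (mul_eq_zero.1 h1).resolve_left (by exact_mod_cast hx.ne')
  exact fun m => zero_of m (key m)

lemma sum_antidiagonal_em_eq_zero {c : ℕ → ℕ → ℂ} {m : ℕ}
    (h : ∀ θ, ∑ p ∈ Finset.HasAntidiagonal.antidiagonal m, c p.1 p.2 * em ((p.1 : ℤ) - p.2) θ = 0) {a b : ℕ}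
    (hab : a + b = m) : c a b = 0 := by
  have hi : ∫ θ, (∑ p ∈ Finset.HasAntidiagonal.antidiagonal m, c p.1 p.2 * em ((p.1 : ℤ) - p.2) θ) *
      em ((b : ℤ) - a) θ ∂circleMeasure = 0 := by simp [h]
  have e : ∀ θ, (∑ p ∈ Finset.HasAntidiagonal.antidiagonal m, c p.1 p.2 * em ((p.1 : ℤ) - p.2) θ) *
      em ((b : ℤ) - a) θ =
      ∑ p ∈ Finset.HasAntidiagonal.antidiagonal m, c p.1 p.2 * em (((p.1 : ℤ) - p.2) + ((b : ℤ) - a)) θ := fun θ => by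
    rw [Finset.sum_mul]
    exact Finset.sum_congr rfl fun p _ => by rw [em_add]; ring
  simp only [e] at hi
  rw [integral_finsetSum] at hi
  · simp only [integral_const_mul, integral_em] at hi
    rw [Finset.sum_eq_single (a, b)] at hi
    · rw [if_pos (by ring)] at hi
      refine (mul_eq_zero.1 hi).resolve_right ?_
      have := Real.pi_pos
      exact_mod_cast (by positivity : (2 * Real.pi : ℝ) ≠ 0)
    · rintro ⟨a', b'⟩ hp hne
      have h1 : a' + b' = m := Finset.HasAntidiagonal.mem_antidiagonal.1 hp
      rw [if_neg, mul_zero]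
      intro h2
      exact hne (Prod.ext (by simp only; omega) (by simp only; omega))
    · intro hn
      exact absurd (Finset.HasAntidiagonal.mem_antidiagonal.2 hab) hn
  · intro p _
    exact (memLp_one_iff_integrable.1 (memLp_of_continuous_circle (continuous_em _))).const_mul _

/-- Uniqueness of the coefficients. -/
lemma eq_zero_of_PS_eq_zero (hσ : 0 < σ) (hv : AbsConv σ v)
    (h : ∀ ρ θ, 0 < ρ → ρ < σ → PS v ρ θ = 0) (a b : ℕ) : v a b = 0 := by
  -- At fixed angle the double series, grouped by the degree `m = a + b`, is a power series in `ρ`.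
  -- Within one degree the modes `a - b` are distinct, so orthogonality separates them afterwards.
  have hS : ∀ θ m, ∑ p ∈ Finset.HasAntidiagonal.antidiagonal m, v p.1 p.2 * em ((p.1 : ℤ) - p.2) θ = 0 := by
    intro θ
    have hsig : ∀ x, 0 ≤ x → x < σ → Summable fun m : ℕ =>
        ∑ p ∈ Finset.HasAntidiagonal.antidiagonal m, ‖v p.1 p.2‖ * x ^ (p.1 + p.2) :=
      fun x hx hxs => by
        refine (((Finset.HasAntidiagonal.sigmaAntidiagonalEquivProd (A := ℕ)).summable_iff.2
          (hv x hx hxs)).sigma).congr fun m => ?_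
        rw [tsum_fintype]
        exact Finset.sum_coe_sort (Finset.HasAntidiagonal.antidiagonal m)
          (fun p => ‖v p.1 p.2‖ * x ^ (p.1 + p.2))
    refine eq_zero_of_hasSum_pow hσ (fun x hx hxs => ?_) (fun x hx hxs => ?_)
    · refine Summable.of_nonneg_of_le (fun m => by positivity) (fun m => ?_) (hsig x hx hxs)
      calc _ ≤ (∑ p ∈ Finset.HasAntidiagonal.antidiagonal m, ‖v p.1 p.2‖) * x ^ m := by
            gcongr
            refine (norm_sum_le _ _).trans (Finset.sum_le_sum fun p _ => ?_)
            rw [norm_mul, norm_em, mul_one]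
        _ = _ := by
            rw [Finset.sum_mul]
            exact Finset.sum_congr rfl fun p hp => by rw [Finset.HasAntidiagonal.mem_antidiagonal.1 hp]
    · have hsum := hv.summable (ρ := x) (by rwa [abs_of_pos hx]) θ
      rw [← h x θ hx hxs]
      unfold PS
      rw [← (Finset.HasAntidiagonal.sigmaAntidiagonalEquivProd (A := ℕ)).tsum_eq]
      refine Eq.trans (tsum_congr fun m => ?_) (Summable.tsum_sigma
        ((Finset.HasAntidiagonal.sigmaAntidiagonalEquivProd (A := ℕ)).summable_iff.2 hsum)).symm
      rw [tsum_fintype, Finset.sum_mul]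
      rw [← Finset.sum_coe_sort]
      refine Finset.sum_congr rfl fun p _ => ?_
      have e : p.1.1 + p.1.2 = m := Finset.HasAntidiagonal.mem_antidiagonal.1 p.2
      change _ = v p.1.1 p.1.2 * (x : ℂ) ^ (p.1.1 + p.1.2) * em ((p.1.1 : ℤ) - p.1.2) θ
      rw [e]
      ring
  exact sum_antidiagonal_em_eq_zero (fun θ => hS θ (a + b)) rfl

/-! ### Power series whose coefficients are functions of `s` -/

/-- Coefficient functions with `r` continuous derivatives that are bounded by convergent power
series. -/
def FnFam (σ : ℝ) : ℕ → (ℕ → ℕ → ℝ → ℂ) → Prop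
  | 0, v => (∀ a b, Continuous (v a b)) ∧ ∃ N, Maj σ N ∧ ∀ a b s, ‖v a b s‖ ≤ N a b
  | r + 1, v => ((∀ a b, Continuous (v a b)) ∧ ∃ N, Maj σ N ∧ ∀ a b s, ‖v a b s‖ ≤ N a b) ∧
      ∃ dv, (∀ a b s, HasDerivAt (v a b) (dv a b s) s) ∧ FnFam σ r dv

/-- The sum of the power series with coefficients `v_{ab}(s)`. -/
def GS (v : ℕ → ℕ → ℝ → ℂ) (p : ℝ × ℝ × ℝ) : ℂ := PS (fun a b => v a b p.2.2) p.1 p.2.1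

namespace FnFam

variable {r : ℕ} {v : ℕ → ℕ → ℝ → ℂ}

lemma zero (h : FnFam σ r v) : FnFam σ 0 v := by
  cases r with
  | zero => exact h
  | succ r => exact h.1

lemma pred (h : FnFam σ (r + 1) v) : FnFam σ r v := by
  induction r generalizing v with
  | zero => exact h.1
  | succ r ih =>
    obtain ⟨h0, v', hv', h'⟩ := h
    exact ⟨h0, v', hv', ih h'⟩

lemma absConv (h : FnFam σ r v) (s : ℝ) : AbsConv σ (fun a b => v a b s) := by
  obtain ⟨-, N, hN, hv⟩ := h.zero
  exact hN.mono (fun _ _ => norm_nonneg _) fun a b => hv a b s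

lemma poly (h : FnFam σ r v) {c : ℕ → ℕ → ℂ} (p : ℕ) (hc : ∀ a b, ‖c a b‖ ≤ ((a + b : ℕ) : ℝ) ^ p) :
    FnFam σ r (fun a b s => c a b * v a b s) := by
  have base : ∀ {v : ℕ → ℕ → ℝ → ℂ}, FnFam σ 0 v → FnFam σ 0 (fun a b s => c a b * v a b s) := by
    rintro v ⟨hc', N, hN, hv⟩
    have h0 : ∀ a b, 0 ≤ N a b := fun a b => (norm_nonneg _).trans (hv a b 0)
    refine ⟨fun a b => continuous_const.mul (hc' a b), _, hN.pow_mul h0 p, fun a b s => ?_⟩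
    rw [norm_mul]
    exact mul_le_mul (hc a b) (hv a b s) (norm_nonneg _) (by positivity)
  induction r generalizing v with
  | zero => exact base h
  | succ r ih =>
    obtain ⟨h0, v', hv', h'⟩ := h
    exact ⟨base h0, _, fun a b s => (hv' a b s).const_mul (c a b), ih h'⟩

/-- Freezing `s` in the coefficients. Derivatives in `ρ` and `θ` are taken through this family, so
that they require no differentiability in `s`. -/
lemma const {w : ℕ → ℕ → ℂ} (h : AbsConv σ w) (r : ℕ) : FnFam σ r (fun a b _ => w a b) := by
  induction r generalizing w with
  | zero => exact ⟨fun _ _ => continuous_const, _, h, fun _ _ _ => le_rfl⟩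
  | succ r ih =>
    refine ⟨⟨fun _ _ => continuous_const, _, h, fun _ _ _ => le_rfl⟩, fun _ _ _ => 0,
      fun a b s => hasDerivAt_const _ _, ih (w := fun _ _ => 0) ?_⟩
    intro x _ _
    simp

end FnFam

lemma norm_add_le_natCast (a b : ℕ) : ‖((a + b : ℕ) : ℂ)‖ ≤ ((a + b : ℕ) : ℝ) ^ 1 := by
  rw [pow_one, Complex.norm_natCast]

lemma norm_sub_le_natCast (a b : ℕ) :
    ‖Complex.I * (((a : ℤ) - b : ℤ) : ℂ)‖ ≤ ((a + b : ℕ) : ℝ) ^ 1 := by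
  rw [pow_one, norm_mul, Complex.norm_I, one_mul, Complex.norm_intCast]
  push_cast
  rw [abs_le]
  have ha : (0 : ℝ) ≤ a := Nat.cast_nonneg a
  have hb : (0 : ℝ) ≤ b := Nat.cast_nonneg b
  constructor <;> linarith

lemma GS_continuousOn {v : ℕ → ℕ → ℝ → ℂ} (h : FnFam σ 0 v) :
    ContinuousOn (GS v) {p : ℝ × ℝ × ℝ | |p.1| < σ} := by
  obtain ⟨hc, N, hN, hv⟩ := h
  intro p hp
  obtain ⟨y, hy1, hy2⟩ := exists_between (show |p.1| < σ from hp)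
  have hy0 : 0 ≤ y := (abs_nonneg _).trans hy1.le
  have ho : IsOpen {p : ℝ × ℝ × ℝ | |p.1| < y} := isOpen_lt (by fun_prop) continuous_const
  refine ContinuousAt.continuousWithinAt ?_
  have : ContinuousOn (GS v) {p : ℝ × ℝ × ℝ | |p.1| < y} := by
    unfold GS PS
    refine continuousOn_tsum (fun q => ?_) (hN y hy0 hy2) ?_
    · have := hc q.1 q.2
      have h2 := continuous_em ((q.1 : ℤ) - q.2)
      fun_prop
    · intro q x hx
      rw [norm_PS_term]
      exact mul_le_mul (hv _ _ _) (pow_le_pow_left₀ (abs_nonneg _) (le_of_lt hx) _) (by positivity)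
        ((norm_nonneg _).trans (hv _ _ 0))
  exact this.continuousAt (ho.mem_nhds hy1)

/-- The projections of `ℝ × ℝ × ℝ`. -/
def prj0 : ℝ × ℝ × ℝ →L[ℝ] ℝ := ContinuousLinearMap.fst ℝ ℝ (ℝ × ℝ)
/-- The projections of `ℝ × ℝ × ℝ`. -/
def prj1 : ℝ × ℝ × ℝ →L[ℝ] ℝ :=
  (ContinuousLinearMap.fst ℝ ℝ ℝ).comp (ContinuousLinearMap.snd ℝ ℝ (ℝ × ℝ))
/-- The projections of `ℝ × ℝ × ℝ`. -/
def prj2 : ℝ × ℝ × ℝ →L[ℝ] ℝ :=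
  (ContinuousLinearMap.snd ℝ ℝ ℝ).comp (ContinuousLinearMap.snd ℝ ℝ (ℝ × ℝ))

lemma norm_prj0_le : ‖prj0‖ ≤ 1 := ContinuousLinearMap.norm_fst_le ℝ ℝ (ℝ × ℝ)
lemma norm_prj1_le : ‖prj1‖ ≤ 1 := by
  refine (ContinuousLinearMap.opNorm_comp_le _ _).trans (mul_le_one₀ ?_ (norm_nonneg _) ?_)
  · exact ContinuousLinearMap.norm_fst_le ℝ ℝ ℝ
  · exact ContinuousLinearMap.norm_snd_le ℝ ℝ (ℝ × ℝ)
lemma norm_prj2_le : ‖prj2‖ ≤ 1 := by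
  refine (ContinuousLinearMap.opNorm_comp_le _ _).trans (mul_le_one₀ ?_ (norm_nonneg _) ?_)
  · exact ContinuousLinearMap.norm_snd_le ℝ ℝ ℝ
  · exact ContinuousLinearMap.norm_snd_le ℝ ℝ (ℝ × ℝ)

/-- `ρ ∂_ρ` on coefficients. -/
def radial (v : ℕ → ℕ → ℝ → ℂ) : ℕ → ℕ → ℝ → ℂ := fun a b s => ((a + b : ℕ) : ℂ) * v a b s
/-- `∂_θ` on coefficients. -/
def angular (v : ℕ → ℕ → ℝ → ℂ) : ℕ → ℕ → ℝ → ℂ :=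
  fun a b s => Complex.I * (((a : ℤ) - b : ℤ) : ℂ) * v a b s

lemma FnFam.radial {r : ℕ} {v : ℕ → ℕ → ℝ → ℂ} (h : FnFam σ r v) :
    FnFam σ r (NearAxis.radial v) := h.poly 1 norm_add_le_natCast
lemma FnFam.angular {r : ℕ} {v : ℕ → ℕ → ℝ → ℂ} (h : FnFam σ r v) :
    FnFam σ r (NearAxis.angular v) := h.poly 1 norm_sub_le_natCast

lemma smulRight_tsum {ι : Type*} (L : ℝ × ℝ × ℝ →L[ℝ] ℝ) {f : ι → ℂ} (hf : Summable f) :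
    HasSum (fun i => L.smulRight (f i)) (L.smulRight (∑' i, f i)) :=
  (ContinuousLinearMap.smulRightL ℝ (ℝ × ℝ × ℝ) ℂ L).hasSum hf.hasSum

/-- Termwise differentiation on a shell `x < ρ < y`. Writing the radial derivative as `ρ⁻¹` times `ρ
∂_ρ` keeps all exponents, so that the partial derivatives are series of the same kind and the
argument can be iterated. The inner radius `x` bounds `ρ⁻¹`. -/
lemma GS_hasFDerivAt {v v' : ℕ → ℕ → ℝ → ℂ} (h : FnFam σ 0 v) (h' : FnFam σ 0 v')
    (hd : ∀ a b s, HasDerivAt (v a b) (v' a b s) s) {p : ℝ × ℝ × ℝ} (hp0 : 0 < p.1) (hp : p.1 < σ) :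
    HasFDerivAt (GS v) (prj0.smulRight ((p.1 : ℂ)⁻¹ * GS (radial v) p) +
      prj1.smulRight (GS (angular v) p) + prj2.smulRight (GS v' p)) p := by
  have hr := h.radial
  have ha := h.angular
  obtain ⟨y, hy1, hy2⟩ := exists_between hp
  obtain ⟨x, hx0, hx1⟩ := exists_between hp0
  have hy0 : 0 < y := hp0.trans hy1
  obtain ⟨hc, N, hN, hv⟩ := h
  obtain ⟨hc', N', hN', hv'⟩ := h'
  have hN0 : ∀ a b, 0 ≤ N a b := fun a b => (norm_nonneg _).trans (hv a b 0)
  have hN0' : ∀ a b, 0 ≤ N' a b := fun a b => (norm_nonneg _).trans (hv' a b 0)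
  set S : Set (ℝ × ℝ × ℝ) := Ioo x y ×ˢ univ with hS
  have hSo : IsOpen S := isOpen_Ioo.prod isOpen_univ
  have hSc : IsPreconnected S := isPreconnected_Ioo.prod isPreconnected_univ
  have hpS : p ∈ S := ⟨⟨hx1, hy1⟩, mem_univ _⟩
  let f : ℕ × ℕ → ℝ × ℝ × ℝ → ℂ := fun q p =>
    v q.1 q.2 p.2.2 * (p.1 : ℂ) ^ (q.1 + q.2) * em ((q.1 : ℤ) - q.2) p.2.1
  let t : (ℕ → ℕ → ℝ → ℂ) → ℕ × ℕ → ℝ × ℝ × ℝ → ℂ := fun v q p =>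
    v q.1 q.2 p.2.2 * (p.1 : ℂ) ^ (q.1 + q.2) * em ((q.1 : ℤ) - q.2) p.2.1
  let f' : ℕ × ℕ → ℝ × ℝ × ℝ → (ℝ × ℝ × ℝ →L[ℝ] ℂ) := fun q p =>
    prj0.smulRight ((p.1 : ℂ)⁻¹ * t (radial v) q p) + prj1.smulRight (t (angular v) q p) +
      prj2.smulRight (t v' q p)
  have hf : ∀ q p, p ∈ S → HasFDerivAt (f q) (f' q p) p := by
    rintro ⟨a, b⟩ p hpS
    have hp0 : p.1 ≠ 0 := (hx0.trans hpS.1.1).ne'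
    have d1 : HasFDerivAt (fun p : ℝ × ℝ × ℝ => v a b p.2.2) (prj2.smulRight (v' a b p.2.2)) p := by
      have := (hd a b p.2.2).hasFDerivAt.comp p prj2.hasFDerivAt
      refine this.congr_fderiv ?_
      ext <;> simp
    have d2 : HasFDerivAt (fun p : ℝ × ℝ × ℝ => (p.1 : ℂ) ^ (a + b))
        (prj0.smulRight ((p.1 : ℂ)⁻¹ * (((a + b : ℕ) : ℂ) * (p.1 : ℂ) ^ (a + b)))) p := by
      have e : HasDerivAt (fun x : ℝ => (x : ℂ) ^ (a + b))
          ((p.1 : ℂ)⁻¹ * (((a + b : ℕ) : ℂ) * (p.1 : ℂ) ^ (a + b))) p.1 := by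
        have := (hasDerivAt_pow (a + b) (p.1 : ℂ)).comp_ofReal
        convert this using 1
        have hc : (p.1 : ℂ) ≠ 0 := by exact_mod_cast hp0
        rcases Nat.eq_zero_or_pos (a + b) with h0 | h0
        · simp [h0]
        · obtain ⟨m, hm⟩ := Nat.exists_eq_succ_of_ne_zero h0.ne'
          rw [hm, Nat.succ_eq_add_one, Nat.add_sub_cancel, pow_succ]
          field_simp
      have := e.hasFDerivAt.comp p prj0.hasFDerivAt
      refine this.congr_fderiv ?_
      ext <;> simp
    have d3 : HasFDerivAt (fun p : ℝ × ℝ × ℝ => em ((a : ℤ) - b) p.2.1)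
        (prj1.smulRight (Complex.I * (((a : ℤ) - b : ℤ) : ℂ) * em ((a : ℤ) - b) p.2.1)) p := by
      have := (hasDerivAt_em ((a : ℤ) - b) p.2.1).hasFDerivAt.comp p prj1.hasFDerivAt
      refine this.congr_fderiv ?_
      ext <;> simp
    refine ((d1.mul d2).mul d3).congr_fderiv ?_
    ext <;> simp [f', t, radial, angular, prj0, prj1, prj2] <;> ring
  have hu : Summable fun q : ℕ × ℕ => x⁻¹ * (((q.1 + q.2 : ℕ) : ℝ) ^ 1 * N q.1 q.2 * y ^ (q.1 + q.2)) +
      ((q.1 + q.2 : ℕ) : ℝ) ^ 1 * N q.1 q.2 * y ^ (q.1 + q.2) + N' q.1 q.2 * y ^ (q.1 + q.2) :=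
    ((((hN.pow_mul hN0 1) y hy0.le hy2).mul_left x⁻¹).add ((hN.pow_mul hN0 1) y hy0.le hy2)).add
      (hN' y hy0.le hy2)
  have hf' : ∀ q p, p ∈ S → ‖f' q p‖ ≤ x⁻¹ * (((q.1 + q.2 : ℕ) : ℝ) ^ 1 * N q.1 q.2 * y ^ (q.1 + q.2)) +
      ((q.1 + q.2 : ℕ) : ℝ) ^ 1 * N q.1 q.2 * y ^ (q.1 + q.2) + N' q.1 q.2 * y ^ (q.1 + q.2) := by
    rintro ⟨a, b⟩ p hpS
    have hp0 : 0 < p.1 := hx0.trans hpS.1.1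
    have hpow : |p.1| ^ (a + b) ≤ y ^ (a + b) :=
      pow_le_pow_left₀ (abs_nonneg _) (by rw [abs_of_pos hp0]; exact hpS.1.2.le) _
    have b1 : ∀ {w : ℂ} {C : ℝ}, ‖w‖ ≤ C →
        ‖w * (p.1 : ℂ) ^ (a + b) * em ((a : ℤ) - b) p.2.1‖ ≤ C * y ^ (a + b) := fun {w C} hw => by
      rw [norm_PS_term]
      exact mul_le_mul hw hpow (by positivity) ((norm_nonneg _).trans hw)
    have br : ‖radial v a b p.2.2‖ ≤ ((a + b : ℕ) : ℝ) ^ 1 * N a b := by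
      unfold radial
      rw [norm_mul]
      exact mul_le_mul (norm_add_le_natCast a b) (hv _ _ _) (norm_nonneg _) (by positivity)
    have ba : ‖angular v a b p.2.2‖ ≤ ((a + b : ℕ) : ℝ) ^ 1 * N a b := by
      unfold angular
      rw [norm_mul]
      exact mul_le_mul (norm_sub_le_natCast a b) (hv _ _ _) (norm_nonneg _) (by positivity)
    have sm : ∀ {L : ℝ × ℝ × ℝ →L[ℝ] ℝ} {c : ℂ} {C : ℝ}, ‖L‖ ≤ 1 → ‖c‖ ≤ C → ‖L.smulRight c‖ ≤ C :=
      fun {L c C} hL hc => by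
        rw [ContinuousLinearMap.norm_smulRight_apply]
        exact (mul_le_of_le_one_left (norm_nonneg _) hL).trans hc
    refine (norm_add_le _ _).trans (add_le_add ((norm_add_le _ _).trans (add_le_add ?_ ?_)) ?_)
    · refine sm norm_prj0_le ?_
      rw [norm_mul, norm_inv, Complex.norm_real, Real.norm_of_nonneg hp0.le]
      exact mul_le_mul (inv_anti₀ hx0 hpS.1.1.le) (b1 br) (norm_nonneg _) (by positivity)
    · exact sm norm_prj1_le (b1 ba)
    · exact sm norm_prj2_le (b1 (hv' _ _ _))
  have hpa : |p.1| < σ := by rwa [abs_of_pos hp0]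
  have hv0 : FnFam σ 0 v := ⟨hc, N, hN, hv⟩
  have hv0' : FnFam σ 0 v' := ⟨hc', N', hN', hv'⟩
  have key := hasFDerivAt_tsum_of_isPreconnected hu hSo hSc hf hf' hpS
    ((hv0.absConv p.2.2).summable hpa p.2.1) hpS
  refine key.congr_fderiv ?_
  have s1 := smulRight_tsum prj0 (((hr.absConv p.2.2).summable hpa p.2.1).mul_left ((p.1 : ℂ)⁻¹))
  have s2 := smulRight_tsum prj1 ((ha.absConv p.2.2).summable hpa p.2.1)
  have s3 := smulRight_tsum prj2 ((hv0'.absConv p.2.2).summable hpa p.2.1)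
  rw [tsum_mul_left] at s1
  exact ((s1.add s2).add s3).tsum_eq

lemma GS_contDiffOn {r : ℕ} {v : ℕ → ℕ → ℝ → ℂ} (h : FnFam σ r v) :
    ContDiffOn ℝ r (GS v) (Ioo 0 σ ×ˢ univ) := by
  have ho : IsOpen (Ioo 0 σ ×ˢ (univ : Set (ℝ × ℝ))) := isOpen_Ioo.prod isOpen_univ
  induction r generalizing v with
  | zero =>
    rw [Nat.cast_zero, contDiffOn_zero]
    exact (GS_continuousOn h).mono fun p hp => by
      simp only [mem_ofPred_eq]; rw [abs_of_pos hp.1.1]; exact hp.1.2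
  | succ r ih =>
    obtain ⟨h0, v', hv', h'⟩ := id h
    have hd := fun p (hp : p ∈ Ioo 0 σ ×ˢ (univ : Set (ℝ × ℝ))) =>
      GS_hasFDerivAt h0 h'.zero hv' hp.1.1 hp.1.2
    rw [show ((r + 1 : ℕ) : WithTop ℕ∞) = (r : WithTop ℕ∞) + 1 by push_cast; rfl,
      contDiffOn_succ_iff_fderiv_of_isOpen ho]
    refine ⟨fun p hp => (hd p hp).differentiableAt.differentiableWithinAt, by simp, ?_⟩
    have e : ContDiffOn ℝ r (fun p : ℝ × ℝ × ℝ => prj0.smulRight ((p.1 : ℂ)⁻¹ * GS (radial v) p) +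
        prj1.smulRight (GS (angular v) p) + prj2.smulRight (GS v' p)) (Ioo 0 σ ×ˢ univ) := by
      have hL : ∀ L : ℝ × ℝ × ℝ →L[ℝ] ℝ, ∀ {g : ℝ × ℝ × ℝ → ℂ}, ContDiffOn ℝ r g (Ioo 0 σ ×ˢ univ) →
          ContDiffOn ℝ r (fun p => L.smulRight (g p)) (Ioo 0 σ ×ˢ univ) := fun L g hg =>
        (ContinuousLinearMap.smulRightL ℝ (ℝ × ℝ × ℝ) ℂ L).contDiff.comp_contDiffOn hg
      have hi : ContDiffOn ℝ r (fun p : ℝ × ℝ × ℝ => (p.1 : ℂ)⁻¹) (Ioo 0 σ ×ˢ univ) := by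
        refine ContDiffOn.inv ?_ fun p hp => by exact_mod_cast hp.1.1.ne'
        exact (Complex.ofRealCLM.contDiff.comp contDiff_fst).contDiffOn
      exact ((hL _ (hi.mul (ih h.pred.radial))).add (hL _ (ih h.pred.angular))).add (hL _ (ih h'))
    exact e.congr fun p hp => (hd p hp).fderiv

end NearAxis
end

/-! ### Partial derivatives of the series, and the operator P as a Fourier multiplier -/

noncomputable section

namespace NearAxis

/-! ### Partial derivatives -/

/-- `f` has the partial derivative `d` in the direction `i`. -/
def HasPd (i : Fin 3) (f : ℝ → ℝ → ℝ → ℝ) (d ρ θ s : ℝ) : Prop :=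
  ![HasDerivAt (fun r => f r θ s) d ρ, HasDerivAt (fun t => f ρ t s) d θ,
    HasDerivAt (fun t => f ρ θ t) d s] i

lemma HasPd.pd_eq {i : Fin 3} {f : ℝ → ℝ → ℝ → ℝ} {d ρ θ s : ℝ} (h : HasPd i f d ρ θ s) :
    pd i f ρ θ s = d := by
  fin_cases i <;> exact HasDerivAt.deriv h

lemma HasPd.add {i : Fin 3} {f g : ℝ → ℝ → ℝ → ℝ} {d e ρ θ s : ℝ} (h : HasPd i f d ρ θ s)
    (h' : HasPd i g e ρ θ s) : HasPd i (fun ρ θ s => f ρ θ s + g ρ θ s) (d + e) ρ θ s := by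
  fin_cases i <;> exact HasDerivAt.add h h'

lemma HasPd.sub {i : Fin 3} {f g : ℝ → ℝ → ℝ → ℝ} {d e ρ θ s : ℝ} (h : HasPd i f d ρ θ s)
    (h' : HasPd i g e ρ θ s) : HasPd i (fun ρ θ s => f ρ θ s - g ρ θ s) (d - e) ρ θ s := by
  fin_cases i <;> exact HasDerivAt.sub h h'

lemma HasPd.congr {σ : ℝ} {i : Fin 3} {f g : ℝ → ℝ → ℝ → ℝ} {d ρ θ s : ℝ}
    (h : HasPd i f d ρ θ s) (hρ : 0 < ρ) (hρσ : ρ < σ)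
    (hfg : ∀ ρ θ s, 0 < ρ → ρ < σ → g ρ θ s = f ρ θ s) : HasPd i g d ρ θ s := by
  have he : ∀ᶠ r in 𝓝 ρ, 0 < r ∧ r < σ := Ioo_mem_nhds hρ hρσ
  fin_cases i
  · exact HasDerivAt.congr_of_eventuallyEq h (he.mono fun r hr => hfg r θ s hr.1 hr.2)
  · exact HasDerivAt.congr_of_eventuallyEq h (Eventually.of_forall fun t => hfg ρ t s hρ hρσ)
  · exact HasDerivAt.congr_of_eventuallyEq h (Eventually.of_forall fun t => hfg ρ θ t hρ hρσ)

lemma pd_congr {σ : ℝ} (i : Fin 3) {f g : ℝ → ℝ → ℝ → ℝ} {ρ θ s : ℝ} (hρ : 0 < ρ) (hρσ : ρ < σ)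
    (hfg : ∀ ρ θ s, 0 < ρ → ρ < σ → g ρ θ s = f ρ θ s) : pd i g ρ θ s = pd i f ρ θ s := by
  have he : ∀ᶠ r in 𝓝 ρ, 0 < r ∧ r < σ := Ioo_mem_nhds hρ hρσ
  fin_cases i
  · exact Filter.EventuallyEq.deriv_eq (he.mono fun r hr => hfg r θ s hr.1 hr.2)
  · exact Filter.EventuallyEq.deriv_eq (Eventually.of_forall fun t => hfg ρ t s hρ hρσ)
  · exact Filter.EventuallyEq.deriv_eq (Eventually.of_forall fun t => hfg ρ θ t hρ hρσ)

/-- The real part of the sum of a power series with coefficients `v_{ab}(s)`. -/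
def RS (v : ℕ → ℕ → ℝ → ℂ) (ρ θ s : ℝ) : ℝ := (GS v (ρ, θ, s)).re

section RS

variable {σ : ℝ} {v v' : ℕ → ℕ → ℝ → ℂ} {ρ : ℝ}

lemma RS_hasPd0 (h : FnFam σ 0 v) (hρ : 0 < ρ) (hρσ : ρ < σ) (θ s : ℝ) :
    HasPd 0 (RS v) (ρ⁻¹ * RS (radial v) ρ θ s) ρ θ s := by
  have hw := FnFam.const (h.absConv s) 0
  have hz : FnFam σ 0 (fun _ _ _ => (0 : ℂ)) := FnFam.const (w := fun _ _ => 0)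
    (fun x _ _ => by simp) 0
  have hd := GS_hasFDerivAt hw hz (fun a b s => hasDerivAt_const _ _) (p := (ρ, θ, s)) hρ hρσ
  have hl : HasDerivAt (fun r : ℝ => ((r, θ, s) : ℝ × ℝ × ℝ)) (1, 0, 0) ρ :=
    (hasDerivAt_id ρ).prodMk ((hasDerivAt_const ρ θ).prodMk (hasDerivAt_const ρ s))
  have := Complex.reCLM.hasFDerivAt.comp_hasDerivAt ρ (hd.comp_hasDerivAt ρ hl)
  refine HasDerivAt.congr_deriv (f := fun r => RS v r θ s) this ?_
  simp only [_root_.add_apply, ContinuousLinearMap.smulRight_apply, prj0, prj1, prj2,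
    ContinuousLinearMap.comp_apply, ContinuousLinearMap.coe_fst', ContinuousLinearMap.coe_snd',
    one_smul, zero_smul, add_zero, Complex.reCLM_apply]
  rw [← Complex.ofReal_inv, Complex.re_ofReal_mul]
  rfl

lemma RS_hasPd1 (h : FnFam σ 0 v) (hρ : 0 < ρ) (hρσ : ρ < σ) (θ s : ℝ) :
    HasPd 1 (RS v) (RS (angular v) ρ θ s) ρ θ s := by
  have hw := FnFam.const (h.absConv s) 0
  have hz : FnFam σ 0 (fun _ _ _ => (0 : ℂ)) := FnFam.const (w := fun _ _ => 0)
    (fun x _ _ => by simp) 0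
  have hd := GS_hasFDerivAt hw hz (fun a b s => hasDerivAt_const _ _) (p := (ρ, θ, s)) hρ hρσ
  have hl : HasDerivAt (fun t : ℝ => ((ρ, t, s) : ℝ × ℝ × ℝ)) (0, 1, 0) θ :=
    (hasDerivAt_const θ ρ).prodMk ((hasDerivAt_id θ).prodMk (hasDerivAt_const θ s))
  have := Complex.reCLM.hasFDerivAt.comp_hasDerivAt θ (hd.comp_hasDerivAt θ hl)
  refine HasDerivAt.congr_deriv (f := fun t => RS v ρ t s) this ?_
  simp only [_root_.add_apply, ContinuousLinearMap.smulRight_apply, prj0, prj1, prj2,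
    ContinuousLinearMap.comp_apply, ContinuousLinearMap.coe_fst', ContinuousLinearMap.coe_snd',
    one_smul, zero_smul, add_zero, zero_add, Complex.reCLM_apply]
  rfl

lemma RS_hasPd2 (h : FnFam σ 0 v) (h' : FnFam σ 0 v')
    (hd : ∀ a b s, HasDerivAt (v a b) (v' a b s) s) (hρ : 0 < ρ) (hρσ : ρ < σ) (θ s : ℝ) :
    HasPd 2 (RS v) (RS v' ρ θ s) ρ θ s := by
  have hd := GS_hasFDerivAt h h' hd (p := (ρ, θ, s)) hρ hρσ
  have hl : HasDerivAt (fun t : ℝ => ((ρ, θ, t) : ℝ × ℝ × ℝ)) (0, 0, 1) s :=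
    (hasDerivAt_const s ρ).prodMk ((hasDerivAt_const s θ).prodMk (hasDerivAt_id s))
  have := Complex.reCLM.hasFDerivAt.comp_hasDerivAt s (hd.comp_hasDerivAt s hl)
  refine HasDerivAt.congr_deriv (f := fun t => RS v ρ θ t) this ?_
  simp only [_root_.add_apply, ContinuousLinearMap.smulRight_apply, prj0, prj1, prj2,
    ContinuousLinearMap.comp_apply, ContinuousLinearMap.coe_fst', ContinuousLinearMap.coe_snd',
    one_smul, zero_smul, zero_add, Complex.reCLM_apply]
  rfl

end RS

/-! ### Families of Fourier coefficients -/

/-- Fourier coefficients in `s` with `r` weighted summable derivatives. -/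
def RawFam (σ : ℝ) (r : ℕ) (U : ℕ → ℕ → ℤ → ℂ) : Prop :=
  ∃ N, Maj σ N ∧ ∀ a b, (Summable fun j => wt j ^ r * ‖U a b j‖) ∧
    ∑' j, wt j ^ r * ‖U a b j‖ ≤ N a b

/-- The coefficient functions with given Fourier coefficients. -/
def ev (U : ℕ → ℕ → ℤ → ℂ) : ℕ → ℕ → ℝ → ℂ := fun a b => evs (U a b)

/-- `∂_s` on Fourier coefficients. -/
def dsc (U : ℕ → ℕ → ℤ → ℂ) : ℕ → ℕ → ℤ → ℂ := fun a b j => Complex.I * j * U a b j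

namespace RawFam

variable {σ : ℝ} {r : ℕ} {U V : ℕ → ℕ → ℤ → ℂ}

/-- Powers of the mode number in `s` are paid for by the weight, and powers of `a + b` cost nothing.
Derivatives, inclusions and the symbols of `P` are all instances. -/
lemma of_mul (h : RawFam σ r U) {r' p : ℕ} {C : ℝ} {V : ℕ → ℕ → ℤ → ℂ} (hC : 0 ≤ C)
    (hV : ∀ a b j, wt j ^ r' * ‖V a b j‖ ≤
      C * (1 + ((a + b : ℕ) : ℝ) ^ p) * (wt j ^ r * ‖U a b j‖)) : RawFam σ r' V := by
  obtain ⟨N, hN, hU⟩ := h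
  have hw : ∀ r j, 0 ≤ wt j ^ r := fun r j => pow_nonneg (wt_pos j).le _
  have hN0 : ∀ a b, 0 ≤ N a b := fun a b =>
    (tsum_nonneg fun j => mul_nonneg (hw _ _) (norm_nonneg _)).trans (hU a b).2
  refine ⟨fun a b => C * (N a b + ((a + b : ℕ) : ℝ) ^ p * N a b),
    (hN.add (hN.pow_mul hN0 p)).const_mul C, fun a b => ?_⟩
  have hs : Summable fun j => wt j ^ r' * ‖V a b j‖ :=
    Summable.of_nonneg_of_le (fun j => mul_nonneg (hw _ _) (norm_nonneg _)) (hV a b)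
      ((hU a b).1.mul_left _)
  refine ⟨hs, (hs.tsum_le_tsum (hV a b) ((hU a b).1.mul_left _)).trans ?_⟩
  rw [tsum_mul_left]
  calc _ ≤ C * (1 + ((a + b : ℕ) : ℝ) ^ p) * N a b :=
        mul_le_mul_of_nonneg_left (hU a b).2 (by positivity)
    _ = _ := by ring

lemma mono (h : RawFam σ r U) {r' : ℕ} (hr : r' ≤ r) : RawFam σ r' U :=
  h.of_mul (C := 1) (p := 0) zero_le_one fun a b j => by
    have h1 : wt j ^ r' ≤ wt j ^ r := pow_le_pow_right₀ (one_le_wt j) hr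
    have h2 : 0 ≤ wt j ^ r * ‖U a b j‖ := mul_nonneg (pow_nonneg (wt_pos j).le _) (norm_nonneg _)
    have := mul_le_mul_of_nonneg_right h1 (norm_nonneg (U a b j))
    rw [pow_zero]; linarith

lemma deriv (h : RawFam σ (r + 1) U) : RawFam σ r (dsc U) :=
  h.of_mul (C := 1) (p := 0) zero_le_one fun a b j => by
    have hw := wt_pos j
    have h1 : wt j ^ r * ‖dsc U a b j‖ ≤ wt j ^ (r + 1) * ‖U a b j‖ := by
      unfold dsc
      rw [norm_mul, norm_mul, Complex.norm_I, one_mul, Complex.norm_intCast, pow_succ, mul_assoc]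
      exact mul_le_mul_of_nonneg_left
        (mul_le_mul_of_nonneg_right (abs_le_wt j) (norm_nonneg _)) (by positivity)
    have h2 : 0 ≤ wt j ^ (r + 1) * ‖U a b j‖ := by positivity
    rw [pow_zero]; linarith

lemma summable_norm (h : RawFam σ r U) (a b : ℕ) : Summable fun j => ‖U a b j‖ := by
  obtain ⟨N, hN, hU⟩ := h.mono (Nat.zero_le r)
  simpa using (hU a b).1

lemma add (hU : RawFam σ r U) (hV : RawFam σ r V) : RawFam σ r (fun a b j => U a b j + V a b j) := by
  obtain ⟨N, hN, hU⟩ := hU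
  obtain ⟨M, hM, hV⟩ := hV
  refine ⟨_, hN.add hM, fun a b => ?_⟩
  have hle : ∀ j, wt j ^ r * ‖U a b j + V a b j‖ ≤ wt j ^ r * ‖U a b j‖ + wt j ^ r * ‖V a b j‖ :=
    fun j => by
      rw [← mul_add]
      exact mul_le_mul_of_nonneg_left (norm_add_le _ _) (pow_nonneg (wt_pos j).le _)
  have hs := Summable.of_nonneg_of_le (fun j => mul_nonneg (pow_nonneg (wt_pos j).le _)
    (norm_nonneg _)) hle ((hU a b).1.add (hV a b).1)
  refine ⟨hs, (hs.tsum_le_tsum hle ((hU a b).1.add (hV a b).1)).trans ?_⟩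
  rw [(hU a b).1.tsum_add (hV a b).1]
  exact add_le_add (hU a b).2 (hV a b).2

lemma fnFam (h : RawFam σ r U) : FnFam σ r (ev U) := by
  have base : ∀ {U : ℕ → ℕ → ℤ → ℂ}, RawFam σ 0 U → FnFam σ 0 (ev U) := by
    intro U h
    refine ⟨fun a b => continuous_evs (h.summable_norm a b), ?_⟩
    obtain ⟨N, hN, hU⟩ := h
    refine ⟨N, hN, fun a b s => ?_⟩
    have := hU a b
    simp only [pow_zero, one_mul] at this
    exact (norm_evs_le this.1 s).trans this.2
  induction r generalizing U with
  | zero => exact base h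
  | succ r ih =>
    refine ⟨base (h.mono (Nat.zero_le _)), ev (dsc U), fun a b s => ?_, ih h.deriv⟩
    obtain ⟨N, hN, hU⟩ := h.mono (r' := 1) (by omega)
    exact hasDerivAt_evs (by simpa using (hU a b).1) s

lemma hasDerivAt (h : RawFam σ (r + 1) U) (a b : ℕ) (s : ℝ) :
    HasDerivAt (ev U a b) (ev (dsc U) a b s) s := by
  obtain ⟨N, hN, hU⟩ := h.mono (r' := 1) (by omega)
  exact hasDerivAt_evs (by simpa using (hU a b).1) s

end RawFam

/-! ### The regularizing operator -/

/-- The symbol of `P` on the coefficients of `z^a w^b e^{ijs}`. -/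
def pSym (D : ℕ) (K : ℝ) (a b : ℕ) (j : ℤ) : ℂ :=
  ((((j : ℝ) ^ 2 / K ^ 2) ^ D + ((((a : ℤ) - b : ℤ) : ℝ) ^ 2 / K ^ 2) ^ D : ℝ) : ℂ)

lemma abs_sub_le_add (a b : ℕ) : |(((a : ℤ) - b : ℤ) : ℝ)| ≤ ((a + b : ℕ) : ℝ) := by
  push_cast
  rw [abs_le]
  have ha : (0 : ℝ) ≤ a := Nat.cast_nonneg a
  have hb : (0 : ℝ) ≤ b := Nat.cast_nonneg b
  constructor <;> linarith

lemma RawFam.symS {σ : ℝ} {r : ℕ} {U : ℕ → ℕ → ℤ → ℂ} {i : ℕ} (h : RawFam σ (r + 2 * i) U) (K : ℝ) :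
    RawFam σ r (fun a b j => ((((j : ℝ) ^ 2 / K ^ 2) ^ i : ℝ) : ℂ) * U a b j) :=
  h.of_mul (C := ((K ^ 2)⁻¹) ^ i) (p := 0) (by positivity) fun a b j => by
    rw [norm_mul, Complex.norm_real, Real.norm_of_nonneg (by positivity), pow_zero, pow_add, pow_mul]
    have hw := wt_pos j
    have h1 : (j : ℝ) ^ 2 ≤ wt j ^ 2 := by
      rw [← sq_abs]; exact pow_le_pow_left₀ (abs_nonneg _) (abs_le_wt j) 2
    have h2 : ((j : ℝ) ^ 2 / K ^ 2) ^ i ≤ (K ^ 2)⁻¹ ^ i * (wt j ^ 2) ^ i := by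
      rw [← mul_pow]
      refine pow_le_pow_left₀ (by positivity) ?_ i
      rw [div_eq_inv_mul]
      exact mul_le_mul_of_nonneg_left h1 (by positivity)
    calc _ ≤ wt j ^ r * ((K ^ 2)⁻¹ ^ i * (wt j ^ 2) ^ i * ‖U a b j‖) := by gcongr
      _ = (K ^ 2)⁻¹ ^ i * 1 * (wt j ^ r * (wt j ^ 2) ^ i * ‖U a b j‖) := by ring
      _ ≤ _ := by gcongr; norm_num

lemma RawFam.symTheta {σ : ℝ} {r : ℕ} {U : ℕ → ℕ → ℤ → ℂ} (h : RawFam σ r U) (K : ℝ) (i : ℕ) :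
    RawFam σ r (fun a b j => ((((((a : ℤ) - b : ℤ) : ℝ) ^ 2 / K ^ 2) ^ i : ℝ) : ℂ) * U a b j) :=
  h.of_mul (C := ((K ^ 2)⁻¹) ^ i) (p := 2 * i) (by positivity) fun a b j => by
    rw [norm_mul, Complex.norm_real, Real.norm_of_nonneg (by positivity), pow_mul]
    have hw := wt_pos j
    have h1 : (((a : ℤ) - b : ℤ) : ℝ) ^ 2 ≤ (((a + b : ℕ) : ℝ)) ^ 2 := by
      rw [← sq_abs]; exact pow_le_pow_left₀ (abs_nonneg _) (abs_sub_le_add a b) 2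
    have h2 : ((((a : ℤ) - b : ℤ) : ℝ) ^ 2 / K ^ 2) ^ i ≤ (K ^ 2)⁻¹ ^ i * (((a + b : ℕ) : ℝ) ^ 2) ^ i := by
      rw [← mul_pow]
      refine pow_le_pow_left₀ (by positivity) ?_ i
      rw [div_eq_inv_mul]
      exact mul_le_mul_of_nonneg_left h1 (by positivity)
    calc _ ≤ wt j ^ r * ((K ^ 2)⁻¹ ^ i * (((a + b : ℕ) : ℝ) ^ 2) ^ i * ‖U a b j‖) := by gcongr
      _ = (K ^ 2)⁻¹ ^ i * (((a + b : ℕ) : ℝ) ^ 2) ^ i * (wt j ^ r * ‖U a b j‖) := by ring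
      _ ≤ _ := by gcongr; linarith

lemma RawFam.preg {σ : ℝ} {r D : ℕ} {U : ℕ → ℕ → ℤ → ℂ} (h : RawFam σ (r + 2 * D) U) (K : ℝ) :
    RawFam σ r (fun a b j => pSym D K a b j * U a b j) := by
  refine ((h.symS K).add ((h.mono (by omega : r ≤ r + 2 * D)).symTheta K D)).of_mul (C := 1) (p := 0)
    zero_le_one fun a b j => ?_
  rw [pow_zero, ← add_mul, ← Complex.ofReal_add]
  have : 0 ≤ wt j ^ r * ‖pSym D K a b j * U a b j‖ :=
    mul_nonneg (pow_nonneg (wt_pos j).le _) (norm_nonneg _)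
  unfold pSym at this ⊢
  linarith

lemma RS_const_mul (c : ℝ) (v : ℕ → ℕ → ℝ → ℂ) (ρ θ s : ℝ) :
    RS (fun a b s => (c : ℂ) * v a b s) ρ θ s = c * RS v ρ θ s := by
  unfold RS GS
  rw [PS_mul_left, Complex.re_ofReal_mul]

lemma RS_add {σ : ℝ} {v w : ℕ → ℕ → ℝ → ℂ} (hv : FnFam σ 0 v) (hw : FnFam σ 0 w) {ρ : ℝ}
    (hρ : |ρ| < σ) (θ s : ℝ) :
    RS (fun a b s => v a b s + w a b s) ρ θ s = RS v ρ θ s + RS w ρ θ s := by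
  unfold RS GS
  rw [PS_add (hv.absConv s) (hw.absConv s) hρ, Complex.add_re]

lemma RS_congr {v w : ℕ → ℕ → ℝ → ℂ} {s : ℝ} (h : ∀ a b, v a b s = w a b s) (ρ θ : ℝ) :
    RS v ρ θ s = RS w ρ θ s := by
  unfold RS GS
  simp only [h]

/-- The action of `P` on power series. -/
lemma Preg_RS {σ : ℝ} {D : ℕ} {K : ℝ} {r₀ : ℝ → E3} (hL : 0 < axisLength r₀)
    (hsp : ∀ s, speed r₀ s = axisLength r₀ / (2 * Real.pi)) {U : ℕ → ℕ → ℤ → ℂ}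
    (hU : RawFam σ (2 * D) U) {φ : ℝ → ℝ → ℝ → ℝ}
    (hφ : ∀ ρ θ s, 0 < ρ → ρ < σ → φ ρ θ s = RS (ev U) ρ θ s) {ρ : ℝ} (hρ : 0 < ρ) (hρσ : ρ < σ)
    (θ s : ℝ) :
    Preg D K r₀ φ ρ θ s = RS (ev (fun a b j => pSym D K a b j * U a b j)) ρ θ s := by
  -- In scaled arclength the speed is `L / 2π`, so the arclength derivative is `∂_s` itself.
  have harc : ∀ (u : ℝ → ℝ → ℝ → ℝ), arcDeriv r₀ u = pd 2 u := by
    intro u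
    funext ρ θ s
    have := Real.pi_pos
    unfold arcDeriv
    rw [hsp, show axisLength r₀ / (2 * Real.pi * (axisLength r₀ / (2 * Real.pi))) = 1 by
      field_simp, one_mul]
  have h1 : ∀ i ≤ D, ∀ ρ θ s, 0 < ρ → ρ < σ →
      (fun (u : ℝ → ℝ → ℝ → ℝ) (ρ' θ' s' : ℝ) =>
        -(1 / K ^ 2) * arcDeriv r₀ (arcDeriv r₀ u) ρ' θ' s')^[i] φ ρ θ s =
      RS (ev (fun a b j => ((((j : ℝ) ^ 2 / K ^ 2) ^ i : ℝ) : ℂ) * U a b j)) ρ θ s := by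
    intro i
    induction i with
    | zero =>
      intro _ ρ θ s h0 h1
      simpa using hφ ρ θ s h0 h1
    | succ i ih =>
      intro hi ρ θ s h0 h1
      have ih' := ih (by omega)
      rw [Function.iterate_succ_apply']
      simp only [harc]
      set V : ℕ → ℕ → ℤ → ℂ := fun a b j => ((((j : ℝ) ^ 2 / K ^ 2) ^ i : ℝ) : ℂ) * U a b j with hV
      have hV2 : RawFam σ 2 V := (hU.mono (show 2 + 2 * i ≤ 2 * D by omega)).symS K
      have e1 : ∀ ρ θ s, 0 < ρ → ρ < σ → pd 2 ((fun (u : ℝ → ℝ → ℝ → ℝ) (ρ' θ' s' : ℝ) =>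
          -(1 / K ^ 2) * pd 2 (pd 2 u) ρ' θ' s')^[i] φ) ρ θ s = RS (ev (dsc V)) ρ θ s := by
        intro ρ θ s h0 h1
        simp only [harc] at ih'
        exact ((RS_hasPd2 (hV2.mono (by omega)).fnFam ((hV2.deriv).mono (by omega)).fnFam
          hV2.hasDerivAt h0 h1 θ s).congr h0 h1 ih').pd_eq
      have e2 := ((RS_hasPd2 (hV2.deriv.mono (by omega)).fnFam (hV2.deriv.deriv).fnFam
          hV2.deriv.hasDerivAt h0 h1 θ s).congr h0 h1 e1).pd_eq
      rw [e2, ← RS_const_mul]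
      refine RS_congr (fun a b => ?_) ρ θ
      unfold ev
      rw [← evs_mul_left]
      refine congrFun (evs_congr fun j => ?_) s
      simp only [dsc, hV]
      push_cast
      rw [pow_succ]
      linear_combination (-(1 / (K : ℂ) ^ 2) * j ^ 2 * (((j : ℂ) ^ 2 / (K : ℂ) ^ 2) ^ i * U a b j)) *
        Complex.I_sq
  have h2 : ∀ i ≤ D, ∀ ρ θ s, 0 < ρ → ρ < σ →
      (fun (u : ℝ → ℝ → ℝ → ℝ) (ρ' θ' s' : ℝ) =>
        -(1 / K ^ 2) * pd 1 (pd 1 u) ρ' θ' s')^[i] φ ρ θ s =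
      RS (ev (fun a b j => ((((((a : ℤ) - b : ℤ) : ℝ) ^ 2 / K ^ 2) ^ i : ℝ) : ℂ) * U a b j)) ρ θ s := by
    intro i
    induction i with
    | zero =>
      intro _ ρ θ s h0 h1
      simpa using hφ ρ θ s h0 h1
    | succ i ih =>
      intro hi ρ θ s h0 h1
      have ih' := ih (by omega)
      rw [Function.iterate_succ_apply']
      set V : ℕ → ℕ → ℤ → ℂ := fun a b j =>
        ((((((a : ℤ) - b : ℤ) : ℝ) ^ 2 / K ^ 2) ^ i : ℝ) : ℂ) * U a b j with hV
      have hV2 : FnFam σ 0 (ev V) := ((hU.mono (Nat.zero_le _)).symTheta K i).fnFam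
      have e1 : ∀ ρ θ s, 0 < ρ → ρ < σ → pd 1 ((fun (u : ℝ → ℝ → ℝ → ℝ) (ρ' θ' s' : ℝ) =>
          -(1 / K ^ 2) * pd 1 (pd 1 u) ρ' θ' s')^[i] φ) ρ θ s = RS (angular (ev V)) ρ θ s :=
        fun ρ θ s h0 h1 => ((RS_hasPd1 hV2 h0 h1 θ s).congr h0 h1 ih').pd_eq
      have e2 := ((RS_hasPd1 hV2.angular h0 h1 θ s).congr h0 h1 e1).pd_eq
      rw [e2, ← RS_const_mul]
      refine RS_congr (fun a b => ?_) ρ θ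
      unfold angular ev
      rw [← evs_mul_left, ← evs_mul_left, ← evs_mul_left]
      refine congrFun (evs_congr fun j => ?_) s
      simp only [hV]
      push_cast
      rw [pow_succ]
      linear_combination (-(1 / (K : ℂ) ^ 2) * (a - b) ^ 2 *
        ((((a : ℂ) - b) ^ 2 / (K : ℂ) ^ 2) ^ i * U a b j)) * Complex.I_sq
  have f1 := (RawFam.symS (r := 0) (i := D) (by simpa using hU) K)
  have f2 := (hU.mono (Nat.zero_le _)).symTheta K D
  unfold Preg
  rw [h1 D le_rfl ρ θ s hρ hρσ, h2 D le_rfl ρ θ s hρ hρσ,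
    ← RS_add f1.fnFam f2.fnFam (by rwa [abs_of_pos hρ])]
  refine RS_congr (fun a b => ?_) ρ θ
  unfold ev
  rw [← evs_add (f1.summable_norm a b) (f2.summable_norm a b)]
  refine congrFun (evs_congr fun j => ?_) s
  unfold pSym
  push_cast
  ring

end NearAxis
end

/-! ### From the differential equation to the residual power series -/

noncomputable section

namespace NearAxis

/-! ### The equation off the axis -/

lemma em_one_eq (θ : ℝ) : em 1 θ = (Real.cos θ : ℂ) + (Real.sin θ : ℂ) * Complex.I := by
  have h1 := em_one_add θ
  have h2 := em_one_sub θ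
  push_cast at h1 h2
  push_cast
  linear_combination (h1 + h2) / 2

lemma em_neg_one_eq (θ : ℝ) : em (-1) θ = (Real.cos θ : ℂ) - (Real.sin θ : ℂ) * Complex.I := by
  have h1 := em_one_add θ
  have h2 := em_one_sub θ
  push_cast at h1 h2
  push_cast
  linear_combination (h1 - h2) / 2

section Geometry

variable {r₀ : ℝ → E3} {ℓ : ℝ}

lemma hs_hasPd0 (r₀ : ℝ → E3) (ρ θ s : ℝ) :
    HasPd 0 (hs r₀) (-(speed r₀ s * curvature r₀ s * Real.cos θ)) ρ θ s := by
  have := ((((hasDerivAt_id ρ).const_mul (curvature r₀ s)).mul_const (Real.cos θ)).const_sub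
    1).const_mul (speed r₀ s)
  refine HasDerivAt.congr_deriv (f := fun r => hs r₀ r θ s) this ?_
  ring

lemma hs_hasPd1 (r₀ : ℝ → E3) (ρ θ s : ℝ) :
    HasPd 1 (hs r₀) (speed r₀ s * curvature r₀ s * ρ * Real.sin θ) ρ θ s := by
  have := (((Real.hasDerivAt_cos θ).const_mul (curvature r₀ s * ρ)).const_sub
    1).const_mul (speed r₀ s)
  refine HasDerivAt.congr_deriv (f := fun t => hs r₀ ρ t s) this ?_
  ring

lemma Btilde_eq (r₀ : ℝ → E3) (B₀ : ℝ → ℝ) (i : Fin 3) (ρ θ s : ℝ) :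
    Btilde r₀ B₀ i ρ θ s = B₀ s * speed r₀ s * gInv r₀ ρ θ s i 2 := by
  unfold Btilde grad
  congr 1
  have h0 : pd 0 (fun _ _ s' => s') ρ θ s = 0 := by simp [pd]
  have h1 : pd 1 (fun _ _ s' => s') ρ θ s = 0 := by simp [pd]
  have h2 : pd 2 (fun _ _ s' => s') ρ θ s = 1 := by simp [pd]
  rw [Fin.sum_univ_three, h0, h1, h2]
  ring

/-- The components of `√g (∇φ + B̃)` in terms of the flux `J`. -/
lemma sqrtG_mul_field (hℓ : ∀ s, speed r₀ s = ℓ) (B₀ : ℝ → ℝ) {φ : ℝ → ℝ → ℝ → ℝ}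
    {J : ℝ → ℝ → ℝ → ℝ} {ρ θ s : ℝ} (hρ : 0 < ρ) (hh : 0 < hs r₀ ρ θ s)
    (hJ : hs r₀ ρ θ s * J ρ θ s =
      pd 2 φ ρ θ s - ℓ * torsion r₀ s * pd 1 φ ρ θ s + ℓ * B₀ s) (i : Fin 3) :
    sqrtG r₀ ρ θ s * (grad r₀ φ i ρ θ s + Btilde r₀ B₀ i ρ θ s) =
      ![ρ * hs r₀ ρ θ s * pd 0 φ ρ θ s,
        hs r₀ ρ θ s * ρ⁻¹ * pd 1 φ ρ θ s - ρ * (ℓ * torsion r₀ s) * J ρ θ s, ρ * J ρ θ s] i := by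
  have hJ' : J ρ θ s = (pd 2 φ ρ θ s - ℓ * torsion r₀ s * pd 1 φ ρ θ s + ℓ * B₀ s) / hs r₀ ρ θ s := by
    field_simp; linarith
  rw [Btilde_eq, grad, Fin.sum_univ_three, hJ', hℓ]
  fin_cases i
  · simp [gInv, sqrtG]
  · simp [gInv, sqrtG, hℓ]; field_simp; ring
  · simp [gInv, sqrtG, hℓ]; field_simp; ring

/-- The partial derivatives of `√g B̃` exist. -/
lemma exists_hasPd_sqrtG_Btilde (hℓ : ∀ s, speed r₀ s = ℓ) {B₀ : ℝ → ℝ}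
    (hκ : Differentiable ℝ (curvature r₀)) (hB : Differentiable ℝ B₀) {σ : ℝ}
    (hh : ∀ ρ θ s, 0 < ρ → ρ < σ → 0 < hs r₀ ρ θ s) {ρ : ℝ} (hρ : 0 < ρ) (hρσ : ρ < σ) (θ s : ℝ)
    (i : Fin 3) :
    ∃ d, HasPd i (fun ρ θ s => sqrtG r₀ ρ θ s * Btilde r₀ B₀ i ρ θ s) d ρ θ s := by
  have hne := (hh ρ θ s hρ hρσ).ne'
  have hsp : speed r₀ = fun _ => ℓ := funext hℓ
  fin_cases i
  · refine ⟨0, ?_⟩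
    refine HasDerivAt.congr_of_eventuallyEq (f := fun _ => (0 : ℝ)) (hasDerivAt_const _ _) ?_
    exact Eventually.of_forall fun r => by simp [Btilde_eq, gInv]
  · have hd : DifferentiableAt ℝ (fun t => hs r₀ ρ t s) θ :=
      (show HasDerivAt (fun t => hs r₀ ρ t s) _ θ from hs_hasPd1 r₀ ρ θ s).differentiableAt
    refine ⟨_, DifferentiableAt.hasDerivAt (f := fun t => sqrtG r₀ ρ t s * Btilde r₀ B₀ 1 ρ t s) ?_⟩
    simp only [Btilde_eq, gInv, sqrtG]
    simp only [Matrix.of_apply, Matrix.cons_val]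
    exact (hd.const_mul _).mul (((differentiableAt_const _).div (hd.pow 2)
      (pow_ne_zero 2 hne)).const_mul _)
  · have hd : DifferentiableAt ℝ (fun t => hs r₀ ρ θ t) s := by
      unfold hs
      rw [hsp]
      have := hκ s
      fun_prop
    refine ⟨_, DifferentiableAt.hasDerivAt (f := fun t => sqrtG r₀ ρ θ t * Btilde r₀ B₀ 2 ρ θ t) ?_⟩
    simp only [Btilde_eq, gInv, sqrtG]
    simp only [Matrix.of_apply, Matrix.cons_val, hsp]
    exact (hd.const_mul _).mul (((hB s).mul_const _).mul ((differentiableAt_const _).div (hd.pow 2)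
      (pow_ne_zero 2 hne)))

end Geometry

/-- The data entering the equation: potential, its derivative in `s`, and the flux. -/
structure FluxData (σ : ℝ) (r₀ : ℝ → E3) (ℓ : ℝ) (B₀ : ℝ → ℝ) (φ : ℝ → ℝ → ℝ → ℝ)
    (v v' w w' : ℕ → ℕ → ℝ → ℂ) : Prop where
  speed_eq : ∀ s, speed r₀ s = ℓ
  curv : Differentiable ℝ (curvature r₀)
  diffB : Differentiable ℝ B₀
  hs_pos : ∀ ρ θ s, 0 < ρ → ρ < σ → 0 < hs r₀ ρ θ s
  eq_RS : ∀ ρ θ s, 0 < ρ → ρ < σ → φ ρ θ s = RS v ρ θ s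
  fam_v : FnFam σ 0 v
  fam_v' : FnFam σ 0 v'
  deriv_v : ∀ a b s, HasDerivAt (v a b) (v' a b s) s
  fam_w : FnFam σ 0 w
  fam_w' : FnFam σ 0 w'
  deriv_w : ∀ a b s, HasDerivAt (w a b) (w' a b s) s
  flux : ∀ ρ θ s, 0 < ρ → ρ < σ → hs r₀ ρ θ s * RS w ρ θ s =
    RS v' ρ θ s - ℓ * torsion r₀ s * RS (angular v) ρ θ s + ℓ * B₀ s

namespace FluxData

variable {σ ℓ : ℝ} {r₀ : ℝ → E3} {B₀ : ℝ → ℝ} {φ : ℝ → ℝ → ℝ → ℝ} {v v' w w' : ℕ → ℕ → ℝ → ℂ}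

lemma pd0 (h : FluxData σ r₀ ℓ B₀ φ v v' w w') {ρ : ℝ} (hρ : 0 < ρ) (hρσ : ρ < σ) (θ s : ℝ) :
    pd 0 φ ρ θ s = ρ⁻¹ * RS (radial v) ρ θ s :=
  ((RS_hasPd0 h.fam_v hρ hρσ θ s).congr hρ hρσ h.eq_RS).pd_eq

lemma pd1 (h : FluxData σ r₀ ℓ B₀ φ v v' w w') {ρ : ℝ} (hρ : 0 < ρ) (hρσ : ρ < σ) (θ s : ℝ) :
    pd 1 φ ρ θ s = RS (angular v) ρ θ s :=
  ((RS_hasPd1 h.fam_v hρ hρσ θ s).congr hρ hρσ h.eq_RS).pd_eq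

lemma pd2 (h : FluxData σ r₀ ℓ B₀ φ v v' w w') {ρ : ℝ} (hρ : 0 < ρ) (hρσ : ρ < σ) (θ s : ℝ) :
    pd 2 φ ρ θ s = RS v' ρ θ s :=
  ((RS_hasPd2 h.fam_v h.fam_v' h.deriv_v hρ hρσ θ s).congr hρ hρσ h.eq_RS).pd_eq

lemma flux_pd (h : FluxData σ r₀ ℓ B₀ φ v v' w w') {ρ : ℝ} (hρ : 0 < ρ) (hρσ : ρ < σ) (θ s : ℝ) :
    hs r₀ ρ θ s * RS w ρ θ s = pd 2 φ ρ θ s - ℓ * torsion r₀ s * pd 1 φ ρ θ s + ℓ * B₀ s := by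
  rw [h.flux ρ θ s hρ hρσ, h.pd1 hρ hρσ, h.pd2 hρ hρσ]

/-- With the flux as an unknown of its own, the components of `√g (∇φ + B̃)` contain no quotient by
`h_s`. They are differentiated by the product rule alone, and `B₀` and the torsion are not
differentiated separately. -/
lemma hasPd_field (h : FluxData σ r₀ ℓ B₀ φ v v' w w') {ρ : ℝ} (hρ : 0 < ρ) (hρσ : ρ < σ) (θ s : ℝ)
    (i : Fin 3) :
    HasPd i (fun ρ θ s => sqrtG r₀ ρ θ s * (grad r₀ φ i ρ θ s + Btilde r₀ B₀ i ρ θ s))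
      (![-(ℓ * curvature r₀ s * Real.cos θ) * RS (radial v) ρ θ s +
          hs r₀ ρ θ s * (ρ⁻¹ * RS (radial (radial v)) ρ θ s),
        ρ⁻¹ * (ℓ * curvature r₀ s * ρ * Real.sin θ * RS (angular v) ρ θ s +
          hs r₀ ρ θ s * RS (angular (angular v)) ρ θ s) -
          ρ * (ℓ * torsion r₀ s) * RS (angular w) ρ θ s,
        ρ * RS w' ρ θ s] i) ρ θ s := by
  fin_cases i
  · have hd : HasPd 0 (fun ρ θ s => hs r₀ ρ θ s * RS (radial v) ρ θ s)
        (-(ℓ * curvature r₀ s * Real.cos θ) * RS (radial v) ρ θ s +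
          hs r₀ ρ θ s * (ρ⁻¹ * RS (radial (radial v)) ρ θ s)) ρ θ s := by
      have := HasDerivAt.mul (hs_hasPd0 r₀ ρ θ s) (RS_hasPd0 h.fam_v.radial hρ hρσ θ s)
      rw [h.speed_eq] at this
      exact this
    refine hd.congr hρ hρσ fun ρ θ s h0 h1 => ?_
    rw [sqrtG_mul_field h.speed_eq B₀ h0 (h.hs_pos ρ θ s h0 h1) (h.flux_pd h0 h1 θ s)]
    simp only [Fin.zero_eta, Matrix.cons_val_zero, h.pd0 h0 h1]
    field_simp
  · have hd : HasPd 1 (fun ρ θ s => ρ⁻¹ * (hs r₀ ρ θ s * RS (angular v) ρ θ s) -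
        ρ * (ℓ * torsion r₀ s) * RS w ρ θ s)
        (ρ⁻¹ * (ℓ * curvature r₀ s * ρ * Real.sin θ * RS (angular v) ρ θ s +
          hs r₀ ρ θ s * RS (angular (angular v)) ρ θ s) -
          ρ * (ℓ * torsion r₀ s) * RS (angular w) ρ θ s) ρ θ s := by
      have := ((HasDerivAt.mul (hs_hasPd1 r₀ ρ θ s) (RS_hasPd1 h.fam_v.angular hρ hρσ θ s)).const_mul
        ρ⁻¹).sub (HasDerivAt.const_mul (ρ * (ℓ * torsion r₀ s)) (RS_hasPd1 h.fam_w hρ hρσ θ s))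
      rw [h.speed_eq] at this
      exact this
    refine hd.congr hρ hρσ fun ρ θ s h0 h1 => ?_
    rw [sqrtG_mul_field h.speed_eq B₀ h0 (h.hs_pos ρ θ s h0 h1) (h.flux_pd h0 h1 θ s)]
    simp only [Fin.mk_one, Matrix.cons_val_one, Matrix.cons_val_zero, h.pd1 h0 h1]
    ring
  · have hd : HasPd 2 (fun ρ θ s => ρ * RS w ρ θ s) (ρ * RS w' ρ θ s) ρ θ s :=
      HasDerivAt.const_mul ρ (RS_hasPd2 h.fam_w h.fam_w' h.deriv_w hρ hρσ θ s)
    refine hd.congr hρ hρσ fun ρ θ s h0 h1 => ?_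
    rw [sqrtG_mul_field h.speed_eq B₀ h0 (h.hs_pos ρ θ s h0 h1) (h.flux_pd h0 h1 θ s)]
    rfl

lemma sqrtG_pos (h : FluxData σ r₀ ℓ B₀ φ v v' w w') {ρ : ℝ} (hρ : 0 < ρ) (hρσ : ρ < σ) (θ s : ℝ) :
    0 < sqrtG r₀ ρ θ s := mul_pos hρ (h.hs_pos ρ θ s hρ hρσ)

lemma exists_hasPd_Btilde (h : FluxData σ r₀ ℓ B₀ φ v v' w w') {ρ : ℝ} (hρ : 0 < ρ) (hρσ : ρ < σ)
    (θ s : ℝ) (i : Fin 3) :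
    ∃ d, HasPd i (fun ρ θ s => sqrtG r₀ ρ θ s * Btilde r₀ B₀ i ρ θ s) d ρ θ s :=
  exists_hasPd_sqrtG_Btilde h.speed_eq h.curv h.diffB h.hs_pos hρ hρσ θ s i

/-- Only the combination of gradient and `B̃` is expressed through the flux. The gradient alone is
reached by subtracting `B̃`, which is differentiable by inspection. -/
lemma exists_hasPd_grad (h : FluxData σ r₀ ℓ B₀ φ v v' w w') {ρ : ℝ} (hρ : 0 < ρ) (hρσ : ρ < σ)
    (θ s : ℝ) (i : Fin 3) :
    ∃ d, HasPd i (fun ρ θ s => sqrtG r₀ ρ θ s * grad r₀ φ i ρ θ s) d ρ θ s := by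
  obtain ⟨d, hd⟩ := h.exists_hasPd_Btilde hρ hρσ θ s i
  exact ⟨_, ((h.hasPd_field hρ hρσ θ s i).sub hd).congr hρ hρσ fun ρ θ s _ _ => by ring⟩

/-- `ρ √g ∇·(∇φ + B̃)` in terms of the coefficients. -/
lemma divg_total (h : FluxData σ r₀ ℓ B₀ φ v v' w w') {ρ : ℝ} (hρ : 0 < ρ) (hρσ : ρ < σ) (θ s : ℝ) :
    ρ * (sqrtG r₀ ρ θ s * (divg r₀ (grad r₀ φ) ρ θ s + divg r₀ (Btilde r₀ B₀) ρ θ s)) =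
      hs r₀ ρ θ s * (RS (radial (radial v)) ρ θ s + RS (angular (angular v)) ρ θ s) -
      ℓ * curvature r₀ s * ρ * (Real.cos θ * RS (radial v) ρ θ s - Real.sin θ * RS (angular v) ρ θ s) +
      ρ ^ 2 * (RS w' ρ θ s - ℓ * torsion r₀ s * RS (angular w) ρ θ s) := by
  have hg := (h.sqrtG_pos hρ hρσ θ s).ne'
  -- `pd` is additive only where both derivatives exist. This is where the two existence statements
  -- are used.
  have hsum : ∀ i, pd i (fun ρ θ s => sqrtG r₀ ρ θ s * grad r₀ φ i ρ θ s) ρ θ s +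
      pd i (fun ρ θ s => sqrtG r₀ ρ θ s * Btilde r₀ B₀ i ρ θ s) ρ θ s =
      pd i (fun ρ θ s => sqrtG r₀ ρ θ s * (grad r₀ φ i ρ θ s + Btilde r₀ B₀ i ρ θ s)) ρ θ s := by
    intro i
    obtain ⟨d, hd⟩ := h.exists_hasPd_Btilde hρ hρσ θ s i
    obtain ⟨e, he⟩ := h.exists_hasPd_grad hρ hρσ θ s i
    rw [hd.pd_eq, he.pd_eq, ← (he.add hd).pd_eq]
    exact pd_congr i hρ hρσ fun ρ θ s _ _ => by ring
  have e : sqrtG r₀ ρ θ s * (divg r₀ (grad r₀ φ) ρ θ s + divg r₀ (Btilde r₀ B₀) ρ θ s) =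
      ∑ i, pd i (fun ρ θ s => sqrtG r₀ ρ θ s * (grad r₀ φ i ρ θ s + Btilde r₀ B₀ i ρ θ s)) ρ θ s := by
    unfold divg
    rw [← mul_add, mul_inv_cancel_left₀ hg, ← Finset.sum_add_distrib]
    exact Finset.sum_congr rfl fun i _ => hsum i
  rw [e, Fin.sum_univ_three, (h.hasPd_field hρ hρσ θ s 0).pd_eq, (h.hasPd_field hρ hρσ θ s 1).pd_eq,
    (h.hasPd_field hρ hρσ θ s 2).pd_eq]
  simp only [Matrix.cons_val]
  field_simp
  ring

end FluxData

section Perp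

variable {σ : ℝ} {ψ : ℝ → ℝ → ℝ → ℝ} {p : ℕ → ℕ → ℝ → ℂ}

lemma lapPerp_RS (hp : FnFam σ 0 p) (hψ : ∀ ρ θ s, 0 < ρ → ρ < σ → ψ ρ θ s = RS p ρ θ s) {ρ : ℝ}
    (hρ : 0 < ρ) (hρσ : ρ < σ) (θ s : ℝ) :
    HasPd 0 (fun ρ θ s => ρ * pd 0 ψ ρ θ s) (ρ⁻¹ * RS (radial (radial p)) ρ θ s) ρ θ s ∧
    HasPd 1 (pd 1 ψ) (RS (angular (angular p)) ρ θ s) ρ θ s := by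
  constructor
  · refine (RS_hasPd0 hp.radial hρ hρσ θ s).congr hρ hρσ fun ρ θ s h0 h1 => ?_
    rw [((RS_hasPd0 hp h0 h1 θ s).congr h0 h1 hψ).pd_eq, mul_inv_cancel_left₀ h0.ne']
  · refine (RS_hasPd1 hp.angular hρ hρσ θ s).congr hρ hρσ fun ρ θ s h0 h1 => ?_
    rw [((RS_hasPd1 hp h0 h1 θ s).congr h0 h1 hψ).pd_eq]

lemma sq_mul_lapPerp (hp : FnFam σ 0 p) (hψ : ∀ ρ θ s, 0 < ρ → ρ < σ → ψ ρ θ s = RS p ρ θ s) {ρ : ℝ}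
    (hρ : 0 < ρ) (hρσ : ρ < σ) (θ s : ℝ) :
    ρ ^ 2 * lapPerp ψ ρ θ s = RS (radial (radial p)) ρ θ s + RS (angular (angular p)) ρ θ s := by
  obtain ⟨h1, h2⟩ := lapPerp_RS hp hψ hρ hρσ θ s
  unfold lapPerp
  rw [h1.pd_eq, h2.pd_eq]
  field_simp

/-- The regularizing part of the divergence. -/
lemma FluxData.divg_BK {ℓ : ℝ} {r₀ : ℝ → E3} {B₀ : ℝ → ℝ} {φ : ℝ → ℝ → ℝ → ℝ}
    {v v' w w' : ℕ → ℕ → ℝ → ℂ} (h : FluxData σ r₀ ℓ B₀ φ v v' w w') {D : ℕ} {K : ℝ}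
    (hp : FnFam σ 0 p)
    (hψ : ∀ ρ θ s, 0 < ρ → ρ < σ → Preg D K r₀ φ ρ θ s = RS p ρ θ s) {ρ : ℝ} (hρ : 0 < ρ)
    (hρσ : ρ < σ) (θ s : ℝ) :
    divg r₀ (BK D K r₀ B₀ φ) ρ θ s = divg r₀ (grad r₀ φ) ρ θ s +
      ρ / sqrtG r₀ ρ θ s * lapPerp (Preg D K r₀ φ) ρ θ s + divg r₀ (Btilde r₀ B₀) ρ θ s := by
  obtain ⟨h1, h2⟩ := lapPerp_RS hp hψ hρ hρσ θ s
  have hg := (h.sqrtG_pos hρ hρσ θ s).ne'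
  set d : Fin 3 → ℝ := ![ρ⁻¹ * RS (radial (radial p)) ρ θ s, ρ⁻¹ * RS (angular (angular p)) ρ θ s, 0]
    with hd
  -- The factor `ρ / √g` of the regularizing part cancels the `√g` of the divergence, which leaves
  -- `ρ Δ_⊥` in divergence form.
  have hP : ∀ i, HasPd i (fun ρ θ s => ρ * (![1, 1 / ρ ^ 2, 0] i * pd i (Preg D K r₀ φ) ρ θ s))
      (d i) ρ θ s := by
    intro i
    fin_cases i
    · refine h1.congr hρ hρσ fun ρ θ s _ _ => ?_
      simp
    · refine HasDerivAt.congr_of_eventuallyEq (HasDerivAt.const_mul ρ⁻¹ h2)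
        (Eventually.of_forall fun t => ?_)
      simp only [Fin.mk_one, Matrix.cons_val_one, Matrix.cons_val_zero]
      field_simp
    · refine HasDerivAt.congr_of_eventuallyEq (hasDerivAt_const s (0 : ℝ))
        (Eventually.of_forall fun t => ?_)
      simp
  have hsum : ∀ i, pd i (fun ρ θ s => sqrtG r₀ ρ θ s * BK D K r₀ B₀ φ i ρ θ s) ρ θ s =
      pd i (fun ρ θ s => sqrtG r₀ ρ θ s * grad r₀ φ i ρ θ s) ρ θ s +
      pd i (fun ρ θ s => sqrtG r₀ ρ θ s * Btilde r₀ B₀ i ρ θ s) ρ θ s + d i := by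
    intro i
    obtain ⟨b, hb⟩ := h.exists_hasPd_Btilde hρ hρσ θ s i
    obtain ⟨e, he⟩ := h.exists_hasPd_grad hρ hρσ θ s i
    rw [hb.pd_eq, he.pd_eq]
    refine (((he.add hb).add (hP i)).congr hρ hρσ fun ρ θ s h0 h1 => ?_).pd_eq
    have hg' := (h.sqrtG_pos h0 h1 θ s).ne'
    unfold BK
    field_simp
  unfold divg lapPerp
  rw [h1.pd_eq, h2.pd_eq]
  simp only [hsum, Finset.sum_add_distrib]
  rw [Fin.sum_univ_three (f := d)]
  simp only [hd, Matrix.cons_val]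
  field_simp
  ring

end Perp

/-- The coefficients of `ρ √g` times the equation. -/
def residual (ℓ : ℝ) (κ τ : ℝ → ℝ) (v p w w' : ℕ → ℕ → ℝ → ℂ) (a b : ℕ) (s : ℝ) : ℂ :=
  (4 * a * b : ℂ) * (ℓ * v a b s + p a b s)
  - (ℓ * κ s / 2) * (shz (fun a b => (4 * a * b : ℂ) * v a b s) a b +
      shw (fun a b => (4 * a * b : ℂ) * v a b s) a b)
  - ℓ * κ s * (shz (fun a b => (b : ℂ) * v a b s) a b + shw (fun a b => (a : ℂ) * v a b s) a b)
  + shz (shw (fun a b => w' a b s - ℓ * τ s * angular w a b s)) a b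

lemma AbsConv.natMul {σ : ℝ} {v : ℕ → ℕ → ℂ} (h : AbsConv σ v) :
    AbsConv σ (fun a b => (a : ℂ) * v a b) ∧ AbsConv σ (fun a b => (b : ℂ) * v a b) ∧
    AbsConv σ (fun a b => (4 * a * b : ℂ) * v a b) := by
  have h1 : AbsConv σ (fun a b => (a : ℂ) * v a b) := h.poly 1 fun a b => by
    rw [Complex.norm_natCast, pow_one]; exact_mod_cast Nat.le_add_right a b
  have h2 : ∀ {v : ℕ → ℕ → ℂ}, AbsConv σ v → AbsConv σ (fun a b => (b : ℂ) * v a b) :=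
    fun {v} h => h.poly 1 fun a b => by
      rw [Complex.norm_natCast, pow_one]; exact_mod_cast Nat.le_add_left b a
  refine ⟨h1, h2 h, ?_⟩
  have := (h2 h1).const_mul 4
  refine Maj.mono this (fun _ _ => norm_nonneg _) fun a b => le_of_eq ?_
  congr 1; ring

lemma PS_congr {v w : ℕ → ℕ → ℂ} (h : ∀ a b, v a b = w a b) (ρ θ : ℝ) : PS v ρ θ = PS w ρ θ := by
  unfold PS; simp only [h]

lemma PS_sub {σ : ℝ} {v w : ℕ → ℕ → ℂ} (hv : AbsConv σ v) (hw : AbsConv σ w) {ρ : ℝ} (hρ : |ρ| < σ)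
    (θ : ℝ) : PS (fun a b => v a b - w a b) ρ θ = PS v ρ θ - PS w ρ θ := by
  have := PS_add hv (hw.const_mul (-1)) hρ θ
  rw [PS_mul_left] at this
  rw [sub_eq_add_neg, ← neg_one_mul (PS w ρ θ), ← this]
  exact PS_congr (fun a b => by ring) ρ θ

lemma AbsConv.sub {σ : ℝ} {v w : ℕ → ℕ → ℂ} (hv : AbsConv σ v) (hw : AbsConv σ w) :
    AbsConv σ (fun a b => v a b - w a b) :=
  (hv.add (hw.const_mul (-1))).mono (fun _ _ => norm_nonneg _) fun a b => by
    simp only [neg_one_mul, ← sub_eq_add_neg, le_refl]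

section Residual

variable {σ : ℝ} {v p w w' : ℕ → ℕ → ℝ → ℂ}

lemma absConv_residual (ℓ : ℝ) (κ τ : ℝ → ℝ) (hv : FnFam σ 0 v) (hp : FnFam σ 0 p)
    (hw : FnFam σ 0 w) (hw' : FnFam σ 0 w') (s : ℝ) :
    AbsConv σ (fun a b => residual ℓ κ τ v p w w' a b s) := by
  have n := (hv.absConv s).natMul
  have m := (((hv.absConv s).const_mul ℓ).add (hp.absConv s)).natMul
  exact ((m.2.2.sub ((n.2.2.shz.add n.2.2.shw).const_mul _)).sub
    ((n.2.1.shz.add n.1.shw).const_mul _)).add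
    (((hw'.absConv s).sub ((hw.angular.absConv s).const_mul _)).shw.shz)

/-- A shift of indices is multiplication by `z` or `w`. Here `z + w = 2ρ cos θ` produces `h_s`, and
`zw = ρ²` produces the factor of the flux term. -/
lemma PS_residual (ℓ : ℝ) (κ τ : ℝ → ℝ) (hv : FnFam σ 0 v) (hp : FnFam σ 0 p)
    (hw : FnFam σ 0 w) (hw' : FnFam σ 0 w') {ρ : ℝ} (hρ : |ρ| < σ) (θ s : ℝ) :
    PS (fun a b => residual ℓ κ τ v p w w' a b s) ρ θ =
      (ℓ * (1 - κ s * ρ * Real.cos θ) : ℝ) * PS (fun a b => (4 * a * b : ℂ) * v a b s) ρ θ +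
      PS (fun a b => (4 * a * b : ℂ) * p a b s) ρ θ -
      (ℓ * κ s * ρ : ℝ) * (em 1 θ * PS (fun a b => (b : ℂ) * v a b s) ρ θ +
        em (-1) θ * PS (fun a b => (a : ℂ) * v a b s) ρ θ) +
      (ρ ^ 2 : ℝ) * (PS (fun a b => w' a b s) ρ θ -
        (ℓ * τ s : ℝ) * PS (fun a b => angular w a b s) ρ θ) := by
  have n := (hv.absConv s).natMul
  have np := (hp.absConv s).natMul
  have m := (((hv.absConv s).const_mul ℓ).add (hp.absConv s)).natMul
  have hW := (hw'.absConv s).sub ((hw.angular.absConv s).const_mul (ℓ * τ s))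
  have c1 := (n.2.2.shz.add n.2.2.shw).const_mul (ℓ * κ s / 2 : ℂ)
  have c2 := (n.2.1.shz.add n.1.shw).const_mul (ℓ * κ s : ℂ)
  unfold residual
  rw [PS_add ((m.2.2.sub c1).sub c2) hW.shw.shz hρ, PS_sub (m.2.2.sub c1) c2 hρ, PS_sub m.2.2 c1 hρ,
    PS_mul_left, PS_mul_left, PS_add n.2.2.shz n.2.2.shw hρ, PS_add n.2.1.shz n.1.shw hρ,
    PS_shz, PS_shz, PS_shz, PS_shw, PS_shw, PS_shw, PS_sub (hw'.absConv s)
    ((hw.angular.absConv s).const_mul (ℓ * τ s)) hρ, PS_mul_left]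
  have e1 : PS (fun a b => (4 * a * b : ℂ) * (ℓ * v a b s + p a b s)) ρ θ =
      ℓ * PS (fun a b => (4 * a * b : ℂ) * v a b s) ρ θ +
      PS (fun a b => (4 * a * b : ℂ) * p a b s) ρ θ := by
    rw [← PS_mul_left, ← PS_add (n.2.2.const_mul _) np.2.2 hρ]
    exact PS_congr (fun a b => by ring) ρ θ
  rw [e1, em_one_eq, em_neg_one_eq]
  push_cast
  have hsc := Real.sin_sq_add_cos_sq θ
  have hsc' : (Complex.sin θ) ^ 2 + (Complex.cos θ) ^ 2 = 1 := Complex.sin_sq_add_cos_sq _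
  linear_combination ((ρ : ℂ) ^ 2 * (PS (fun a b => w' a b s) ρ θ -
        (ℓ * τ s) * PS (fun a b => angular w a b s) ρ θ)) * (hsc' -
        Complex.sin θ ^ 2 * Complex.I_sq)

/-- The identity `(a + b)² - (a - b)² = 4ab`, that is, `ρ²Δ_⊥ = 4zw ∂_z∂_w`. -/
lemma PS_radial_angular {v : ℕ → ℕ → ℝ → ℂ} (hv : FnFam σ 0 v) {ρ : ℝ} (hρ : |ρ| < σ) (θ s : ℝ) :
    RS (radial (radial v)) ρ θ s + RS (angular (angular v)) ρ θ s =
      (PS (fun a b => (4 * a * b : ℂ) * v a b s) ρ θ).re := by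
  unfold RS GS
  rw [← Complex.add_re, ← PS_add (hv.radial.radial.absConv s) (hv.angular.angular.absConv s) hρ]
  congr 1
  refine PS_congr (fun a b => ?_) ρ θ
  simp only [radial, angular]
  push_cast
  linear_combination ((a : ℂ) - b) ^ 2 * v a b s * Complex.I_sq

/-- Both sides are `ρ ∂_x = ρ(∂_z + ∂_w)`, with `z∂_z` and `w∂_w` acting on the coefficients as
multiplication by `a` and by `b`. -/
lemma cos_sin_radial_angular {v : ℕ → ℕ → ℝ → ℂ} (hv : FnFam σ 0 v) {ρ : ℝ} (hρ : |ρ| < σ)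
    (θ s : ℝ) :
    Real.cos θ * RS (radial v) ρ θ s - Real.sin θ * RS (angular v) ρ θ s =
      (em 1 θ * PS (fun a b => (b : ℂ) * v a b s) ρ θ +
        em (-1) θ * PS (fun a b => (a : ℂ) * v a b s) ρ θ).re := by
  have n := (hv.absConv s).natMul
  have e1 : GS (radial v) (ρ, θ, s) = PS (fun a b => (a : ℂ) * v a b s) ρ θ +
      PS (fun a b => (b : ℂ) * v a b s) ρ θ := by
    rw [← PS_add n.1 n.2.1 hρ]
    exact PS_congr (fun a b => by simp only [radial]; push_cast; ring) ρ θ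
  have e2 : GS (angular v) (ρ, θ, s) = Complex.I * (PS (fun a b => (a : ℂ) * v a b s) ρ θ -
      PS (fun a b => (b : ℂ) * v a b s) ρ θ) := by
    rw [← PS_sub n.1 n.2.1 hρ, ← PS_mul_left]
    exact PS_congr (fun a b => by simp only [angular]; push_cast; ring) ρ θ
  unfold RS
  rw [← Complex.re_ofReal_mul, ← Complex.re_ofReal_mul, ← Complex.sub_re, e1, e2, em_one_eq,
    em_neg_one_eq]
  congr 1
  ring

/-- The equation times `ρ √g` is the real part of the residual. -/
lemma FluxData.equation_eq {ℓ : ℝ} {r₀ : ℝ → E3} {B₀ : ℝ → ℝ} {φ : ℝ → ℝ → ℝ → ℝ}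
    {v' : ℕ → ℕ → ℝ → ℂ} (h : FluxData σ r₀ ℓ B₀ φ v v' w w') {D : ℕ} {K : ℝ} (hp : FnFam σ 0 p)
    (hψ : ∀ ρ θ s, 0 < ρ → ρ < σ → Preg D K r₀ φ ρ θ s = RS p ρ θ s) {ρ : ℝ} (hρ : 0 < ρ)
    (hρσ : ρ < σ) (θ s : ℝ) :
    ρ * (sqrtG r₀ ρ θ s * (divg r₀ (grad r₀ φ) ρ θ s +
      ρ / sqrtG r₀ ρ θ s * lapPerp (Preg D K r₀ φ) ρ θ s + divg r₀ (Btilde r₀ B₀) ρ θ s)) =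
    (PS (fun a b => residual ℓ (curvature r₀) (torsion r₀) v p w w' a b s) ρ θ).re := by
  have hρa : |ρ| < σ := by rwa [abs_of_pos hρ]
  have hg := (h.sqrtG_pos hρ hρσ θ s).ne'
  have e : ρ * (sqrtG r₀ ρ θ s * (divg r₀ (grad r₀ φ) ρ θ s +
      ρ / sqrtG r₀ ρ θ s * lapPerp (Preg D K r₀ φ) ρ θ s + divg r₀ (Btilde r₀ B₀) ρ θ s)) =
      ρ * (sqrtG r₀ ρ θ s * (divg r₀ (grad r₀ φ) ρ θ s + divg r₀ (Btilde r₀ B₀) ρ θ s)) +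
      ρ ^ 2 * lapPerp (Preg D K r₀ φ) ρ θ s := by
    field_simp
    ring
  rw [e, h.divg_total hρ hρσ, sq_mul_lapPerp hp hψ hρ hρσ, PS_radial_angular h.fam_v hρa,
    PS_radial_angular hp hρa, cos_sin_radial_angular h.fam_v hρa,
    PS_residual ℓ _ _ h.fam_v hp h.fam_w h.fam_w' hρa]
  simp only [Complex.add_re, Complex.sub_re, Complex.re_ofReal_mul]
  unfold hs RS GS
  rw [h.speed_eq]
  simp only []
  ring

end Residual

end NearAxis
end

/-! ### Growth classes, the flux equation, and the Fourier coefficients of the residual -/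

noncomputable section

namespace NearAxis

open Hs

/-! ### Families of geometric growth -/

/-- `‖u_{ab}‖` is bounded by a polynomial times `σ^{-(a+b)}`. -/
def Grow (σ : ℝ) {r : ℕ} (u : ℕ → ℕ → Hs r) : Prop :=
  ∃ (M : ℝ) (p : ℕ), 0 ≤ M ∧ ∀ a b, ‖u a b‖ ≤ M * (1 + a + b) ^ p * σ⁻¹ ^ (a + b)

lemma maj_geometric {σ : ℝ} (hσ : 0 < σ) : Maj σ (fun a b => σ⁻¹ ^ (a + b)) := fun x hx hxs => by
  have h : Summable fun n : ℕ => (σ⁻¹ * x) ^ n :=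
    summable_geometric_of_lt_one (by positivity) (by rwa [inv_mul_lt_iff₀ hσ, mul_one])
  refine (h.mul_of_nonneg h (fun n => by positivity) fun n => by positivity).congr fun p => ?_
  rw [← pow_add, mul_pow]

lemma maj_poly_geometric {σ : ℝ} (hσ : 0 < σ) (p : ℕ) :
    Maj σ (fun a b => (1 + a + b : ℝ) ^ p * σ⁻¹ ^ (a + b)) := by
  have h := maj_geometric hσ
  refine ((h.add (h.pow_mul (fun a b => by positivity) p)).const_mul (2 ^ p)).mono
    (fun a b => by positivity) fun a b => ?_
  have h1 : (1 + a + b : ℝ) ^ p ≤ 2 ^ p * (1 + ((a + b : ℕ) : ℝ) ^ p) := by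
    push_cast
    have hab : (0 : ℝ) ≤ a + b := by positivity
    rcases le_total (a + b : ℝ) 1 with h | h
    · calc (1 + a + b : ℝ) ^ p ≤ 2 ^ p := pow_le_pow_left₀ (by positivity) (by linarith) p
        _ ≤ _ := le_mul_of_one_le_right (by positivity) (by linarith [pow_nonneg hab p])
    · calc (1 + a + b : ℝ) ^ p ≤ (2 * (a + b)) ^ p := pow_le_pow_left₀ (by positivity) (by linarith) p
        _ = 2 ^ p * (a + b : ℝ) ^ p := mul_pow _ _ _
        _ ≤ _ := by gcongr; linarith
  calc _ ≤ 2 ^ p * (1 + ((a + b : ℕ) : ℝ) ^ p) * σ⁻¹ ^ (a + b) :=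
        mul_le_mul_of_nonneg_right h1 (by positivity)
    _ = _ := by ring

namespace Grow

variable {σ : ℝ} {r : ℕ} {u v : ℕ → ℕ → Hs r}

lemma maj (h : Grow σ u) (hσ : 0 < σ) : Maj σ (fun a b => ‖u a b‖) := by
  obtain ⟨M, p, hM, hu⟩ := h
  refine ((maj_poly_geometric hσ p).const_mul M).mono (fun _ _ => norm_nonneg _) fun a b => ?_
  rw [← mul_assoc]; exact hu a b

lemma rawFam {u : ℕ → ℕ → Hs (r + 1)} (h : Grow σ u) (hσ : 0 < σ) :
    RawFam σ r (fun a b j => u a b j) :=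
  ⟨_, (h.maj hσ).const_mul embC, fun _ _ => ⟨summable_weight _, tsum_weight_le _⟩⟩

lemma of_le {r' : ℕ} {w : ℕ → ℕ → Hs r'} (h : Grow σ u) (hσ : 0 < σ) {C : ℝ} {p : ℕ} (hC : 0 ≤ C)
    (hw : ∀ a b, ‖w a b‖ ≤ C * (1 + a + b) ^ p * ‖u a b‖) : Grow σ w := by
  obtain ⟨M, p', hM, hu⟩ := h
  refine ⟨C * M, p + p', by positivity, fun a b => (hw a b).trans ?_⟩
  calc _ ≤ C * (1 + a + b) ^ p * (M * (1 + a + b) ^ p' * σ⁻¹ ^ (a + b)) :=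
        mul_le_mul_of_nonneg_left (hu a b) (by positivity)
    _ = _ := by ring

lemma add (hu : Grow σ u) (hv : Grow σ v) (hσ : 0 < σ) : Grow σ (fun a b => u a b + v a b) := by
  obtain ⟨M, p, hM, hu⟩ := hu
  obtain ⟨M', p', hM', hv⟩ := hv
  refine ⟨M + M', p + p', by positivity, fun a b => (norm_add_le _ _).trans ?_⟩
  have h1 : (1 : ℝ) ≤ 1 + a + b := by linarith [Nat.cast_nonneg (α := ℝ) a, Nat.cast_nonneg (α := ℝ) b]
  have e1 : (1 + a + b : ℝ) ^ p ≤ (1 + a + b) ^ (p + p') := pow_le_pow_right₀ h1 (by omega)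
  have e2 : (1 + a + b : ℝ) ^ p' ≤ (1 + a + b) ^ (p + p') := pow_le_pow_right₀ h1 (by omega)
  calc _ ≤ M * (1 + a + b) ^ p * σ⁻¹ ^ (a + b) + M' * (1 + a + b) ^ p' * σ⁻¹ ^ (a + b) :=
        add_le_add (hu a b) (hv a b)
    _ ≤ M * (1 + a + b) ^ (p + p') * σ⁻¹ ^ (a + b) + M' * (1 + a + b) ^ (p + p') * σ⁻¹ ^ (a + b) := by
        gcongr
    _ = _ := by ring

lemma mulL (h : Grow σ u) (hσ : 0 < σ) (κ : Hs r) : Grow σ (fun a b => Hs.mulL r κ (u a b)) :=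
  h.of_le hσ (C := algC r * ‖κ‖) (p := 0) (mul_nonneg (algC_nonneg r) (norm_nonneg _)) fun a b => by
    rw [pow_zero, mul_one]; exact norm_mulL_le _ _

lemma multL {r' : ℕ} {d : ℤ → ℂ} {C : ℝ} (h : Grow σ u) (hσ : 0 < σ) (hd : MultBound d r r' C) :
    Grow σ (fun a b => Hs.multL d r r' (u a b)) :=
  h.of_le hσ (C := C) (p := 0) hd.1 fun a b => by
    rw [pow_zero, mul_one]; exact hd.norm_le _

lemma divh {X Y : ℕ → ℕ → Hs r} {κ : Hs r} (hY : Grow σ Y) (h : IsDivh κ Y X) (hσ : 0 < σ)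
    (hκ : 2 * (algC r * ‖κ‖) ≤ σ⁻¹) : Grow σ X := by
  obtain ⟨M, p, hM, hu⟩ := hY
  exact ⟨2 * M, p, by positivity, fun a b =>
    h.bound hM (inv_pos.2 hσ) hκ (n := a + b) (fun a b _ => hu a b) a b le_rfl⟩

end Grow

/-- The recursion of `IsDivh` is multiplication by `1 - κ(z + w)/2` read coefficientwise, and `z + w
= 2ρ cos θ`. -/
lemma PS_of_isDivh {σ : ℝ} {r : ℕ} (hr : 1 ≤ r) {κ : Hs r} {Y X : ℕ → ℕ → Hs r}
    (h : IsDivh κ Y X) {s k : ℝ} (hκ : evs κ s = k) (hX : AbsConv σ (fun a b => evs (X a b) s))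
    (hY : AbsConv σ (fun a b => evs (Y a b) s)) {ρ : ℝ} (hρ : |ρ| < σ) (θ : ℝ) :
    (1 - k * ρ * Real.cos θ : ℝ) * PS (fun a b => evs (X a b) s) ρ θ =
      PS (fun a b => evs (Y a b) s) ρ θ := by
  have hsz : ∀ a b, evs (shz X a b : Hs r) s = shz (fun a b => evs (X a b) s) a b := by
    intro a b
    rcases a with _ | a
    · simp [shz, evs, Hs.zero_apply]
    · rfl
  have hsw : ∀ a b, evs (shw X a b : Hs r) s = shw (fun a b => evs (X a b) s) a b := by
    intro a b
    rcases b with _ | b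
    · simp [shw, evs, Hs.zero_apply]
    · rfl
  have e : ∀ a b, evs (X a b) s = evs (Y a b) s +
      (k / 2 : ℂ) * (shz (fun a b => evs (X a b) s) a b + shw (fun a b => evs (X a b) s) a b) := by
    intro a b
    conv_lhs => rw [h a b]
    rw [← hsz, ← hsw, ← evs_add (summable_norm_pos hr _) (summable_norm_pos hr _), ← hκ]
    have e1 : evs (Y a b + (1 / 2 : ℂ) • mulL r κ (shz X a b + shw X a b) : Hs r) s =
        evs (fun j => Y a b j + (1 / 2) * conv κ (shz X a b + shw X a b : Hs r) j) s := by
      refine congrFun (evs_congr fun j => ?_) s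
      rw [Hs.add_apply, Hs.smul_apply, mulL_apply hr]
    have hc : Summable fun j => ‖(1 / 2 : ℂ) * conv κ (shz X a b + shw X a b : Hs r) j‖ := by
      have := (summable_norm_pos hr (mulL r κ (shz X a b + shw X a b))).mul_left (1 / 2)
      refine this.congr fun j => ?_
      rw [norm_mul, mulL_apply hr]
      norm_num
    rw [e1, evs_add (summable_norm_pos hr _) hc, evs_mul_left,
      evs_conv (summable_norm_pos hr _) (summable_norm_pos hr _)]
    have e2 : evs (shz X a b + shw X a b : Hs r) s = evs (fun j => shz X a b j + shw X a b j) s :=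
      congrFun (evs_congr fun j => by rw [Hs.add_apply]) s
    rw [e2]
    ring
  have hp : PS (fun a b => evs (X a b) s) ρ θ = PS (fun a b => evs (Y a b) s +
      (k / 2 : ℂ) * (shz (fun a b => evs (X a b) s) a b + shw (fun a b => evs (X a b) s) a b)) ρ θ :=
    PS_congr e ρ θ
  rw [PS_add hY ((hX.shz.add hX.shw).const_mul _) hρ, PS_mul_left, PS_add hX.shz hX.shw hρ, PS_shz,
    PS_shw] at hp
  have h1 := em_one_add θ
  push_cast at h1 ⊢
  linear_combination hp + (k / 2 * ρ * PS (fun a b => evs (X a b) s) ρ θ) * h1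

section Recursion

variable {q D : ℕ} {K ℓ : ℝ} {κ τ B : Hs (q + 1)} {u : ℕ → ℕ → Hs (q + 2 * D)}
  {J : ℕ → ℕ → Hs (q + 1)} {σ : ℝ}

lemma Grow.fluxY (hD : 1 ≤ D) (hu : Grow σ u) (hσ : 0 < σ) :
    Grow σ (fun a b => NearAxis.fluxY q D ℓ τ B a b (u a b)) := by
  have hB : Grow σ (fun a b => if a + b = 0 then B else 0 : ℕ → ℕ → Hs (q + 1)) := by
    refine ⟨‖B‖, 0, norm_nonneg _, fun a b => ?_⟩
    show ‖(if a + b = 0 then B else 0 : Hs (q + 1))‖ ≤ _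
    split_ifs with h
    · simp [h]
    · rw [norm_zero]; positivity
  have h1 := (hu.multL hσ (multBound_deriv (r := q + 2 * D) (r' := q + 1) (i := 1) (by omega))).of_le
    (w := fun a b => (ℓ : ℂ)⁻¹ • derivL 1 (q + 2 * D) (q + 1) (u a b)) hσ
    (C := ‖(ℓ : ℂ)⁻¹‖) (p := 0) (norm_nonneg _) fun a b => by
      rw [pow_zero, mul_one, norm_smul]
  have h2 := ((hu.multL hσ (multBound_one (r := q + 2 * D) (r' := q + 1) (by omega))).mulL hσ τ).of_le
    (w := fun a b => (-(Complex.I * ((a - b : ℤ) : ℂ))) • Hs.mulL (q + 1) τ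
      (incl (q + 2 * D) (q + 1) (u a b))) hσ (C := 1) (p := 1) zero_le_one fun a b => by
      rw [norm_smul, norm_neg]
      refine mul_le_mul_of_nonneg_right ((norm_sub_le_natCast a b).trans ?_) (norm_nonneg _)
      push_cast; linarith
  refine ((hB.add h1 hσ).add h2 hσ).of_le hσ (C := 1) (p := 0) zero_le_one fun a b => ?_
  rw [pow_zero, one_mul, one_mul]
  unfold NearAxis.fluxY
  rw [neg_smul, ← sub_eq_add_neg]

lemma evs_fluxY (hq : 1 ≤ q) (hD : 1 ≤ D) {s t β : ℝ} (hτ : evs τ s = t) (hB : evs B s = β)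
    (a b : ℕ) (u : Hs (q + 2 * D)) :
    evs (NearAxis.fluxY q D ℓ τ B a b u) s = (if a + b = 0 then (β : ℂ) else 0) +
      (ℓ : ℂ)⁻¹ * evs (fun j => Complex.I * j * u j) s -
      (t : ℂ) * (Complex.I * (((a : ℤ) - b : ℤ) : ℂ) * evs u s) := by
  have hQ : 1 ≤ q + 1 := by omega
  set v : Hs (q + 1) := incl (q + 2 * D) (q + 1) u with hv
  have h1 : Summable fun j => ‖(if a + b = 0 then B else 0 : Hs (q + 1)) j‖ := summable_norm_pos hQ _
  have hd : ∀ j, (derivL 1 (q + 2 * D) (q + 1) u : Hs (q + 1)) j = Complex.I * j * u j := fun j => by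
    rw [(multBound_deriv (by omega)).multL_apply, pow_one]
  have h2 : Summable fun j => ‖(ℓ : ℂ)⁻¹ * (derivL 1 (q + 2 * D) (q + 1) u : Hs (q + 1)) j‖ := by
    simp only [norm_mul]
    exact (summable_norm_pos hQ _).mul_left _
  have h3 : Summable fun j => ‖-(Complex.I * ((a - b : ℤ) : ℂ)) * mulL (q + 1) τ v j‖ := by
    simp only [norm_mul]
    exact (summable_norm_pos hQ _).mul_left _
  have e : evs (NearAxis.fluxY q D ℓ τ B a b u) s = evs (fun j =>
      ((if a + b = 0 then B else 0 : Hs (q + 1)) j +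
      (ℓ : ℂ)⁻¹ * (derivL 1 (q + 2 * D) (q + 1) u : Hs (q + 1)) j) +
      -(Complex.I * ((a - b : ℤ) : ℂ)) * mulL (q + 1) τ v j) s := by
    refine congrFun (evs_congr fun j => ?_) s
    unfold NearAxis.fluxY
    rw [Hs.sub_apply, Hs.add_apply, Hs.smul_apply, Hs.smul_apply]
    ring
  have h12 : Summable fun j => ‖(if a + b = 0 then B else 0 : Hs (q + 1)) j +
      (ℓ : ℂ)⁻¹ * (derivL 1 (q + 2 * D) (q + 1) u : Hs (q + 1)) j‖ :=
    Summable.of_nonneg_of_le (fun _ => norm_nonneg _) (fun _ => norm_add_le _ _) (h1.add h2)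
  rw [e, evs_add h12 h3, evs_add h1 h2, evs_mul_left, evs_mul_left,
    evs_congr (mulL_apply hQ τ v), evs_conv (summable_norm_pos hQ _) (summable_norm_pos hQ _), hτ,
    evs_congr hd, evs_congr (incl_apply (by omega) u)]
  have eB : evs (if a + b = 0 then B else 0 : Hs (q + 1)) s = if a + b = 0 then (β : ℂ) else 0 := by
    split_ifs
    · exact hB
    · simp [evs, Hs.zero_apply]
  rw [eB]
  push_cast
  ring

/-- The flux equation. -/
lemma flux_eq (hq : 1 ≤ q) (hD : 1 ≤ D) (hℓ : 0 < ℓ) (hσ : 0 < σ) (hu : Grow σ u) (hJ : Grow σ J)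
    (h : IsDivh κ (fun a b => fluxY q D ℓ τ B a b (u a b)) J) {s k t β : ℝ} (hκ : evs κ s = k)
    (hτ : evs τ s = t) (hB : evs B s = β) {ρ : ℝ} (hρ : |ρ| < σ) (θ : ℝ) :
    (ℓ * (1 - k * ρ * Real.cos θ) : ℝ) * PS (fun a b => ev (fun a b => J a b) a b s) ρ θ =
      PS (fun a b => ev (dsc fun a b => u a b) a b s) ρ θ -
      (ℓ * t : ℝ) * PS (fun a b => angular (ev fun a b => u a b) a b s) ρ θ + (ℓ * β : ℝ) := by
  have hJ' := ((hJ.rawFam hσ).fnFam).absConv s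
  have hY' := (((hu.fluxY (ℓ := ℓ) (τ := τ) (B := B) hD hσ).rawFam hσ).fnFam).absConv s
  have hu1 : RawFam σ 1 (fun a b j => u a b j) := by
    obtain ⟨D, rfl⟩ := Nat.exists_eq_add_of_le' hD
    exact (Grow.rawFam (r := q + 2 * D + 1) hu hσ).mono (by omega)
  have h0 := hu1.fnFam.pred
  have hd := (hu1.deriv.fnFam).absConv s
  have ha := h0.angular.absConv s
  have key := PS_of_isDivh (by omega) h hκ hJ' hY' hρ θ
  have hδ : AbsConv σ (fun a b => if a + b = 0 then (β : ℂ) else 0) := fun x hx hxs => by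
    refine summable_of_ne_finset_zero (s := {(0, 0)}) fun p hp => ?_
    have : ¬ (p.1 + p.2 = 0) := fun h => hp (by
      rw [Finset.mem_singleton]; exact Prod.ext (by simp only; omega) (by simp only; omega))
    simp only [if_neg this, norm_zero, zero_mul]
  have eδ : PS (fun a b => if a + b = 0 then (β : ℂ) else 0) ρ θ = β := by
    unfold PS
    rw [tsum_eq_single (0, 0)]
    · simp [em_zero]
    · intro p hp
      have : ¬ (p.1 + p.2 = 0) := fun h => hp (Prod.ext (by simp only; omega) (by simp only; omega))
      simp only [if_neg this, zero_mul]
  have e : PS (fun a b => evs (fluxY q D ℓ τ B a b (u a b)) s) ρ θ = β +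
      (ℓ : ℂ)⁻¹ * PS (fun a b => ev (dsc fun a b => u a b) a b s) ρ θ -
      t * PS (fun a b => angular (ev fun a b => u a b) a b s) ρ θ := by
    rw [← eδ, ← PS_mul_left, ← PS_mul_left, ← PS_add hδ (hd.const_mul _) hρ,
      ← PS_sub (hδ.add (hd.const_mul _)) (ha.const_mul _) hρ]
    exact PS_congr (fun a b => evs_fluxY hq hD hτ hB a b (u a b)) ρ θ
  rw [e] at key
  have hℓ' : (ℓ : ℂ) ≠ 0 := by exact_mod_cast hℓ.ne'
  push_cast at key ⊢
  change (ℓ : ℂ) * (1 - k * ρ * Complex.cos θ) * PS (fun a b => evs (J a b) s) ρ θ = _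
  rw [mul_assoc, key]
  field_simp
  ring

/-- The Fourier coefficients of the residual. -/
def residualSeq (D : ℕ) (K ℓ : ℝ) (κ τ : Hs (q + 1)) (u : ℕ → ℕ → Hs (q + 2 * D))
    (J : ℕ → ℕ → Hs (q + 1)) (a b : ℕ) (j : ℤ) : ℂ :=
  (4 * (a + 1) * (b + 1) : ℂ) * ((ellSym D K ℓ (a - b) j : ℝ) * u (a + 1) (b + 1) j)
  - ℓ * mulL (q + 1) κ (((2 * a + 1) * (b + 1) : ℂ) • incl (q + 2 * D) (q + 1) (u a (b + 1)) +
          ((a + 1) * (2 * b + 1) : ℂ) • incl (q + 2 * D) (q + 1) (u (a + 1) b)) j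
  + Complex.I * j * J a b j
  - ℓ * (Complex.I * ((a - b : ℤ) : ℂ)) * mulL (q + 1) τ (J a b) j

/-- Multiplication by `ellSym` undoes the resolvents in `stepU`. It never vanishes because `ℓ > 0`,
so nothing is lost in either direction. -/
lemma residualSeq_eq_zero_iff (hD : 1 ≤ D) (hK : 0 < K) (hℓ : 0 < ℓ) (a b : ℕ) :
    (∀ j, residualSeq D K ℓ κ τ u J a b j = 0) ↔
      u (a + 1) (b + 1) = stepU q D K ℓ κ τ a b (u a (b + 1)) (u (a + 1) b) (J a b) := by
  have hab : (4 * (a + 1) * (b + 1) : ℂ) ≠ 0 := by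
    have : (4 * (a + 1) * (b + 1) : ℝ) ≠ 0 := by positivity
    exact_mod_cast this
  have key : ∀ j, residualSeq D K ℓ κ τ u J a b j =
      (4 * (a + 1) * (b + 1) : ℂ) * (ellSym D K ℓ (a - b) j : ℝ) * (u (a + 1) (b + 1) j -
        stepU q D K ℓ κ τ a b (u a (b + 1)) (u (a + 1) b) (J a b) j) := by
    intro j
    have he : ((ellSym D K ℓ (a - b) j : ℝ) : ℂ) ≠ 0 := by
      exact_mod_cast (ellSym_pos D K hℓ _ j).ne'
    unfold residualSeq stepU
    rw [Hs.smul_apply, Hs.add_apply, Hs.sub_apply, Hs.smul_apply, Hs.smul_apply,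
      resL_apply hD hK hℓ (isNum_one _), resL_apply hD hK hℓ (isNum_j _),
      resL_apply hD hK hℓ (isNum_k _)]
    field_simp
    ring
  constructor
  · intro h
    ext j
    have := h j
    rw [key j] at this
    have he : ((ellSym D K ℓ (a - b) j : ℝ) : ℂ) ≠ 0 := by
      exact_mod_cast (ellSym_pos D K hℓ _ j).ne'
    exact sub_eq_zero.1 ((mul_eq_zero.1 this).resolve_left (mul_ne_zero hab he))
  · intro h j
    rw [key j, ← h, sub_self, mul_zero]

/-- On the edges every term carries a vanishing factor or a shifted index. The equation imposes
nothing there, and so these coefficients are free data. -/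
lemma residual_edge {p v w w' : ℕ → ℕ → ℝ → ℂ} {k t : ℝ → ℝ} {a b : ℕ} (hab : a = 0 ∨ b = 0) (s : ℝ) :
    residual ℓ k t v p w w' a b s = 0 := by
  unfold residual
  rcases hab with rfl | rfl
  · rcases b with _ | b <;> simp [shz, shw]
  · rcases a with _ | a <;> simp [shz, shw]

/-- Passing from square summable to absolutely summable coefficients costs one weight. What remains
is at least `2 * D`, enough to apply `P` classically. -/
lemma Grow.rawFam_pred (hq : 1 ≤ q) (hσ : 0 < σ) (hu : Grow σ u) :
    RawFam σ (q - 1 + 2 * D) (fun a b j => u a b j) := by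
  obtain ⟨q, rfl⟩ := Nat.exists_eq_add_of_le' hq
  have : q + 1 + 2 * D = q + 2 * D + 1 := by ring
  have h2 : ∀ n (e : n = q + 2 * D + 1) (u : ℕ → ℕ → Hs n), Grow σ u →
      RawFam σ (q + 2 * D) (fun a b j => u a b j) := by
    rintro n rfl u hu
    exact hu.rawFam hσ
  simpa using h2 _ this u hu

/-- This is the origin of the weights in `stepU`. At the coefficient of `z^{a+1}w^{b+1}` the
Laplacian part contributes `2a(b+1)` and the derivative of `h_s` contributes `b+1`, together
`(2a+1)(b+1)`; symmetrically in `a` and `b`. The shift by `(1, 1)` leaves the poloidal number `a -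
b` unchanged. -/
lemma residual_eq_evs (hq : 1 ≤ q) (hD : 1 ≤ D) (hσ : 0 < σ) (hu : Grow σ u) (hJ : Grow σ J)
    {k t : ℝ → ℝ} (hκ : ∀ s, evs κ s = k s) (hτ : ∀ s, evs τ s = t s) (a b : ℕ) :
    (Summable fun j => ‖residualSeq D K ℓ κ τ u J a b j‖) ∧ ∀ s,
    residual ℓ k t (ev fun a b => u a b) (ev fun a b j => pSym D K a b j * u a b j)
      (ev fun a b => J a b) (ev (dsc fun a b => J a b)) (a + 1) (b + 1) s =
      evs (residualSeq D K ℓ κ τ u J a b) s := by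
  have hQ : 1 ≤ q + 1 := by omega
  have hR := hu.rawFam_pred hq hσ
  have hP := hR.preg K
  have hJ1 := (hJ.rawFam hσ).mono hq
  set X : Hs (q + 1) := ((2 * a + 1) * (b + 1) : ℂ) • incl (q + 2 * D) (q + 1) (u a (b + 1)) +
          ((a + 1) * (2 * b + 1) : ℂ) • incl (q + 2 * D) (q + 1) (u (a + 1) b) with hX
  have sU : ∀ a b, Summable fun j => ‖u a b j‖ := fun a b => summable_norm_pos (by omega) _
  have s1 : Summable fun j => ‖(4 * (a + 1) * (b + 1) : ℂ) * (ℓ * u (a + 1) (b + 1) j +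
      pSym D K (a + 1) (b + 1) j * u (a + 1) (b + 1) j)‖ := by
    simp only [norm_mul (4 * (a + 1) * (b + 1) : ℂ)]
    refine Summable.mul_left _ (Summable.of_nonneg_of_le (fun _ => norm_nonneg _)
      (fun _ => norm_add_le _ _) (Summable.add ?_ (hP.summable_norm _ _)))
    simp only [norm_mul]
    exact (sU _ _).mul_left _
  have s2 : Summable fun j => ‖-(ℓ : ℂ) * mulL (q + 1) κ X j‖ := by
    simp only [norm_mul]
    exact (summable_norm_pos hQ _).mul_left _
  have s3 : Summable fun j : ℤ => ‖Complex.I * j * J a b j‖ := hJ1.deriv.summable_norm a b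
  have s4 : Summable fun j => ‖-(ℓ * (Complex.I * ((a - b : ℤ) : ℂ))) * mulL (q + 1) τ (J a b) j‖ := by
    simp only [norm_mul]
    exact (summable_norm_pos hQ _).mul_left _
  have hseq : ∀ j, residualSeq D K ℓ κ τ u J a b j =
      (((4 * (a + 1) * (b + 1) : ℂ) * (ℓ * u (a + 1) (b + 1) j +
      pSym D K (a + 1) (b + 1) j * u (a + 1) (b + 1) j) + -(ℓ : ℂ) * mulL (q + 1) κ X j) +
      Complex.I * j * J a b j) + -(ℓ * (Complex.I * ((a - b : ℤ) : ℂ))) * mulL (q + 1) τ (J a b) j := by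
    intro j
    have : ((ellSym D K ℓ (a - b) j : ℝ) : ℂ) = ℓ + pSym D K (a + 1) (b + 1) j := by
      have : (((a + 1 : ℕ) : ℤ) - ((b + 1 : ℕ) : ℤ)) = a - b := by push_cast; ring
      unfold ellSym pSym
      rw [this]
      push_cast
      ring
    unfold residualSeq
    rw [this, ← hX]
    ring
  have s12 := Summable.of_nonneg_of_le (fun _ => norm_nonneg _) (fun _ => norm_add_le _ _) (s1.add s2)
  have s123 := Summable.of_nonneg_of_le (fun _ => norm_nonneg _) (fun _ => norm_add_le _ _) (s12.add s3)
  have s1234 := Summable.of_nonneg_of_le (fun _ => norm_nonneg _) (fun _ => norm_add_le _ _)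
    (s123.add s4)
  refine ⟨s1234.congr fun j => by rw [hseq j], fun s => ?_⟩
  have sX : evs X s = ((2 * a + 1) * (b + 1) : ℂ) * evs (u a (b + 1)) s +
      ((a + 1) * (2 * b + 1) : ℂ) * evs (u (a + 1) b) s := by
    rw [← evs_mul_left, ← evs_mul_left, ← evs_add]
    · refine congrFun (evs_congr fun j => ?_) s
      rw [hX, Hs.add_apply, Hs.smul_apply, Hs.smul_apply, incl_apply (by omega),
        incl_apply (by omega)]
    · simp only [norm_mul]; exact (sU _ _).mul_left _
    · simp only [norm_mul]; exact (sU _ _).mul_left _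
  rw [evs_congr hseq, evs_add s123 s4, evs_add s12 s3, evs_add s1 s2, evs_mul_left, evs_mul_left,
    evs_mul_left, evs_add (by simp only [norm_mul]; exact (sU _ _).mul_left _)
      (hP.summable_norm (a + 1) (b + 1)), evs_mul_left,
    evs_congr (mulL_apply hQ κ X), evs_conv (summable_norm_pos hQ _) (summable_norm_pos hQ _), hκ,
    evs_congr (mulL_apply hQ τ (J a b)), evs_conv (summable_norm_pos hQ _) (summable_norm_pos hQ _),
    hτ, sX]
  have ed : dsc (fun a b => (J a b : ℤ → ℂ)) a b = fun j => Complex.I * j * J a b j := rfl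
  simp only [residual, shz, shw, ev, angular, ed]
  push_cast
  ring

end Recursion

end NearAxis
end

/-! ### Calculus of uniform convergence of derivatives, and passage to Fourier coefficients -/

noncomputable section

namespace NearAxis

open Hs

/-! ### Convergence in `C^k` of periodic functions -/

/-- Uniform convergence of continuous periodic functions. -/
structure UnifConv {ι : Type*} (l : Filter ι) (f : ι → ℝ → ℝ) (g : ℝ → ℝ) : Prop where
  cont : ∀ i, Continuous (f i)
  periodic : ∀ i, Function.Periodic (f i) (2 * Real.pi)
  cont_lim : Continuous g
  periodic_lim : Function.Periodic g (2 * Real.pi)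
  unif : ∃ e : ι → ℝ, Tendsto e l (𝓝 0) ∧ ∀ᶠ i in l, ∀ s, |f i s - g s| ≤ e i

/-- Uniform convergence of periodic functions together with `k` derivatives. -/
def CkConv {ι : Type*} (l : Filter ι) : ℕ → (ι → ℝ → ℝ) → (ℝ → ℝ) → Prop
  | 0, f, g => UnifConv l f g
  | k + 1, f, g => UnifConv l f g ∧ ∃ (f' : ι → ℝ → ℝ) (g' : ℝ → ℝ),
      (∀ i s, HasDerivAt (f i) (f' i s) s) ∧ (∀ s, HasDerivAt g (g' s) s) ∧ CkConv l k f' g'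

lemma exists_bound_of_periodic {E : Type*} [NormedAddCommGroup E] {g : ℝ → E} (hg : Continuous g)
    (hp : Function.Periodic g (2 * Real.pi)) : ∃ C, 0 ≤ C ∧ ∀ s, ‖g s‖ ≤ C := by
  obtain ⟨C, hC⟩ := (isCompact_Icc (a := (0 : ℝ)) (b := 2 * Real.pi)).exists_bound_of_continuousOn
    hg.continuousOn
  have h2 : (0 : ℝ) < 2 * Real.pi := by positivity
  refine ⟨C, (norm_nonneg _).trans (hC 0 ⟨le_rfl, h2.le⟩), fun s => ?_⟩
  obtain ⟨y, hy, hys⟩ := hp.exists_mem_Ico₀ h2 s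
  rw [hys]
  exact hC y ⟨hy.1, hy.2.le⟩

lemma exists_lower_bound_of_periodic {g : ℝ → ℝ} (hg : Continuous g)
    (hp : Function.Periodic g (2 * Real.pi)) (h0 : ∀ s, 0 < g s) : ∃ c, 0 < c ∧ ∀ s, c ≤ g s := by
  have h2 : (0 : ℝ) < 2 * Real.pi := by positivity
  obtain ⟨x, -, hx⟩ := (isCompact_Icc (a := (0 : ℝ)) (b := 2 * Real.pi)).exists_isMinOn
    ⟨0, ⟨le_rfl, h2.le⟩⟩ hg.continuousOn
  refine ⟨g x, h0 x, fun s => ?_⟩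
  obtain ⟨y, hy, hys⟩ := hp.exists_mem_Ico₀ h2 s
  rw [hys]
  exact hx ⟨hy.1, hy.2.le⟩

namespace UnifConv

variable {ι : Type*} {l : Filter ι} {f₁ f₂ f : ι → ℝ → ℝ} {g₁ g₂ g : ℝ → ℝ}

lemma add (h₁ : UnifConv l f₁ g₁) (h₂ : UnifConv l f₂ g₂) :
    UnifConv l (fun i s => f₁ i s + f₂ i s) (fun s => g₁ s + g₂ s) := by
  refine ⟨fun i => (h₁.cont i).add (h₂.cont i), fun i => (h₁.periodic i).add (h₂.periodic i),
    h₁.cont_lim.add h₂.cont_lim, h₁.periodic_lim.add h₂.periodic_lim, ?_⟩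
  obtain ⟨e₁, t₁, b₁⟩ := h₁.unif
  obtain ⟨e₂, t₂, b₂⟩ := h₂.unif
  refine ⟨fun i => e₁ i + e₂ i, by simpa using t₁.add t₂, ?_⟩
  filter_upwards [b₁, b₂] with i h1 h2 s
  rw [add_sub_add_comm]
  exact (abs_add_le _ _).trans (add_le_add (h1 s) (h2 s))

lemma mul (h₁ : UnifConv l f₁ g₁) (h₂ : UnifConv l f₂ g₂) :
    UnifConv l (fun i s => f₁ i s * f₂ i s) (fun s => g₁ s * g₂ s) := by
  refine ⟨fun i => (h₁.cont i).mul (h₂.cont i), fun i => (h₁.periodic i).mul (h₂.periodic i),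
    h₁.cont_lim.mul h₂.cont_lim, h₁.periodic_lim.mul h₂.periodic_lim, ?_⟩
  obtain ⟨e₁, t₁, b₁⟩ := h₁.unif
  obtain ⟨e₂, t₂, b₂⟩ := h₂.unif
  obtain ⟨C₁, hC₁, c₁⟩ := exists_bound_of_periodic h₁.cont_lim h₁.periodic_lim
  obtain ⟨C₂, hC₂, c₂⟩ := exists_bound_of_periodic h₂.cont_lim h₂.periodic_lim
  refine ⟨fun i => e₁ i * e₂ i + e₁ i * C₂ + C₁ * e₂ i,
    by simpa using ((t₁.mul t₂).add (t₁.mul_const C₂)).add (t₂.const_mul C₁), ?_⟩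
  filter_upwards [b₁, b₂] with i h1 h2 s
  have e : f₁ i s * f₂ i s - g₁ s * g₂ s = (f₁ i s - g₁ s) * (f₂ i s - g₂ s) +
      (f₁ i s - g₁ s) * g₂ s + g₁ s * (f₂ i s - g₂ s) := by ring
  rw [e]
  have p1 := (abs_nonneg _).trans (h1 s)
  refine (abs_add_le _ _).trans (add_le_add ((abs_add_le _ _).trans (add_le_add ?_ ?_)) ?_) <;>
    rw [abs_mul]
  · exact mul_le_mul (h1 s) (h2 s) (abs_nonneg _) p1
  · exact mul_le_mul (h1 s) (c₂ s) (abs_nonneg _) p1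
  · exact mul_le_mul (c₁ s) (h2 s) (abs_nonneg _) hC₁

lemma const (c : ℝ) : UnifConv l (fun _ _ => c) (fun _ => c) :=
  ⟨fun _ => continuous_const, fun _ _ => rfl, continuous_const, fun _ => rfl,
    fun _ => 0, tendsto_const_nhds, Eventually.of_forall fun _ _ => by simp⟩

lemma exists_lower (h : UnifConv l f g) (h0 : ∀ s, 0 < g s) :
    ∃ c, 0 < c ∧ (∀ s, c ≤ g s) ∧ ∀ᶠ i in l, ∀ s, c ≤ f i s := by
  obtain ⟨c, hc, hcg⟩ := exists_lower_bound_of_periodic h.cont_lim h.periodic_lim h0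
  obtain ⟨e, t, b⟩ := h.unif
  refine ⟨c / 2, half_pos hc, fun s => (half_le_self hc.le).trans (hcg s), ?_⟩
  filter_upwards [b, t.eventually (gt_mem_nhds (half_pos hc))] with i h1 h2 s
  have := abs_le.1 ((h1 s).trans h2.le)
  linarith [hcg s, this.1]

lemma inv (h : UnifConv l f g) (hf : ∀ i s, 0 < f i s) (hg : ∀ s, 0 < g s) :
    UnifConv l (fun i s => (f i s)⁻¹) (fun s => (g s)⁻¹) := by
  refine ⟨fun i => (h.cont i).inv₀ fun s => (hf i s).ne', fun i s => by simp only [h.periodic i s],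
    h.cont_lim.inv₀ fun s => (hg s).ne', fun s => by simp only [h.periodic_lim s], ?_⟩
  obtain ⟨c, hc, c1, c2⟩ := h.exists_lower hg
  obtain ⟨e, t, b⟩ := h.unif
  refine ⟨fun i => e i * (c⁻¹ * c⁻¹), by simpa using t.mul_const (c⁻¹ * c⁻¹), ?_⟩
  filter_upwards [b, c2] with i h1 h2 s
  have e1 : (f i s)⁻¹ - (g s)⁻¹ = (g s - f i s) * ((f i s)⁻¹ * (g s)⁻¹) := by
    have := (hf i s).ne'; have := (hg s).ne'; field_simp
  have p1 := hf i s
  have p2 := hg s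
  rw [e1, abs_mul, abs_sub_comm, abs_of_pos (by positivity : 0 < (f i s)⁻¹ * (g s)⁻¹)]
  refine mul_le_mul (h1 s) ?_ (by positivity) ((abs_nonneg _).trans (h1 s))
  exact mul_le_mul (inv_anti₀ hc (h2 s)) (inv_anti₀ hc (c1 s)) (by positivity) (by positivity)

lemma sqrt (h : UnifConv l f g) (hf : ∀ i s, 0 < f i s) (hg : ∀ s, 0 < g s) :
    UnifConv l (fun i s => √(f i s)) (fun s => √(g s)) := by
  refine ⟨fun i => (h.cont i).sqrt, fun i s => by simp only [h.periodic i s], h.cont_lim.sqrt,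
    fun s => by simp only [h.periodic_lim s], ?_⟩
  obtain ⟨c, hc, c1⟩ := exists_lower_bound_of_periodic h.cont_lim h.periodic_lim hg
  obtain ⟨e, t, b⟩ := h.unif
  refine ⟨fun i => e i * (√c)⁻¹, by simpa using t.mul_const (√c)⁻¹, ?_⟩
  filter_upwards [b] with i h1 s
  have p1 : 0 < √(f i s) := Real.sqrt_pos.2 (hf i s)
  have p3 : 0 < √c := Real.sqrt_pos.2 hc
  have p2 : √c ≤ √(g s) := Real.sqrt_le_sqrt (c1 s)
  have e1 : |f i s - g s| = |√(f i s) - √(g s)| * (√(f i s) + √(g s)) := by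
    rw [← abs_of_pos (by linarith : 0 < √(f i s) + √(g s)), ← abs_mul]
    congr 1
    have h1 := Real.sq_sqrt (hf i s).le
    have h2 := Real.sq_sqrt (hg s).le
    linear_combination h2 - h1
  rw [← div_eq_mul_inv, le_div_iff₀ p3]
  refine le_trans ?_ (h1 s)
  rw [e1]
  exact mul_le_mul_of_nonneg_left (by linarith) (abs_nonneg _)

end UnifConv

namespace CkConv

variable {ι : Type*} {l : Filter ι} {k : ℕ} {f₁ f₂ f : ι → ℝ → ℝ} {g₁ g₂ g : ℝ → ℝ}

lemma zero (h : CkConv l k f g) : UnifConv l f g := by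
  cases k with
  | zero => exact h
  | succ k => exact h.1

lemma pred (h : CkConv l (k + 1) f g) : CkConv l k f g := by
  induction k generalizing f g with
  | zero => exact h.1
  | succ k ih =>
    obtain ⟨h0, f', g', d1, d2, h'⟩ := h
    exact ⟨h0, f', g', d1, d2, ih h'⟩

lemma of_le (h : CkConv l k f g) {k' : ℕ} (hk : k' ≤ k) : CkConv l k' f g := by
  induction k, hk using Nat.le_induction with
  | base => exact h
  | succ k _ ih => exact ih h.pred

lemma add (h₁ : CkConv l k f₁ g₁) (h₂ : CkConv l k f₂ g₂) :
    CkConv l k (fun i s => f₁ i s + f₂ i s) (fun s => g₁ s + g₂ s) := by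
  induction k generalizing f₁ f₂ g₁ g₂ with
  | zero => exact UnifConv.add h₁ h₂
  | succ k ih =>
    obtain ⟨a1, f1, g1, d1, e1, b1⟩ := h₁
    obtain ⟨a2, f2, g2, d2, e2, b2⟩ := h₂
    exact ⟨a1.add a2, _, _, fun i s => (d1 i s).add (d2 i s), fun s => (e1 s).add (e2 s), ih b1 b2⟩

lemma mul (h₁ : CkConv l k f₁ g₁) (h₂ : CkConv l k f₂ g₂) :
    CkConv l k (fun i s => f₁ i s * f₂ i s) (fun s => g₁ s * g₂ s) := by
  induction k generalizing f₁ f₂ g₁ g₂ with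
  | zero => exact UnifConv.mul h₁ h₂
  | succ k ih =>
    have p1 := h₁.pred
    have p2 := h₂.pred
    obtain ⟨a1, f1, g1, d1, e1, b1⟩ := h₁
    obtain ⟨a2, f2, g2, d2, e2, b2⟩ := h₂
    exact ⟨a1.mul a2, _, _, fun i s => (d1 i s).mul (d2 i s), fun s => (e1 s).mul (e2 s),
      (ih b1 p2).add (ih p1 b2)⟩

lemma const (c : ℝ) : CkConv l k (fun _ _ => c) (fun _ => c) := by
  induction k generalizing c with
  | zero => exact UnifConv.const c
  | succ k ih =>
    exact ⟨UnifConv.const c, _, _, fun i s => hasDerivAt_const _ _, fun s => hasDerivAt_const _ _,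
      ih 0⟩

lemma neg (h : CkConv l k f g) : CkConv l k (fun i s => -f i s) (fun s => -g s) := by
  simpa using (const (l := l) (k := k) (-1)).mul h

lemma sub (h₁ : CkConv l k f₁ g₁) (h₂ : CkConv l k f₂ g₂) :
    CkConv l k (fun i s => f₁ i s - f₂ i s) (fun s => g₁ s - g₂ s) := by
  simpa [sub_eq_add_neg] using h₁.add h₂.neg

lemma inv (h : CkConv l k f g) (hf : ∀ i s, 0 < f i s) (hg : ∀ s, 0 < g s) :
    CkConv l k (fun i s => (f i s)⁻¹) (fun s => (g s)⁻¹) := by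
  induction k with
  | zero => exact UnifConv.inv h hf hg
  | succ k ih =>
    have p := ih h.pred
    obtain ⟨a, f', g', d, e, b⟩ := h
    refine ⟨a.inv hf hg, fun i s => -(f' i s * ((f i s)⁻¹ * (f i s)⁻¹)),
      fun s => -(g' s * ((g s)⁻¹ * (g s)⁻¹)), fun i s => ?_, fun s => ?_, (b.mul (p.mul p)).neg⟩
    · refine ((d i s).fun_inv (hf i s).ne').congr_deriv ?_
      have := (hf i s).ne'; field_simp
    · refine ((e s).fun_inv (hg s).ne').congr_deriv ?_
      have := (hg s).ne'; field_simp

lemma sqrt (h : CkConv l k f g) (hf : ∀ i s, 0 < f i s) (hg : ∀ s, 0 < g s) :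
    CkConv l k (fun i s => √(f i s)) (fun s => √(g s)) := by
  induction k with
  | zero => exact UnifConv.sqrt h hf hg
  | succ k ih =>
    have p := (ih h.pred).inv (fun i s => Real.sqrt_pos.2 (hf i s)) (fun s => Real.sqrt_pos.2 (hg s))
    obtain ⟨a, f', g', d, e, b⟩ := h
    refine ⟨a.sqrt hf hg, fun i s => f' i s * (2⁻¹ * (√(f i s))⁻¹),
      fun s => g' s * (2⁻¹ * (√(g s))⁻¹), fun i s => ?_, fun s => ?_, b.mul ((const _).mul p)⟩
    · refine ((d i s).sqrt (hf i s).ne').congr_deriv ?_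
      have := (Real.sqrt_pos.2 (hf i s)).ne'; field_simp
    · refine ((e s).sqrt (hg s).ne').congr_deriv ?_
      have := (Real.sqrt_pos.2 (hg s)).ne'; field_simp

/-- The `k`-th derivatives. -/
lemma iteratedDeriv (h : CkConv l k f g) : ∃ (F : ι → ℝ → ℝ) (G : ℝ → ℝ), UnifConv l F G ∧
    (∀ i, ContDiff ℝ k (fun s => (f i s : ℂ)) ∧
      iteratedDeriv k (fun s => (f i s : ℂ)) = fun s => (F i s : ℂ)) ∧
    ContDiff ℝ k (fun s => (g s : ℂ)) ∧ iteratedDeriv k (fun s => (g s : ℂ)) = fun s => (G s : ℂ) := by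
  have aux : ∀ {f f' F : ℝ → ℝ} {k : ℕ}, (∀ s, HasDerivAt f (f' s) s) →
      ContDiff ℝ k (fun s => (f' s : ℂ)) →
      _root_.iteratedDeriv k (fun s => (f' s : ℂ)) = (fun s => (F s : ℂ)) →
      ContDiff ℝ (k + 1 : ℕ) (fun s => (f s : ℂ)) ∧
        _root_.iteratedDeriv (k + 1) (fun s => (f s : ℂ)) = fun s => (F s : ℂ) := by
    intro f f' F k hd hc hi
    have hd' : ∀ s, HasDerivAt (fun s => (f s : ℂ)) (f' s : ℂ) s := fun s => (hd s).ofReal_comp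
    have e : deriv (fun s => (f s : ℂ)) = fun s => (f' s : ℂ) := funext fun s => (hd' s).deriv
    refine ⟨?_, by rw [iteratedDeriv_succ', e, hi]⟩
    rw [show ((k + 1 : ℕ) : WithTop ℕ∞) = (k : WithTop ℕ∞) + 1 by push_cast; rfl,
      contDiff_succ_iff_deriv]
    refine ⟨fun s => (hd' s).differentiableAt, by simp, ?_⟩
    rw [e]
    exact hc
  induction k generalizing f g with
  | zero =>
    refine ⟨f, g, h, fun i => ⟨?_, by simp⟩, ?_, by simp⟩
    · rw [Nat.cast_zero, contDiff_zero]
      exact Complex.continuous_ofReal.comp (UnifConv.cont h i)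
    · rw [Nat.cast_zero, contDiff_zero]
      exact Complex.continuous_ofReal.comp (UnifConv.cont_lim h)
  | succ k ih =>
    obtain ⟨-, f', g', d, e, b⟩ := h
    obtain ⟨F, G, hFG, hF, hG⟩ := ih b
    exact ⟨F, G, hFG, fun i => aux (d i) (hF i).1 (hF i).2, aux e hG.1 hG.2⟩

/-- Convergence of the Fourier coefficients in `H^k`. -/
lemma exists_Hs {k : ℕ} (hk : 1 ≤ k) (h : CkConv l k f g) :
    ∃ (u : ι → Hs k) (v : Hs k), Tendsto u l (𝓝 v) ∧ (∀ i s, evs (u i) s = f i s) ∧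
      ∀ s, evs v s = g s := by
  obtain ⟨F, G, hFG, hF, hG⟩ := h.iteratedDeriv
  have hUG := h.zero
  have per : ∀ {f : ℝ → ℝ}, Function.Periodic f (2 * Real.pi) →
      Function.Periodic (fun s => (f s : ℂ)) (2 * Real.pi) := fun hf s => by simp only [hf s]
  have nrm : ∀ x : ℝ, ‖(x : ℂ)‖ = |x| := fun x => by rw [Complex.norm_real, Real.norm_eq_abs]
  have ex : ∀ {f F : ℝ → ℝ}, Continuous f → Function.Periodic f (2 * Real.pi) → Continuous F →
      Function.Periodic F (2 * Real.pi) → ContDiff ℝ k (fun s => (f s : ℂ)) →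
      _root_.iteratedDeriv k (fun s => (f s : ℂ)) = (fun s => (F s : ℂ)) →
      ∃ u : Hs k, (∀ j, u j = fc (fun s => (f s : ℂ)) j) ∧ ∀ s, evs u s = f s := by
    intro f F c1 p1 c2 p2 hc hi
    obtain ⟨N1, hN1, b1⟩ := exists_bound_of_periodic c1 p1
    obtain ⟨N2, hN2, b2⟩ := exists_bound_of_periodic c2 p2
    obtain ⟨u, hu, -⟩ := contDiff_lower hc (per p1) (N := N1 + N2) (by positivity)
      (fun s => by rw [nrm]; exact (b1 s).trans (by linarith))
      (fun s => by rw [hi]; simp only []; rw [nrm]; exact (b2 s).trans (by linarith))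
    refine ⟨u, hu, fun s => ?_⟩
    have hs : Summable fun j => ‖fc (fun s => (f s : ℂ)) j‖ :=
      (summable_norm_pos hk u).congr fun j => by rw [hu j]
    exact (congrFun (evs_congr hu) s).trans
      (eq_evs_fc (Complex.continuous_ofReal.comp c1) (per p1) hs s).symm
  choose u hu1 hu2 using fun i => ex (hUG.cont i) (hUG.periodic i) (hFG.cont i) (hFG.periodic i)
    (hF i).1 (hF i).2
  obtain ⟨v, hv1, hv2⟩ := ex hUG.cont_lim hUG.periodic_lim hFG.cont_lim hFG.periodic_lim hG.1 hG.2
  refine ⟨u, v, ?_, hu2, hv2⟩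
  obtain ⟨e₁, t₁, b₁⟩ := hUG.unif
  obtain ⟨e₂, t₂, b₂⟩ := hFG.unif
  rw [tendsto_iff_norm_sub_tendsto_zero]
  have ht : Tendsto (fun i => 2 ^ (k + 1) * (2 * Real.pi * (e₁ i + e₂ i))) l (𝓝 0) := by
    simpa using ((t₁.add t₂).const_mul (2 * Real.pi)).const_mul (2 ^ (k + 1))
  refine squeeze_zero' (Eventually.of_forall fun _ => norm_nonneg _) ?_ ht
  filter_upwards [b₁, b₂] with i h1 h2
  have p1 := (abs_nonneg _).trans (h1 0)
  have p2 := (abs_nonneg _).trans (h2 0)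
  have hi : _root_.iteratedDeriv k (fun s => (f i s : ℂ) - (g s : ℂ)) =
      fun s => (F i s : ℂ) - (G s : ℂ) := by
    funext s
    have := iteratedDeriv_fun_sub (x := s) ((hF i).1.contDiffAt) (hG.1.contDiffAt)
    rw [this, (hF i).2, hG.2]
  -- Applied to the difference of the functions. The uniform bounds for the orders `0` and `k` tend
  -- to zero, and with them the norm of its coefficients.
  obtain ⟨w, hw, hwn⟩ := contDiff_lower ((hF i).1.sub hG.1)
    ((per (hUG.periodic i)).sub (per hUG.periodic_lim)) (N := e₁ i + e₂ i) (by positivity)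
    (fun s => by rw [← Complex.ofReal_sub, nrm]; exact (h1 s).trans (by linarith))
    (fun s => by
      rw [hi]; simp only []; rw [← Complex.ofReal_sub, nrm]; exact (h2 s).trans (by linarith))
  have : u i - v = w := by
    ext j
    have hsw : Summable fun j => ‖w j‖ := summable_norm_pos hk w
    have hsd : Summable fun j => ‖(u i - v : Hs k) j‖ := summable_norm_pos hk _
    rw [Hs.sub_apply, hw, hu1, hv1]
    unfold fc
    rw [← mul_sub, ← integral_sub]
    · simp only [sub_mul]
    · exact memLp_one_iff_integrable.1 (memLp_of_continuous_circle
        ((Complex.continuous_ofReal.comp (hUG.cont i)).mul (continuous_em _)))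
    · exact memLp_one_iff_integrable.1 (memLp_of_continuous_circle
        ((Complex.continuous_ofReal.comp hUG.cont_lim).mul (continuous_em _)))
  rw [this]
  exact hwn

end CkConv

end NearAxis
end

/-! ### Curvature, torsion and frame as continuous functions of the axis -/

noncomputable section

namespace NearAxis

open Hs

/-! ### Dependence of the geometry on the axis -/

lemma cross_zero (u v : E3) : cross u v 0 = u 1 * v 2 - u 2 * v 1 := by
  simp [cross, crossProduct]
lemma cross_one (u v : E3) : cross u v 1 = u 2 * v 0 - u 0 * v 2 := by
  simp [cross, crossProduct]
lemma cross_two (u v : E3) : cross u v 2 = u 0 * v 1 - u 1 * v 0 := by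
  simp [cross, crossProduct]

lemma norm_sq_E3 (u : E3) : ‖u‖ ^ 2 = u 0 * u 0 + u 1 * u 1 + u 2 * u 2 := by
  rw [EuclideanSpace.real_norm_sq_eq, Fin.sum_univ_three]; ring

lemma inner_E3 (u v : E3) : inner ℝ u v = u 0 * v 0 + u 1 * v 1 + u 2 * v 2 := by
  simp [PiLp.inner_apply, Fin.sum_univ_three, mul_comm]

/-- Lagrange's identity. It shows below that the denominator of the torsion does not vanish. -/
lemma norm_cross_sq (u v : E3) : ‖cross u v‖ ^ 2 = ‖u‖ ^ 2 * ‖v‖ ^ 2 - inner ℝ u v ^ 2 := by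
  rw [norm_sq_E3, norm_sq_E3, norm_sq_E3, inner_E3, cross_zero, cross_one, cross_two]
  ring

namespace IsAxis

variable {k : ℕ} {r : ℝ → E3}

/-- The constant value of `ℓ'`. -/
def _root_.NearAxis.ell (r : ℝ → E3) : ℝ := axisLength r / (2 * Real.pi)

lemma ell_pos (h : IsAxis k r) : 0 < ell r := div_pos h.length_pos (by positivity)

lemma norm_deriv (h : IsAxis k r) (s : ℝ) : ‖deriv r s‖ = ell r := h.speed_eq s

lemma hasDerivAt_deriv (h : IsAxis k r) (hk : 2 ≤ k) (s : ℝ) :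
    HasDerivAt (deriv r) (iteratedDeriv 2 r s) s := by
  have := hasDerivAt_iteratedDeriv h.contDiff (i := 1) (by omega) s
  rwa [iteratedDeriv_one] at this

lemma tangent_eq (h : IsAxis k r) : tangent r = fun s => (ell r)⁻¹ • deriv r s :=
  funext fun s => by unfold tangent; rw [h.speed_eq]; rfl

lemma deriv_tangent (h : IsAxis k r) (hk : 2 ≤ k) (s : ℝ) :
    deriv (tangent r) s = (ell r)⁻¹ • iteratedDeriv 2 r s := by
  rw [h.tangent_eq]
  exact ((h.hasDerivAt_deriv hk s).const_smul (ell r)⁻¹).deriv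

lemma curvature_eq (h : IsAxis k r) (hk : 2 ≤ k) (s : ℝ) :
    curvature r s = ‖iteratedDeriv 2 r s‖ * ((ell r)⁻¹ * (ell r)⁻¹) := by
  have hl := h.ell_pos
  have hsp : speed r s = ell r := h.speed_eq s
  unfold curvature
  rw [h.deriv_tangent hk, norm_smul, hsp, Real.norm_of_nonneg (by positivity)]
  field_simp

lemma norm_second_pos (h : IsAxis k r) (hk : 2 ≤ k) (s : ℝ) : 0 < ‖iteratedDeriv 2 r s‖ := by
  have h1 := h.curvature_pos s
  rw [h.curvature_eq hk] at h1
  have hl := h.ell_pos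
  exact pos_of_mul_pos_left h1 (by positivity)

/-- The speed is constant, so the derivative of its square is zero. -/
lemma inner_deriv (h : IsAxis k r) (hk : 2 ≤ k) (s : ℝ) :
    inner ℝ (deriv r s) (iteratedDeriv 2 r s) = 0 := by
  have h1 := (h.hasDerivAt_deriv hk s).norm_sq
  have h2 : (fun s => ‖deriv r s‖ ^ 2) = fun _ => ell r ^ 2 := funext fun s => by rw [h.norm_deriv]
  rw [h2] at h1
  have := h1.unique (hasDerivAt_const s _)
  linarith

lemma norm_cross_pos (h : IsAxis k r) (hk : 2 ≤ k) (s : ℝ) :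
    0 < ‖cross (deriv r s) (iteratedDeriv 2 r s)‖ ^ 2 := by
  rw [norm_cross_sq, h.inner_deriv hk, h.norm_deriv]
  have := h.norm_second_pos hk s
  have := h.ell_pos
  simp only [ne_eq, OfNat.ofNat_ne_zero, not_false_eq_true, zero_pow, sub_zero]
  positivity

end IsAxis

/-- The closed axes of class `C^k`. -/
abbrev Axes (k : ℕ) : Type := {r : ℝ → E3 // IsAxis k r}

/-- Convergence to the axis `r₀` in `C^k`. -/
def nearAxes (k : ℕ) (r₀ : ℝ → E3) : Filter (Axes k) :=
  comap (fun r : Axes k => cNorm k (fun s => r.1 s - r₀ s)) (𝓝 0)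

section Convergence

variable {k : ℕ} {r₀ : ℝ → E3}

/-- Each derivative counted in `cNorm` bounds its components uniformly. Taking `j` derivatives
leaves `m = k - j` of them for the mode of convergence. -/
lemma ckConv_component (h₀ : IsAxis k r₀) (a : Fin 3) {m j : ℕ} (hj : j + m = k) :
    CkConv (nearAxes k r₀) m (fun r s => iteratedDeriv j r.1 s a) (fun s => iteratedDeriv j r₀ s a) := by
  have hc : ∀ {r : ℝ → E3}, IsAxis k r → ∀ {j}, j < k → ∀ s,
      HasDerivAt (fun s => iteratedDeriv j r s a) (iteratedDeriv (j + 1) r s a) s := by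
    intro r h j hj s
    exact (EuclideanSpace.proj a : E3 →L[ℝ] ℝ).hasFDerivAt.comp_hasDerivAt s
      (hasDerivAt_iteratedDeriv h.contDiff hj s)
  have hU : ∀ {j}, j ≤ k → UnifConv (nearAxes k r₀) (fun r s => iteratedDeriv j r.1 s a)
      (fun s => iteratedDeriv j r₀ s a) := by
    intro j hj
    have hcont : ∀ {r : ℝ → E3}, IsAxis k r → Continuous fun s => iteratedDeriv j r s a :=
      fun h => (EuclideanSpace.proj a : E3 →L[ℝ] ℝ).continuous.comp
        (h.contDiff.continuous_iteratedDeriv j (by exact_mod_cast hj))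
    have hper : ∀ {r : ℝ → E3}, IsAxis k r →
        Function.Periodic (fun s => iteratedDeriv j r s a) (2 * Real.pi) := fun h s => by
      simp only [iteratedDeriv_periodic h.periodic j s]
    refine ⟨fun r => hcont r.2, fun r => hper r.2, hcont h₀, hper h₀,
      fun r => (cNorm k (fun s => r.1 s - r₀ s)).toReal, ?_, ?_⟩
    · have h1 : Tendsto (fun r : Axes k => cNorm k (fun s => r.1 s - r₀ s)) (nearAxes k r₀) (𝓝 0) :=
        tendsto_comap
      exact (ENNReal.tendsto_toReal ENNReal.zero_ne_top).comp h1
    -- The real value of the norm bounds something only where the norm is finite, which is so near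
    -- the limit.
    · have h1 : ∀ᶠ r : Axes k in nearAxes k r₀, cNorm k (fun s => r.1 s - r₀ s) < ⊤ :=
        tendsto_comap.eventually (gt_mem_nhds ENNReal.zero_lt_top)
      filter_upwards [h1] with r hr s
      have e : iteratedDeriv j (fun s => r.1 s - r₀ s) s = iteratedDeriv j r.1 s - iteratedDeriv j r₀ s :=
        iteratedDeriv_fun_sub ((r.2.contDiff.of_le (by exact_mod_cast hj)).contDiffAt)
          ((h₀.contDiff.of_le (by exact_mod_cast hj)).contDiffAt)
      have h2 : ‖iteratedDeriv j (fun s => r.1 s - r₀ s) s‖ₑ ≤ cNorm k (fun s => r.1 s - r₀ s) := by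
        unfold cNorm
        refine le_trans (le_iSup (fun s => ‖iteratedDeriv j (fun s => r.1 s - r₀ s) s‖ₑ) s) ?_
        exact Finset.single_le_sum (f := fun j => ⨆ s : ℝ, ‖iteratedDeriv j (fun s => r.1 s - r₀ s) s‖ₑ)
          (fun _ _ => zero_le) (Finset.mem_range.2 (by omega))
      have h3 := ENNReal.toReal_mono hr.ne h2
      rw [toReal_enorm, e] at h3
      refine le_trans ?_ h3
      have := PiLp.norm_apply_le (iteratedDeriv j r.1 s - iteratedDeriv j r₀ s) a
      simpa using this
  induction m generalizing j with
  | zero => exact hU (by omega)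
  | succ m ih =>
    exact ⟨hU (by omega), _, _, fun r s => hc r.2 (by omega) s, fun s => hc h₀ (by omega) s,
      ih (by omega)⟩

lemma ckConv_norm_sq {ι : Type*} {l : Filter ι} {m : ℕ} {f : ι → ℝ → E3} {g : ℝ → E3}
    (h : ∀ a, CkConv l m (fun i s => f i s a) (fun s => g s a)) :
    CkConv l m (fun i s => ‖f i s‖ ^ 2) (fun s => ‖g s‖ ^ 2) := by
  simp only [norm_sq_E3]
  exact (((h 0).mul (h 0)).add ((h 1).mul (h 1))).add ((h 2).mul (h 2))

lemma ckConv_norm {ι : Type*} {l : Filter ι} {m : ℕ} {f : ι → ℝ → E3} {g : ℝ → E3}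
    (h : ∀ a, CkConv l m (fun i s => f i s a) (fun s => g s a)) (hf : ∀ i s, 0 < ‖f i s‖)
    (hg : ∀ s, 0 < ‖g s‖) : CkConv l m (fun i s => ‖f i s‖) (fun s => ‖g s‖) := by
  have := (ckConv_norm_sq h).sqrt (fun i s => by have := hf i s; positivity)
    (fun s => by have := hg s; positivity)
  simpa only [Real.sqrt_sq (norm_nonneg _)] using this

lemma ckConv_cross {ι : Type*} {l : Filter ι} {m : ℕ} {f₁ f₂ : ι → ℝ → E3} {g₁ g₂ : ℝ → E3}
    (h₁ : ∀ a, CkConv l m (fun i s => f₁ i s a) (fun s => g₁ s a))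
    (h₂ : ∀ a, CkConv l m (fun i s => f₂ i s a) (fun s => g₂ s a)) (a : Fin 3) :
    CkConv l m (fun i s => cross (f₁ i s) (f₂ i s) a) (fun s => cross (g₁ s) (g₂ s) a) := by
  fin_cases a
  · simp only [Fin.zero_eta, cross_zero]
    exact ((h₁ 1).mul (h₂ 2)).sub ((h₁ 2).mul (h₂ 1))
  · simp only [Fin.mk_one, cross_one]
    exact ((h₁ 2).mul (h₂ 0)).sub ((h₁ 0).mul (h₂ 2))
  · simp only [Fin.reduceFinMk, cross_two]
    exact ((h₁ 0).mul (h₂ 1)).sub ((h₁ 1).mul (h₂ 0))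

lemma ckConv_ell (h₀ : IsAxis (k + 1) r₀) :
    CkConv (nearAxes (k + 1) r₀) k (fun r _ => ell r.1) (fun _ => ell r₀) := by
  have h : ∀ a, CkConv (nearAxes (k + 1) r₀) k (fun r s => deriv r.1 s a) (fun s => deriv r₀ s a) :=
    fun a => by
      have := ckConv_component h₀ a (j := 1) (m := k) (by omega)
      simpa only [iteratedDeriv_one] using this
  have := ckConv_norm h (fun r s => by rw [r.2.norm_deriv]; exact r.2.ell_pos)
    (fun s => by rw [h₀.norm_deriv]; exact h₀.ell_pos)
  have e : ∀ {r : ℝ → E3}, IsAxis (k + 1) r → ∀ s, ‖deriv r s‖ = ell r := fun h s => h.norm_deriv s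
  have e2 : (fun (r : Axes (k + 1)) s => ‖deriv r.1 s‖) = fun r _ => ell r.1 :=
    funext fun r => funext fun s => r.2.norm_deriv s
  have e3 : (fun s => ‖deriv r₀ s‖) = fun _ => ell r₀ := funext fun s => h₀.norm_deriv s
  rwa [e2, e3] at this

lemma tendsto_ell (h₀ : IsAxis (k + 1) r₀) :
    Tendsto (fun r : Axes (k + 1) => ell r.1) (nearAxes (k + 1) r₀) (𝓝 (ell r₀)) := by
  obtain ⟨e, t, b⟩ := (ckConv_ell h₀).zero.unif
  rw [tendsto_iff_norm_sub_tendsto_zero]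
  exact squeeze_zero' (Eventually.of_forall fun _ => norm_nonneg _) (b.mono fun r hr => hr 0) t

lemma ckConv_curvature (h₀ : IsAxis (k + 2) r₀) :
    CkConv (nearAxes (k + 2) r₀) k (fun r => curvature r.1) (curvature r₀) := by
  have hl := ((ckConv_ell (k := k + 1) h₀).of_le (Nat.le_succ k)).inv (fun r _ => r.2.ell_pos)
    (fun _ => h₀.ell_pos)
  have hn := ckConv_norm (fun a => ckConv_component h₀ a (j := 2) (m := k) (by omega))
    (fun r s => r.2.norm_second_pos (by omega) s) (fun s => h₀.norm_second_pos (by omega) s)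
  have := hn.mul (hl.mul hl)
  have e2 : (fun (r : Axes (k + 2)) s => ‖iteratedDeriv 2 r.1 s‖ * ((ell r.1)⁻¹ * (ell r.1)⁻¹)) =
      fun r => curvature r.1 :=
    funext fun r => funext fun s => (r.2.curvature_eq (by omega) s).symm
  have e3 : (fun s => ‖iteratedDeriv 2 r₀ s‖ * ((ell r₀)⁻¹ * (ell r₀)⁻¹)) = curvature r₀ :=
    funext fun s => (h₀.curvature_eq (by omega) s).symm
  rwa [e2, e3] at this

/-- The triple product formula needs three derivatives of the curve and none of the frame, so an
axis of class `C^{4+q}` leaves `q + 1` derivatives. This is the regularity demanded of the axis. -/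
lemma ckConv_torsion (h₀ : IsAxis (k + 3) r₀) :
    CkConv (nearAxes (k + 3) r₀) k (fun r => torsion r.1) (torsion r₀) := by
  have c1 : ∀ a, CkConv (nearAxes (k + 3) r₀) k (fun r s => deriv r.1 s a) (fun s => deriv r₀ s a) :=
    fun a => by
      have := (ckConv_component h₀ a (j := 1) (m := k + 2) (by omega)).of_le (k' := k) (by omega)
      simpa only [iteratedDeriv_one] using this
  have c2 := fun a => (ckConv_component h₀ a (j := 2) (m := k + 1) (by omega)).of_le (k' := k) (by omega)
  have c3 := fun a => ckConv_component h₀ a (j := 3) (m := k) (by omega)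
  have cc := ckConv_cross c1 c2
  have hi := (ckConv_norm_sq cc).inv (fun r s => r.2.norm_cross_pos (by omega) s)
    (fun s => h₀.norm_cross_pos (by omega) s)
  have := ((((cc 0).mul (c3 0)).add ((cc 1).mul (c3 1))).add ((cc 2).mul (c3 2))).mul hi
  simp only [← inner_E3, ← div_eq_mul_inv] at this
  exact this

/-- Tangent, normal and binormal depend continuously on the axis. -/
lemma ckConv_frame (h₀ : IsAxis (k + 2) r₀) (a : Fin 3) :
    CkConv (nearAxes (k + 2) r₀) k (fun r s => tangent r.1 s a) (fun s => tangent r₀ s a) ∧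
    CkConv (nearAxes (k + 2) r₀) k (fun r s => normal r.1 s a) (fun s => normal r₀ s a) ∧
    CkConv (nearAxes (k + 2) r₀) k (fun r s => binormal r.1 s a) (fun s => binormal r₀ s a) := by
  have hl := ((ckConv_ell (k := k + 1) h₀).of_le (Nat.le_succ k)).inv (fun r _ => r.2.ell_pos)
    (fun _ => h₀.ell_pos)
  have ht : ∀ a, CkConv (nearAxes (k + 2) r₀) k (fun r s => tangent r.1 s a)
      (fun s => tangent r₀ s a) := fun a => by
    have c1 : CkConv (nearAxes (k + 2) r₀) k (fun r s => deriv r.1 s a) (fun s => deriv r₀ s a) := by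
      have := (ckConv_component h₀ a (j := 1) (m := k + 1) (by omega)).of_le (k' := k) (by omega)
      simpa only [iteratedDeriv_one] using this
    have := hl.mul c1
    have e : ∀ {r : ℝ → E3}, IsAxis (k + 2) r → (fun s => (ell r)⁻¹ * deriv r s a) =
        fun s => tangent r s a := fun h => funext fun s => by rw [h.tangent_eq]; rfl
    have e2 : (fun (r : Axes (k + 2)) s => (ell r.1)⁻¹ * deriv r.1 s a) = fun r s => tangent r.1 s a :=
      funext fun r => e r.2
    rwa [e h₀, e2] at this
  have hn : ∀ a, CkConv (nearAxes (k + 2) r₀) k (fun r s => normal r.1 s a)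
      (fun s => normal r₀ s a) := fun a => by
    have c2 := ckConv_component h₀ a (j := 2) (m := k) (by omega)
    have hk := ((ckConv_curvature h₀).mul ((ckConv_ell (k := k + 1) h₀).of_le (Nat.le_succ k))).inv
      (fun r s => mul_pos (r.2.curvature_pos s) r.2.ell_pos)
      (fun s => mul_pos (h₀.curvature_pos s) h₀.ell_pos)
    have := hk.mul (hl.mul c2)
    have e : ∀ {r : ℝ → E3}, IsAxis (k + 2) r → (fun s => (curvature r s * ell r)⁻¹ *
        ((ell r)⁻¹ * iteratedDeriv 2 r s a)) = fun s => normal r s a := fun {r} h => funext fun s => by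
      have hsp : speed r s = ell r := h.speed_eq s
      unfold normal
      rw [h.deriv_tangent (by omega), hsp]
      rfl
    have e2 : (fun (r : Axes (k + 2)) s => (curvature r.1 s * ell r.1)⁻¹ *
        ((ell r.1)⁻¹ * iteratedDeriv 2 r.1 s a)) = fun r s => normal r.1 s a :=
      funext fun r => e r.2
    rwa [e h₀, e2] at this
  exact ⟨ht a, hn a, ckConv_cross ht hn a⟩

end Convergence

end NearAxis
end

/-! ### Passage between analytic functions and families of Fourier coefficients -/

noncomputable section

namespace NearAxis

open Hs

/-! ### Near-axis expansions of power series -/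

/-- The expansion coefficients `f_{mn}` of a family. -/
def coefOf {Q : ℕ} (U : ℕ → ℕ → Hs Q) (m n : ℕ) (s : ℝ) : ℂ := evs (U n (m - n)) s

lemma expCoeff_eq (c : ℕ → ℕ → ℝ → ℂ) (m : ℕ) (θ s : ℝ) :
    expCoeff c m θ s = ∑ n ∈ Finset.range (m + 1), c m n s * em (2 * (n : ℤ) - m) θ := by
  unfold expCoeff em
  refine Finset.sum_congr rfl fun n _ => ?_
  push_cast
  rfl

lemma expCoeff_coefOf {Q : ℕ} (U : ℕ → ℕ → Hs Q) (m : ℕ) (θ s : ℝ) :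
    expCoeff (coefOf U) m θ s = ∑ p ∈ Finset.HasAntidiagonal.antidiagonal m,
      em ((p.1 : ℤ) - p.2) θ * evs (U p.1 p.2) s := by
  rw [expCoeff_eq, Finset.Nat.sum_antidiagonal_eq_sum_range_succ
    (fun a b => em ((a : ℤ) - b) θ * evs (U a b) s)]
  refine Finset.sum_congr rfl fun n hn => ?_
  have hn' : n ≤ m := Nat.lt_succ_iff.1 (Finset.mem_range.1 hn)
  have : (n : ℤ) - ((m - n : ℕ) : ℤ) = 2 * (n : ℤ) - m := by push_cast [hn']; ring
  rw [this, mul_comm]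
  rfl

/-- Coefficients of a real function. -/
def IsReal {Q : ℕ} (U : ℕ → ℕ → Hs Q) : Prop := ∀ a b, conjH (U a b) = U b a

lemma IsReal.evs {Q : ℕ} {U : ℕ → ℕ → Hs Q} (h : IsReal U) (a b : ℕ) (s : ℝ) :
    (starRingEnd ℂ) (NearAxis.evs (U a b) s) = NearAxis.evs (U b a) s := by
  rw [← evs_star, ← h a b]
  exact congrFun (evs_congr fun j => (conjH_apply _ j).symm) s

lemma IsReal.im_expCoeff {Q : ℕ} {U : ℕ → ℕ → Hs Q} (h : IsReal U) (m : ℕ) (θ s : ℝ) :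
    (expCoeff (coefOf U) m θ s).im = 0 := by
  rw [← Complex.conj_eq_iff_im, expCoeff_coefOf, map_sum, ← Finset.Nat.sum_antidiagonal_swap]
  refine Finset.sum_congr rfl fun p _ => ?_
  rw [map_mul, conj_em, h.evs]
  simp

/-- The real part of a family. -/
def symm {Q : ℕ} (u : ℕ → ℕ → Hs Q) (a b : ℕ) : Hs Q := (1 / 2 : ℂ) • (u a b + conjH (u b a))

lemma isReal_symm {Q : ℕ} (u : ℕ → ℕ → Hs Q) : IsReal (symm u) := fun a b => by
  ext j
  simp only [symm, conjH_apply, Hs.smul_apply, Hs.add_apply, map_mul, map_add, Complex.conj_conj,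
    neg_neg, map_div₀, map_one, map_ofNat]
  ring

lemma norm_symm_le {Q : ℕ} (u : ℕ → ℕ → Hs Q) {a b : ℕ} {C : ℝ} (h1 : ‖u a b‖ ≤ C)
    (h2 : ‖u b a‖ ≤ C) : ‖symm u a b‖ ≤ C := by
  unfold symm
  rw [norm_smul]
  have : ‖(1 / 2 : ℂ)‖ = 1 / 2 := by norm_num
  rw [this]
  have := norm_add_le (u a b) (conjH (u b a))
  rw [norm_conjH] at this
  linarith

lemma Grow.symm {σ : ℝ} {Q : ℕ} {u : ℕ → ℕ → Hs Q} (h : Grow σ u) : Grow σ (NearAxis.symm u) := by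
  obtain ⟨M, p, hM, hu⟩ := h
  refine ⟨M, p, hM, fun a b => norm_symm_le u (hu a b) ((hu b a).trans (le_of_eq ?_))⟩
  rw [add_comm b a, add_right_comm]

/-- Complex conjugation exchanges `z` and `w`. -/
lemma PS_conj_swap (v : ℕ → ℕ → ℂ) (ρ θ : ℝ) :
    PS (fun a b => (starRingEnd ℂ) (v b a)) ρ θ = (starRingEnd ℂ) (PS v ρ θ) := by
  unfold PS
  rw [Complex.conj_tsum, ← (Equiv.prodComm ℕ ℕ).tsum_eq]
  refine tsum_congr fun p => ?_
  simp only [Equiv.prodComm_apply, Prod.fst_swap, Prod.snd_swap, map_mul, map_pow,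
    Complex.conj_ofReal, conj_em, neg_sub, add_comm]

/-- Symmetrizing the coefficients replaces the sum `f` by the mean of `f` and its conjugate, which
has the same real part. -/
lemma RS_symm {σ : ℝ} (hσ : 0 < σ) {Q : ℕ} {u : ℕ → ℕ → Hs (Q + 1)} (h : Grow σ u) {ρ : ℝ}
    (hρ : |ρ| < σ) (θ s : ℝ) :
    RS (ev fun a b => NearAxis.symm u a b) ρ θ s = RS (ev fun a b => u a b) ρ θ s := by
  have hc : AbsConv σ (fun a b => evs (u a b) s) := (h.rawFam hσ).fnFam.absConv s
  have hswap : AbsConv σ (fun a b => (starRingEnd ℂ) (evs (u b a) s)) := fun x hx hxs => by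
    have := (Equiv.prodComm ℕ ℕ).summable_iff.2 (hc x hx hxs)
    refine this.congr fun p => ?_
    simp [add_comm]
  have e : ∀ a b, evs (NearAxis.symm u a b) s =
      (1 / 2) * (evs (u a b) s + (starRingEnd ℂ) (evs (u b a) s)) := fun a b => by
    rw [← evs_star, ← evs_add (summable_norm_pos (by omega) _)
      ((summable_norm_pos (by omega) (conjH (u b a))).congr fun j => by rw [conjH_apply]; rfl),
      ← evs_mul_left]
    exact congrFun (evs_congr fun j => by
      rw [NearAxis.symm, Hs.smul_apply, Hs.add_apply, conjH_apply]; rfl) s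
  have e2 : PS (fun a b => (starRingEnd ℂ) (evs (u b a) s)) ρ θ =
      (starRingEnd ℂ) (PS (fun a b => evs (u a b) s) ρ θ) :=
    PS_conj_swap (fun a b => evs (u a b) s) ρ θ
  unfold RS GS ev
  have : PS (fun a b => evs (NearAxis.symm u a b) s) ρ θ =
      (1 / 2) * (PS (fun a b => evs (u a b) s) ρ θ +
        (starRingEnd ℂ) (PS (fun a b => evs (u a b) s) ρ θ)) := by
    rw [← e2, ← PS_add hc hswap hρ, ← PS_mul_left]
    exact PS_congr e ρ θ
  simp only [this, Complex.add_conj]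
  simp

/-- `{(a, b) | a + b ≤ M}`. -/
def box (M : ℕ) : Finset (ℕ × ℕ) :=
  (Finset.range (M + 1) ×ˢ Finset.range (M + 1)).filter fun p => p.1 + p.2 ≤ M

lemma mem_box {M : ℕ} {p : ℕ × ℕ} : p ∈ box M ↔ p.1 + p.2 ≤ M := by
  unfold box
  rw [Finset.mem_filter, Finset.mem_product, Finset.mem_range, Finset.mem_range]
  omega

lemma sum_box {E : Type*} [AddCommMonoid E] (F : ℕ × ℕ → E) (M : ℕ) :
    ∑ m ∈ Finset.range (M + 1), ∑ p ∈ Finset.HasAntidiagonal.antidiagonal m, F p = ∑ p ∈ box M, F p := by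
  rw [← Finset.sum_fiberwise_of_maps_to (s := box M) (t := Finset.range (M + 1))
    (g := fun p => p.1 + p.2) (fun p hp => Finset.mem_range.2 (Nat.lt_succ_of_le (mem_box.1 hp)))]
  refine Finset.sum_congr rfl fun m hm => Finset.sum_congr ?_ fun _ _ => rfl
  ext p
  rw [Finset.mem_filter, mem_box, Finset.HasAntidiagonal.mem_antidiagonal]
  have := Finset.mem_range.1 hm
  omega

/-- Partial sums up to degree `M` are sums over these triangles. They exhaust all index pairs, so
unconditional summability yields convergence degree by degree. -/
lemma tendsto_box : Tendsto box atTop atTop := by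
  refine tendsto_atTop_finset_of_monotone (fun M N h p hp => ?_) fun p => ⟨p.1 + p.2, mem_box.2 le_rfl⟩
  exact mem_box.2 ((mem_box.1 hp).trans h)

lemma wt_sub_le (a b : ℕ) : wt ((a : ℤ) - b) ≤ 1 + a + b := by
  have := abs_sub_le_add a b
  unfold wt
  push_cast at this ⊢
  linarith

section Expansion

variable {Q : ℕ} {σ : ℝ} {U : ℕ → ℕ → Hs Q}

lemma summable_wt_mul (hσ : 0 < σ) (hU : Grow σ U) {ρ : ℝ} (h0 : 0 ≤ ρ) (h1 : ρ < σ) :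
    Summable fun p : ℕ × ℕ => wt ((p.1 : ℤ) - p.2) ^ Q * ‖((ρ : ℂ) ^ (p.1 + p.2)) • U p.1 p.2‖ := by
  have hw : Grow σ (fun a b => ((1 + a + b : ℝ) ^ Q : ℂ) • U a b) :=
    hU.of_le hσ (C := 1) (p := Q) zero_le_one fun a b => by
      rw [norm_smul, one_mul, norm_pow]
      refine mul_le_mul_of_nonneg_right (le_of_eq ?_) (norm_nonneg _)
      congr 1
      rw [Complex.norm_real, Real.norm_of_nonneg (by positivity)]
  refine Summable.of_nonneg_of_le (fun p => mul_nonneg (pow_nonneg (wt_pos _).le _) (norm_nonneg _))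
    (fun p => ?_) (hw.maj hσ ρ h0 h1)
  beta_reduce
  rw [norm_smul, norm_smul, norm_pow, norm_pow, Complex.norm_real, Complex.norm_real,
    Real.norm_of_nonneg h0, Real.norm_of_nonneg (by positivity)]
  calc _ ≤ (1 + p.1 + p.2 : ℝ) ^ Q * (ρ ^ (p.1 + p.2) * ‖U p.1 p.2‖) := by
        refine mul_le_mul_of_nonneg_right (pow_le_pow_left₀ (wt_pos _).le (wt_sub_le _ _) _) (by positivity)
    _ = _ := by ring

/-- The expansion of a power series converges in `H^Q`. -/
lemma tendsto_sobolevNorm_sub (hQ : 1 ≤ Q) (hσ : 0 < σ) (hU : Grow σ U) {ρ : ℝ} (h0 : 0 ≤ ρ)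
    (h1 : ρ < σ) :
    Tendsto (fun M : ℕ => sobolevNorm Q (fun θ s => RS (ev fun a b => U a b) ρ θ s -
      ∑ m ∈ Finset.range (M + 1), ρ ^ m * (expCoeff (coefOf U) m θ s).re)) atTop (𝓝 0) := by
  set y : ℕ × ℕ → Hs Q := fun p => ((ρ : ℂ) ^ (p.1 + p.2)) • U p.1 p.2 with hy
  have hs := summable_wt_mul hσ hU h0 h1
  have hterm : ∀ θ s, Summable fun p : ℕ × ℕ => em ((p.1 : ℤ) - p.2) θ * evs (y p) s := by
    intro θ s
    refine Summable.of_norm_bounded (g := fun p => embC * (wt ((p.1 : ℤ) - p.2) ^ Q * ‖y p‖))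
      (hs.mul_left _) fun p => ?_
    rw [norm_mul, norm_em, one_mul]
    refine (norm_evs_le (summable_norm_pos hQ _) s).trans ((tsum_norm_le hQ _).trans ?_)
    exact mul_le_mul_of_nonneg_left
      (le_mul_of_one_le_left (norm_nonneg _) (one_le_pow₀ (one_le_wt _))) embC_nonneg
  have hev : ∀ p : ℕ × ℕ, ∀ s, evs (y p) s = (ρ : ℂ) ^ (p.1 + p.2) * evs (U p.1 p.2) s := by
    intro p s
    rw [← evs_mul_left]
    exact congrFun (evs_congr fun j => by rw [hy, Hs.smul_apply]) s
  have hPS : ∀ θ s, PS (fun a b => ev (fun a b => U a b) a b s) ρ θ =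
      ∑' p : ℕ × ℕ, em ((p.1 : ℤ) - p.2) θ * evs (y p) s := by
    intro θ s
    unfold PS ev
    exact tsum_congr fun p => by rw [hev]; ring
  have hpart : ∀ M θ s, ((∑ m ∈ Finset.range (M + 1), ρ ^ m * (expCoeff (coefOf U) m θ s).re : ℝ)) =
      (∑ p ∈ box M, em ((p.1 : ℤ) - p.2) θ * evs (y p) s).re := by
    intro M θ s
    rw [← sum_box, Complex.re_sum]
    refine Finset.sum_congr rfl fun m _ => ?_
    rw [← Complex.re_ofReal_mul, expCoeff_coefOf, Finset.mul_sum]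
    congr 1
    refine Finset.sum_congr rfl fun p hp => ?_
    rw [hev, Finset.HasAntidiagonal.mem_antidiagonal.1 hp]
    push_cast
    ring
  have htail : ∀ M θ s, RS (ev fun a b => U a b) ρ θ s -
      ∑ m ∈ Finset.range (M + 1), ρ ^ m * (expCoeff (coefOf U) m θ s).re =
      (∑' p : {p // p ∉ box M}, em ((p.1.1 : ℤ) - p.1.2) θ * evs (y p.1) s).re := by
    intro M θ s
    rw [hpart]
    unfold RS GS
    rw [hPS, ← (hterm θ s).sum_add_tsum_subtype_compl (box M), Complex.add_re, add_sub_cancel_left]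
  have hlim : Tendsto (fun M => ENNReal.ofReal (upC Q * ∑' p : {p // p ∉ box M},
      wt ((p.1.1 : ℤ) - p.1.2) ^ Q * ‖y p.1‖)) atTop (𝓝 0) := by
    have := (((tendsto_tsum_compl_atTop_zero fun p : ℕ × ℕ =>
      wt ((p.1 : ℤ) - p.2) ^ Q * ‖y p‖).comp tendsto_box).const_mul (upC Q))
    rw [mul_zero] at this
    simpa using ENNReal.tendsto_ofReal this
  refine tendsto_of_tendsto_of_tendsto_of_le_of_le tendsto_const_nhds hlim (fun _ => zero_le)
    fun M => ?_
  simp only [htail]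
  exact sobolev_upper hQ (fun p : {p // p ∉ box M} => (p.1.1 : ℤ) - p.1.2) (fun p => y p.1)
    (hs.comp_injective Subtype.val_injective)

/-- In degree `m` all poloidal numbers are at most `m` in absolute value, so `θ`-derivatives cost at
most `(1 + m) ^ Q`. -/
lemma sobolevNorm_expCoeff_le (hQ : 1 ≤ Q) (U : ℕ → ℕ → Hs Q) (m : ℕ) :
    sobolevNorm Q (fun θ s => (expCoeff (coefOf U) m θ s).re) ≤
      ENNReal.ofReal (upC Q * ((1 + m) ^ Q *
        ∑ p ∈ Finset.HasAntidiagonal.antidiagonal m, ‖U p.1 p.2‖)) := by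
  have h := sobolev_upper hQ (ι := Finset.HasAntidiagonal.antidiagonal (A := ℕ) m)
    (fun p => (p.1.1 : ℤ) - p.1.2) (fun p => U p.1.1 p.1.2) (Summable.of_finite)
  have e : ∀ θ s, (expCoeff (coefOf U) m θ s) =
      ∑' p : Finset.HasAntidiagonal.antidiagonal (A := ℕ) m,
        em ((p.1.1 : ℤ) - p.1.2) θ * evs (U p.1.1 p.1.2) s := by
    intro θ s
    rw [expCoeff_coefOf, tsum_fintype]
    exact (Finset.sum_coe_sort (Finset.HasAntidiagonal.antidiagonal m)
      (fun p => em ((p.1 : ℤ) - p.2) θ * evs (U p.1 p.2) s)).symm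
  simp only [← e] at h
  refine h.trans (ENNReal.ofReal_le_ofReal (mul_le_mul_of_nonneg_left ?_ (upC_nonneg Q)))
  rw [tsum_fintype, Finset.sum_coe_sort (Finset.HasAntidiagonal.antidiagonal m)
    (fun p => wt ((p.1 : ℤ) - p.2) ^ Q * ‖U p.1 p.2‖), Finset.mul_sum]
  refine Finset.sum_le_sum fun p hp => mul_le_mul_of_nonneg_right ?_ (norm_nonneg _)
  refine pow_le_pow_left₀ (wt_pos _).le ((wt_sub_le _ _).trans (le_of_eq ?_)) _
  rw [← Finset.HasAntidiagonal.mem_antidiagonal.1 hp]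
  push_cast; ring

lemma expNorm_coefOf_le (hQ : 1 ≤ Q) (hσ : 0 ≤ σ) (U : ℕ → ℕ → Hs Q) {C : ℝ}
    (h : ∀ m, σ ^ m * (upC Q * ((1 + m) ^ Q *
      ∑ p ∈ Finset.HasAntidiagonal.antidiagonal m, ‖U p.1 p.2‖)) ≤ C) :
    expNorm σ Q (coefOf U) ≤ ENNReal.ofReal C := by
  refine iSup_le fun m => ?_
  refine (mul_le_mul_right (sobolevNorm_expCoeff_le hQ U m) _).trans ?_
  rw [← ENNReal.ofReal_mul (by positivity)]
  exact ENNReal.ofReal_le_ofReal (h m)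

lemma sum_antidiagonal_norm_le {U : ℕ → ℕ → Hs Q} {m : ℕ} {C : ℝ}
    (h : ∀ a b, a + b = m → ‖U a b‖ ≤ C) :
    ∑ p ∈ Finset.HasAntidiagonal.antidiagonal m, ‖U p.1 p.2‖ ≤ (1 + m) * C := by
  refine (Finset.sum_le_card_nsmul _ _ C fun p hp =>
    h _ _ (Finset.HasAntidiagonal.mem_antidiagonal.1 hp)).trans (le_of_eq ?_)
  rw [Finset.Nat.card_antidiagonal, nsmul_eq_mul]
  push_cast; ring

/-- A power series with real coefficients is analytic. -/
lemma hasExpansion_RS (hQ : 1 ≤ Q) {f : ℝ → ℝ → ℝ → ℝ} (hσ : 0 < σ) (hU : Grow σ U)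
    (hr : IsReal U) (hf : ∀ ρ θ s, 0 ≤ ρ → ρ < σ → f ρ θ s = RS (ev fun a b => U a b) ρ θ s)
    (hn : expNorm σ Q (coefOf U) < ⊤) : HasExpansion σ Q f (coefOf U) := by
  refine ⟨fun ρ h0 h1 θ s => ?_, fun m n _ => evs_periodic _, hr.im_expCoeff, hn, fun ρ h0 h1 => ?_⟩
  · rw [hf _ _ _ h0 h1, hf _ _ _ h0 h1, hf _ _ _ h0 h1]
    unfold RS GS PS ev
    constructor
    · simp only [em_periodic _ θ]
    · simp only [evs_periodic _ s]
  · simpa only [hf _ _ _ h0 h1] using tendsto_sobolevNorm_sub hQ hσ hU h0 h1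

end Expansion

/-! ### Fourier coefficients of expansions -/

lemma tfc_conj (f : ℝ → ℝ → ℝ) (k j : ℤ) : (starRingEnd ℂ) (tfc f k j) = tfc f (-k) (-j) := by
  unfold tfc
  rw [map_mul, ← integral_conj]
  congr 1
  · simp [Complex.conj_ofNat]
  · refine integral_congr_ae (Eventually.of_forall fun p => ?_)
    simp only [map_mul, Complex.conj_ofReal, em2, conj_em]

/-- An expansion does not presuppose that its coefficient functions are measurable. At each `s` the
sum over `n` is a finite trigonometric polynomial in `θ`, so a `θ`-integral recovers the
coefficient. Its integrability then comes from that of `f_m` by Fubini. -/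
lemma integrable_expCoeff_slice {c : ℕ → ℕ → ℝ → ℂ} {m : ℕ} (hre : ∀ θ s, (expCoeff c m θ s).im = 0)
    (hi : Integrable (fun p : ℝ × ℝ => (expCoeff c m p.1 p.2).re) torusMeasure) {n : ℕ} (hn : n ≤ m) :
    Integrable (c m n) circleMeasure ∧
    ∀ j, fc (c m n) j = tfc (fun θ s => (expCoeff c m θ s).re) (2 * (n : ℤ) - m) j := by
  have hC : ∀ θ s, (((expCoeff c m θ s).re : ℝ) : ℂ) = expCoeff c m θ s := fun θ s =>
    Complex.ext (by simp) (by simp [hre])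
  have h2 : (2 * Real.pi : ℂ) ≠ 0 := by exact_mod_cast Real.two_pi_pos.ne'
  have hslice : ∀ s, ∫ θ, expCoeff c m θ s * em (-(2 * (n : ℤ) - m)) θ ∂circleMeasure =
      (2 * Real.pi : ℂ) * c m n s := by
    intro s
    have e : ∀ θ, expCoeff c m θ s * em (-(2 * (n : ℤ) - m)) θ = ∑ n' ∈ Finset.range (m + 1),
        c m n' s * em ((2 * (n' : ℤ) - m) + -(2 * (n : ℤ) - m)) θ := fun θ => by
      rw [expCoeff_eq, Finset.sum_mul]
      exact Finset.sum_congr rfl fun n' _ => by rw [em_add]; ring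
    simp only [e]
    rw [integral_finsetSum]
    · simp only [integral_const_mul, integral_em]
      rw [Finset.sum_eq_single n]
      · rw [if_pos (by ring)]; push_cast; ring
      · intro n' _ hne
        rw [if_neg (by omega), mul_zero]
      · intro h
        exact absurd (Finset.mem_range.2 (Nat.lt_succ_of_le hn)) h
    · intro n' _
      exact (memLp_one_iff_integrable.1 (memLp_of_continuous_circle (continuous_em _))).const_mul _
  have hI : ∀ j, Integrable (fun p : ℝ × ℝ => (((expCoeff c m p.1 p.2).re : ℝ) : ℂ) *
      em2 (-(2 * (n : ℤ) - m), -j) p) (circleMeasure.prod circleMeasure) := fun j => by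
    rw [← torusMeasure_eq]
    exact integrable_mul_em2 hi.ofReal _
  refine ⟨?_, fun j => ?_⟩
  · have h0 := ((hI 0).swap.integral_prod_left).const_mul ((2 * Real.pi : ℂ)⁻¹)
    refine h0.congr (Eventually.of_forall fun s => ?_)
    simp only [Function.comp, Prod.swap_prod_mk, em2, neg_zero, em_zero, mul_one, hC]
    rw [hslice, inv_mul_cancel_left₀ h2]
  · unfold fc tfc
    rw [torusMeasure_eq, integral_prod_symm _ (hI j)]
    have : ∀ s, ∫ θ, (((expCoeff c m θ s).re : ℝ) : ℂ) * em2 (-(2 * (n : ℤ) - m), -j) (θ, s)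
        ∂circleMeasure = (2 * Real.pi : ℂ) * (c m n s * em (-j) s) := fun s => by
      simp only [em2, hC, ← mul_assoc]
      rw [integral_mul_const, hslice]
    simp only [this]
    rw [integral_const_mul]
    field_simp

/-- The Fourier coefficients of an expansion. -/
lemma HasExpansion.exists_coeff {σ : ℝ} (hσ : 0 < σ) {Q : ℕ} (hQ : 1 ≤ Q) {f : ℝ → ℝ → ℝ → ℝ}
    {c : ℕ → ℕ → ℝ → ℂ} (h : HasExpansion σ Q f c) : ∃ u : ℕ → ℕ → Hs Q, IsReal u ∧
      (∀ a b j, u a b j = fc (c (a + b) a) j) ∧ (∀ a b, c (a + b) a =ᵐ[volume] evs (u a b)) ∧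
      ∀ a b, ‖u a b‖ ≤ 2 ^ (Q + 1) * (expNorm σ Q c).toReal * σ⁻¹ ^ (a + b) := by
  have hle : ∀ m, ENNReal.ofReal (σ ^ m) * sobolevNorm Q (fun θ s => (expCoeff c m θ s).re) ≤
      expNorm σ Q c := fun m => le_iSup (fun m => ENNReal.ofReal (σ ^ m) *
        sobolevNorm Q (fun θ s => (expCoeff c m θ s).re)) m
  have hpos : ∀ m : ℕ, ENNReal.ofReal (σ ^ m) ≠ 0 := fun m => by
    rw [Ne, ENNReal.ofReal_eq_zero, not_le]; positivity
  have hfin : ∀ m, sobolevNorm Q (fun θ s => (expCoeff c m θ s).re) < ⊤ := by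
    intro m
    by_contra hcon
    rw [not_lt, top_le_iff] at hcon
    have := hle m
    rw [hcon, ENNReal.mul_top (hpos m), top_le_iff] at this
    exact h.norm_lt_top.ne this
  have hreal : ∀ m, (sobolevNorm Q (fun θ s => (expCoeff c m θ s).re)).toReal ≤
      (expNorm σ Q c).toReal * σ⁻¹ ^ m := by
    intro m
    have := ENNReal.toReal_mono h.norm_lt_top.ne (hle m)
    rw [ENNReal.toReal_mul, ENNReal.toReal_ofReal (by positivity)] at this
    rw [inv_pow, ← div_eq_mul_inv, le_div_iff₀ (by positivity), mul_comm]
    exact this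
  choose hi u hu hun using fun (m : ℕ) (k : ℤ) => sobolev_lower (hfin m) k
  have hk : ∀ a b : ℕ, 2 * (a : ℤ) - ((a + b : ℕ) : ℤ) = (a : ℤ) - b := fun a b => by push_cast; ring
  have hs := fun a b : ℕ => integrable_expCoeff_slice (h.coeff_real (a + b)) (hi (a + b) 0)
    (Nat.le_add_right a b)
  have hfc : ∀ a b j, u (a + b) (a - b) j = fc (c (a + b) a) j := fun a b j => by
    rw [hu, (hs a b).2, hk]
  refine ⟨fun a b => u (a + b) (a - b), fun a b => ?_, hfc, fun a b => ?_, fun a b => ?_⟩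
  · ext j
    rw [conjH_apply, hu, hu, tfc_conj, neg_neg, neg_sub, add_comm a b]
  · refine ae_of_ae_circle (h.coeff_periodic _ _ (Nat.le_add_right a b)) (evs_periodic _) ?_
    have hsum : Summable fun j => ‖fc (c (a + b) a) j‖ :=
      (summable_norm_pos hQ (u (a + b) (a - b))).congr fun j => by rw [hfc]
    refine (ae_eq_evs_fc (hs a b).1 hsum).trans (Eventually.of_forall fun s => ?_)
    exact congrFun (evs_congr fun j => (hfc a b j).symm) s
  · calc _ ≤ 2 ^ (Q + 1) * (sobolevNorm Q (fun θ s => (expCoeff c (a + b) θ s).re)).toReal :=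
          hun _ _
      _ ≤ 2 ^ (Q + 1) * ((expNorm σ Q c).toReal * σ⁻¹ ^ (a + b)) :=
          mul_le_mul_of_nonneg_left (hreal _) (by positivity)
      _ = _ := by ring

/-- A continuous function on the torus is determined by its Fourier coefficients. -/
lemma eq_zero_of_tfc_eq_zero {f : ℝ → ℝ → ℝ} (hc : Continuous fun p : ℝ × ℝ => f p.1 p.2)
    (hp : IsTorusFun f) (h : ∀ k j, tfc f k j = 0) (θ s : ℝ) : f θ s = 0 := by
  have h2 : ((2 * Real.pi : ℝ) : ℂ) ≠ 0 := by exact_mod_cast Real.two_pi_pos.ne'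
  have hg : ∀ k s, ∫ θ, (f θ s : ℂ) * em (-k) θ ∂circleMeasure = 0 := by
    intro k
    have hcont : Continuous fun s => ∫ θ, (f θ s : ℂ) * em (-k) θ ∂circleMeasure := by
      simp only [integral_circle_eq]
      have hc' : Continuous (Function.uncurry fun (s : ℝ) (θ : ℝ) => (f θ s : ℂ) * em (-k) θ) := by
        have h1 : Continuous fun p : ℝ × ℝ => f p.2 p.1 := hc.comp continuous_swap
        exact (Complex.continuous_ofReal.comp h1).mul ((continuous_em (-k)).comp continuous_snd)
      exact intervalIntegral.continuous_parametric_intervalIntegral_of_continuous' hc' _ _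
    have hper : Function.Periodic (fun s => ∫ θ, (f θ s : ℂ) * em (-k) θ ∂circleMeasure)
        (2 * Real.pi) := fun s => by simp only [(hp _ s).2]
    have hz : (fun s => ∫ θ, (f θ s : ℂ) * em (-k) θ ∂circleMeasure) =ᵐ[circleMeasure] 0 := by
      refine ae_eq_zero_of_fourier_eq_zero
        (memLp_one_iff_integrable.1 (memLp_of_continuous_circle hcont)) fun j => ?_
      have ht := h k (-j)
      unfold tfc at ht
      have hI : Integrable (fun p : ℝ × ℝ => (f p.1 p.2 : ℂ) * em2 (-k, - -j) p)
          (circleMeasure.prod circleMeasure) := by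
        rw [← torusMeasure_eq]
        exact memLp_one_iff_integrable.1 (memLp_of_continuous_torus
          ((Complex.continuous_ofReal.comp hc).mul (continuous_em2 _)))
      have ht' := (mul_eq_zero.1 ht).resolve_left (by
        have := Real.pi_pos
        refine inv_ne_zero ?_
        exact_mod_cast (by positivity : (2 * Real.pi * (2 * Real.pi) : ℝ) ≠ 0))
      rw [torusMeasure_eq, integral_prod_symm _ hI] at ht'
      rw [← ht']
      refine integral_congr_ae (Eventually.of_forall fun s => ?_)
      simp only [em2, ← mul_assoc, neg_neg]
      rw [integral_mul_const]
    exact fun s => congrFun (eq_of_ae_circle hcont continuous_const hper (fun _ => rfl) hz) s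
  have hfs : Continuous fun θ => (f θ s : ℂ) :=
    Complex.continuous_ofReal.comp (hc.comp (continuous_id.prodMk continuous_const))
  have := eq_of_ae_circle hfs continuous_const (fun θ => by simp only [(hp θ s).1]) (fun _ => rfl)
    (ae_eq_zero_of_fourier_eq_zero (memLp_one_iff_integrable.1 (memLp_of_continuous_circle hfs))
      fun j => by simpa using hg (-j) s)
  exact Complex.ofReal_eq_zero.1 (congrFun this θ)

/-- Continuous functions with almost everywhere equal expansion coefficients are equal. -/
lemma eq_of_expansion_ae_eq {Q : ℕ} {ρ : ℝ} {f g : ℝ → ℝ → ℝ} {c d : ℕ → ℕ → ℝ → ℂ}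
    (hf : Tendsto (fun M : ℕ => sobolevNorm Q (fun θ s => f θ s -
      ∑ m ∈ Finset.range (M + 1), ρ ^ m * (expCoeff c m θ s).re)) atTop (𝓝 0))
    (hg : Tendsto (fun M : ℕ => sobolevNorm Q (fun θ s => g θ s -
      ∑ m ∈ Finset.range (M + 1), ρ ^ m * (expCoeff d m θ s).re)) atTop (𝓝 0))
    (hcd : ∀ m n, n ≤ m → c m n =ᵐ[volume] d m n)
    (hfc : Continuous fun p : ℝ × ℝ => f p.1 p.2) (hgc : Continuous fun p : ℝ × ℝ => g p.1 p.2)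
    (hfp : IsTorusFun f) (hgp : IsTorusFun g) (θ s : ℝ) : f θ s = g θ s := by
  have hkey : ∀ k j, tfc (fun θ s => f θ s - g θ s) k j = 0 := by
    intro k j
    -- The two partial sums agree almost everywhere, so `f - g` is the difference of the two
    -- remainders.
    have hae : ∀ M : ℕ, ∀ᵐ p : ℝ × ℝ ∂torusMeasure,
        ∑ m ∈ Finset.range (M + 1), ρ ^ m * (expCoeff c m p.1 p.2).re =
        ∑ m ∈ Finset.range (M + 1), ρ ^ m * (expCoeff d m p.1 p.2).re := by
      intro M
      have h1 : ∀ᵐ s ∂circleMeasure, ∀ m n, n ≤ m → c m n s = d m n s := by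
        rw [ae_all_iff]; intro m
        rw [ae_all_iff]; intro n
        by_cases hnm : n ≤ m
        · exact (ae_restrict_of_ae (hcd m n hnm)).mono fun s hs _ => hs
        · exact Eventually.of_forall fun s h => absurd h hnm
      rw [torusMeasure_eq]
      have h2 : ∀ᵐ p : ℝ × ℝ ∂circleMeasure.prod circleMeasure, ∀ m n, n ≤ m →
          c m n p.2 = d m n p.2 := Measure.quasiMeasurePreserving_snd.ae h1
      filter_upwards [h2] with p hp
      refine Finset.sum_congr rfl fun m _ => ?_
      rw [expCoeff_eq, expCoeff_eq]
      congr 2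
      exact Finset.sum_congr rfl fun n hn => by rw [hp m n (Nat.lt_succ_iff.1 (Finset.mem_range.1 hn))]
    have hto : ∀ {F : ℕ → ℝ≥0∞}, Tendsto F atTop (𝓝 0) →
        Tendsto (fun M => 2 ^ (Q + 1) * (F M).toReal) atTop (𝓝 0) := fun hF => by
      have := ((ENNReal.tendsto_toReal ENNReal.zero_ne_top).comp hF).const_mul (2 ^ (Q + 1))
      simpa using this
    have hev : ∀ {F : ℕ → ℝ≥0∞}, Tendsto F atTop (𝓝 0) → ∀ᶠ M in atTop, F M < ⊤ := fun hF =>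
      hF.eventually (gt_mem_nhds ENNReal.zero_lt_top)
    have hlim := (hto hf).add (hto hg)
    rw [add_zero] at hlim
    rw [← norm_le_zero_iff]
    refine ge_of_tendsto hlim ?_
    filter_upwards [hev hf, hev hg] with M h1 h2
    obtain ⟨i1, u1, hu1, n1⟩ := sobolev_lower h1 k
    obtain ⟨i2, u2, hu2, n2⟩ := sobolev_lower h2 k
    -- Each Fourier coefficient of `f - g` is bounded by the `H^Q` norms of the remainders, whatever
    -- `M`, hence is zero.
    have e : tfc (fun θ s => f θ s - g θ s) k j = u1 j - u2 j := by
      rw [hu1, hu2]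
      unfold tfc
      beta_reduce
      rw [← mul_sub]
      refine congrArg _ (Eq.trans ?_ (integral_sub (integrable_mul_em2 (i1.ofReal (𝕜 := ℂ)) (-k, -j))
        (integrable_mul_em2 (i2.ofReal (𝕜 := ℂ)) (-k, -j))))
      refine integral_congr_ae ((hae M).mono fun p hp => ?_)
      simp only [hp]
      push_cast
      ring
    rw [e]
    exact (norm_sub_le _ _).trans (add_le_add ((apply_le_norm _ _).trans n1)
      ((apply_le_norm _ _).trans n2))
  have := eq_zero_of_tfc_eq_zero (f := fun θ s => f θ s - g θ s) (hfc.sub hgc)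
    (fun θ s => by simp only [(hfp θ s).1, (hfp θ s).2, (hgp θ s).1, (hgp θ s).2, and_self]) hkey θ s
  exact sub_eq_zero.1 this

end NearAxis
end

/-! ### Equivalence of the equation with the recursion -/

noncomputable section

namespace NearAxis

open Hs

/-! ### The regularized Poisson equation and the recursion -/

lemma differentiable_of_evs {r : ℕ} (hr : 2 ≤ r) {f : ℝ → ℝ} {u : Hs r} (h : ∀ s, evs u s = f s) :
    Differentiable ℝ f := by
  obtain ⟨r, rfl⟩ := Nat.exists_eq_add_of_le' hr
  intro s
  have hs : Summable fun j => wt j * ‖u j‖ :=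
    Summable.of_nonneg_of_le (fun j => mul_nonneg (wt_pos j).le (norm_nonneg _))
      (fun j => mul_le_mul_of_nonneg_right (le_self_pow₀ (one_le_wt j) (Nat.succ_ne_zero r))
        (norm_nonneg _)) (summable_weight (r := r + 1) u)
  have h1 := Complex.reCLM.hasFDerivAt.comp_hasDerivAt s (hasDerivAt_evs hs s)
  have e : (⇑Complex.reCLM ∘ evs u) = f := funext fun s => by simp [h]
  rw [e] at h1
  exact h1.differentiableAt

lemma IsReal.im_PS {Q : ℕ} {U : ℕ → ℕ → Hs Q} (h : IsReal U) (ρ θ s : ℝ) :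
    (PS (fun a b => NearAxis.evs (U a b) s) ρ θ).im = 0 := by
  rw [← Complex.conj_eq_iff_im, ← PS_conj_swap]
  exact PS_congr (fun a b => h.evs b a s) ρ θ

/-- The left hand side of the equation minus the right hand side. -/
def defect (D : ℕ) (K : ℝ) (r₀ : ℝ → E3) (B₀ : ℝ → ℝ) (φ : ℝ → ℝ → ℝ → ℝ) (ρ θ s : ℝ) : ℝ :=
  divg r₀ (grad r₀ φ) ρ θ s + ρ / sqrtG r₀ ρ θ s * lapPerp (Preg D K r₀ φ) ρ θ s +
    divg r₀ (Btilde r₀ B₀) ρ θ s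

lemma pd_zero (i : Fin 3) : pd i (fun _ _ _ => 0) = fun _ _ _ => 0 := by
  funext ρ θ s
  fin_cases i <;> simp [pd]

/-- Serves for the imaginary part of a real power series: this is the zero function, which solves
the problem with `B₀ = 0`. -/
lemma defect_zero (D : ℕ) (K : ℝ) (r₀ : ℝ → E3) (ρ θ s : ℝ) :
    defect D K r₀ (fun _ => 0) (fun _ _ _ => 0) ρ θ s = 0 := by
  have h1 : ∀ i, grad r₀ (fun _ _ _ => 0) i = fun _ _ _ => 0 := fun i => by
    funext ρ θ s
    simp [grad, pd_zero]
  have h2 : ∀ i, Btilde r₀ (fun _ => 0) i = fun _ _ _ => 0 := fun i => by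
    funext ρ θ s
    simp [Btilde]
  have h3 : Preg D K r₀ (fun _ _ _ => 0) = fun _ _ _ => 0 := by
    have e1 : arcDeriv r₀ (fun _ _ _ => 0) = fun _ _ _ => 0 := by
      funext ρ θ s
      simp [arcDeriv, pd_zero]
    funext ρ θ s
    unfold Preg
    rw [Function.iterate_fixed (by simp [e1]), Function.iterate_fixed (by simp [pd_zero])]
    simp
  simp [defect, divg, lapPerp, h1, h2, h3, pd_zero]

lemma residual_const_mul (c : ℂ) (ℓ : ℝ) (k t : ℝ → ℝ) (v p w w' : ℕ → ℕ → ℝ → ℂ) (a b : ℕ) (s : ℝ) :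
    residual ℓ k t (fun a b s => c * v a b s) (fun a b s => c * p a b s) (fun a b s => c * w a b s)
      (fun a b s => c * w' a b s) a b s = c * residual ℓ k t v p w w' a b s := by
  unfold residual angular
  rcases a with _ | a <;> rcases b with _ | b <;> simp only [shz, shw] <;> ring

/-- The data of the problem in Fourier space. -/
structure Setup (q : ℕ) (σ : ℝ) (r₀ : ℝ → E3) (B₀ : ℝ → ℝ) (κ τ B : Hs (q + 1)) : Prop where
  pos : 0 < σ
  axis : IsAxis (4 + q) r₀
  evs_κ : ∀ s, evs κ s = curvature r₀ s
  evs_τ : ∀ s, evs τ s = torsion r₀ s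
  evs_B : ∀ s, evs B s = B₀ s
  small : 2 * (algC (q + 1) * ‖κ‖) ≤ σ⁻¹
  hs_pos : ∀ ρ θ s, 0 < ρ → ρ < σ → 0 < hs r₀ ρ θ s

namespace Setup

variable {q D : ℕ} {K σ : ℝ} {r₀ : ℝ → E3} {B₀ : ℝ → ℝ} {κ τ B : Hs (q + 1)}
  {IC u : ℕ → ℕ → Hs (q + 2 * D)} {J : ℕ → ℕ → Hs (q + 1)} {φ : ℝ → ℝ → ℝ → ℝ}

lemma mono (S : Setup q σ r₀ B₀ κ τ B) {σ' : ℝ} (h0 : 0 < σ') (h : σ' ≤ σ) :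
    Setup q σ' r₀ B₀ κ τ B :=
  ⟨h0, S.axis, S.evs_κ, S.evs_τ, S.evs_B, S.small.trans (inv_anti₀ h0 h),
    fun ρ θ s h1 h2 => S.hs_pos ρ θ s h1 (h2.trans_le h)⟩

lemma grow_flux (S : Setup q σ r₀ B₀ κ τ B) (hD : 1 ≤ D) (hu : Grow σ u)
    (hJ : IsDivh κ (fun a b => fluxY q D (ell r₀) τ B a b (u a b)) J) : Grow σ J :=
  (hu.fluxY hD S.pos).divh hJ S.pos S.small

lemma complex_flux (S : Setup q σ r₀ B₀ κ τ B) (hq : 1 ≤ q) (hD : 1 ≤ D) (hu : Grow σ u)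
    (hJ : IsDivh κ (fun a b => fluxY q D (ell r₀) τ B a b (u a b)) J) {ρ : ℝ} (hρ : 0 < ρ)
    (hρσ : ρ < σ) (θ s : ℝ) :
    (hs r₀ ρ θ s : ℂ) * GS (ev fun a b => J a b) (ρ, θ, s) =
      GS (ev (dsc fun a b => u a b)) (ρ, θ, s) -
      (ell r₀ * torsion r₀ s : ℝ) * GS (angular (ev fun a b => u a b)) (ρ, θ, s) +
      (ell r₀ * B₀ s : ℝ) := by
  have := flux_eq hq hD S.axis.ell_pos S.pos hu (S.grow_flux hD hu hJ) hJ (S.evs_κ s) (S.evs_τ s)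
    (S.evs_B s) (ρ := ρ) (by rwa [abs_of_pos hρ]) θ
  have e : hs r₀ ρ θ s = ell r₀ * (1 - curvature r₀ s * ρ * Real.cos θ) := by
    unfold hs; rw [S.axis.speed_eq]; rfl
  rw [e]
  exact this

lemma fluxData (S : Setup q σ r₀ B₀ κ τ B) (hq : 1 ≤ q) (hD : 1 ≤ D) (hu : Grow σ u)
    (hJ : IsDivh κ (fun a b => fluxY q D (ell r₀) τ B a b (u a b)) J)
    (hφ : ∀ ρ θ s, 0 < ρ → ρ < σ → φ ρ θ s = RS (ev fun a b => u a b) ρ θ s) :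
    FluxData σ r₀ (ell r₀) B₀ φ (ev fun a b => u a b) (ev (dsc fun a b => u a b))
      (ev fun a b => J a b) (ev (dsc fun a b => J a b)) := by
  have hu1 : RawFam σ 1 (fun a b j => u a b j) := (hu.rawFam_pred hq S.pos).mono (by omega)
  have hJ1 := ((S.grow_flux hD hu hJ).rawFam S.pos).mono hq
  refine ⟨S.axis.speed_eq, differentiable_of_evs (by omega) S.evs_κ,
    differentiable_of_evs (by omega) S.evs_B, S.hs_pos, hφ, hu1.fnFam.pred, hu1.deriv.fnFam,
    hu1.hasDerivAt, hJ1.fnFam.pred, hJ1.deriv.fnFam, hJ1.hasDerivAt, fun ρ θ s h0 h1 => ?_⟩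
  have := congrArg Complex.re (S.complex_flux hq hD hu hJ h0 h1 θ s)
  rw [Complex.re_ofReal_mul, Complex.add_re, Complex.sub_re, Complex.re_ofReal_mul,
    Complex.ofReal_re] at this
  exact this

lemma preg_eq (S : Setup q σ r₀ B₀ κ τ B) (hq : 1 ≤ q) (hu : Grow σ u)
    (hφ : ∀ ρ θ s, 0 < ρ → ρ < σ → φ ρ θ s = RS (ev fun a b => u a b) ρ θ s) (ρ θ s : ℝ)
    (hρ : 0 < ρ) (hρσ : ρ < σ) : Preg D K r₀ φ ρ θ s =
      RS (ev fun a b j => pSym D K a b j * u a b j) ρ θ s :=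
  Preg_RS S.axis.length_pos S.axis.speed_eq ((hu.rawFam_pred hq S.pos).mono (by omega)) hφ hρ hρσ θ s

lemma fnFam_preg (S : Setup q σ r₀ B₀ κ τ B) (hq : 1 ≤ q) (hu : Grow σ u) :
    FnFam σ 0 (ev fun a b j => pSym D K a b j * u a b j) :=
  (((hu.rawFam_pred hq S.pos).preg K).mono (Nat.zero_le _)).fnFam

lemma defect_eq (S : Setup q σ r₀ B₀ κ τ B) (hq : 1 ≤ q) (hD : 1 ≤ D) (hu : Grow σ u)
    (hJ : IsDivh κ (fun a b => fluxY q D (ell r₀) τ B a b (u a b)) J)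
    (hφ : ∀ ρ θ s, 0 < ρ → ρ < σ → φ ρ θ s = RS (ev fun a b => u a b) ρ θ s)
    {ρ : ℝ} (hρ : 0 < ρ) (hρσ : ρ < σ) (θ s : ℝ) :
    ρ * (sqrtG r₀ ρ θ s * defect D K r₀ B₀ φ ρ θ s) =
    (PS (fun a b => residual (ell r₀) (curvature r₀) (torsion r₀) (ev fun a b => u a b)
      (ev fun a b j => pSym D K a b j * u a b j) (ev fun a b => J a b)
      (ev (dsc fun a b => J a b)) a b s) ρ θ).re :=
  (S.fluxData hq hD hu hJ hφ).equation_eq (S.fnFam_preg hq hu) (S.preg_eq hq hu hφ) hρ hρσ θ s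

/-- The recursion implies the equation. -/
lemma defect_eq_zero (S : Setup q σ r₀ B₀ κ τ B) (hq : 1 ≤ q) (hD : 1 ≤ D) (hK : 0 < K)
    (hu : Grow σ u) (h : IsSol q D K (ell r₀) κ τ B IC u J)
    (hφ : ∀ ρ θ s, 0 < ρ → ρ < σ → φ ρ θ s = RS (ev fun a b => u a b) ρ θ s)
    {ρ : ℝ} (hρ : 0 < ρ) (hρσ : ρ < σ) (θ s : ℝ) : defect D K r₀ B₀ φ ρ θ s = 0 := by
  have hz : ∀ a b, residual (ell r₀) (curvature r₀) (torsion r₀) (ev fun a b => u a b)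
      (ev fun a b j => pSym D K a b j * u a b j) (ev fun a b => J a b)
      (ev (dsc fun a b => J a b)) a b s = 0 := by
    intro a b
    rcases a with _ | a
    · exact residual_edge (Or.inl rfl) s
    · rcases b with _ | b
      · exact residual_edge (Or.inr rfl) s
      · rw [(residual_eq_evs hq hD S.pos hu (S.grow_flux hD hu h.flux) S.evs_κ S.evs_τ a b).2,
          evs_congr ((residualSeq_eq_zero_iff hD hK S.axis.ell_pos a b).2 (h.step a b))]
        simp [evs]
  have h1 := S.defect_eq (K := K) hq hD hu h.flux hφ hρ hρσ θ s
  simp only [hz] at h1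
  have h2 : sqrtG r₀ ρ θ s ≠ 0 := (mul_pos hρ (S.hs_pos ρ θ s hρ hρσ)).ne'
  simpa [PS, hρ.ne', h2] using h1

/-- The equation implies the recursion. -/
lemma isSol_of_defect (S : Setup q σ r₀ B₀ κ τ B) (hq : 1 ≤ q) (hD : 1 ≤ D) (hK : 0 < K)
    (hu : Grow σ u) (hr : IsReal u)
    (hφ : ∀ ρ θ s, 0 < ρ → ρ < σ → φ ρ θ s = RS (ev fun a b => u a b) ρ θ s)
    (hz : ∀ ρ θ s, 0 < ρ → ρ < σ → defect D K r₀ B₀ φ ρ θ s = 0)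
    (hic : ∀ a b, a = 0 ∨ b = 0 → u a b = IC a b) :
    ∃ J, IsSol q D K (ell r₀) κ τ B IC u J := by
  set J := divh κ (fun a b => fluxY q D (ell r₀) τ B a b (u a b)) with hJd
  have hJ : IsDivh κ (fun a b => fluxY q D (ell r₀) τ B a b (u a b)) J := isDivh_divh _ _
  have hJg := S.grow_flux hD hu hJ
  set R := fun s a b => residual (ell r₀) (curvature r₀) (torsion r₀) (ev fun a b => u a b)
      (ev fun a b j => pSym D K a b j * u a b j) (ev fun a b => J a b)
      (ev (dsc fun a b => J a b)) a b s with hR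
  have F := S.fluxData hq hD hu hJ hφ
  have hP : FnFam σ 0 (ev fun a b j => pSym D K a b j * u a b j) := S.fnFam_preg hq hu
  -- The equation is real and so gives only the real part of the residual series. Multiplying all
  -- coefficients by `-I` turns imaginary parts into real parts. Since `u` is real, the rotated
  -- series represents the zero function with zero data, and the same identity makes the imaginary
  -- part of the residual vanish.
  have rot : ∀ {v : ℕ → ℕ → ℝ → ℂ}, FnFam σ 0 v → FnFam σ 0 (fun a b s => -Complex.I * v a b s) :=
    fun hv => hv.poly (c := fun _ _ => -Complex.I) 0 (fun _ _ => by simp)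
  have RS_rot : ∀ (v : ℕ → ℕ → ℝ → ℂ) ρ θ s, RS (fun a b s => -Complex.I * v a b s) ρ θ s =
      (GS v (ρ, θ, s)).im := fun v ρ θ s => by
    unfold RS GS
    rw [PS_mul_left]
    simp
  have ang_rot : ∀ v : ℕ → ℕ → ℝ → ℂ, angular (fun a b s => -Complex.I * v a b s) =
      fun a b s => -Complex.I * angular v a b s := fun v => by
    funext a b s; unfold angular; ring
  have him : ∀ ρ θ s, (GS (ev fun a b => u a b) (ρ, θ, s)).im = 0 := fun ρ θ s => hr.im_PS ρ θ s
  have F' : FluxData σ r₀ (ell r₀) (fun _ => 0) (fun _ _ _ => 0)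
      (fun a b s => -Complex.I * ev (fun a b => u a b) a b s)
      (fun a b s => -Complex.I * ev (dsc fun a b => u a b) a b s)
      (fun a b s => -Complex.I * ev (fun a b => J a b) a b s)
      (fun a b s => -Complex.I * ev (dsc fun a b => J a b) a b s) := by
    refine ⟨F.speed_eq, F.curv, differentiable_const _, F.hs_pos, fun ρ θ s _ _ => ?_, rot F.fam_v,
      rot F.fam_v', fun a b s => (F.deriv_v a b s).const_mul _, rot F.fam_w, rot F.fam_w',
      fun a b s => (F.deriv_w a b s).const_mul _, fun ρ θ s h0 h1 => ?_⟩
    · rw [RS_rot, him]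
    · have := congrArg Complex.im (S.complex_flux hq hD hu hJ h0 h1 θ s)
      rw [Complex.im_ofReal_mul, Complex.add_im, Complex.sub_im, Complex.im_ofReal_mul,
        Complex.ofReal_im] at this
      rw [ang_rot, RS_rot, RS_rot, RS_rot, mul_zero]
      exact this
  have hψ : ∀ ρ θ s, 0 < ρ → ρ < σ → Preg D K r₀ (fun _ _ _ => 0) ρ θ s =
      RS (fun a b s => -Complex.I * ev (fun a b j => pSym D K a b j * u a b j) a b s) ρ θ s := by
    intro ρ θ s h0 h1
    have hraw : RawFam σ (2 * D) (fun a b j => -Complex.I * u a b j) :=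
      ((hu.rawFam_pred hq S.pos).mono (r' := 2 * D) (by omega)).of_mul (C := 1) (p := 0) zero_le_one
        fun a b j => by
          have := mul_nonneg (pow_nonneg (wt_pos j).le (2 * D)) (norm_nonneg (u a b j))
          simp only [norm_mul, norm_neg, Complex.norm_I, one_mul, pow_zero]
          linarith
    have := Preg_RS (φ := fun _ _ _ => 0) (K := K) S.axis.length_pos S.axis.speed_eq hraw
      (fun ρ θ s _ _ => by
        rw [← him ρ θ s, ← RS_rot]
        exact RS_congr (fun a b => (evs_mul_left _ _ _).symm) ρ θ) h0 h1 θ s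
    rw [this]
    refine RS_congr (fun a b => ?_) ρ θ
    unfold ev
    rw [← evs_mul_left]
    exact congrFun (evs_congr fun j => by ring) s
  have hPS : ∀ ρ θ s, 0 < ρ → ρ < σ → PS (R s) ρ θ = 0 := by
    intro ρ θ s h0 h1
    have e1 := S.defect_eq (K := K) hq hD hu hJ hφ h0 h1 θ s
    rw [hz ρ θ s h0 h1, mul_zero, mul_zero] at e1
    have e2 := F'.equation_eq (rot hP) hψ h0 h1 θ s
    have e3 := defect_zero D K r₀ ρ θ s
    unfold defect at e3
    rw [e3, mul_zero, mul_zero] at e2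
    simp only [residual_const_mul] at e2
    rw [PS_mul_left] at e2
    refine Complex.ext e1.symm ?_
    simpa using e2.symm
  have hR0 : ∀ a b s, R s a b = 0 := fun a b s =>
    eq_zero_of_PS_eq_zero S.pos (absConv_residual _ _ _ F.fam_v hP F.fam_w F.fam_w' s)
      (fun ρ θ h0 h1 => hPS ρ θ s h0 h1) a b
  refine ⟨J, hic, fun a b => ?_, hJ⟩
  rw [← residualSeq_eq_zero_iff hD hK S.axis.ell_pos]
  obtain ⟨h1, h2⟩ := residual_eq_evs (K := K) (ℓ := ell r₀) hq hD S.pos hu hJg S.evs_κ S.evs_τ a b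
  have h3 : evs (residualSeq D K (ell r₀) κ τ u J a b) = evs (fun _ => 0) := by
    funext s
    rw [← h2 s]
    simpa [evs] using hR0 (a + 1) (b + 1) s
  exact congrFun (evs_injective h1 (by simp) fun s => congrFun h3 s)

/-- The solution of the recursion with real data is real. -/
lemma isReal (S : Setup q σ r₀ B₀ κ τ B) (hq : 1 ≤ q) (hD : 1 ≤ D) (hK : 0 < K)
    (hu : Grow σ u) (h : IsSol q D K (ell r₀) κ τ B IC u J) (hIC : IsReal IC) : IsReal u := by
  have hRS : ∀ ρ θ s, 0 < ρ → ρ < σ → RS (ev fun a b => u a b) ρ θ s =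
      RS (ev fun a b => symm u a b) ρ θ s := by
    obtain ⟨D, rfl⟩ := Nat.exists_eq_add_of_le' hD
    exact fun ρ θ s h0 h1 =>
      (RS_symm (Q := q + 2 * D + 1) S.pos hu (by rwa [abs_of_pos h0]) θ s).symm
  -- The symmetrized family has the same real part as `u`, so it solves the same equation. Real data
  -- are unchanged by symmetrizing, so it solves the same recursion, and uniqueness identifies it
  -- with `u`.
  obtain ⟨J', h'⟩ := S.isSol_of_defect (IC := IC) hq hD hK hu.symm (isReal_symm u) hRS
    (fun ρ θ s h0 h1 => S.defect_eq_zero hq hD hK hu h (fun _ _ _ _ _ => rfl) h0 h1 θ s)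
    (fun a b hab => by
      ext j
      rw [symm, h.ic a b hab, h.ic b a hab.symm, hIC]
      simp only [Hs.smul_apply, Hs.add_apply]
      ring)
  rw [h.unique h']
  exact isReal_symm u

end Setup

end NearAxis
end

/-! ### Existence, uniqueness and a radius common to all nearby axes -/

noncomputable section

namespace NearAxis

open Hs

/-! ### Existence and uniqueness of near-axis solutions -/

lemma fc_congr_ae {f g : ℝ → ℂ} (h : f =ᵐ[volume] g) (j : ℤ) : fc f j = fc g j := by
  unfold fc
  congr 1
  exact integral_congr_ae ((ae_restrict_of_ae h).mono fun s hs => by simp only [hs])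

namespace Setup

variable {q D : ℕ} {K σ : ℝ} {r₀ : ℝ → E3} {B₀ : ℝ → ℝ} {κ τ B : Hs (q + 1)}
  {IC u : ℕ → ℕ → Hs (q + 2 * D)} {J : ℕ → ℕ → Hs (q + 1)} {cIC : ℕ → ℕ → ℝ → ℂ}

lemma isNearAxisSolution (S : Setup q σ r₀ B₀ κ τ B) (hq : 1 ≤ q) (hD : 1 ≤ D) (hK : 0 < K)
    (hu : Grow σ u) (h : IsSol q D K (ell r₀) κ τ B IC u J) (hIC : IsReal IC)
    (hn : expNorm σ (q + 2 * D) (coefOf u) < ⊤)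
    (hcIC : ∀ a b, cIC (a + b) a =ᵐ[volume] evs (IC a b)) :
    IsNearAxisSolution q D K σ r₀ B₀ cIC (RS (ev fun a b => u a b)) (coefOf u) := by
  have hR := hu.rawFam_pred hq S.pos
  refine ⟨hasExpansion_RS (by omega) S.pos hu (S.isReal hq hD hK hu h hIC) (fun _ _ _ _ _ => rfl) hn,
    fun m => ⟨?_, ?_⟩, ?_, ?_, fun s => ?_, fun ρ θ s h0 h1 => ?_⟩
  · have := hcIC 0 m
    rw [zero_add, ← h.ic 0 m (Or.inl rfl)] at this
    exact this.symm
  · have := hcIC m 0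
    rw [add_zero, ← h.ic m 0 (Or.inr rfl)] at this
    have e : coefOf u m m = evs (u m 0) := by
      funext s
      unfold coefOf
      rw [Nat.sub_self]
    rw [e]
    exact this.symm
  · refine Complex.continuous_re.comp_continuousOn ((GS_continuousOn hR.fnFam.zero).mono ?_)
    rintro ⟨ρ, x⟩ ⟨hρ, -⟩
    show |ρ| < σ
    rw [abs_of_nonneg hρ.1]
    exact hρ.2
  · exact Complex.reCLM.contDiff.comp_contDiffOn (GS_contDiffOn (hR.mono (r' := 2 * D) (by omega)).fnFam)
  -- `P` uses up `2 * D` derivatives in `s`, and for `q = 1` its image need not be differentiable in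
  -- `s`. With `s` frozen the series is smooth in `ρ` and `θ`, which is what `Δ_⊥` requires.
  · have hc : FnFam σ 2 (fun a b _ => ev (fun a b j => pSym D K a b j * u a b j) a b s) :=
      FnFam.const ((S.fnFam_preg hq hu).absConv s) 2
    have h1 := Complex.reCLM.contDiff.comp_contDiffOn (GS_contDiffOn hc)
    have h2 : ContDiff ℝ 2 (fun p : ℝ × ℝ => ((p.1, p.2, s) : ℝ × ℝ × ℝ)) :=
      contDiff_fst.prodMk (contDiff_snd.prodMk contDiff_const)
    refine (h1.comp h2.contDiffOn fun p hp => ⟨hp.1, mem_univ _⟩).congr fun p hp => ?_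
    exact S.preg_eq hq hu (fun _ _ _ _ _ => rfl) p.1 p.2 s hp.1.1 hp.1.2
  · have := S.defect_eq_zero hq hD hK hu h (φ := RS (ev fun a b => u a b)) (fun _ _ _ _ _ => rfl) h0 h1 θ s
    unfold defect at this
    linarith

/-- An arbitrary solution is the sum of its own expansion, by uniqueness of Fourier coefficients and
continuity. Its coefficients then satisfy the recursion with the same data and coincide with `u`. -/
lemma eq_RS_of_isNearAxisSolution (S : Setup q σ r₀ B₀ κ τ B) (hq : 1 ≤ q) (hD : 1 ≤ D) (hK : 0 < K)
    (h : IsSol q D K (ell r₀) κ τ B IC u J) (hfc : ∀ a b j, IC a b j = fc (cIC (a + b) a) j)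
    {φ : ℝ → ℝ → ℝ → ℝ} {c : ℕ → ℕ → ℝ → ℂ} (hφ : IsNearAxisSolution q D K σ r₀ B₀ cIC φ c)
    {ρ : ℝ} (hρ : 0 ≤ ρ) (hρσ : ρ < σ) (θ s : ℝ) : φ ρ θ s = RS (ev fun a b => u a b) ρ θ s := by
  obtain ⟨u', hr, hu', hae, hb⟩ := hφ.expansion.exists_coeff S.pos (by omega)
  have hg : Grow σ u' := ⟨2 ^ (q + 2 * D + 1) * (expNorm σ (q + 2 * D) c).toReal, 0, by positivity,
    fun a b => by rw [pow_zero, mul_one]; exact hb a b⟩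
  have hc : ∀ ρ, 0 ≤ ρ → ρ < σ → Continuous fun p : ℝ × ℝ => ((ρ, p.1, p.2) : ℝ × ℝ × ℝ) :=
    fun ρ _ _ => by fun_prop
  have hRS : ∀ ρ θ s, 0 ≤ ρ → ρ < σ → φ ρ θ s = RS (ev fun a b => u' a b) ρ θ s := by
    intro ρ θ s h0 h1
    refine eq_of_expansion_ae_eq (hφ.expansion.converges ρ h0 h1)
      (tendsto_sobolevNorm_sub (by omega) S.pos hg h0 h1) (fun m n hnm => ?_) ?_ ?_
      (hφ.expansion.periodic ρ h0 h1) (fun θ s => ?_) θ s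
    · have := hae n (m - n)
      rwa [Nat.add_sub_cancel' hnm] at this
    · exact hφ.continuousOn.comp_continuous (hc ρ h0 h1) fun p => ⟨⟨h0, h1⟩, mem_univ _⟩
    · exact Complex.continuous_re.comp ((GS_continuousOn (hg.rawFam_pred hq S.pos).fnFam.zero).comp_continuous
        (hc ρ h0 h1) fun p => by show |ρ| < σ; rwa [abs_of_nonneg h0])
    · unfold RS GS PS ev
      constructor
      · simp only [em_periodic _ θ]
      · simp only [evs_periodic _ s]
  obtain ⟨J', h'⟩ := S.isSol_of_defect (IC := IC) (φ := φ) hq hD hK hg hr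
    (fun ρ θ s h0 h1 => hRS ρ θ s h0.le h1)
    (fun ρ θ s h0 h1 => by
      have := hφ.equation ρ θ s h0 h1
      unfold defect
      linarith)
    (fun a b hab => by
      ext j
      rw [hu', hfc]
      refine fc_congr_ae ?_ j
      rcases hab with rfl | rfl
      · rw [zero_add]; exact (hφ.initial b).1
      · rw [add_zero]; exact (hφ.initial a).2)
  rw [hRS ρ θ s hρ hρσ, h'.unique h]

end Setup

/-! ### The choice of the radius -/

lemma tendsto_poly_mul_half_pow (n : ℕ) :
    Tendsto (fun m : ℕ => (1 + m : ℝ) ^ n * (1 / 2) ^ m) atTop (𝓝 0) := by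
  have h := tendsto_pow_const_mul_const_pow_of_abs_lt_one n (r := 1 / 2) (by norm_num [abs_of_pos])
  have := ((tendsto_add_atTop_iff_nat 1).2 h).const_mul 2
  rw [mul_zero] at this
  refine this.congr fun m => ?_
  push_cast
  rw [pow_succ, add_comm (m : ℝ) 1]
  ring

lemma exists_poly_mul_half_pow_le (n : ℕ) :
    ∃ A : ℝ, 0 ≤ A ∧ ∀ m : ℕ, (1 + m : ℝ) ^ n * (1 / 2) ^ m ≤ A := by
  obtain ⟨A, hA⟩ := (tendsto_poly_mul_half_pow n).bddAbove_range
  refine ⟨A, ?_, fun m => hA ⟨m, rfl⟩⟩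
  exact le_trans (by positivity) (hA ⟨0, rfl⟩)

/-- At half the radius `1 / R` a factor `2^{-m}` is left over. It beats `(1 + m) ^ (Q + 1)`, where
`Q` powers come from the `θ`-derivatives and one from the number of modes of degree `m`. -/
lemma geometric_term_le {Q : ℕ} {R N : ℝ} (hR : 0 < R) {U : ℕ → ℕ → Hs Q}
    (hU : ∀ a b, ‖U a b‖ ≤ N * R ^ (a + b)) (m : ℕ) :
    (1 / (2 * R)) ^ m * (upC Q * ((1 + m) ^ Q *
      ∑ p ∈ Finset.HasAntidiagonal.antidiagonal m, ‖U p.1 p.2‖)) ≤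
      N * upC Q * ((1 + m) ^ (Q + 1) * (1 / 2) ^ m) := by
  have h1 := sum_antidiagonal_norm_le (U := U) (m := m) (C := N * R ^ m) fun a b hab => by
    rw [← hab]; exact hU a b
  have h2 := upC_nonneg Q
  calc _ ≤ (1 / (2 * R)) ^ m * (upC Q * ((1 + m) ^ Q * ((1 + m) * (N * R ^ m)))) := by gcongr
    _ = _ := by
      rw [one_div, mul_inv, mul_pow, pow_succ, inv_pow R, one_div]
      field_simp

/-- Of the `4 + q` derivatives of the axis the torsion uses three, leaving exactly the `q + 1`
needed here. The curvature has one to spare. -/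
lemma exists_geometry {q : ℕ} {r₀ : ℝ → E3} (h₀ : IsAxis (4 + q) r₀) :
    ∃ (κ τ : Axes (4 + q) → Hs (q + 1)) (κ₀ τ₀ : Hs (q + 1)),
      Tendsto κ (nearAxes (4 + q) r₀) (𝓝 κ₀) ∧ Tendsto τ (nearAxes (4 + q) r₀) (𝓝 τ₀) ∧
      Tendsto (fun r : Axes (4 + q) => ell r.1) (nearAxes (4 + q) r₀) (𝓝 (ell r₀)) ∧
      (∀ r s, evs (κ r) s = curvature r.1 s) ∧ (∀ r s, evs (τ r) s = torsion r.1 s) ∧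
      (∀ s, evs κ₀ s = curvature r₀ s) ∧ ∀ s, evs τ₀ s = torsion r₀ s := by
  rw [show 4 + q = q + 1 + 3 by omega] at h₀ ⊢
  obtain ⟨κ, κ₀, h1, h2, h3⟩ := ((ckConv_curvature (k := q + 2) h₀).of_le (Nat.le_succ _)).exists_Hs
    (k := q + 1) (by omega)
  obtain ⟨τ, τ₀, h4, h5, h6⟩ := (ckConv_torsion (k := q + 1) h₀).exists_Hs (by omega)
  exact ⟨κ, τ, κ₀, τ₀, h1, h4, tendsto_ell (k := q + 3) h₀, h2, h5, h3, h6⟩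

/-- The geometric data of an axis are bounded. -/
structure GeomBound (q : ℕ) (ℓ₀ k₀ : ℝ) (r : ℝ → E3) (κ τ : Hs (q + 1)) : Prop where
  axis : IsAxis (4 + q) r
  evs_κ : ∀ s, evs κ s = curvature r s
  evs_τ : ∀ s, evs τ s = torsion r s
  norm_κ : ‖κ‖ ≤ k₀
  norm_τ : ‖τ‖ ≤ k₀
  le_ell : ℓ₀ / 2 ≤ ell r
  ell_le : ell r ≤ 2 * ℓ₀

/-- The reciprocal of twice the radius of the tube. -/
def rate (q D : ℕ) (K σ₀ ℓ₀ k₀ : ℝ) : ℝ :=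
  growthC q D K (ℓ₀ / 2) (2 * ℓ₀) k₀ + 2 * (algC (q + 1) * k₀) + 2 * (algC q * k₀) + embC * k₀ +
    σ₀⁻¹ + 1

section Rate

variable {q D : ℕ} {K σ₀ ℓ₀ k₀ : ℝ}

lemma one_le_growthC (hℓ₀ : 0 < ℓ₀) (hk₀ : 0 ≤ k₀) : 1 ≤ growthC q D K (ℓ₀ / 2) (2 * ℓ₀) k₀ := by
  have h1 := algC_nonneg (q + 1)
  have h2 := resC_nonneg (D := D) (K := K) (half_pos hℓ₀)
  unfold growthC fluxC
  rw [add_assoc, add_assoc]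
  refine le_add_of_nonneg_right ?_
  positivity

/-- Each summand of `rate` meets one demand: the growth of the recursion, the division by `h_s` in
`H^{q+1}` and in `H^q`, the supremum of the curvature, and the radius of the data. All depend only
on `ℓ₀` and `k₀`, so one tube serves every axis with these bounds. -/
lemma rate_bounds (hσ₀ : 0 < σ₀) (hℓ₀ : 0 < ℓ₀) (hk₀ : 0 ≤ k₀) :
    growthC q D K (ℓ₀ / 2) (2 * ℓ₀) k₀ ≤ rate q D K σ₀ ℓ₀ k₀ ∧
    2 * (algC (q + 1) * k₀) ≤ rate q D K σ₀ ℓ₀ k₀ ∧ 2 * (algC q * k₀) ≤ rate q D K σ₀ ℓ₀ k₀ ∧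
    embC * k₀ ≤ rate q D K σ₀ ℓ₀ k₀ ∧ σ₀⁻¹ ≤ rate q D K σ₀ ℓ₀ k₀ ∧ 1 ≤ rate q D K σ₀ ℓ₀ k₀ := by
  have h1 := one_le_growthC (q := q) (D := D) (K := K) hℓ₀ hk₀
  have h2 : 0 ≤ 2 * (algC (q + 1) * k₀) := by have := algC_nonneg (q + 1); positivity
  have h3 : 0 ≤ 2 * (algC q * k₀) := by have := algC_nonneg q; positivity
  have h4 : 0 ≤ embC * k₀ := mul_nonneg embC_nonneg hk₀
  have h5 : 0 < σ₀⁻¹ := inv_pos.2 hσ₀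
  unfold rate
  refine ⟨?_, ?_, ?_, ?_, ?_, ?_⟩ <;> linarith

namespace GeomBound

variable {r : ℝ → E3} {κ τ B : Hs (q + 1)} {IC u : ℕ → ℕ → Hs (q + 2 * D)}
  {J : ℕ → ℕ → Hs (q + 1)} {B₀ : ℝ → ℝ}

lemma curvature_mul_le (G : GeomBound q ℓ₀ k₀ r κ τ) (s : ℝ) : curvature r s ≤ embC * k₀ := by
  have h1 := norm_evs_le (summable_norm_pos (by omega) κ) s
  rw [G.evs_κ, Complex.norm_real] at h1
  exact ((le_abs_self _).trans h1).trans ((tsum_norm_le (by omega) κ).trans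
    (mul_le_mul_of_nonneg_left G.norm_κ embC_nonneg))

lemma lt_inv_curvature (G : GeomBound q ℓ₀ k₀ r κ τ) (hσ₀ : 0 < σ₀) (hℓ₀ : 0 < ℓ₀) (hk₀ : 0 ≤ k₀)
    (s : ℝ) : 1 / (2 * rate q D K σ₀ ℓ₀ k₀) < (curvature r s)⁻¹ := by
  obtain ⟨-, -, -, h4, -, h6⟩ := rate_bounds (q := q) (D := D) (K := K) hσ₀ hℓ₀ hk₀
  rw [one_div]
  refine inv_strictAnti₀ (G.axis.curvature_pos s) ?_
  linarith [G.curvature_mul_le s]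

lemma setup (G : GeomBound q ℓ₀ k₀ r κ τ) (hσ₀ : 0 < σ₀) (hℓ₀ : 0 < ℓ₀) (hk₀ : 0 ≤ k₀)
    (hB : ∀ s, evs B s = B₀ s) :
    Setup q (1 / (2 * rate q D K σ₀ ℓ₀ k₀)) r B₀ κ τ B := by
  obtain ⟨-, h2, -, -, -, h6⟩ := rate_bounds (q := q) (D := D) (K := K) hσ₀ hℓ₀ hk₀
  refine ⟨by positivity, G.axis, G.evs_κ, G.evs_τ, hB, ?_, fun ρ θ s h0 h1 => ?_⟩
  · have := mul_le_mul_of_nonneg_left G.norm_κ (algC_nonneg (q + 1))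
    rw [one_div, inv_inv]
    linarith
  · have hk := G.axis.curvature_pos s
    have h3 := h1.trans (G.lt_inv_curvature (D := D) (K := K) hσ₀ hℓ₀ hk₀ s)
    have h4 : curvature r s * ρ < 1 := by
      have := mul_lt_mul_of_pos_left h3 hk
      rwa [mul_inv_cancel₀ hk.ne'] at this
    have h5 : curvature r s * ρ * Real.cos θ ≤ curvature r s * ρ :=
      mul_le_of_le_one_right (by positivity) (Real.cos_le_one θ)
    unfold hs
    rw [G.axis.speed_eq]
    exact mul_pos G.axis.ell_pos (by linarith)

lemma bound (G : GeomBound q ℓ₀ k₀ r κ τ) (hD : 1 ≤ D) (hK : 0 < K) (hσ₀ : 0 < σ₀) (hℓ₀ : 0 < ℓ₀)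
    (hk₀ : 0 ≤ k₀) {M : ℝ} (hM : 0 ≤ M) (hB : ‖B‖ ≤ M) (hIC : ∀ a b, ‖IC a b‖ ≤ M * σ₀⁻¹ ^ (a + b))
    (h : IsSol q D K (ell r) κ τ B IC u J) (a b : ℕ) :
    ‖u a b‖ ≤ 2 * M * rate q D K σ₀ ℓ₀ k₀ ^ (a + b) := by
  obtain ⟨h1, -, -, -, h5, -⟩ := rate_bounds (q := q) (D := D) (K := K) hσ₀ hℓ₀ hk₀
  refine (h.bound hD hK (half_pos hℓ₀) G.le_ell G.ell_le hk₀ G.norm_κ G.norm_τ hM h1 hB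
    (fun a b => (hIC a b).trans ?_) a b).1
  have := inv_pos.2 hσ₀
  gcongr

end GeomBound

lemma grow_of_bound (hσ₀ : 0 < σ₀) (hℓ₀ : 0 < ℓ₀) (hk₀ : 0 ≤ k₀) {Q : ℕ} {u : ℕ → ℕ → Hs Q} {N : ℝ}
    (hN : 0 ≤ N) (h : ∀ a b, ‖u a b‖ ≤ N * rate q D K σ₀ ℓ₀ k₀ ^ (a + b)) :
    Grow (1 / (2 * rate q D K σ₀ ℓ₀ k₀)) u := by
  obtain ⟨-, -, -, -, -, h6⟩ := rate_bounds (q := q) (D := D) (K := K) hσ₀ hℓ₀ hk₀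
  refine ⟨N, 0, hN, fun a b => (h a b).trans ?_⟩
  rw [one_div, inv_inv, pow_zero, mul_one]
  gcongr
  linarith

end Rate

end NearAxis
end

/-! ### Cartesian derivatives of power series, and analyticity on smaller tubes -/

noncomputable section

namespace NearAxis

open Hs

/-! ### The magnetic field -/

section HsEval

variable {r : ℕ}

lemma evs_Hs_add (hr : 1 ≤ r) (u v : Hs r) (s : ℝ) : evs (u + v : Hs r) s = evs u s + evs v s := by
  rw [← evs_add (summable_norm_pos hr u) (summable_norm_pos hr v)]
  exact congrFun (evs_congr fun j => Hs.add_apply u v j) s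

lemma evs_Hs_smul (c : ℂ) (u : Hs r) (s : ℝ) : evs (c • u : Hs r) s = c * evs u s := by
  rw [← evs_mul_left]
  exact congrFun (evs_congr fun j => Hs.smul_apply c u j) s

lemma evs_mulL (hr : 1 ≤ r) (f u : Hs r) (s : ℝ) : evs (mulL r f u) s = evs f s * evs u s := by
  rw [evs_congr (mulL_apply hr f u), evs_conv (summable_norm_pos hr f) (summable_norm_pos hr u)]

lemma evs_incl {r' : ℕ} (h : r' ≤ r) (u : Hs r) (s : ℝ) : evs (incl r r' u) s = evs u s :=
  congrFun (evs_congr (incl_apply h u)) s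

end HsEval

lemma Grow.absConv {σ : ℝ} {r : ℕ} (hr : 1 ≤ r) (hσ : 0 < σ) {u : ℕ → ℕ → Hs r} (h : Grow σ u)
    (s : ℝ) : AbsConv σ (fun a b => evs (u a b) s) := by
  obtain ⟨r, rfl⟩ := Nat.exists_eq_add_of_le' hr
  exact (h.rawFam hσ).fnFam.absConv s

lemma Grow.smul {σ : ℝ} {r : ℕ} {u : ℕ → ℕ → Hs r} (h : Grow σ u) (hσ : 0 < σ) (c : ℂ) :
    Grow σ (fun a b => c • u a b) :=
  h.of_le hσ (C := ‖c‖) (p := 0) (norm_nonneg _) fun a b => by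
    rw [pow_zero, mul_one]; exact (norm_smul c (u a b)).le

/-- The coefficients of `c ∂_z + d ∂_w`. -/
def dzw (c d : ℂ) {r : ℕ} (u : ℕ → ℕ → Hs r) (a b : ℕ) : Hs r :=
  (c * (a + 1)) • u (a + 1) b + (d * (b + 1)) • u a (b + 1)

/-- Differentiation in `z` or `w` shifts the degree by one. This costs a factor `σ⁻¹` and one
polynomial power, both admitted by `Grow`. -/
lemma Grow.shift {σ : ℝ} {r : ℕ} {u : ℕ → ℕ → Hs r} (h : Grow σ u) (hσ : 0 < σ) :
    Grow σ (fun a b => ((a + 1 : ℂ)) • u (a + 1) b) ∧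
    Grow σ (fun a b => ((b + 1 : ℂ)) • u a (b + 1)) := by
  obtain ⟨M, p, hM, hu⟩ := h
  have key : ∀ (a b n : ℕ) (x : ℝ), (n : ℝ) + 1 ≤ 1 + a + b →
      x ≤ M * (2 + a + b) ^ p * σ⁻¹ ^ (a + b + 1) →
      ((n : ℝ) + 1) * x ≤ (M * 2 ^ p * σ⁻¹) * (1 + a + b) ^ (p + 1) * σ⁻¹ ^ (a + b) := by
    intro a b n x hn hx
    have ha : (0 : ℝ) ≤ a := Nat.cast_nonneg a
    have hb : (0 : ℝ) ≤ b := Nat.cast_nonneg b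
    have h1 : (2 + a + b : ℝ) ^ p ≤ (2 * (1 + a + b)) ^ p :=
      pow_le_pow_left₀ (by positivity) (by linarith) p
    have h2 : x ≤ M * (2 * (1 + a + b)) ^ p * σ⁻¹ ^ (a + b + 1) := hx.trans (by gcongr)
    calc _ ≤ (1 + a + b : ℝ) * (M * (2 * (1 + a + b)) ^ p * σ⁻¹ ^ (a + b + 1)) :=
          (mul_le_mul_of_nonneg_left h2 (by positivity)).trans
            (mul_le_mul_of_nonneg_right hn (by positivity))
      _ = _ := by rw [mul_pow]; ring
  have hn : ∀ n : ℕ, ‖(n + 1 : ℂ)‖ = n + 1 := fun n => by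
    rw [← Nat.cast_one, ← Nat.cast_add, Complex.norm_natCast]; push_cast; rfl
  refine ⟨⟨M * 2 ^ p * σ⁻¹, p + 1, by positivity, fun a b => ?_⟩,
    ⟨M * 2 ^ p * σ⁻¹, p + 1, by positivity, fun a b => ?_⟩⟩
  · rw [norm_smul, hn]
    refine key a b a _ (by linarith [Nat.cast_nonneg (α := ℝ) b]) ((hu (a + 1) b).trans (le_of_eq ?_))
    rw [show a + 1 + b = a + b + 1 by ring]
    push_cast
    ring
  · rw [norm_smul, hn]
    refine key a b b _ (by linarith [Nat.cast_nonneg (α := ℝ) a]) ((hu a (b + 1)).trans (le_of_eq ?_))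
    rw [show a + (b + 1) = a + b + 1 by ring]
    push_cast
    ring

lemma Grow.dzw {σ : ℝ} {r : ℕ} {u : ℕ → ℕ → Hs r} (h : Grow σ u) (hσ : 0 < σ) (c d : ℂ) :
    Grow σ (NearAxis.dzw c d u) := by
  obtain ⟨h1, h2⟩ := h.shift hσ
  have := (h1.smul hσ c).add (h2.smul hσ d) hσ
  simp only [smul_smul] at this
  exact this

/-- Cartesian derivatives of power series. -/
lemma RS_dzw {σ : ℝ} {r : ℕ} (hr : 1 ≤ r) {u : ℕ → ℕ → Hs r} (h : Grow σ u) {ρ : ℝ} (hρ : 0 < ρ)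
    (hρσ : ρ < σ) (θ s : ℝ) :
    RS (ev fun a b => dzw 1 1 u a b) ρ θ s = ρ⁻¹ * (Real.cos θ * RS (radial (ev fun a b => u a b)) ρ θ s -
      Real.sin θ * RS (angular (ev fun a b => u a b)) ρ θ s) ∧
    RS (ev fun a b => dzw Complex.I (-Complex.I) u a b) ρ θ s =
      ρ⁻¹ * (Real.sin θ * RS (radial (ev fun a b => u a b)) ρ θ s +
      Real.cos θ * RS (angular (ev fun a b => u a b)) ρ θ s) := by
  have hσ : 0 < σ := hρ.trans hρσ
  have hρa : |ρ| < σ := by rwa [abs_of_pos hρ]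
  have hρ' : (ρ : ℂ) ≠ 0 := by exact_mod_cast hρ.ne'
  set X : ℕ → ℕ → ℂ := fun a b => (a + 1) * evs (u (a + 1) b) s with hX
  set Y : ℕ → ℕ → ℂ := fun a b => (b + 1) * evs (u a (b + 1)) s with hY
  have aX : AbsConv σ X := by
    have := (h.shift hσ).1.absConv hr hσ s
    simpa only [evs_Hs_smul] using this
  have aY : AbsConv σ Y := by
    have := (h.shift hσ).2.absConv hr hσ s
    simpa only [evs_Hs_smul] using this
  have eX : ∀ a b : ℕ, shz X a b = a * evs (u a b) s := fun a b => by
    rcases a with _ | a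
    · simp [shz]
    · simp only [shz, hX]; push_cast; ring
  have eY : ∀ a b : ℕ, shw Y a b = b * evs (u a b) s := fun a b => by
    rcases b with _ | b
    · simp [shw]
    · simp only [shw, hY]; push_cast; ring
  have e1 : GS (radial (ev fun a b => u a b)) (ρ, θ, s) =
      ρ * em 1 θ * PS X ρ θ + ρ * em (-1) θ * PS Y ρ θ := by
    rw [← PS_shz, ← PS_shw, ← PS_add aX.shz aY.shw hρa]
    exact PS_congr (fun a b => by rw [eX, eY]; simp only [radial, ev]; push_cast; ring) ρ θ
  have e2 : GS (angular (ev fun a b => u a b)) (ρ, θ, s) =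
      Complex.I * (ρ * em 1 θ * PS X ρ θ - ρ * em (-1) θ * PS Y ρ θ) := by
    rw [← PS_shz, ← PS_shw, ← PS_sub aX.shz aY.shw hρa, ← PS_mul_left]
    exact PS_congr (fun a b => by rw [eX, eY]; simp only [angular, ev]; push_cast; ring) ρ θ
  have e3 : ∀ c d : ℂ, GS (ev fun a b => dzw c d u a b) (ρ, θ, s) = c * PS X ρ θ + d * PS Y ρ θ := by
    intro c d
    rw [← PS_mul_left, ← PS_mul_left, ← PS_add (aX.const_mul c) (aY.const_mul d) hρa]
    refine PS_congr (fun a b => ?_) ρ θ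
    simp only [ev, dzw, hX, hY]
    rw [evs_Hs_add hr, evs_Hs_smul, evs_Hs_smul]
    ring
  have ec : (Real.cos θ : ℂ) ^ 2 + (Real.sin θ : ℂ) ^ 2 = 1 := by
    exact_mod_cast Real.cos_sq_add_sin_sq θ
  have hI := Complex.I_sq
  unfold RS
  constructor
  · rw [← Complex.re_ofReal_mul (Real.cos θ), ← Complex.re_ofReal_mul (Real.sin θ), ← Complex.sub_re,
      ← Complex.re_ofReal_mul, e1, e2, e3, em_one_eq, em_neg_one_eq]
    congr 1
    push_cast at ec ⊢
    field_simp
    linear_combination (-(PS X ρ θ) - PS Y ρ θ) * ec +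
      (Complex.sin θ ^ 2 * (PS X ρ θ + PS Y ρ θ)) * hI
  · rw [← Complex.re_ofReal_mul (Real.cos θ), ← Complex.re_ofReal_mul (Real.sin θ), ← Complex.add_re,
      ← Complex.re_ofReal_mul, e1, e2, e3, em_one_eq, em_neg_one_eq]
    congr 1
    push_cast at ec ⊢
    field_simp
    linear_combination (-(PS X ρ θ) + PS Y ρ θ) * Complex.I * ec -
      (Complex.sin θ * Complex.cos θ * (PS X ρ θ + PS Y ρ θ)) * hI

/-- `P` takes `H^{q+2D}` into `H^q` with norm polynomial in the degree. Hence the field has only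
`H^q` coefficients, while the radius is not reduced. -/
lemma multBound_pSym (q D : ℕ) (K : ℝ) (a b : ℕ) :
    MultBound (pSym D K a b) (q + 2 * D) q (2 * (K ^ 2)⁻¹ ^ D * (1 + a + b) ^ (2 * D)) := by
  refine ⟨by positivity, fun j => ?_⟩
  have hw := one_le_wt j
  have ha : (0 : ℝ) ≤ a := Nat.cast_nonneg a
  have hb : (0 : ℝ) ≤ b := Nat.cast_nonneg b
  have h1 : |(j : ℝ)| ^ (2 * D) ≤ (1 + a + b) ^ (2 * D) * wt j ^ (2 * D) := by
    rw [← mul_pow]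
    refine pow_le_pow_left₀ (abs_nonneg _) ?_ _
    have : |(j : ℝ)| ≤ wt j := by unfold wt; linarith
    nlinarith
  have h2 : |(((a : ℤ) - b : ℤ) : ℝ)| ^ (2 * D) ≤ (1 + a + b) ^ (2 * D) * wt j ^ (2 * D) := by
    rw [← mul_pow]
    refine pow_le_pow_left₀ (abs_nonneg _) ?_ _
    have := abs_sub_le_add a b
    push_cast at this ⊢
    nlinarith
  have e : ‖pSym D K a b j‖ = (K ^ 2)⁻¹ ^ D * (|(j : ℝ)| ^ (2 * D) + |(((a : ℤ) - b : ℤ) : ℝ)| ^ (2 * D)) := by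
    unfold pSym
    rw [Complex.norm_real, Real.norm_of_nonneg (by positivity), pow_mul, pow_mul, sq_abs, sq_abs,
      div_pow, div_pow, inv_pow]
    ring
  rw [e, pow_add]
  have hq : 0 ≤ wt j ^ q := by positivity
  have hK : 0 ≤ (K ^ 2)⁻¹ ^ D := by positivity
  calc _ ≤ wt j ^ q * ((K ^ 2)⁻¹ ^ D * ((1 + a + b) ^ (2 * D) * wt j ^ (2 * D) +
        (1 + a + b) ^ (2 * D) * wt j ^ (2 * D))) := by gcongr
    _ = _ := by ring

/-- A power series of class `H^Q` is analytic on smaller tubes. -/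
lemma Grow.isAnalytic {σ σ' : ℝ} {Q : ℕ} (hQ : 1 ≤ Q) {Z : ℕ → ℕ → Hs Q} (hZ : Grow σ Z)
    (hσ' : 0 < σ') (hlt : σ' < σ) {f : ℝ → ℝ → ℝ → ℝ}
    (hf : ∀ ρ θ s, 0 ≤ ρ → ρ < σ' → f ρ θ s = RS (ev fun a b => Z a b) ρ θ s) :
    IsAnalytic σ' Q f := by
  have hσ := hσ'.trans hlt
  -- An expansion requires real coefficients, whereas `f` is known only as a real part. Symmetrizing
  -- supplies them without changing `f`.
  obtain ⟨M, p, hM, hs⟩ := hZ.symm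
  have hZ' : Grow σ' (NearAxis.symm Z) := ⟨M, p, hM, fun a b => (hs a b).trans (by gcongr)⟩
  obtain ⟨Q, rfl⟩ := Nat.exists_eq_add_of_le' hQ
  have hx : |σ' / σ| < 1 := by
    rw [abs_of_pos (by positivity), div_lt_one hσ]; exact hlt
  -- `Grow` admits polynomial factors, which the supremum norm at radius `σ` need not. The ratio
  -- `(σ' / σ) ^ m` absorbs them, at the price of a smaller tube.
  have hlim : Tendsto (fun m : ℕ => (1 + m : ℝ) ^ (Q + 1 + 1 + p) * (σ' / σ) ^ m) atTop (𝓝 0) := by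
    have h := tendsto_pow_const_mul_const_pow_of_abs_lt_one (Q + 1 + 1 + p) hx
    have := ((tendsto_add_atTop_iff_nat 1).2 h).const_mul (σ' / σ)⁻¹
    rw [mul_zero] at this
    refine this.congr fun m => ?_
    have : σ' / σ ≠ 0 := by positivity
    push_cast
    rw [pow_succ (σ' / σ), add_comm (m : ℝ) 1]
    field_simp
  obtain ⟨A, hA⟩ := hlim.bddAbove_range
  refine ⟨_, hasExpansion_RS (by omega) hσ' hZ' (isReal_symm Z) (fun ρ θ s h0 h1 => ?_) ?_⟩
  · rw [hf ρ θ s h0 h1]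
    exact (RS_symm hσ hZ (by rw [abs_of_nonneg h0]; exact h1.trans hlt) θ s).symm
  · refine (expNorm_coefOf_le (by omega) hσ'.le _ (C := upC (Q + 1) * M * A) fun m => ?_).trans_lt
      ENNReal.ofReal_lt_top
    have h1 := sum_antidiagonal_norm_le (U := NearAxis.symm Z) (m := m)
      (C := M * (1 + m) ^ p * σ⁻¹ ^ m) fun a b hab => by
        refine (hs a b).trans (le_of_eq ?_)
        rw [← hab]; push_cast; ring
    have h2 := upC_nonneg (Q + 1)
    calc _ ≤ σ' ^ m * (upC (Q + 1) * ((1 + m) ^ (Q + 1) * ((1 + m) * (M * (1 + m) ^ p * σ⁻¹ ^ m)))) := by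
          gcongr
      _ = upC (Q + 1) * M * ((1 + m : ℝ) ^ (Q + 1 + 1 + p) * (σ' / σ) ^ m) := by
          rw [div_pow, inv_pow]; field_simp; ring
      _ ≤ _ := mul_le_mul_of_nonneg_left (hA ⟨m, rfl⟩) (by positivity)

end NearAxis
end

/-! ### The Cartesian components of the magnetic field -/

noncomputable section

namespace NearAxis

open Hs

/-- Only the limit objects of the convergence statements are used. The frame has `q + 2`
derivatives, of which `q` suffice. -/
lemma exists_frame {q : ℕ} (hq : 1 ≤ q) {r₀ : ℝ → E3} (h₀ : IsAxis (4 + q) r₀) :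
    ∃ n b t : Fin 3 → Hs q, (∀ k s, evs (n k) s = (normal r₀ s k : ℝ)) ∧
      (∀ k s, evs (b k) s = (binormal r₀ s k : ℝ)) ∧ ∀ k s, evs (t k) s = (tangent r₀ s k : ℝ) := by
  rw [show 4 + q = q + 2 + 2 by omega] at h₀
  have h := fun k => ckConv_frame (k := q + 2) h₀ k
  have aux : ∀ {f : Axes (q + 2 + 2) → ℝ → ℝ} {g : ℝ → ℝ},
      CkConv (nearAxes (q + 2 + 2) r₀) (q + 2) f g → ∃ v : Hs q, ∀ s, evs v s = (g s : ℝ) := by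
    intro f g hc
    obtain ⟨_, v, -, -, hv⟩ := (hc.of_le (k' := q) (by omega)).exists_Hs hq
    exact ⟨v, hv⟩
  choose t ht using fun k => aux (h k).1
  choose n hn using fun k => aux (h k).2.1
  choose b hb using fun k => aux (h k).2.2
  exact ⟨n, b, t, hn, hb, ht⟩

lemma RS_eq_add {σ : ℝ} {v w z : ℕ → ℕ → ℝ → ℂ} {s : ℝ} (hv : AbsConv σ (fun a b => v a b s))
    (hw : AbsConv σ (fun a b => w a b s)) {ρ : ℝ} (hρ : |ρ| < σ) (θ : ℝ)
    (h : ∀ a b, z a b s = v a b s + w a b s) : RS z ρ θ s = RS v ρ θ s + RS w ρ θ s := by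
  unfold RS GS
  rw [← Complex.add_re, ← PS_add hv hw hρ]
  exact congrArg Complex.re (PS_congr h ρ θ)

section RSHs

variable {σ : ℝ} {r : ℕ} {A X : ℕ → ℕ → Hs r} {ρ : ℝ}

lemma RS_Hs_add (hr : 1 ≤ r) (hσ : 0 < σ) (hA : Grow σ A) (hX : Grow σ X) (hρ : |ρ| < σ) (θ s : ℝ) :
    RS (ev fun a b => (A a b + X a b : Hs r)) ρ θ s =
      RS (ev fun a b => A a b) ρ θ s + RS (ev fun a b => X a b) ρ θ s :=
  RS_eq_add (hA.absConv hr hσ s) (hX.absConv hr hσ s) hρ θ fun _ _ => evs_Hs_add hr _ _ s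

lemma RS_Hs_smul (c : ℝ) (X : ℕ → ℕ → Hs r) (ρ θ s : ℝ) :
    RS (ev fun a b => ((c : ℂ) • X a b : Hs r)) ρ θ s = c * RS (ev fun a b => X a b) ρ θ s := by
  rw [← RS_const_mul]
  exact RS_congr (fun a b => evs_Hs_smul _ _ s) ρ θ

lemma RS_mulL (hr : 1 ≤ r) {f : Hs r} {x s : ℝ} (hf : evs f s = x) (X : ℕ → ℕ → Hs r) (ρ θ : ℝ) :
    RS (ev fun a b => mulL r f (X a b)) ρ θ s = x * RS (ev fun a b => X a b) ρ θ s := by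
  rw [← RS_const_mul]
  exact RS_congr (fun a b => (evs_mulL hr f _ s).trans (by rw [hf]; rfl)) ρ θ

end RSHs

namespace Setup

variable {q D : ℕ} {K σ : ℝ} {r₀ : ℝ → E3} {B₀ : ℝ → ℝ} {κ τ B : Hs (q + 1)}
  {u : ℕ → ℕ → Hs (q + 2 * D)} {J : ℕ → ℕ → Hs (q + 1)} {φ : ℝ → ℝ → ℝ → ℝ}

/-- The Cartesian components of the field are power series off the axis. -/
lemma exists_field (S : Setup q σ r₀ B₀ κ τ B) (hq : 1 ≤ q) (hD : 1 ≤ D) (hu : Grow σ u)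
    (hJ : IsDivh κ (fun a b => fluxY q D (ell r₀) τ B a b (u a b)) J)
    (hsm : 2 * (algC q * ‖κ‖) ≤ σ⁻¹)
    (hφ : ∀ ρ θ s, 0 < ρ → ρ < σ → φ ρ θ s = RS (ev fun a b => u a b) ρ θ s) :
    ∃ Z : Fin 3 → ℕ → ℕ → Hs q, (∀ k, Grow σ (Z k)) ∧ ∀ k ρ θ s, 0 < ρ → ρ < σ →
      toVector r₀ (BK D K r₀ B₀ φ) ρ θ s k = RS (ev fun a b => Z k a b) ρ θ s := by
  obtain ⟨n, b, t, hn, hb, ht⟩ := exists_frame hq S.axis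
  have hσ := S.pos
  have hℓ := S.axis.ell_pos
  set v : ℕ → ℕ → Hs q := fun a b => incl (q + 2 * D) q (u a b) with hv
  set p : ℕ → ℕ → Hs q := fun a b => multL (pSym D K a b) (q + 2 * D) q (u a b) with hp
  set κ' : Hs q := incl (q + 1) q κ with hκ'
  have gv : Grow σ v := hu.multL hσ (multBound_one (by omega))
  have gp : Grow σ p := hu.of_le hσ (C := 2 * (K ^ 2)⁻¹ ^ D) (p := 2 * D) (by positivity) fun a b =>
    (multBound_pSym q D K a b).norm_le _
  have ev_v : (ev fun a b => v a b) = ev fun a b => u a b := by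
    funext a b s; exact evs_incl (by omega) _ _
  have ev_p : (ev fun a b => p a b) = ev fun a b j => pSym D K a b j * u a b j := by
    funext a b s; exact congrFun (evs_congr ((multBound_pSym q D K a b).multL_apply _)) s
  have hκn : ‖κ'‖ ≤ ‖κ‖ := by
    have := (multBound_one (r := q + 1) (r' := q) (by omega)).norm_le κ
    rwa [one_mul] at this
  -- The transverse derivatives of `Pφ` divided by `1 - κρ cos θ`. The division takes place in
  -- `H^q`, which explains `hsm`.
  set X : ℂ → ℂ → ℕ → ℕ → Hs q := fun c d => divh κ' (dzw c d p) with hX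
  have gX : ∀ c d, Grow σ (X c d) := fun c d => (gp.dzw hσ c d).divh (isDivh_divh _ _) hσ
    ((mul_le_mul_of_nonneg_left (mul_le_mul_of_nonneg_left hκn (algC_nonneg q)) zero_le_two).trans hsm)
  set W : ℂ → ℂ → ℕ → ℕ → Hs q := fun c d a b => dzw c d v a b + (((ell r₀)⁻¹ : ℝ) : ℂ) • X c d a b with hW
  have gW : ∀ c d, Grow σ (W c d) := fun c d => (gv.dzw hσ c d).add ((gX c d).smul hσ _) hσ
  set J' : ℕ → ℕ → Hs q := fun a b => incl (q + 1) q (J a b) with hJ'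
  have gJ : Grow σ J := S.grow_flux hD hu hJ
  have gJ' : Grow σ J' := gJ.multL hσ (multBound_one (by omega))
  -- `∂_x = ∂_z + ∂_w` along the normal, `∂_y = i(∂_z - ∂_w)` along the binormal, and the flux along
  -- the tangent. The torsion in `∂r/∂s` cancels the torsion in the `θ`-component, and the singular
  -- factors `ρ⁻¹` of polar coordinates disappear.
  refine ⟨fun k a c => mulL q (n k) (W 1 1 a c) + mulL q (b k) (W Complex.I (-Complex.I) a c) +
    mulL q (t k) (J' a c), fun k => (((gW _ _).mulL hσ _).add ((gW _ _).mulL hσ _) hσ).add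
      (gJ'.mulL hσ _) hσ, fun k ρ θ s h0 h1 => ?_⟩
  have hρa : |ρ| < σ := by rwa [abs_of_pos h0]
  have hh := S.hs_pos ρ θ s h0 h1
  have hsp : speed r₀ s = ell r₀ := S.axis.speed_eq s
  have F := S.fluxData hq hD hu hJ hφ
  have fp : FnFam σ 0 (ev fun a b j => pSym D K a b j * u a b j) := S.fnFam_preg hq hu
  have hψ : ∀ ρ θ s, 0 < ρ → ρ < σ → Preg D K r₀ φ ρ θ s =
      RS (ev fun a b j => pSym D K a b j * u a b j) ρ θ s := S.preg_eq hq hu hφ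
  have a0 := F.pd0 h0 h1 θ s
  have a1 := F.pd1 h0 h1 θ s
  have b0 := ((RS_hasPd0 fp h0 h1 θ s).congr h0 h1 hψ).pd_eq
  have b1 := ((RS_hasPd1 fp h0 h1 θ s).congr h0 h1 hψ).pd_eq
  obtain ⟨v1, v2⟩ := RS_dzw hq gv h0 h1 θ s
  obtain ⟨p1, p2⟩ := RS_dzw hq gp h0 h1 θ s
  rw [ev_v] at v1 v2
  rw [ev_p] at p1 p2
  have hdiv : ∀ c d, hs r₀ ρ θ s * ((ell r₀)⁻¹ * RS (ev fun a b => X c d a b) ρ θ s) =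
      RS (ev fun a b => dzw c d p a b) ρ θ s := by
    intro c d
    have hk : evs κ' s = curvature r₀ s := by rw [hκ', evs_incl (by omega), S.evs_κ]
    have := congrArg Complex.re (PS_of_isDivh hq (isDivh_divh κ' (dzw c d p)) hk
      ((gX c d).absConv hq hσ s) ((gp.dzw hσ c d).absConv hq hσ s) hρa θ)
    rw [Complex.re_ofReal_mul] at this
    change _ * RS (ev fun a b => X c d a b) ρ θ s = RS (ev fun a b => dzw c d p a b) ρ θ s at this
    rw [← this, hs, hsp]
    field_simp
  have hWs : ∀ c d, RS (ev fun a b => W c d a b) ρ θ s = RS (ev fun a b => dzw c d v a b) ρ θ s +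
      (hs r₀ ρ θ s)⁻¹ * RS (ev fun a b => dzw c d p a b) ρ θ s := by
    intro c d
    rw [← hdiv, inv_mul_cancel_left₀ hh.ne', ← RS_Hs_smul]
    exact RS_Hs_add hq hσ (gv.dzw hσ c d) ((gX c d).smul hσ _) hρa θ s
  have hZ : RS (ev fun a c => (mulL q (n k) (W 1 1 a c) + mulL q (b k) (W Complex.I (-Complex.I) a c) +
      mulL q (t k) (J' a c) : Hs q)) ρ θ s =
      normal r₀ s k * RS (ev fun a b => W 1 1 a b) ρ θ s +
      binormal r₀ s k * RS (ev fun a b => W Complex.I (-Complex.I) a b) ρ θ s +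
      tangent r₀ s k * RS (ev fun a b => J a b) ρ θ s := by
    have eJ : RS (ev fun a b => J a b) ρ θ s = RS (ev fun a b => J' a b) ρ θ s :=
      RS_congr (fun a b => (evs_incl (by omega) _ _).symm) ρ θ
    have c1 := (gW 1 1).mulL hσ (n k)
    have c2 := (gW Complex.I (-Complex.I)).mulL hσ (b k)
    rw [RS_Hs_add hq hσ (c1.add c2 hσ) (gJ'.mulL hσ (t k)) hρa, RS_Hs_add hq hσ c1 c2 hρa,
      RS_mulL hq (hn k s), RS_mulL hq (hb k s), RS_mulL hq (ht k s), eJ]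
  rw [hZ, hWs, hWs, v1, v2, p1, p2]
  have hfield : ∀ i, grad r₀ φ i ρ θ s + Btilde r₀ B₀ i ρ θ s = (sqrtG r₀ ρ θ s)⁻¹ *
      ![ρ * hs r₀ ρ θ s * pd 0 φ ρ θ s, hs r₀ ρ θ s * ρ⁻¹ * pd 1 φ ρ θ s -
        ρ * (ell r₀ * torsion r₀ s) * RS (ev fun a b => J a b) ρ θ s,
        ρ * RS (ev fun a b => J a b) ρ θ s] i := fun i => by
    rw [← sqrtG_mul_field (ℓ := ell r₀) (J := RS (ev fun a b => J a b)) S.axis.speed_eq B₀ h0 hh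
      (F.flux_pd h0 h1 θ s) i, inv_mul_cancel_left₀ (F.sqrtG_pos h0 h1 θ s).ne']
  have hBK : ∀ i, BK D K r₀ B₀ φ i ρ θ s = (sqrtG r₀ ρ θ s)⁻¹ *
      ![ρ * hs r₀ ρ θ s * pd 0 φ ρ θ s, hs r₀ ρ θ s * ρ⁻¹ * pd 1 φ ρ θ s -
        ρ * (ell r₀ * torsion r₀ s) * RS (ev fun a b => J a b) ρ θ s,
        ρ * RS (ev fun a b => J a b) ρ θ s] i +
      ρ / sqrtG r₀ ρ θ s * (![1, 1 / ρ ^ 2, 0] i * pd i (Preg D K r₀ φ) ρ θ s) := fun i => by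
    unfold BK
    rw [hfield]
  have hsq : sqrtG r₀ ρ θ s = ρ * hs r₀ ρ θ s := rfl
  have e : toVector r₀ (BK D K r₀ B₀ φ) ρ θ s k = BK D K r₀ B₀ φ 0 ρ θ s *
        (Real.cos θ * normal r₀ s k + Real.sin θ * binormal r₀ s k) +
      BK D K r₀ B₀ φ 1 ρ θ s *
        (-(ρ * Real.sin θ) * normal r₀ s k + ρ * Real.cos θ * binormal r₀ s k) +
      BK D K r₀ B₀ φ 2 ρ θ s * (-(ell r₀ * torsion r₀ s * ρ * Real.sin θ) * normal r₀ s k +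
        ell r₀ * torsion r₀ s * ρ * Real.cos θ * binormal r₀ s k + hs r₀ ρ θ s * tangent r₀ s k) := by
    unfold toVector
    rw [Fin.sum_univ_three]
    simp [coordBasis, hsp]
    ring
  rw [e, hBK, hBK, hBK, hsq, ← a1, ← b1]
  have hρ' := h0.ne'
  have hh' := hh.ne'
  have r0 : RS (radial (ev fun a b => u a b)) ρ θ s = ρ * pd 0 φ ρ θ s := by
    rw [a0, mul_inv_cancel_left₀ hρ']
  have r1 : RS (radial (ev fun a b j => pSym D K a b j * u a b j)) ρ θ s =
      ρ * pd 0 (Preg D K r₀ φ) ρ θ s := by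
    rw [b0, mul_inv_cancel_left₀ hρ']
  rw [r0, r1]
  simp only [Matrix.cons_val_zero, Matrix.cons_val_one, Matrix.cons_val]
  field_simp
  ring

lemma divg_field (S : Setup q σ r₀ B₀ κ τ B) (hq : 1 ≤ q) (hD : 1 ≤ D) (hK : 0 < K) (hu : Grow σ u)
    {IC : ℕ → ℕ → Hs (q + 2 * D)} (h : IsSol q D K (ell r₀) κ τ B IC u J)
    (hφ : ∀ ρ θ s, 0 < ρ → ρ < σ → φ ρ θ s = RS (ev fun a b => u a b) ρ θ s)
    {ρ : ℝ} (hρ : 0 < ρ) (hρσ : ρ < σ) (θ s : ℝ) : divg r₀ (BK D K r₀ B₀ φ) ρ θ s = 0 := by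
  rw [(S.fluxData hq hD hu h.flux hφ).divg_BK (S.fnFam_preg hq hu) (S.preg_eq hq hu hφ) hρ hρσ θ s]
  exact S.defect_eq_zero hq hD hK hu h hφ hρ hρσ θ s

end Setup

end NearAxis
end

/-! ### Uniform tails and the assembly of solutions for nearby axes -/

noncomputable section

namespace NearAxis

open Hs

/-! ### Dependence on the axis -/

lemma evs_Hs_sub {r : ℕ} (hr : 1 ≤ r) (u v : Hs r) (s : ℝ) :
    evs (u - v : Hs r) s = evs u s - evs v s := by
  have : u - v = u + (-1 : ℂ) • v := by rw [neg_one_smul, sub_eq_add_neg]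
  rw [this, evs_Hs_add hr, evs_Hs_smul]
  ring

/-- The common geometric bound makes all degrees from some `n` on small at once. The finitely many
degrees below `n` are handled by convergence of each coefficient. -/
lemma eventually_geometric_term_le {ι : Type*} {l : Filter ι} {Q : ℕ} {R N : ℝ} (hR : 0 < R)
    {U : ι → ℕ → ℕ → Hs Q} (hU : ∀ᶠ i in l, ∀ a b, ‖U i a b‖ ≤ N * R ^ (a + b))
    (hlim : ∀ a b, Tendsto (fun i => ‖U i a b‖) l (𝓝 0)) {ε : ℝ} (hε : 0 < ε) :
    ∀ᶠ i in l, ∀ m, (1 / (2 * R)) ^ m * (upC Q * ((1 + m) ^ Q *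
      ∑ p ∈ Finset.HasAntidiagonal.antidiagonal m, ‖U i p.1 p.2‖)) ≤ ε := by
  have h1 := (tendsto_poly_mul_half_pow (Q + 1)).const_mul (N * upC Q)
  rw [mul_zero] at h1
  obtain ⟨n, hn⟩ := eventually_atTop.1 (h1.eventually (gt_mem_nhds hε))
  have h2 : ∀ m : ℕ, ∀ᶠ i in l, (1 / (2 * R)) ^ m * (upC Q * ((1 + m) ^ Q *
      ∑ p ∈ Finset.HasAntidiagonal.antidiagonal m, ‖U i p.1 p.2‖)) < ε := by
    intro m
    have h3 : Tendsto (fun i => ∑ p ∈ Finset.HasAntidiagonal.antidiagonal m, ‖U i p.1 p.2‖) l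
        (𝓝 (∑ _p ∈ Finset.HasAntidiagonal.antidiagonal m, 0)) :=
      tendsto_finsetSum _ fun p _ => hlim p.1 p.2
    have h4 := ((h3.const_mul ((1 + m : ℝ) ^ Q)).const_mul (upC Q)).const_mul ((1 / (2 * R)) ^ m)
    rw [Finset.sum_const_zero, mul_zero, mul_zero, mul_zero] at h4
    exact h4.eventually (gt_mem_nhds hε)
  filter_upwards [hU, (Filter.eventually_all_finset (Finset.range n)).2 fun m _ => h2 m] with i hi hi' m
  by_cases hm : m < n
  · exact (hi' m (Finset.mem_range.2 hm)).le
  · exact (geometric_term_le hR hi m).trans (hn m (not_lt.1 hm)).le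

lemma exists_delta_of_eventually {k : ℕ} {r₀ : ℝ → E3} {P : Axes k → Prop}
    (h : ∀ᶠ r in nearAxes k r₀, P r) : ∃ δ : ℝ≥0∞, 0 < δ ∧ ∀ (r : ℝ → E3) (hr : IsAxis k r),
      cNorm k (fun s => r s - r₀ s) < δ → P ⟨r, hr⟩ := by
  obtain ⟨δ, hδ, hP⟩ := (ENNReal.nhds_zero_basis.comap
    (fun r : Axes k => cNorm k (fun s => r.1 s - r₀ s))).eventually_iff.1 h
  exact ⟨δ, hδ, fun r hr hlt => hP (x := ⟨r, hr⟩) hlt⟩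

section Solution

variable {q D : ℕ} {K σ₀ ℓ₀ k₀ M A : ℝ} {r : ℝ → E3} {κ τ B : Hs (q + 1)}
  {IC : ℕ → ℕ → Hs (q + 2 * D)} {B₀ : ℝ → ℝ} {cIC : ℕ → ℕ → ℝ → ℂ}

lemma GeomBound.solution (G : GeomBound q ℓ₀ k₀ r κ τ) (hq : 1 ≤ q) (hD : 1 ≤ D) (hK : 0 < K)
    (hσ₀ : 0 < σ₀) (hℓ₀ : 0 < ℓ₀) (hk₀ : 0 ≤ k₀) (hM : 0 ≤ M) (hB : ‖B‖ ≤ M)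
    (hIC : ∀ a b, ‖IC a b‖ ≤ M * σ₀⁻¹ ^ (a + b)) (hBs : ∀ s, evs B s = B₀ s) (hr : IsReal IC)
    (hcIC : ∀ a b, cIC (a + b) a =ᵐ[volume] evs (IC a b))
    (hA : ∀ m : ℕ, (1 + m : ℝ) ^ (q + 2 * D + 1) * (1 / 2) ^ m ≤ A) :
    expNorm (1 / (2 * rate q D K σ₀ ℓ₀ k₀)) (q + 2 * D)
      (coefOf fun a b => (sol q D K (ell r) κ τ B IC a b).1) ≤
        ENNReal.ofReal (2 * M * upC (q + 2 * D) * A) ∧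
    IsNearAxisSolution q D K (1 / (2 * rate q D K σ₀ ℓ₀ k₀)) r B₀ cIC
      (RS (ev fun a b => (sol q D K (ell r) κ τ B IC a b).1))
      (coefOf fun a b => (sol q D K (ell r) κ τ B IC a b).1) := by
  have hb := G.bound hD hK hσ₀ hℓ₀ hk₀ hM hB hIC (isSol_sol q D K (ell r) κ τ B IC)
  obtain ⟨-, -, -, -, -, h6⟩ := rate_bounds (q := q) (D := D) (K := K) hσ₀ hℓ₀ hk₀
  have hR : 0 < rate q D K σ₀ ℓ₀ k₀ := zero_lt_one.trans_le h6
  have hup := upC_nonneg (q + 2 * D)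
  have hn := expNorm_coefOf_le (Q := q + 2 * D) (by omega) (one_div_pos.2 (mul_pos two_pos hR)).le
    (fun a b => (sol q D K (ell r) κ τ B IC a b).1) (C := 2 * M * upC (q + 2 * D) * A) fun m =>
      (geometric_term_le hR hb m).trans (mul_le_mul_of_nonneg_left (hA m) (by positivity))
  exact ⟨hn, (G.setup hσ₀ hℓ₀ hk₀ hBs).isNearAxisSolution hq hD hK
    (grow_of_bound hσ₀ hℓ₀ hk₀ (by positivity) hb) (isSol_sol q D K (ell r) κ τ B IC) hr
    (hn.trans_lt ENNReal.ofReal_lt_top) hcIC⟩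

lemma eventually_geomBound {r₀ : ℝ → E3} {κ τ : Axes (4 + q) → Hs (q + 1)} {κ₀ τ₀ : Hs (q + 1)}
    (hℓ₀ : 0 < ell r₀)
    (tκ : Tendsto κ (nearAxes (4 + q) r₀) (𝓝 κ₀)) (tτ : Tendsto τ (nearAxes (4 + q) r₀) (𝓝 τ₀))
    (tℓ : Tendsto (fun r : Axes (4 + q) => ell r.1) (nearAxes (4 + q) r₀) (𝓝 (ell r₀)))
    (eκ : ∀ r s, evs (κ r) s = curvature r.1 s) (eτ : ∀ r s, evs (τ r) s = torsion r.1 s)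
    (hκ : ‖κ₀‖ < k₀) (hτ : ‖τ₀‖ < k₀) :
    ∀ᶠ r in nearAxes (4 + q) r₀, GeomBound q (ell r₀) k₀ r.1 (κ r) (τ r) := by
  filter_upwards [tκ.norm.eventually (gt_mem_nhds hκ), tτ.norm.eventually (gt_mem_nhds hτ),
    tℓ.eventually (lt_mem_nhds (half_lt_self hℓ₀)),
    tℓ.eventually (gt_mem_nhds (lt_two_mul_self hℓ₀))] with r h1 h2 h3 h4
  exact ⟨r.2, eκ r, eτ r, h1.le, h2.le, h3.le, h4.le⟩

end Solution

end NearAxis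
end

/-! ### Assembly of the theorem -/

theorem corollary1 (q D : ℕ) (hq : 1 ≤ q) (hD : 1 ≤ D) (K σ₀ : ℝ) (hK : 0 < K) (hσ₀ : 0 < σ₀)
    (r₀ : ℝ → E3) (hr₀ : IsAxis (4 + q) r₀) :
    ∃ σ : ℝ, 0 < σ ∧ σ ≤ σ₀ ∧ (∀ s, σ < (curvature r₀ s)⁻¹) ∧
    ∃ C : ℝ≥0,
    ∀ B₀ : ℝ → ℝ, Continuous B₀ → Function.Periodic B₀ (2 * Real.pi) →
      sobolevNormCircle (1 + q) B₀ < ⊤ →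
    ∀ (φIC : ℝ → ℝ → ℝ → ℝ) (cIC : ℕ → ℕ → ℝ → ℂ),
      HasExpansion σ₀ (q + 2 * D) φIC cIC →
      (∀ m n, 0 < n → n < m → ∀ s, cIC m n s = 0) →
    ∃ (φ : ℝ → ℝ → ℝ → ℝ) (c : ℕ → ℕ → ℝ → ℂ),
      -- existence of the solution
      IsNearAxisSolution q D K σ r₀ B₀ cIC φ c ∧
      -- uniqueness
      (∀ (σ' : ℝ) (φ' : ℝ → ℝ → ℝ → ℝ) (c' : ℕ → ℕ → ℝ → ℂ), 0 < σ' → σ' ≤ σ →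
        IsNearAxisSolution q D K σ' r₀ B₀ cIC φ' c' →
        ∀ ρ θ s, 0 ≤ ρ → ρ < σ' → φ' ρ θ s = φ ρ θ s) ∧
      -- bound by the norms of the inputs
      expNorm σ (q + 2 * D) c ≤
        C * sobolevNormCircle (1 + q) B₀ + C * expNorm σ₀ (q + 2 * D) cIC ∧
      -- continuity in the axis
      (∀ ε : ℝ≥0∞, 0 < ε → ∃ δ : ℝ≥0∞, 0 < δ ∧
        ∀ r₁ : ℝ → E3, IsAxis (4 + q) r₁ → cNorm (4 + q) (fun s => r₁ s - r₀ s) < δ →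
          (∀ s, σ < (curvature r₁ s)⁻¹) ∧
          ∃ (φ₁ : ℝ → ℝ → ℝ → ℝ) (c₁ : ℕ → ℕ → ℝ → ℂ),
            IsNearAxisSolution q D K σ r₁ B₀ cIC φ₁ c₁ ∧
            expNorm σ (q + 2 * D) (fun m n s => c₁ m n s - c m n s) < ε) ∧
      -- the field
      ∃ B : ℝ → ℝ → ℝ → E3,
        (∀ ρ θ s, 0 < ρ → ρ < σ →
          B ρ θ s = toVector r₀ (BK D K r₀ B₀ φ) ρ θ s ∧
          divg r₀ (BK D K r₀ B₀ φ) ρ θ s = 0) ∧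
        ∀ σ' : ℝ, 0 < σ' → σ' < σ → ∀ i : Fin 3,
          IsAnalytic σ' q (fun ρ θ s => B ρ θ s i) := by
  obtain ⟨κ, τ, κ₀, τ₀, tκ, tτ, tℓ, eκ, eτ, eκ₀, eτ₀⟩ := exists_geometry hr₀
  have hℓ₀ := hr₀.ell_pos
  -- The added `1` makes the bounds strict for the given axis, so that they persist for nearby ones.
  set k₀ : ℝ := ‖κ₀‖ + ‖τ₀‖ + 1 with hk₀d
  have nκ := norm_nonneg κ₀
  have nτ := norm_nonneg τ₀
  have hk₀ : 0 ≤ k₀ := by positivity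
  have G₀ : GeomBound q (ell r₀) k₀ r₀ κ₀ τ₀ :=
    ⟨hr₀, eκ₀, eτ₀, by linarith, by linarith, by linarith, by linarith⟩
  have hG := eventually_geomBound hℓ₀ tκ tτ tℓ eκ eτ (k₀ := k₀) (by linarith) (by linarith)
  obtain ⟨-, h2, h3, -, h5, h6⟩ := rate_bounds (q := q) (D := D) (K := K) hσ₀ hℓ₀ hk₀
  obtain ⟨A, hA0, hA⟩ := exists_poly_mul_half_pow_le (q + 2 * D + 1)
  set R := rate q D K σ₀ (ell r₀) k₀ with hRd
  have hR : 0 < R := zero_lt_one.trans_le h6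
  have hσ : 0 < 1 / (2 * R) := by positivity
  have hup := upC_nonneg (q + 2 * D)
  -- The constant: `2 * upC * A` bounds the expansion norm by the size `M` of the data, and the two
  -- powers of `2` come from passing from Sobolev norms of `B₀` and of the initial data to their
  -- Fourier coefficients.
  refine ⟨1 / (2 * R), hσ, ?_, G₀.lt_inv_curvature hσ₀ hℓ₀ hk₀,
    (2 * upC (q + 2 * D) * A * (2 ^ (q + 1 + 1) + 2 ^ (q + 2 * D + 1))).toNNReal, ?_⟩
  · rw [one_div]
    exact inv_le_of_inv_le₀ hσ₀ (by linarith)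
  intro B₀ hBc hBp hBn φIC cIC hφIC _
  rw [add_comm 1 q] at hBn ⊢
  obtain ⟨B, hBj, hBnorm⟩ := sobolevCircle_lower hBn
  have hBs : ∀ s, evs B s = B₀ s := fun s => by
    rw [evs_congr hBj]
    refine (eq_evs_fc (Complex.continuous_ofReal.comp hBc) 
      (fun s => congrArg Complex.ofReal (hBp s)) ?_ s).symm
    exact (Hs.summable_norm_pos (by omega) B).congr fun j => congrArg norm (hBj j)
  obtain ⟨IC, hICr, hICfc, hICae, hICn⟩ := hφIC.exists_coeff hσ₀ (by omega)
  set NB := (sobolevNormCircle (q + 1) B₀).toReal with hNB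
  set NI := (expNorm σ₀ (q + 2 * D) cIC).toReal with hNI
  have hNB0 : 0 ≤ NB := ENNReal.toReal_nonneg
  have hNI0 : 0 ≤ NI := ENNReal.toReal_nonneg
  -- One linear quantity dominating both inputs, as the induction treats `B₀` and the initial data
  -- with a single constant.
  set M : ℝ := 2 ^ (q + 1 + 1) * NB + 2 ^ (q + 2 * D + 1) * NI with hMd
  have hM : 0 ≤ M := by positivity
  have hBM : ‖B‖ ≤ M := hBnorm.trans (le_add_of_nonneg_right (by positivity))
  have hICM : ∀ a b, ‖IC a b‖ ≤ M * σ₀⁻¹ ^ (a + b) := fun a b => (hICn a b).trans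
    (mul_le_mul_of_nonneg_right (le_add_of_nonneg_left (by positivity)) (by positivity))
  have hsol := fun {r : ℝ → E3} {κ τ : Hs (q + 1)} (G : GeomBound q (ell r₀) k₀ r κ τ) =>
    G.solution (B₀ := B₀) (cIC := cIC) hq hD hK hσ₀ hℓ₀ hk₀ hM hBM hICM hBs hICr hICae hA
  have hbd := fun {r : ℝ → E3} {κ τ : Hs (q + 1)} (G : GeomBound q (ell r₀) k₀ r κ τ) =>
    G.bound hD hK hσ₀ hℓ₀ hk₀ hM hBM hICM (isSol_sol q D K (ell r) κ τ B IC)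
  have S := G₀.setup (D := D) (K := K) hσ₀ hℓ₀ hk₀ hBs
  set u : ℕ → ℕ → Hs (q + 2 * D) := fun a b => (sol q D K (ell r₀) κ₀ τ₀ B IC a b).1 with hu
  have hS : IsSol q D K (ell r₀) κ₀ τ₀ B IC u _ := isSol_sol q D K (ell r₀) κ₀ τ₀ B IC
  have hgrow : Grow (1 / (2 * R)) u := grow_of_bound hσ₀ hℓ₀ hk₀ (by positivity) (hbd G₀)
  refine ⟨RS (ev fun a b => u a b), coefOf u, (hsol G₀).2, ?_, ?_, ?_, ?_⟩
  · intro σ' φ' c' h0 hle hφ' ρ θ s hρ hρσ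
    exact (S.mono h0 hle).eq_RS_of_isNearAxisSolution hq hD hK hS hICfc hφ' hρ hρσ θ s
  · refine (hsol G₀).1.trans ?_
    have e1 : sobolevNormCircle (q + 1) B₀ = ENNReal.ofReal NB := (ENNReal.ofReal_toReal hBn.ne).symm
    have e2 : expNorm σ₀ (q + 2 * D) cIC = ENNReal.ofReal NI :=
      (ENNReal.ofReal_toReal hφIC.norm_lt_top.ne).symm
    rw [e1, e2, ← mul_add, ← ENNReal.ofReal_add hNB0 hNI0]
    change _ ≤ ENNReal.ofReal _ * _
    rw [← ENNReal.ofReal_mul (by positivity)]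
    refine ENNReal.ofReal_le_ofReal ?_
    have hx : 0 ≤ 2 * upC (q + 2 * D) * A := by positivity
    have : M ≤ (2 ^ (q + 1 + 1) + 2 ^ (q + 2 * D + 1)) * (NB + NI) := by
      have h1 : (0 : ℝ) ≤ 2 ^ (q + 1 + 1) * NI := by positivity
      have h2 : (0 : ℝ) ≤ 2 ^ (q + 2 * D + 1) * NB := by positivity
      rw [hMd]; linarith
    calc _ = 2 * upC (q + 2 * D) * A * M := by ring
      _ ≤ 2 * upC (q + 2 * D) * A * ((2 ^ (q + 1 + 1) + 2 ^ (q + 2 * D + 1)) * (NB + NI)) :=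
          mul_le_mul_of_nonneg_left this hx
      _ = _ := by ring
  · intro ε hε
    -- `ε` may be infinite, and the limit argument yields only `≤`. A finite number strictly below
    -- `ε` settles both.
    obtain ⟨e, he0, heε⟩ := ENNReal.lt_iff_exists_nnreal_btwn.1 hε
    have he : (0 : ℝ) < e := by exact_mod_cast he0
    -- Both solutions obey the bound `2 * M * R ^ (a + b)` with the same `R`, hence the `4`.
    have hdiff : ∀ᶠ r in nearAxes (4 + q) r₀, ∀ a b,
        ‖(sol q D K (ell r.1) (κ r) (τ r) B IC a b).1 - u a b‖ ≤ 4 * M * R ^ (a + b) :=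
      hG.mono fun r G a b => (norm_sub_le _ _).trans
        ((add_le_add (hbd G a b) (hbd G₀ a b)).trans (le_of_eq (by ring)))
    have hlim : ∀ a b, Tendsto (fun r : Axes (4 + q) =>
        ‖(sol q D K (ell r.1) (κ r) (τ r) B IC a b).1 - u a b‖) (nearAxes (4 + q) r₀) (𝓝 0) :=
      fun a b => tendsto_iff_norm_sub_tendsto_zero.1 (tendsto_sol hD hK hℓ₀ tℓ tκ tτ a b)
    have hev := eventually_geometric_term_le
      (U := fun (r : Axes (4 + q)) a b => (sol q D K (ell r.1) (κ r) (τ r) B IC a b).1 - u a b)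
      hR hdiff hlim he
    obtain ⟨δ, hδ, hP⟩ := exists_delta_of_eventually (hG.and hev)
    refine ⟨δ, hδ, fun r₁ hr₁ hlt => ?_⟩
    obtain ⟨G₁, hterm⟩ := hP r₁ hr₁ hlt
    refine ⟨G₁.lt_inv_curvature hσ₀ hℓ₀ hk₀, _, _, (hsol G₁).2, lt_of_le_of_lt ?_ heε⟩
    have hle := expNorm_coefOf_le (Q := q + 2 * D) (by omega) hσ.le
      (fun a b => (sol q D K (ell r₁) (κ ⟨r₁, hr₁⟩) (τ ⟨r₁, hr₁⟩) B IC a b).1 - u a b) hterm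
    rw [ENNReal.ofReal_coe_nnreal] at hle
    refine le_trans (le_of_eq ?_) hle
    congr 1
    funext m n s
    exact (evs_Hs_sub (by omega) _ _ s).symm
  · have hsm : 2 * (Hs.algC q * ‖κ₀‖) ≤ (1 / (2 * R))⁻¹ := by
      rw [one_div, inv_inv]
      have := mul_le_mul_of_nonneg_left G₀.norm_κ (Hs.algC_nonneg q)
      linarith
    obtain ⟨Z, hZ, hZB⟩ := S.exists_field (K := K) hq hD hgrow hS.flux hsm (fun _ _ _ _ _ => rfl)
    -- The extension to the axis is the value of the power series at `ρ = 0`, where the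
    -- contravariant components themselves are singular.
    refine ⟨fun ρ θ s => WithLp.toLp 2 fun k => RS (ev fun a b => Z k a b) ρ θ s,
      fun ρ θ s h0 h1 => ⟨?_, S.divg_field hq hD hK hgrow hS (fun _ _ _ _ _ => rfl) h0 h1 θ s⟩,
      fun σ' h0 hlt i => (hZ i).isAnalytic hq h0 hlt fun _ _ _ _ _ => rfl⟩
    ext k
    exact (hZB k ρ θ s h0 h1).symm
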